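/- Let $k$ be an infinite field, and let $X \subset \mathbb{P}^n_k$ be a non-empty locally closed subscheme all of whose irreducible components have the same dimension $m \ge 1$. Let $\overline{X}$ be the scheme-theoretic closure of $X$ in $\mathbb{P}^n_k$, let $X_{\rm reg} \subset X$ be the set of points whose local rings are regular, and let $X_{\rm sing} = X \setminus X_{\rm reg}$. Let $Z, T \subset \mathbb{P}^n_k$ be closed subschemes with $\dim T \le 0$ and $X \cap Z \cap T = \emptyset$, and assume that $Z \cap \overline{X}$ is a reduced finite $k$-scheme contained in $X_{\rm reg}$. Terminology. For integers $a, b \ge 0$, a Noetherian scheme $Y$ is an $(R_a + S_b)$-scheme if $\mathcal{O}_{Y,y}$ is regular for every $y \in Y$ with $\dim \mathcal{O}_{Y,y} \le a$, and ${\rm depth}(\mathcal{O}_{Y,y}) \ge \min(b, \dim \mathcal{O}_{Y,y})$ for every $y \in Y$. For a hypersurface $H \subset \mathbb{P}^n_k$, the scheme $X \cap H$ is good if (G1) $T \cap X \cap H = \emptyset$; (G2) $X \cap H$ is an effective Cartier divisor on $X$ of dimension $m-1$; (G3) $X \cap H$ contains no irreducible component of $X_{\rm sing}$. A property holds for a general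 hypersurface $H$ containing $Z$ if there is $d_0$ such that for every $d \ge d_0$ there is a non-empty dense open subscheme $\mathcal{U}$ of the linear system $|H^0(\mathbb{P}^n_k, \mathcal{I}_Z(d))|$ (the projective space of lines in $H^0(\mathbb{P}^n_k, \mathcal{I}_Z(d))$) such that the property holds for every $H \in \mathcal{U}(k)$. Theorem. Let $a, b \ge 0$ and assume that $X$ is an $(R_a + S_b)$-scheme. Then a general hypersurface $H \subset \mathbb{P}^n_k$ containing $Z$ satisfies the following: 1. $X \cap H$ is good; 2. $X_{\rm reg} \cap H$ is regular; 3. $X \cap H$ is an $(R_a + S_b)$-scheme. Moreover, if instead of being an $(R_a+S_b)$-scheme $X$ is assumed to be reduced (respectively normal), then a general hypersurface $H \subset \mathbb{P}^n_k$ containing $Z$ satisfies (1), (2), and $X \cap H$ is reduced (respectively normal). -/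

import Mathlib

open AlgebraicGeometry CategoryTheory

universe u v

noncomputable section

namespace Bertini

/-! ### Local conditions on schemes -/

/-- The depth of a Noetherian local ring: the supremum of the lengths of the regular sequences
contained in the maximal ideal. -/
def depth (R : Type u) [CommRing R] [IsLocalRing R] : ℕ∞ :=
  ⨆ (rs : List R) (_ : ∀ r ∈ rs, r ∈ IsLocalRing.maximalIdeal R)
    (_ : RingTheory.Sequence.IsRegular R rs), (rs.length : ℕ∞)

/-- The regular locus `X_reg`: the points whose local rings are regular. -/
def regularLocus (X : Scheme.{u}) : Set X := {x | IsRegularLocalRing (X.presheaf.stalk x)}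

/-- The singular locus `X_sing`: the complement of `X_reg`. -/
def singularLocus (X : Scheme.{u}) : Set X := (regularLocus X)ᶜ

/-- `X` is regular in codimension `a`. -/
def IsRegularInCodim (a : ℕ) (X : Scheme.{u}) : Prop :=
  ∀ x : X, ringKrullDim (X.presheaf.stalk x) ≤ (a : WithBot ℕ∞) → x ∈ regularLocus X

/-- Serre's condition `S_b`: `depth 𝒪_{X,x} ≥ min (b, dim 𝒪_{X,x})` for every point `x`. -/
def SatisfiesS (b : ℕ) (X : Scheme.{u}) : Prop :=
  ∀ x : X, min (b : WithBot ℕ∞) (ringKrullDim (X.presheaf.stalk x)) ≤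
    (depth (X.presheaf.stalk x) : WithBot ℕ∞)

/-- `(R_a + S_b)`-schemes. -/
structure IsRSScheme (a b : ℕ) (X : Scheme.{u}) : Prop where
  isNoetherian : AlgebraicGeometry.IsNoetherian X
  regularInCodim : IsRegularInCodim a X
  satisfiesS : SatisfiesS b X

/-- A scheme is normal if all its local rings are integrally closed domains. -/
def IsNormalScheme (X : Scheme.{u}) : Prop :=
  ∀ x : X, IsDomain (X.presheaf.stalk x) ∧ IsIntegrallyClosed (X.presheaf.stalk x)

/-- The closed subscheme defined by `I` is an effective Cartier divisor: locally, `I` is generated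
by one nonzerodivisor. -/
def IsEffectiveCartier {X : Scheme.{u}} (I : X.IdealSheafData) : Prop :=
  ∀ x : X, ∃ U : X.affineOpens, x ∈ U.1 ∧
    ∃ s ∈ nonZeroDivisors Γ(X, U.1), I.ideal U = Ideal.span {s}

/-! ### Projective space, hypersurfaces and linear systems -/

instance gradedAlgebraHomogeneousSubmodule {ι : Type v} {k : Type u} [CommRing k] :
    GradedAlgebra (MvPolynomial.homogeneousSubmodule ι k) :=
  MvPolynomial.gradedAlgebra

/-- The projective space `Proj k[x_j : j ∈ ι]`. -/
abbrev projSpace (ι : Type v) (k : Type u) [CommRing k] : Scheme.{max u v} :=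
  Proj (MvPolynomial.homogeneousSubmodule ι k)

/-- The projective space `ℙⁿ_k = Proj k[x_0, …, x_n]`. -/
abbrev PP (n : ℕ) (k : Type u) [CommRing k] : Scheme.{u} := projSpace (Fin (n + 1)) k

variable {k : Type u} [Field k] {n : ℕ}

/-- The structure morphism `ℙⁿ_k ⟶ Spec k`. -/
def PP.structureMap (n : ℕ) (k : Type u) [Field k] : PP n k ⟶ Spec (.of k) :=
  Proj.toSpecZero _ ≫ Spec.map (CommRingCat.ofHom
    (algebraMap k (MvPolynomial.homogeneousSubmodule (Fin (n + 1)) k 0)))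

lemma X_mem {ι : Type v} (j : ι) :
    (MvPolynomial.X j : MvPolynomial ι k) ∈ MvPolynomial.homogeneousSubmodule ι k 1 :=
  MvPolynomial.isHomogeneous_X k j

lemma C_mem {ι : Type v} (c : k) :
    (MvPolynomial.C c : MvPolynomial ι k) ∈ MvPolynomial.homogeneousSubmodule ι k (0 • 1) := by
  rw [zero_smul]
  exact MvPolynomial.isHomogeneous_C ι c

/-- The fraction `f / x_j ^ d`, of degree `0`, for a form `f` of degree `d`. -/
def dehomogenize {d : ℕ} (f : MvPolynomial.homogeneousSubmodule (Fin (n + 1)) k d)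
    (j : Fin (n + 1)) :
    HomogeneousLocalization.Away (MvPolynomial.homogeneousSubmodule (Fin (n + 1)) k)
      (MvPolynomial.X j) :=
  HomogeneousLocalization.Away.mk _ (X_mem j) d f.1
    (by simpa only [smul_eq_mul, mul_one] using f.2)

/-- The affine chart `D₊(x_j)` of `ℙⁿ_k`. -/
def chart (n : ℕ) (k : Type u) [Field k] (j : Fin (n + 1)) : (PP n k).affineOpens :=
  ⟨Proj.basicOpen _ (MvPolynomial.X j),
    Proj.isAffineOpen_basicOpen _ _ (X_mem j) one_pos⟩

/-- The identification of the degree `0` part of `k[x][1 / x_j]` with the ring of regular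
functions on the chart `D₊(x_j)`. -/
def chartMap (n : ℕ) (k : Type u) [Field k] (j : Fin (n + 1)) :
    HomogeneousLocalization.Away (MvPolynomial.homogeneousSubmodule (Fin (n + 1)) k)
      (MvPolynomial.X j) →+* Γ(PP n k, (chart n k j).1) :=
  (Proj.awayToSection _ (MvPolynomial.X j)).hom

/-- The regular function `f / x_j ^ d` on the chart `D₊(x_j)`. -/
def chartSection {d : ℕ} (f : MvPolynomial.homogeneousSubmodule (Fin (n + 1)) k d)
    (j : Fin (n + 1)) : Γ(PP n k, (chart n k j).1) :=
  chartMap n k j (dehomogenize f j)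

/-- The ideal sheaf of the hypersurface `H_f ⊂ ℙⁿ_k` of a form `f` of degree `d`: `H_f` is the
scheme-theoretic union of its affine pieces `Spec (k[x]_(x_j) / (f / x_j ^ d))`. -/
def hypersurface {d : ℕ} (f : MvPolynomial.homogeneousSubmodule (Fin (n + 1)) k d) :
    (PP n k).IdealSheafData :=
  ⨅ j : Fin (n + 1),
    (Spec.map (CommRingCat.ofHom (Ideal.Quotient.mk (Ideal.span {dehomogenize f j}))) ≫
      Proj.awayι _ (MvPolynomial.X j) (X_mem j) one_pos).ker

lemma dehomogenize_add {d : ℕ} (f g : MvPolynomial.homogeneousSubmodule (Fin (n + 1)) k d)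
    (j : Fin (n + 1)) : dehomogenize (f + g) j = dehomogenize f j + dehomogenize g j := by
  apply HomogeneousLocalization.val_injective
  rw [HomogeneousLocalization.val_add]
  simp only [dehomogenize, HomogeneousLocalization.Away.val_mk, Submodule.coe_add]
  rw [Localization.add_mk_self]

lemma dehomogenize_smul {d : ℕ} (c : k)
    (f : MvPolynomial.homogeneousSubmodule (Fin (n + 1)) k d) (j : Fin (n + 1)) :
    dehomogenize (c • f) j =
      HomogeneousLocalization.Away.mk _ (X_mem j) 0 (MvPolynomial.C c) (C_mem c) *
        dehomogenize f j := by
  apply HomogeneousLocalization.val_injective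
  rw [HomogeneousLocalization.val_mul]
  simp only [dehomogenize, HomogeneousLocalization.Away.val_mk, Submodule.coe_smul,
    MvPolynomial.smul_eq_C_mul]
  rw [Localization.mk_mul]
  congr 1
  exact Subtype.ext (by simp)

/-- `H⁰(ℙⁿ_k, 𝓘_Z(d))`: the forms of degree `d` that vanish on the closed subscheme `Z`, that is,
whose dehomogenizations on all charts lie in the ideal of `Z`. -/
def formsThrough (Z : (PP n k).IdealSheafData) (d : ℕ) :
    Submodule k (MvPolynomial.homogeneousSubmodule (Fin (n + 1)) k d) where
  carrier := {f | ∀ j, chartSection f j ∈ Z.ideal (chart n k j)}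
  zero_mem' j := by
    have h := dehomogenize_add (0 : MvPolynomial.homogeneousSubmodule (Fin (n + 1)) k d) 0 j
    rw [add_zero, left_eq_add] at h
    rw [chartSection, h, map_zero]
    exact zero_mem _
  add_mem' hf hg j := by
    rw [chartSection, dehomogenize_add, map_add]
    exact add_mem (hf j) (hg j)
  smul_mem' c f hf j := by
    rw [chartSection, dehomogenize_smul, map_mul]
    exact Ideal.mul_mem_left _ _ (hf j)

/-- The `k`-rational point `[c]` of projective space with homogeneous coordinates `c ≠ 0`: its
homogeneous prime ideal is generated by the homogeneous polynomials vanishing at `c`. -/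
def rationalPoint {ι : Type v} (c : ι → k) (hc : c ≠ 0) : projSpace ι k where
  asHomogeneousIdeal :=
    (RingHom.ker (MvPolynomial.eval c)).homogeneousCore (MvPolynomial.homogeneousSubmodule ι k)
  isPrime := (RingHom.ker_isPrime (MvPolynomial.eval c)).homogeneousCore
  not_irrelevant_le h := by
    classical
    refine hc (funext fun j => ?_)
    have h1 : (MvPolynomial.X j : MvPolynomial ι k) ∈
        HomogeneousIdeal.irrelevant (MvPolynomial.homogeneousSubmodule ι k) := by
      rw [HomogeneousIdeal.mem_irrelevant_iff, GradedRing.proj_apply]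
      exact DirectSum.decompose_of_mem_ne _ (X_mem j) one_ne_zero
    have h2 := Ideal.toIdeal_homogeneousCore_le _ _ (h h1)
    simpa [RingHom.mem_ker] using h2

/-- The linear system `|V| = ℙ(V)` of a `k`-vector space `V`, in which the nonzero vectors of `V`
up to scaling are the `k`-rational points. The homogeneous coordinates are the coordinates of
vectors with respect to a basis of `V`. -/
abbrev linearSystem (k : Type u) [Field k] (V : Type u) [AddCommGroup V] [Module k V] :
    Scheme.{u} :=
  projSpace (Module.Basis.ofVectorSpaceIndex k V) k

/-- The `k`-rational point of `|V|` given by a nonzero vector. -/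
def linearSystemPoint {V : Type u} [AddCommGroup V] [Module k V] (v : V) (hv : v ≠ 0) :
    linearSystem k V :=
  rationalPoint (fun j => (Module.Basis.ofVectorSpace k V).repr v j) (fun h => hv (by
    apply (Module.Basis.ofVectorSpace k V).repr.injective
    rw [map_zero]
    exact Finsupp.ext fun j => congrFun h j))

/-- A general hypersurface `H_f ⊂ ℙⁿ_k` containing `Z` satisfies `P`: for all `d ≫ 0` there is a
nonempty dense open `U ⊂ |H⁰(ℙⁿ_k, 𝓘_Z(d))|` such that `P` holds for all `H_f ∈ U(k)`. -/
def ForGeneralHypersurface (Z : (PP n k).IdealSheafData)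
    (P : (PP n k).IdealSheafData → Prop) : Prop :=
  ∃ d₀ : ℕ, ∀ d ≥ d₀, ∃ U : (linearSystem k (formsThrough Z d)).Opens,
    (U : Set (linearSystem k (formsThrough Z d))).Nonempty ∧
    Dense (U : Set (linearSystem k (formsThrough Z d))) ∧
    ∀ (f : formsThrough Z d) (hf : f ≠ 0), linearSystemPoint f hf ∈ U → P (hypersurface f.1)

/-! ### Hypersurface sections -/

/-- `X ∩ H` is good, for `X` of dimension `m` with an immersion `i : X ⟶ ℙⁿ_k` and closed
subschemes `T`, `H` of `ℙⁿ_k`. -/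
structure IsGood {X : Scheme.{u}} (i : X ⟶ PP n k) (m : ℕ) (T H : (PP n k).IdealSheafData) :
    Prop where
  disjoint : ∀ x ∈ (H.comap i).support, i x ∉ T.support
  cartier : IsEffectiveCartier (H.comap i)
  dim_eq : topologicalKrullDim (H.comap i).subscheme = ((m - 1 : ℕ) : WithBot ℕ∞)
  not_contains : ∀ C ∈ irreducibleComponents (singularLocus X),
    ¬ (Subtype.val '' C ⊆ ((H.comap i).support : Set X))

/-- `X_reg ∩ H` is regular. -/
def RegularOnRegularLocus {X : Scheme.{u}} (i : X ⟶ PP n k) (H : (PP n k).IdealSheafData) : Prop :=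
  ∀ y : (H.comap i).subscheme, (H.comap i).subschemeι y ∈ regularLocus X →
    y ∈ regularLocus (H.comap i).subscheme

end Bertini

end

noncomputable section

namespace Bertini

/-! ### Minimal generators of the maximal ideal -/

/-! Reducedness is `R₀ + S₁` and normality is `R₁ + S₂` for Noetherian schemes (Serre), so
everything follows from the statement about `R_a + S_b`.

A set of forms of degree `d` through `Z` is generic if it contains the complement of the zeros of a
nonzero polynomial function on `H⁰(𝓘_Z(d))` (`IsGeneric`). Over an infinite field generic sets can
be intersected. Since `H_f` does not change when `f` is scaled, a generic property of `H_f` holds at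
all rational points of a dense open subset of the linear system (`IsGeneric.exists_opens`). For
large `d` the forms generate `𝓘_Z` on every chart (`exists_span_chartSection_eq`), so a generic form
avoids any given finite set of points of `X` outside `Z`.

The points to avoid are those of `X ∩ T`, one point on each component of `X_sing`, the associated
points of `X` (so that the equation of `H` is a nonzerodivisor), the singular points of codimension
at most `a + 1`, and the points where `S_{b+1}` fails. None of them lies on `Z`, because the points
of `Z` in `X` are regular closed points, disjoint from `T`, in a scheme of positive dimension. The
last two sets are finite (`finite_singular`, `finite_not_satisfiesS`). Indeed regularity and
Cohen-Macaulayness spread from a point to a neighbourhood inside its closure, the depth grows by one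
at nearby proper specializations, and a singular point has codimension at least `a + 1` by `R_a`, so
its proper specializations have codimension at least `a + 2`. The spreading of regularity rests on
generic regularity of finitely generated domains over an arbitrary field
(`genericallyRegular_of_finiteType`), which is obtained by passing to a purely inseparable extension
over which the function field becomes separable over a rational one, and descending along successive
`p`-th roots.

Once these points are avoided, passing to `X ∩ H` lowers the dimension of a local ring by exactly
one and the depth by at most one. Hence `S_{b+1}` at the points of `X` on `H` gives `S_b` on `X ∩
H`, and a point of codimension at most `a` on `X ∩ H` is a regular point of `X`. It remains regular
on `X ∩ H` provided that the equation of `H` is not in `𝔪_x²`.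

That last condition is arranged at all points `x` of `X`. Outside `Z` it is Bertini's theorem
(`isGeneric_mul_notMem_sq`): on an integral stratum with function field `K`, choose derivations dual
to some coordinate functions, at least `trdeg K` of them. Membership in `𝔪_x²` forces the equation
and all these derivatives to vanish at `x`, which is more linear conditions on the form than the
stratum has dimensions, so the bad forms satisfy a nontrivial polynomial equation. This count needs
no separability. At the finitely many points of `Z`, the reducedness of `Z ∩ X̄` says that the forms
through `Z` generate `𝔪_x`, so not all of them lie in `𝔪_x²`
(`isGeneric_mul_notMem_sq_of_mem_support`).

Finally `X ∩ H` has dimension at most `m - 1` because `H` contains no component of `X`, and at least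
`m - 1` because a generic equation is not a unit on a suitable affine piece of a component
(`isGeneric_not_isUnit`). The latter is seen from norms to a polynomial ring: units have constant
norm, while a nonzero nonunit has nonconstant norm. -/

lemma le_of_add_one_le_add_one {a b : WithBot ℕ∞} (h : a + 1 ≤ b + 1) : a ≤ b := by
  induction a with
  | bot => exact bot_le
  | coe a =>
    induction b with
    | bot =>
      rw [WithBot.bot_add, le_bot_iff] at h
      exact absurd h (by exact_mod_cast WithBot.coe_ne_bot)
    | coe b =>
      have h' : a + 1 ≤ b + 1 := by exact_mod_cast h
      exact WithBot.coe_le_coe.mpr ((ENat.add_le_add_iff_right ENat.one_ne_top).mp h')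

section RegularLocal

open IsLocalRing

variable {R : Type u} [CommRing R]

lemma exists_linearIndepOn_cotangentSpace [IsLocalRing R] [IsNoetherianRing R]
    (s : Set (maximalIdeal R)) (hs : Submodule.span R s = ⊤) (t : Set (CotangentSpace R))
    (hts : t ⊆ (maximalIdeal R).toCotangent '' s)
    (ht : LinearIndepOn (ResidueField R) id t) :
    ∃ b : Set (CotangentSpace R), t ⊆ b ∧ b ⊆ (maximalIdeal R).toCotangent '' s ∧ b.Finite ∧
      b.ncard = (maximalIdeal R).spanFinrank ∧ Submodule.span (ResidueField R) b = ⊤ := by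
  obtain ⟨b, hbs, htb, hsb, hb⟩ := exists_linearIndepOn_id_extension ht hts
  have htop : Submodule.span (ResidueField R) b = ⊤ := by
    rw [eq_top_iff, ← CotangentSpace.span_image_eq_top_iff.mpr hs]
    exact Submodule.span_le.mpr hsb
  let B := Module.Basis.mk (v := fun x : b => (x : CotangentSpace R)) hb (by simp [htop])
  have hfin : Finite b := Module.Finite.finite_basis B
  refine ⟨b, htb, hbs, hfin, ?_, htop⟩
  rw [spanFinrank_maximalIdeal_eq_finrank_cotangentSpace, Module.finrank_eq_nat_card_basis B,
    Nat.card_coe_set_eq]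

lemma span_image_val_maximalIdeal [IsLocalRing R] [IsNoetherianRing R]
    (s : Set (maximalIdeal R))
    (hs : Submodule.span (ResidueField R) ((maximalIdeal R).toCotangent '' s) = ⊤) :
    Ideal.span (Subtype.val '' s) = maximalIdeal R := by
  have h := CotangentSpace.span_image_eq_top_iff.mp hs
  have h2 := congrArg (Submodule.map (maximalIdeal R).subtype) h
  rw [Submodule.map_span, Submodule.map_top, Submodule.range_subtype] at h2
  exact h2

lemma exists_finset_span_eq_maximalIdeal [IsLocalRing R] [IsNoetherianRing R] (s : Set R)
    (hs : Ideal.span s = maximalIdeal R) :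
    ∃ T : Finset R, (T : Set R) ⊆ s ∧ Ideal.span (T : Set R) = maximalIdeal R ∧
      T.card = (maximalIdeal R).spanFinrank := by
  classical
  have hsm : s ⊆ maximalIdeal R := hs ▸ Ideal.subset_span
  let s' : Set (maximalIdeal R) := Subtype.val ⁻¹' s
  have hs' : Submodule.span R s' = ⊤ := by
    apply Submodule.map_injective_of_injective (maximalIdeal R).injective_subtype
    rw [Submodule.map_span, Submodule.map_top, Submodule.range_subtype]
    have : (maximalIdeal R).subtype '' s' = s := by
      have := Subtype.image_preimage_coe (maximalIdeal R : Set R) s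
      rw [Set.inter_eq_right.mpr hsm] at this
      exact this
    rw [this]; exact hs
  obtain ⟨b, -, hbs, hfin, hcard, htop⟩ := exists_linearIndepOn_cotangentSpace s' hs' ∅
    (Set.empty_subset _) (linearIndepOn_empty _ _)
  have hbs' : ∀ y, y ∈ b → ∃ z, z ∈ s' ∧ (maximalIdeal R).toCotangent z = y :=
    fun y hy => hbs hy
  choose! σ hσ using hbs'
  have himg : (maximalIdeal R).toCotangent '' (σ '' b) = b := by
    rw [← Set.image_comp]
    exact (Set.image_congr fun x hx => (hσ _ hx).2).trans (Set.image_id b)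
  have hinj : Set.InjOn (fun x => (σ x : R)) b := fun x hx y hy hxy => by
    rw [← (hσ _ hx).2, ← (hσ _ hy).2, Subtype.ext hxy]
  have hfin' : ((fun x => (σ x : R)) '' b).Finite := hfin.image _
  refine ⟨hfin'.toFinset, ?_, ?_, ?_⟩
  · rw [hfin'.coe_toFinset]
    rintro _ ⟨x, hx, rfl⟩
    exact (hσ _ hx).1
  · rw [hfin'.coe_toFinset]
    have := span_image_val_maximalIdeal (σ '' b) (by rw [himg, htop])
    rwa [← Set.image_comp] at this
  · rw [← Set.ncard_eq_toFinset_card _ hfin', hinj.ncard_image, hcard]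

/-- Since `x` is nonzero in `𝔪/𝔪²`, its class extends to a basis taken from the classes of `s`;
Nakayama lifts the basis to generators. The bound counts generators other than `x`. -/
lemma exists_finset_span_insert_eq_maximalIdeal [IsLocalRing R] [IsNoetherianRing R] (s : Set R)
    {x : R} (hs : Ideal.span (insert x s) = maximalIdeal R) (hx : x ∉ maximalIdeal R ^ 2) :
    ∃ T : Finset R, (T : Set R) ⊆ s ∧ Ideal.span (insert x (T : Set R)) = maximalIdeal R ∧
      T.card + 1 ≤ (maximalIdeal R).spanFinrank := by
  classical
  have hsm : insert x s ⊆ (maximalIdeal R : Set R) := hs ▸ Ideal.subset_span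
  have hxm : x ∈ maximalIdeal R := hsm (Set.mem_insert _ _)
  let x' : maximalIdeal R := ⟨x, hxm⟩
  let s' : Set (maximalIdeal R) := Subtype.val ⁻¹' (insert x s)
  have hs' : Submodule.span R s' = ⊤ := by
    apply Submodule.map_injective_of_injective (maximalIdeal R).injective_subtype
    rw [Submodule.map_span, Submodule.map_top, Submodule.range_subtype]
    have : (maximalIdeal R).subtype '' s' = insert x s := by
      have := Subtype.image_preimage_coe (maximalIdeal R : Set R) (insert x s)
      rw [Set.inter_eq_right.mpr hsm] at this
      exact this
    rw [this]; exact hs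
  have hx0 : (maximalIdeal R).toCotangent x' ≠ 0 := by
    rwa [Ne, Ideal.toCotangent_eq_zero]
  obtain ⟨b, hxb, hbs, hfin, hcard, htop⟩ := exists_linearIndepOn_cotangentSpace s' hs'
    {(maximalIdeal R).toCotangent x'}
    (by rintro _ rfl; exact ⟨x', Set.mem_insert _ _, rfl⟩)
    (LinearIndepOn.singleton hx0)
  rw [Set.singleton_subset_iff] at hxb
  have hbs' : ∀ y, y ∈ b → ∃ z, z ∈ s' ∧ (maximalIdeal R).toCotangent z = y :=
    fun y hy => hbs hy
  choose! σ hσ using hbs'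
  set c := b \ {(maximalIdeal R).toCotangent x'} with hc
  have hcb : c ⊆ b := Set.sdiff_subset
  have himg : (maximalIdeal R).toCotangent '' (σ '' c) = c := by
    rw [← Set.image_comp]
    exact (Set.image_congr fun x hx => (hσ _ (hcb hx)).2).trans (Set.image_id c)
  have hfin' : ((fun x => (σ x : R)) '' c).Finite := (hfin.subset hcb).image _
  refine ⟨hfin'.toFinset, ?_, ?_, ?_⟩
  · rw [hfin'.coe_toFinset]
    rintro _ ⟨y, hy, rfl⟩
    have h1 := (hσ _ (hcb hy)).1
    rcases h1 with h1 | h1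
    · exfalso
      apply hy.2
      rw [Set.mem_singleton_iff, ← (hσ _ (hcb hy)).2]
      exact congrArg _ (Subtype.ext h1)
    · exact h1
  · rw [hfin'.coe_toFinset]
    have := span_image_val_maximalIdeal (insert x' (σ '' c))
      (by rw [Set.image_insert_eq, himg, hc, Set.insert_sdiff_singleton, Set.insert_eq_of_mem hxb,
        htop])
    rwa [Set.image_insert_eq, ← Set.image_comp] at this
  · rw [← Set.ncard_eq_toFinset_card _ hfin']
    have h1 : c.ncard + 1 = b.ncard := Set.ncard_sdiff_singleton_add_one hxb hfin
    have h2 := Set.ncard_image_le (f := fun x => (σ x : R)) (hfin.subset hcb)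
    omega

/-- A local ring whose maximal ideal is generated by `n ≤ dim R` elements is regular. -/
lemma isRegularLocalRing_of_span_le [IsLocalRing R] [IsNoetherianRing R] (T : Finset R)
    (hT : Ideal.span (T : Set R) = maximalIdeal R) (h : (T.card : WithBot ℕ∞) ≤ ringKrullDim R) :
    IsRegularLocalRing R := by
  apply IsRegularLocalRing.of_spanFinrank_maximalIdeal_le
  refine le_trans ?_ h
  rw [← hT]
  have := Submodule.spanFinrank_span_le_ncard_of_finite (R := R) T.finite_toSet
  rw [Set.ncard_coe_finset] at this
  exact_mod_cast this

lemma ringKrullDim_le_quotient_add_one [IsLocalRing R] [IsNoetherianRing R] {f : R}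
    (hf : f ∈ maximalIdeal R) : ringKrullDim R ≤ ringKrullDim (R ⧸ Ideal.span {f}) + 1 := by
  have := ringKrullDim_le_ringKrullDim_quotient_add_card (R := R) {f}
    (by simpa [IsLocalRing.ringJacobson_eq_maximalIdeal] using hf)
  rw [Finset.coe_singleton] at this
  simpa using this

instance isLocalRing_quotient [IsLocalRing R] (I : Ideal R) [Nontrivial (R ⧸ I)] :
    IsLocalRing (R ⧸ I) :=
  IsLocalRing.of_surjective' (Ideal.Quotient.mk I) Ideal.Quotient.mk_surjective

lemma nontrivial_quotient_span_singleton [IsLocalRing R] {f : R} (hf : f ∈ maximalIdeal R) :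
    Nontrivial (R ⧸ Ideal.span {f}) :=
  Ideal.Quotient.nontrivial_iff.mpr fun h => (IsLocalRing.maximalIdeal.isMaximal R).ne_top
    (top_le_iff.mp (h ▸ (Ideal.span_singleton_le_iff_mem _).mpr hf))

lemma maximalIdeal_quotient [IsLocalRing R] (I : Ideal R) [Nontrivial (R ⧸ I)] :
    maximalIdeal (R ⧸ I) = (maximalIdeal R).map (Ideal.Quotient.mk I) := by
  have hI : I ≤ maximalIdeal R := le_maximalIdeal (Ideal.Quotient.nontrivial_iff.mp ‹_›)
  symm
  apply IsLocalRing.eq_maximalIdeal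
  have h : Ideal.comap (Ideal.Quotient.mk I) ((maximalIdeal R).map (Ideal.Quotient.mk I)) =
      maximalIdeal R := by
    rw [Ideal.comap_map_of_surjective _ Ideal.Quotient.mk_surjective, ← RingHom.ker_eq_comap_bot,
      Ideal.mk_ker, sup_eq_left.mpr hI]
  refine (Ideal.map_eq_top_or_isMaximal_of_surjective _ Ideal.Quotient.mk_surjective
    (IsLocalRing.maximalIdeal.isMaximal R)).resolve_left fun htop => ?_
  rw [htop, Ideal.comap_top] at h
  exact (IsLocalRing.maximalIdeal.isMaximal R).ne_top h.symm

/-- Modulo `f` the number of generators of the maximal ideal drops by at least one, the dimension by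
at most one. As the former bounds the latter from above, both drop by exactly one. -/
lemma ringKrullDim_quotient_of_regular [IsRegularLocalRing R] {f : R} (hf : f ∈ maximalIdeal R)
    (hf2 : f ∉ maximalIdeal R ^ 2) : IsRegularLocalRing (R ⧸ Ideal.span {f}) ∧
      ringKrullDim (R ⧸ Ideal.span {f}) + 1 = ringKrullDim R := by
  classical
  have := nontrivial_quotient_span_singleton hf
  obtain ⟨T, -, hT, hcard⟩ := exists_finset_span_insert_eq_maximalIdeal (maximalIdeal R : Set R)
    (x := f) (by rw [Set.insert_eq_of_mem hf, Ideal.span_eq]) hf2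
  set T' := T.image (Ideal.Quotient.mk (Ideal.span {f})) with hT'
  have hspan : Ideal.span (T' : Set (R ⧸ Ideal.span {f})) = maximalIdeal _ := by
    rw [maximalIdeal_quotient, ← hT, Ideal.map_span, Set.image_insert_eq, Finset.coe_image,
      Ideal.Quotient.eq_zero_iff_mem.mpr (Ideal.mem_span_singleton_self f), Ideal.span_insert_zero]
  have h1 := ringKrullDim_le_quotient_add_one hf
  have h2 : (T'.card : WithBot ℕ∞) + 1 ≤ ringKrullDim R := by
    rw [← IsRegularLocalRing.spanFinrank_maximalIdeal]
    have : T'.card ≤ T.card := Finset.card_image_le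
    exact_mod_cast (by omega : T'.card + 1 ≤ (maximalIdeal R).spanFinrank)
  have h3 : IsRegularLocalRing (R ⧸ Ideal.span {f}) :=
    isRegularLocalRing_of_span_le T' hspan (le_of_add_one_le_add_one (h2.trans h1))
  refine ⟨h3, le_antisymm (le_trans ?_ h2) h1⟩
  gcongr
  rw [← IsRegularLocalRing.spanFinrank_maximalIdeal, ← hspan]
  have := Submodule.spanFinrank_span_le_ncard_of_finite (R := R ⧸ Ideal.span {f}) T'.finite_toSet
  rw [Set.ncard_coe_finset] at this
  exact_mod_cast this

/-- The quotient of a regular local ring by an element outside `𝔪²` is regular. -/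
lemma isRegularLocalRing_quotient [IsRegularLocalRing R] {f : R} (hf : f ∈ maximalIdeal R)
    (hf2 : f ∉ maximalIdeal R ^ 2) : IsRegularLocalRing (R ⧸ Ideal.span {f}) :=
  (ringKrullDim_quotient_of_regular hf hf2).1

/-- Induction on the embedding dimension. Prime avoidance gives a regular parameter `x` outside all
minimal primes; `(x)` is prime by induction, and a minimal prime inside `(x)` vanishes by Nakayama.
-/
lemma isDomain_of_isRegularLocalRing (R : Type u) [CommRing R] [hR : IsRegularLocalRing R] :
    IsDomain R := by
  obtain ⟨n, hn⟩ : ∃ n, n = (maximalIdeal R).spanFinrank := ⟨_, rfl⟩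
  induction n generalizing R with
  | zero =>
    rw [eq_comm, Submodule.spanFinrank_eq_zero_iff_eq_bot (maximalIdeal R).fg_of_isNoetherianRing]
      at hn
    exact (IsLocalRing.isField_iff_maximalIdeal_eq.mpr hn).isDomain
  | succ n ih =>
    have hdim : ringKrullDim R = (n + 1 : ℕ) := by
      rw [hn, IsRegularLocalRing.spanFinrank_maximalIdeal]
    have hfin := minimalPrimes.finite_of_isNoetherianRing R
    have hx : ∃ x ∈ maximalIdeal R, x ∉ maximalIdeal R ^ 2 ∧ ∀ P ∈ minimalPrimes R, x ∉ P := by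
      by_contra! hcon
      -- Prime avoidance tolerates two ideals that are not prime; both of these places are taken by
      -- `𝔪²`.
      have hsub : (maximalIdeal R : Set R) ⊆ (maximalIdeal R ^ 2 : Ideal R) ∪
          (maximalIdeal R ^ 2 : Ideal R) ∪ ⋃ P ∈ (hfin.toFinset : Set (Ideal R)), (P : Set R) := by
        intro x hx
        by_cases hx2 : x ∈ maximalIdeal R ^ 2
        · exact Or.inl (Or.inl hx2)
        · obtain ⟨P, hP, hxP⟩ := hcon x hx hx2
          exact Or.inr (Set.mem_biUnion (by simpa using hP) hxP)
      have := (Ideal.subset_union_prime' (f := fun P : Ideal R => P)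
        (s := hfin.toFinset) (fun P hP => (hfin.mem_toFinset.mp hP).1.1)).mp hsub
      have hm2 : ¬ maximalIdeal R ≤ maximalIdeal R ^ 2 := fun h => by
        have h0 : maximalIdeal R = ⊥ := by
          refine Submodule.eq_bot_of_le_smul_of_le_jacobson_bot (maximalIdeal R) _
            (maximalIdeal R).fg_of_isNoetherianRing (by rwa [smul_eq_mul, ← pow_two]) ?_
          rw [IsLocalRing.jacobson_eq_maximalIdeal _ bot_ne_top]
        rw [h0, Submodule.spanFinrank_bot] at hn
        omega
      rcases this with h | h | ⟨P, hP, h⟩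
      · exact hm2 h
      · exact hm2 h
      · have hP' := hfin.mem_toFinset.mp hP
        have := hP'.1.1
        have hPm : P = maximalIdeal R := le_antisymm (le_maximalIdeal this.ne_top) h
        have h0 : (maximalIdeal R).height = 0 := by
          rw [← hPm, Ideal.height_eq_zero_iff]
          exact hP'
        have h1 := IsLocalRing.maximalIdeal_height_eq_ringKrullDim (R := R)
        rw [h0, hdim] at h1
        have : (0 : ℕ∞) = ((n + 1 : ℕ) : ℕ∞) := by exact_mod_cast h1
        exact absurd (by exact_mod_cast this : 0 = n + 1) (by omega)
    obtain ⟨x, hxm, hx2, hxP⟩ := hx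
    obtain ⟨hreg, hd⟩ := ringKrullDim_quotient_of_regular hxm hx2
    have hdom : IsDomain (R ⧸ Ideal.span {x}) := by
      apply ih
      rw [hdim, ← IsRegularLocalRing.spanFinrank_maximalIdeal] at hd
      have : (maximalIdeal (R ⧸ Ideal.span {x})).spanFinrank + 1 = n + 1 := by exact_mod_cast hd
      omega
    rw [Ideal.Quotient.isDomain_iff_prime] at hdom
    -- Every element of `P` is a multiple `x z`, and `x ∉ P` puts `z` in `P`; thus `P = x P`.
    obtain ⟨P, hP, hPx⟩ := Ideal.exists_minimalPrimes_le (I := ⊥) (J := Ideal.span {x}) bot_le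
    have hPprime := hP.1.1
    have h0 : P = ⊥ := by
      refine Submodule.eq_bot_of_le_smul_of_le_jacobson_bot (Ideal.span {x}) P
        P.fg_of_isNoetherianRing ?_ ?_
      · intro y hy
        obtain ⟨z, rfl⟩ := Ideal.mem_span_singleton'.mp (hPx hy)
        rw [smul_eq_mul, mul_comm z x]
        exact Ideal.mul_mem_mul (Ideal.mem_span_singleton_self x)
          ((hPprime.mem_or_mem hy).resolve_right (hxP P hP))
      · rw [IsLocalRing.jacobson_eq_maximalIdeal _ bot_ne_top]
        exact (Ideal.span_singleton_le_iff_mem _).mpr hxm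
    rw [h0] at hPprime
    exact IsDomain.of_bot_isPrime R

end RegularLocal

/-! ### Depth -/

section Depth

open IsLocalRing RingTheory.Sequence

variable {R : Type u} [CommRing R]

lemma exists_isRegular_of_le_depth [IsLocalRing R] {n : ℕ} (h : (n : ℕ∞) ≤ depth R) :
    ∃ rs : List R, rs.length = n ∧ (∀ r ∈ rs, r ∈ maximalIdeal R) ∧ IsWeaklyRegular R rs := by
  rcases Nat.eq_zero_or_pos n with rfl | hn
  · exact ⟨[], rfl, by simp, .nil R R⟩
  by_contra! hcon
  have : depth R ≤ (n - 1 : ℕ) := by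
    refine iSup_le fun rs => iSup_le fun hrs => iSup_le fun hreg => ?_
    by_contra! hlt
    have hlen : n ≤ rs.length := by
      have : n - 1 < rs.length := by exact_mod_cast hlt
      omega
    refine hcon (rs.take n) (by simpa using hlen) (fun r hr => hrs r (List.mem_of_mem_take hr)) ?_
    have := hreg.toIsWeaklyRegular
    rw [← List.take_append_drop n rs, isWeaklyRegular_append_iff] at this
    exact this.1
  have := h.trans this
  have : n ≤ n - 1 := by exact_mod_cast this
  omega

lemma le_depth_of_isWeaklyRegular [IsLocalRing R] (rs : List R)
    (hm : ∀ r ∈ rs, r ∈ maximalIdeal R) (h : IsWeaklyRegular R rs) :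
    (rs.length : ℕ∞) ≤ depth R := by
  refine le_trans ?_ (le_iSup _ rs)
  refine le_trans ?_ (le_iSup _ hm)
  exact le_iSup (fun _ : IsRegular R rs => (rs.length : ℕ∞))
    ((IsLocalRing.isRegular_iff_isWeaklyRegular_of_subset_maximalIdeal hm).mpr h)

lemma isWeaklyRegular_quotient_iff (x : R) (rs : List R) :
    IsWeaklyRegular (QuotSMulTop x R) rs ↔
      IsWeaklyRegular (R ⧸ Ideal.span {x}) (rs.map (Ideal.Quotient.mk (Ideal.span {x}))) := by
  have e : QuotSMulTop x R ≃ₗ[R] R ⧸ Ideal.span {x} :=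
    Submodule.quotEquivOfEq _ _ (by rw [← Submodule.ideal_span_singleton_smul]; simp)
  rw [e.isWeaklyRegular_congr]
  exact (isWeaklyRegular_map_algebraMap_iff (R := R) (R ⧸ Ideal.span {x}) (R ⧸ Ideal.span {x})
    rs).symm

lemma isWeaklyRegular_cons_quotient_iff (x : R) (rs : List R) :
    IsWeaklyRegular R (x :: rs) ↔ IsSMulRegular R x ∧
      IsWeaklyRegular (R ⧸ Ideal.span {x}) (rs.map (Ideal.Quotient.mk (Ideal.span {x}))) := by
  rw [isWeaklyRegular_cons_iff, isWeaklyRegular_quotient_iff]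

/-- Dividing by a regular element lowers the depth by at most one. -/
lemma le_depth_quotient [IsLocalRing R] [IsNoetherianRing R] {x : R} (hx : x ∈ maximalIdeal R)
    (hreg : IsSMulRegular R x) [IsLocalRing (R ⧸ Ideal.span {x})] {n : ℕ}
    (h : ((n + 1 : ℕ) : ℕ∞) ≤ depth R) : (n : ℕ∞) ≤ depth (R ⧸ Ideal.span {x}) := by
  obtain ⟨rs, hlen, hm, hrs⟩ := exists_isRegular_of_le_depth h
  have hrs' := (IsLocalRing.isRegular_iff_isWeaklyRegular_of_subset_maximalIdeal hm).mpr hrs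
  have key : ∃ rs' : List R, rs'.length = n ∧ (∀ r ∈ rs', r ∈ maximalIdeal R) ∧
      IsRegular (QuotSMulTop x R) rs' := by
    have hlt : ∀ (M : Type u) [AddCommGroup M] [Module R M] [Module.Finite R M] [Nontrivial M],
        (maximalIdeal R) • (⊤ : Submodule R M) < ⊤ := fun M _ _ _ _ => by
      refine lt_top_iff_ne_top.mpr (Ne.symm ?_)
      apply Submodule.top_ne_ideal_smul_of_le_jacobson_annihilator
      exact IsLocalRing.maximalIdeal_le_jacobson _
    have hnt : Nontrivial (QuotSMulTop x R) := nontrivial_quotSMulTop_of_mem_maximalIdeal R hx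
    -- Rees: regular sequences of length `n + 1` exist exactly when `Ext^i(R/𝔪, R)` vanishes for `i
    -- ≤ n`. The long exact sequence of multiplication by `x` squeezes `Ext^i(R/𝔪, R/x)` between
    -- degrees `i` and `i + 1`, so one degree is lost.
    let M : ModuleCat.{u} R := ModuleCat.of R R
    have t1 := (ModuleCat.exists_isRegular_tfae (maximalIdeal R) (n + 1) M (hlt R)).out 1 3
    have t2 := (ModuleCat.exists_isRegular_tfae (maximalIdeal R) n
      (ModuleCat.of R (QuotSMulTop x R)) (hlt _)).out 1 3
    have hext := t1.mpr ⟨rs, hlen, hm, hrs'⟩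
    apply t2.mp
    intro i hi
    have zero1 := AddCommGrpCat.isZero_of_iff_subsingleton.mpr (hext i (by omega))
    have zero2 := AddCommGrpCat.isZero_of_iff_subsingleton.mpr (hext (i + 1) (by omega))
    exact AddCommGrpCat.subsingleton_of_isZero <| ShortComplex.Exact.isZero_of_both_zeros
      ((Abelian.Ext.covariant_sequence_exact₃' _
        (IsSMulRegular.smulShortComplex_shortExact (M := M) hreg)) i (i + 1) rfl)
      (zero1.eq_zero_of_src _) (zero2.eq_zero_of_tgt _)
  obtain ⟨rs', hlen', hm', hreg'⟩ := key
  have hw := (isWeaklyRegular_quotient_iff x rs').mp hreg'.toIsWeaklyRegular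
  have := le_depth_of_isWeaklyRegular _ (fun r hr => ?_) hw
  · simpa [hlen'] using this
  · obtain ⟨s, hs, rfl⟩ := List.mem_map.mp hr
    rw [maximalIdeal_quotient]
    exact Ideal.mem_map_of_mem _ (hm' s hs)

lemma depth_le_of_ringEquiv {S : Type v} [CommRing S] [IsLocalRing R] [IsLocalRing S]
    (e : R ≃+* S) : depth R ≤ depth S := by
  refine iSup_le fun rs => iSup_le fun hrs => iSup_le fun hreg => ?_
  have := le_depth_of_isWeaklyRegular (R := S) (rs.map e) (fun r hr => ?_) ?_
  · simpa using this
  · obtain ⟨s, hs, rfl⟩ := List.mem_map.mp hr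
    have := hrs s hs
    rw [mem_maximalIdeal, mem_nonunits_iff] at this ⊢
    rwa [MulEquiv.isUnit_map]
  · refine (AddEquiv.isWeaklyRegular_congr (e := e.toAddEquiv) (as := rs) ?_).mp
      hreg.toIsWeaklyRegular
    refine List.forall₂_map_right_iff.mpr (List.forall₂_same.mpr fun r _ x => ?_)
    simp

lemma depth_eq_of_ringEquiv {S : Type v} [CommRing S] [IsLocalRing R] [IsLocalRing S]
    (e : R ≃+* S) : depth R = depth S :=
  le_antisymm (depth_le_of_ringEquiv e) (depth_le_of_ringEquiv e.symm)

/-- A regular local ring is Cohen-Macaulay: its maximal ideal is generated by a regular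
sequence of length `dim R`. -/
lemma exists_isWeaklyRegular_of_isRegularLocalRing (R : Type u) [CommRing R]
    [hR : IsRegularLocalRing R] :
    ∃ rs : List R, (∀ r ∈ rs, r ∈ maximalIdeal R) ∧ IsWeaklyRegular R rs ∧
      (rs.length : WithBot ℕ∞) = ringKrullDim R := by
  obtain ⟨n, hn⟩ : ∃ n, n = (maximalIdeal R).spanFinrank := ⟨_, rfl⟩
  induction n generalizing R with
  | zero =>
    refine ⟨[], by simp, .nil R R, ?_⟩
    rw [← IsRegularLocalRing.spanFinrank_maximalIdeal, ← hn]
    rfl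
  | succ n ih =>
    have hdom := isDomain_of_isRegularLocalRing R
    have hx : ∃ x ∈ maximalIdeal R, x ∉ maximalIdeal R ^ 2 := by
      by_contra! hcon
      have h0 : maximalIdeal R = ⊥ := by
        refine Submodule.eq_bot_of_le_smul_of_le_jacobson_bot (maximalIdeal R) _
          (maximalIdeal R).fg_of_isNoetherianRing ?_ ?_
        · rw [smul_eq_mul, ← pow_two]; exact hcon
        · rw [IsLocalRing.jacobson_eq_maximalIdeal _ bot_ne_top]
      rw [h0, Submodule.spanFinrank_bot] at hn
      omega
    obtain ⟨x, hxm, hx2⟩ := hx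
    obtain ⟨hreg, hd⟩ := ringKrullDim_quotient_of_regular hxm hx2
    obtain ⟨rs, hrsm, hrs, hlen⟩ := ih (R ⧸ Ideal.span {x}) (by
      rw [← IsRegularLocalRing.spanFinrank_maximalIdeal,
        ← IsRegularLocalRing.spanFinrank_maximalIdeal, ← hn] at hd
      have : (maximalIdeal (R ⧸ Ideal.span {x})).spanFinrank + 1 = n + 1 := by exact_mod_cast hd
      omega)
    obtain ⟨ts, rfl⟩ : ∃ ts : List R, ts.map (Ideal.Quotient.mk (Ideal.span {x})) = rs :=
      List.map_surjective_iff.mpr Ideal.Quotient.mk_surjective rs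
    refine ⟨x :: ts, ?_, ?_, ?_⟩
    · intro r hr
      rcases List.mem_cons.mp hr with rfl | hr
      · exact hxm
      · have h1 := hrsm _ (List.mem_map_of_mem hr)
        by_contra hu
        rw [mem_maximalIdeal, mem_nonunits_iff, not_not] at hu
        exact h1 (hu.map _)
    · rw [isWeaklyRegular_cons_quotient_iff]
      refine ⟨?_, hrs⟩
      have hx0 : x ≠ 0 := fun h => hx2 (h ▸ zero_mem _)
      exact fun a b hab => mul_left_cancel₀ hx0 hab
    · rw [← hd, ← hlen]; simp

lemma ringKrullDim_le_depth_of_isRegularLocalRing (R : Type u) [CommRing R]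
    [hR : IsRegularLocalRing R] : ringKrullDim R ≤ (depth R : WithBot ℕ∞) := by
  obtain ⟨rs, hm, hrs, hlen⟩ := exists_isWeaklyRegular_of_isRegularLocalRing R
  rw [← hlen]
  exact_mod_cast le_depth_of_isWeaklyRegular rs hm hrs

end Depth

/-! ### Regularity of extensions -/

section RegularExtensions

open IsLocalRing

/-- Membership in `𝔪²` is used in this form, without localizing, so that derivations of the ring
itself apply to `s * f` and the condition can be reduced modulo a smaller prime. -/
lemma algebraMap_mem_maximalIdeal_sq_iff {R : Type u} [CommRing R] (P : Ideal R) [P.IsPrime]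
    (f : R) : algebraMap R (Localization.AtPrime P) f ∈
      maximalIdeal (Localization.AtPrime P) ^ 2 ↔ ∃ s ∉ P, s * f ∈ P ^ 2 := by
  rw [← Localization.AtPrime.map_eq_maximalIdeal, ← Ideal.map_pow,
    IsLocalization.algebraMap_mem_map_algebraMap_iff P.primeCompl]
  simp [Ideal.mem_primeCompl_iff]

lemma Derivation.mem_of_mem_sq {k R S : Type*} [CommRing k] [CommRing R] [CommRing S] [Algebra k R]
    [Algebra R S] [Algebra k S] (D : Derivation k R S) (P : Ideal S) {x : R}
    (hx : x ∈ (P.comap (algebraMap R S)) ^ 2) : D x ∈ P := by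
  rw [pow_two] at hx
  refine Submodule.mul_induction_on hx (fun a ha b hb => ?_) (fun a b ha hb => ?_)
  · rw [D.leibniz, Algebra.smul_def, Algebra.smul_def]
    exact add_mem (Ideal.mul_mem_right _ _ ha) (Ideal.mul_mem_right _ _ hb)
  · rw [map_add]
    exact add_mem ha hb

/-- Derivations send `P²` into `P`, and the error term `x · D s` is already in `P`. Hence a
derivative that does not vanish at `P` certifies that `x` is not in the square of the maximal ideal.
-/
lemma Derivation.mem_of_mul_mem_sq {k R S : Type*} [CommRing k] [CommRing R] [CommRing S]
    [Algebra k R] [Algebra R S] [Algebra k S] (D : Derivation k R S) (P : Ideal S) [P.IsPrime]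
    {x s : R} (hs : algebraMap R S s ∉ P) (hx : algebraMap R S x ∈ P)
    (hsx : s * x ∈ (P.comap (algebraMap R S)) ^ 2) : D x ∈ P := by
  have h := Derivation.mem_of_mem_sq D P hsx
  rw [D.leibniz, Algebra.smul_def, Algebra.smul_def] at h
  have h2 := (Submodule.add_mem_iff_left P (Ideal.mul_mem_right (D s) P hx)).mp h
  exact (‹P.IsPrime›.mem_or_mem h2).resolve_left hs

lemma nonempty_localization_quotient_equiv {R : Type u} [CommRing R] (I : Ideal R)
    (Q : Ideal (R ⧸ I)) [Q.IsPrime] :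
    Nonempty (Localization.AtPrime Q ≃+*
      Localization.AtPrime (Q.comap (Ideal.Quotient.mk I)) ⧸
        I.map (algebraMap R (Localization.AtPrime (Q.comap (Ideal.Quotient.mk I))))) := by
  set P := Q.comap (Ideal.Quotient.mk I)
  have h : Algebra.algebraMapSubmonoid (R ⧸ I) P.primeCompl = Q.primeCompl := by
    ext x
    obtain ⟨x, rfl⟩ := Ideal.Quotient.mk_surjective x
    constructor
    · rintro ⟨y, hy, hyx⟩
      rw [Ideal.mem_primeCompl_iff, ← hyx]
      exact hy
    · intro hx
      exact ⟨x, hx, rfl⟩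
  have : IsLocalization.AtPrime (Localization.AtPrime P ⧸
      I.map (algebraMap R (Localization.AtPrime P))) Q := by
    rw [IsLocalization.AtPrime, ← h]
    infer_instance
  exact ⟨(IsLocalization.algEquiv Q.primeCompl (Localization.AtPrime Q) _).toRingEquiv⟩

/-- A standard étale extension of a regular ring is regular. -/
lemma isRegularLocalRing_adjoinRoot {B : Type u} [CommRing B] [IsRegularRing B]
    (f : Polynomial B) (Q : Ideal (AdjoinRoot f)) [Q.IsPrime]
    (hQ : AdjoinRoot.mk f (Polynomial.derivative f) ∉ Q) :
    IsRegularLocalRing (Localization.AtPrime Q) := by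
  let Q' : Ideal (Polynomial B ⧸ Ideal.span {f}) := Q
  have hQ' : Q'.IsPrime := ‹Q.IsPrime›
  obtain ⟨e⟩ := nonempty_localization_quotient_equiv (Ideal.span {f}) Q'
  set P := Q'.comap (Ideal.Quotient.mk (Ideal.span {f})) with hP
  have hfP : f ∈ P := by
    rw [hP, Ideal.mem_comap, Ideal.Quotient.eq_zero_iff_mem.mpr (Ideal.mem_span_singleton_self f)]
    exact zero_mem _
  have hf : algebraMap _ (Localization.AtPrime P) f ∈ maximalIdeal (Localization.AtPrime P) :=
    (IsLocalization.AtPrime.to_map_mem_maximal_iff _ P _).mpr hfP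
  have hf2 : algebraMap _ (Localization.AtPrime P) f ∉
      maximalIdeal (Localization.AtPrime P) ^ 2 := by
    rw [algebraMap_mem_maximalIdeal_sq_iff]
    rintro ⟨s, hs, hsf⟩
    -- The polynomial ring over `B` is regular, and `f` is outside the square of the maximal ideal
    -- because its derivative is invertible there.
    exact hQ (Derivation.mem_of_mul_mem_sq (Polynomial.derivative' (R := B)) P (x := f) (s := s)
      hs hfP hsf)
  have h1 := isRegularLocalRing_quotient hf hf2
  rw [Ideal.map_span, Set.image_singleton] at e
  exact IsRegularLocalRing.of_ringEquiv e.symm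

lemma ringKrullDim_le_of_isIntegral {R S : Type*} [CommRing R] [CommRing S] [Algebra R S]
    [Algebra.IsIntegral R S] : ringKrullDim S ≤ ringKrullDim R := by
  refine Order.krullDim_le_of_strictMono (PrimeSpectrum.comap (algebraMap R S)) fun p q hpq => ?_
  refine lt_of_le_of_ne (Ideal.comap_mono hpq.le) fun h => ?_
  obtain ⟨x, hxq, hxp⟩ := Set.exists_of_ssubset (show (p.asIdeal : Set S) ⊂ q.asIdeal from hpq)
  have := Ideal.comap_lt_comap_of_integral_mem_sdiff (I := p.asIdeal) (J := q.asIdeal)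
    (R := R) (le_of_lt hpq) ⟨hxq, hxp⟩ (Algebra.IsIntegral.isIntegral x)
  exact this.ne (congrArg PrimeSpectrum.asIdeal h)

/-- Nakayama in `S/I`: there the maximal ideal is generated by `y`, so `y` is a multiple of `y²`,
and `1 - d y` is a unit. -/
lemma mem_of_mem_maximalIdeal_sq {S : Type*} [CommRing S] [IsLocalRing S] {y : S} {I : Ideal S}
    (hM : maximalIdeal S = Ideal.span {y} ⊔ I) (hy2 : y ∈ maximalIdeal S ^ 2) : y ∈ I := by
  have hy : y ∈ maximalIdeal S := Ideal.pow_le_self two_ne_zero hy2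
  have h1 : maximalIdeal S ^ 2 ≤ Ideal.span {y ^ 2} ⊔ I := by
    rw [pow_two, Ideal.mul_le]
    intro r hr t ht
    rw [hM] at hr ht
    obtain ⟨r', hr', i, hi, hri⟩ := Submodule.mem_sup.mp hr
    obtain ⟨t', ht', j, hj, htj⟩ := Submodule.mem_sup.mp ht
    obtain ⟨a, rfl⟩ := Ideal.mem_span_singleton'.mp hr'
    obtain ⟨b, rfl⟩ := Ideal.mem_span_singleton'.mp ht'
    rw [← hri, ← htj]
    have : (a * y + i) * (b * y + j) = (a * b) * y ^ 2 + ((b * y + j) * i + (a * y) * j) := by ring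
    rw [this]
    exact add_mem (Ideal.mem_sup_left (Ideal.mul_mem_left _ _ (Ideal.mem_span_singleton_self _)))
      (Ideal.mem_sup_right (add_mem (Ideal.mul_mem_left _ _ hi) (Ideal.mul_mem_left _ _ hj)))
  obtain ⟨a, ha, b, hb, hab⟩ := Submodule.mem_sup.mp (h1 hy2)
  obtain ⟨d, rfl⟩ := Ideal.mem_span_singleton'.mp ha
  have hu : IsUnit (1 - d * y) := by
    by_contra hu
    refine (mem_maximalIdeal (1 : S)).mp ?_ isUnit_one
    have := add_mem ((mem_maximalIdeal _).mpr hu) (Ideal.mul_mem_left _ d hy)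
    rwa [sub_add_cancel] at this
  have hyb : y * (1 - d * y) = b := by linear_combination -hab
  rw [← hyb] at hb
  exact (Ideal.mul_unit_mem_iff_mem _ hu).mp hb

/-! ### Adjoining a `p`-th root to a local ring of characteristic `p` -/

section PthRoot

open Polynomial

variable {R : Type u} [CommRing R]

lemma under_eq_maximalIdeal [IsLocalRing R] {S : Type*} [CommRing S] [Algebra R S] [Algebra.IsIntegral R S]
    (M : Ideal S) [M.IsMaximal] : M.comap (algebraMap R S) = maximalIdeal R :=
  IsLocalRing.eq_maximalIdeal (Ideal.isMaximal_comap_of_isIntegral_of_isMaximal M)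

lemma exists_eq_add_root_sub_mul (f : R[X]) (e : R) (z : AdjoinRoot f) :
    ∃ (r : R) (w : AdjoinRoot f), z = AdjoinRoot.of f r +
      (AdjoinRoot.root f - AdjoinRoot.of f e) * w := by
  obtain ⟨G, rfl⟩ := AdjoinRoot.mk_surjective z
  obtain ⟨H, hH⟩ := Polynomial.X_sub_C_dvd_sub_C_eval (p := G) (a := e)
  refine ⟨G.eval e, AdjoinRoot.mk f H, ?_⟩
  have : G = C (G.eval e) + (X - C e) * H := by rw [← hH]; ring
  conv_lhs => rw [this]
  simp

/-- Lift to `R[X]` and evaluate at `e`: the multiple of `X - e` disappears and the multiple of `f`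
becomes one of `f(e)`. This brings generators of the maximal ideal of the extension back to `R`. -/
lemma mem_span_eval_of_of_eq {f : R[X]} {e r : R} {I : Ideal R} {w : AdjoinRoot f}
    (h : AdjoinRoot.of f r - (AdjoinRoot.root f - AdjoinRoot.of f e) * w ∈
      I.map (AdjoinRoot.of f)) : r ∈ I ⊔ Ideal.span {f.eval e} := by
  obtain ⟨W, rfl⟩ := AdjoinRoot.mk_surjective w
  have h1 : AdjoinRoot.mk f (C r - (X - C e) * W) ∈ (I.map C).map (AdjoinRoot.mk f) := by
    rw [Ideal.map_map]
    change _ ∈ I.map (AdjoinRoot.of f)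
    simpa using h
  obtain ⟨G, hG, hGr⟩ := (Ideal.mem_map_iff_of_surjective _ AdjoinRoot.mk_surjective).mp h1
  rw [← sub_eq_zero, ← map_sub, AdjoinRoot.mk_eq_zero] at hGr
  obtain ⟨V, hV⟩ := hGr
  have h2 := congrArg (eval e) hV
  simp only [eval_sub, eval_mul, eval_C, eval_X, sub_self, zero_mul, sub_zero] at h2
  have hGe : G.eval e ∈ I := by
    have := Ideal.mem_map_of_mem (evalRingHom e) hG
    rw [Ideal.map_map] at this
    have hid : (evalRingHom e).comp C = RingHom.id R := by ext; simp
    rwa [hid, Ideal.map_id] at this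
  have : r = G.eval e - f.eval e * V.eval e := by rw [← h2]; ring
  rw [this]
  exact sub_mem (Ideal.mem_sup_left hGe) (Ideal.mem_sup_right
    (Ideal.mul_mem_right _ _ (Ideal.mem_span_singleton_self _)))

variable [IsLocalRing R]

lemma maximalIdeal_eq_of_root_sub_mem {f : R[X]} {e : R}
    (M : Ideal (AdjoinRoot f)) (hM : M.comap (AdjoinRoot.of f) = maximalIdeal R)
    (hy : AdjoinRoot.root f - AdjoinRoot.of f e ∈ M) :
    M = Ideal.span (insert (AdjoinRoot.root f - AdjoinRoot.of f e)
      (AdjoinRoot.of f '' maximalIdeal R)) := by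
  apply le_antisymm
  · intro z hz
    obtain ⟨r, w, rfl⟩ := exists_eq_add_root_sub_mul f e z
    have hr : r ∈ maximalIdeal R := by
      rw [← hM, Ideal.mem_comap]
      exact (Submodule.add_mem_iff_left M (Ideal.mul_mem_right _ _ hy)).mp hz
    exact add_mem (Ideal.subset_span (Set.mem_insert_of_mem _ ⟨r, hr, rfl⟩))
      (Ideal.mul_mem_right _ _ (Ideal.subset_span (Set.mem_insert _ _)))
  · rw [Ideal.span_le, Set.insert_subset_iff]
    refine ⟨hy, ?_⟩
    rintro _ ⟨r, hr, rfl⟩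
    rw [← hM] at hr
    exact hr

/-- Modulo `𝔪_R` the extension is `κ[X]/(f̄)`, already a field; a Bézout identity over `κ` makes
this explicit. -/
lemma maximalIdeal_eq_of_irreducible {f : R[X]}
    (hf : Irreducible (f.map (residue R)))
    (M : Ideal (AdjoinRoot f)) [M.IsMaximal] (hM : M.comap (AdjoinRoot.of f) = maximalIdeal R) :
    M = (maximalIdeal R).map (AdjoinRoot.of f) := by
  have hle : (maximalIdeal R).map (AdjoinRoot.of f) ≤ M := by
    rw [Ideal.map_le_iff_le_comap, hM]
  have hker : ∀ G : R[X], G.map (residue R) = 0 → AdjoinRoot.mk f G ∈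
      (maximalIdeal R).map (AdjoinRoot.of f) := fun G hG => by
    have : G ∈ (maximalIdeal R).map C := by
      rw [Ideal.mem_map_C_iff]
      intro n
      have := congrArg (fun H => H.coeff n) hG
      simp only [coeff_map, coeff_zero] at this
      rwa [residue_eq_zero_iff] at this
    have h2 := Ideal.mem_map_of_mem (AdjoinRoot.mk f) this
    rw [Ideal.map_map] at h2
    exact h2
  apply le_antisymm _ hle
  intro z hz
  obtain ⟨G, rfl⟩ := AdjoinRoot.mk_surjective z
  by_cases hdvd : f.map (residue R) ∣ G.map (residue R)
  · obtain ⟨V, hV⟩ := hdvd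
    obtain ⟨V, rfl⟩ := Polynomial.map_surjective _ residue_surjective V
    have := hker (G - f * V) (by rw [Polynomial.map_sub, Polynomial.map_mul, hV, sub_self])
    rwa [map_sub, map_mul, AdjoinRoot.mk_self, zero_mul, sub_zero] at this
  · exfalso
    have hcop := (Irreducible.coprime_iff_not_dvd hf).mpr hdvd
    obtain ⟨a, b, hab⟩ := hcop
    obtain ⟨a, rfl⟩ := Polynomial.map_surjective _ residue_surjective a
    obtain ⟨b, rfl⟩ := Polynomial.map_surjective _ residue_surjective b
    have := hle (hker (a * f + b * G - 1) (by simp [hab]))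
    rw [map_sub, map_add, map_mul, map_mul, AdjoinRoot.mk_self, mul_zero, zero_add, map_one] at this
    have h1 : (1 : AdjoinRoot f) ∈ M := by
      have h2 := sub_mem (Ideal.mul_mem_left M (AdjoinRoot.mk f b) hz) this
      rwa [sub_sub_cancel] at h2
    exact (‹M.IsMaximal›.ne_top) ((Ideal.eq_top_iff_one M).mpr h1)

section

variable {p : ℕ} (hp : p.Prime) (c : R)

include hp in
-- The dichotomy behind the descent. Either `𝔪_R` still generates the maximal ideal of the
-- extension, or the root is congruent to some `e` in `R` and only one generator, the root minus
-- `e`, has to be added.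
lemma irreducible_or_exists_eval_mem :
    Irreducible ((X ^ p - C c).map (residue R)) ∨
      ∃ e : R, (X ^ p - C c : R[X]).eval e ∈ maximalIdeal R := by
  by_cases h : ∃ b : ResidueField R, b ^ p = residue R c
  · right
    obtain ⟨b, hb⟩ := h
    obtain ⟨e, rfl⟩ := residue_surjective b
    refine ⟨e, ?_⟩
    rw [← residue_eq_zero_iff]
    simp [hb]
  · left
    push Not at h
    rw [Polynomial.map_sub, Polynomial.map_pow, map_X, map_C]
    exact X_pow_sub_C_irreducible_of_prime hp h

include hp in
-- Otherwise `X - ē` would lie in the ideal of `X^p - c̄` over the residue field, which the degrees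
-- forbid. So the root minus `e` belongs to a minimal system of generators.
lemma root_sub_notMem_sq {e : R}
    [IsLocalRing (AdjoinRoot (X ^ p - C c : R[X]))]
    (hM : maximalIdeal _ = Ideal.span (insert (AdjoinRoot.root (X ^ p - C c) - AdjoinRoot.of _ e)
      (AdjoinRoot.of (X ^ p - C c) '' maximalIdeal R))) :
    AdjoinRoot.root (X ^ p - C c) - AdjoinRoot.of _ e ∉ maximalIdeal (AdjoinRoot _) ^ 2 := by
  intro hy2
  have hym := mem_of_mem_maximalIdeal_sq (I := (maximalIdeal R).map (AdjoinRoot.of _))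
    (by rw [hM, Ideal.span_insert]; rfl) hy2
  have h2 : AdjoinRoot.mk (X ^ p - C c) (X - C e) ∈
      ((maximalIdeal R).map C).map (AdjoinRoot.mk (X ^ p - C c)) := by
    rw [Ideal.map_map]
    change _ ∈ (maximalIdeal R).map (AdjoinRoot.of _)
    simpa using hym
  obtain ⟨G, hG, hGr⟩ := (Ideal.mem_map_iff_of_surjective _ AdjoinRoot.mk_surjective).mp h2
  rw [eq_comm, ← sub_eq_zero, ← map_sub, AdjoinRoot.mk_eq_zero] at hGr
  have h3 := Polynomial.map_dvd (residue R) hGr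
  have hG0 : G.map (residue R) = 0 := by
    ext n
    rw [coeff_map, coeff_zero, residue_eq_zero_iff]
    exact Ideal.mem_map_C_iff.mp hG n
  rw [Polynomial.map_sub (residue R) (p := X - C e), hG0, sub_zero, Polynomial.map_sub,
    Polynomial.map_sub, Polynomial.map_pow, map_X, map_C, map_C] at h3
  have h4 := Polynomial.natDegree_le_of_dvd h3 (X_sub_C_ne_zero _)
  rw [natDegree_X_pow_sub_C, natDegree_X_sub_C] at h4
  exact absurd hp.two_le (by omega)

variable [CharP R p]

include hp in
-- In characteristic `p` the `p`-th power of the root minus `e` is `c - e^p`, which lies in `𝔪_R`.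
lemma root_sub_mem_of_eval_mem {e : R} (he : (X ^ p - C c : R[X]).eval e ∈ maximalIdeal R)
    (M : Ideal (AdjoinRoot (X ^ p - C c))) [hMp : M.IsPrime]
    (hM : M.comap (AdjoinRoot.of (X ^ p - C c)) = maximalIdeal R) :
    AdjoinRoot.root (X ^ p - C c) - AdjoinRoot.of _ e ∈ M := by
  have := Fact.mk hp
  have hchar : CharP R[X] p := inferInstance
  apply hMp.mem_of_pow_mem p
  have h : (AdjoinRoot.root (X ^ p - C c) - AdjoinRoot.of _ e) ^ p =
      AdjoinRoot.of _ (-(X ^ p - C c : R[X]).eval e) := by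
    rw [← AdjoinRoot.mk_X, ← AdjoinRoot.mk_C, ← map_sub, ← map_pow, sub_pow_char, ← sub_eq_zero,
      ← AdjoinRoot.mk_C, ← map_sub, AdjoinRoot.mk_eq_zero]
    refine ⟨1, ?_⟩
    simp
  rw [h]
  rw [← neg_mem_iff, ← hM, Ideal.mem_comap] at he
  exact he

include hp in
lemma isLocalRing_adjoin_pthRoot : IsLocalRing (AdjoinRoot (X ^ p - C c : R[X])) := by
  have hmon : (X ^ p - C c : R[X]).Monic := monic_X_pow_sub_C c hp.ne_zero
  have := hmon.finite_adjoinRoot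
  have hnt : Nontrivial (AdjoinRoot (X ^ p - C c : R[X])) :=
    Ideal.Quotient.nontrivial_iff.mpr fun h => by
      have h1 := hmon.isUnit_iff.mp (Ideal.span_singleton_eq_top.mp h)
      have h2 := congrArg natDegree h1
      rw [natDegree_X_pow_sub_C, natDegree_one] at h2
      exact hp.ne_zero h2
  apply IsLocalRing.of_unique_max_ideal
  obtain ⟨M, hM⟩ := Ideal.exists_maximal (AdjoinRoot (X ^ p - C c : R[X]))
  refine ⟨M, hM, fun M' hM' => ?_⟩
  have h1 := under_eq_maximalIdeal (R := R) M
  have h2 := under_eq_maximalIdeal (R := R) M'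
  rcases irreducible_or_exists_eval_mem hp c with h | ⟨e, he⟩
  · rw [maximalIdeal_eq_of_irreducible h M h1, maximalIdeal_eq_of_irreducible h M' h2]
  · rw [maximalIdeal_eq_of_root_sub_mem M h1 (root_sub_mem_of_eval_mem hp c he M h1),
      maximalIdeal_eq_of_root_sub_mem M' h2 (root_sub_mem_of_eval_mem hp c he M' h2)]

include hp in
/-- Regularity descends along the adjunction of a `p`-th root in characteristic `p`. -/
theorem isRegularLocalRing_of_adjoin_pthRoot [IsNoetherianRing R]
    [hS : IsRegularLocalRing (AdjoinRoot (X ^ p - C c : R[X]))] : IsRegularLocalRing R := by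
  classical
  have hmon : (X ^ p - C c : R[X]).Monic := monic_X_pow_sub_C c hp.ne_zero
  have := hmon.finite_adjoinRoot
  have := hmon.free_adjoinRoot
  set S := AdjoinRoot (X ^ p - C c : R[X]) with hSdef
  have hdim : ringKrullDim S ≤ ringKrullDim R := ringKrullDim_le_of_isIntegral
  have hM := under_eq_maximalIdeal (R := R) (maximalIdeal S)
  -- The extension is integral, so its dimension is at most `dim R`. It is therefore enough to
  -- generate `𝔪_R` by as many elements as the regular extension needs.
  suffices h : ∃ T : Finset R, Ideal.span (T : Set R) = maximalIdeal R ∧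
      T.card ≤ (maximalIdeal S).spanFinrank by
    obtain ⟨T, hT, hcard⟩ := h
    refine isRegularLocalRing_of_span_le T hT (le_trans ?_ hdim)
    rw [← IsRegularLocalRing.spanFinrank_maximalIdeal]
    exact_mod_cast hcard
  have lift : ∀ (A : Set R) (T : Finset S), (T : Set S) ⊆ AdjoinRoot.of _ '' A →
      ∃ T' : Finset R, (T' : Set R) ⊆ A ∧ T'.image (AdjoinRoot.of _) = T ∧ T'.card ≤ T.card := by
    intro A T hT
    have hT2 : ∀ t, t ∈ T → ∃ a, a ∈ A ∧ AdjoinRoot.of _ a = t := fun t ht => hT ht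
    choose! g hg using hT2
    refine ⟨T.image g, ?_, ?_, Finset.card_image_le⟩
    · rw [Finset.coe_image]
      rintro _ ⟨t, ht, rfl⟩
      exact (hg t ht).1
    · rw [Finset.image_image]
      exact (Finset.image_congr fun t ht => (hg t ht).2).trans Finset.image_id
  rcases irreducible_or_exists_eval_mem hp c with h | ⟨e, he⟩
  -- Minimal generators upstairs can be chosen in `𝔪_R`; they generate `𝔪_R` by faithful flatness.
  · have h1 := maximalIdeal_eq_of_irreducible h _ hM
    obtain ⟨T, hT, hspan, hcard⟩ := exists_finset_span_eq_maximalIdeal _ h1.symm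
    obtain ⟨T', hT', himg, hcard'⟩ := lift _ T hT
    refine ⟨T', ?_, hcard'.trans hcard.le⟩
    rw [← Ideal.comap_map_eq_self_of_faithfullyFlat (B := S) (Ideal.span (T' : Set R)),
      Ideal.map_span, ← hM, ← hspan, ← himg, Finset.coe_image]
    rfl
  · have hy := root_sub_mem_of_eval_mem hp c he _ hM
    have h1 := maximalIdeal_eq_of_root_sub_mem _ hM hy
    obtain ⟨T, hT, hspan, hcard⟩ := exists_finset_span_insert_eq_maximalIdeal _ h1.symm (root_sub_notMem_sq hp c h1)
    obtain ⟨T', hT', himg, hcard'⟩ := lift _ T hT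
    -- The generator that does not come from `R`, the root minus `e`, is traded for `e^p - c`, so
    -- the number of generators does not grow.
    refine ⟨insert ((X ^ p - C c : R[X]).eval e) T', ?_, ?_⟩
    · apply le_antisymm
      · rw [Ideal.span_le, Finset.coe_insert, Set.insert_subset_iff]
        exact ⟨he, hT'⟩
      · intro r hr
        rw [Finset.coe_insert, Ideal.span_insert, sup_comm]
        have hr' : AdjoinRoot.of _ r ∈ maximalIdeal S := by rw [← hM] at hr; exact hr
        rw [← hspan, Ideal.mem_span_insert'] at hr'
        obtain ⟨a, ha⟩ := hr'
        apply mem_span_eval_of_of_eq (w := -a)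
        rw [Ideal.map_span, ← Finset.coe_image, himg]
        convert ha using 1
        ring
    · exact (Finset.card_insert_le _ _).trans ((Nat.succ_le_succ hcard').trans hcard)

end

end PthRoot
end RegularExtensions

/-! ### Generic regularity of finitely generated algebras over a field -/

section GenericRegularity

/-- All local rings of `B` on some non-empty basic open set are regular. -/
def GenericallyRegular (B : Type*) [CommRing B] : Prop :=
  ∃ h : B, h ≠ 0 ∧ ∀ (q : Ideal B) [q.IsPrime], h ∉ q →
    IsRegularLocalRing (Localization.AtPrime q)

lemma nonempty_localization_comap_equiv {B L : Type*} [CommRing B] [CommRing L] [Algebra B L]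
    (M : Submonoid B) [IsLocalization M L] (Q : Ideal L) [Q.IsPrime] :
    Nonempty (Localization.AtPrime (Q.comap (algebraMap B L)) ≃+* Localization.AtPrime Q) := by
  have := IsLocalization.isLocalization_isLocalization_atPrime_isLocalization M
    (Localization.AtPrime Q) Q
  exact ⟨(IsLocalization.algEquiv (Q.comap (algebraMap B L)).primeCompl
    (Localization.AtPrime (Q.comap (algebraMap B L))) (Localization.AtPrime Q)).toRingEquiv⟩

lemma isRegularLocalRing_localization_comap_iff {B L : Type*} [CommRing B] [CommRing L]
    [Algebra B L] (M : Submonoid B) [IsLocalization M L] (Q : Ideal L) [Q.IsPrime] :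
    IsRegularLocalRing (Localization.AtPrime (Q.comap (algebraMap B L))) ↔
      IsRegularLocalRing (Localization.AtPrime Q) := by
  obtain ⟨e⟩ := nonempty_localization_comap_equiv M Q
  exact ⟨fun h => IsRegularLocalRing.of_ringEquiv e, fun h => IsRegularLocalRing.of_ringEquiv e.symm⟩

lemma GenericallyRegular.of_ringEquiv {B C : Type*} [CommRing B] [CommRing C] (e : B ≃+* C)
    (hB : GenericallyRegular B) : GenericallyRegular C := by
  obtain ⟨h, h0, hq⟩ := hB
  refine ⟨e h, by simpa using h0, fun q _ hhq => ?_⟩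
  have := hq (q.comap e) (by simpa using hhq)
  exact IsRegularLocalRing.of_ringEquiv <| IsLocalization.ringEquivOfRingEquiv
    (Localization.AtPrime (q.comap e)) (Localization.AtPrime q) e (e.map_primeCompl_comap_eq q)

lemma genericallyRegular_away_iff {B L : Type*} [CommRing B] [CommRing L] [Algebra B L]
    [IsDomain B] {s : B} (hs : s ≠ 0) [IsLocalization.Away s L] :
    GenericallyRegular B ↔ GenericallyRegular L := by
  have hinj : Function.Injective (algebraMap B L) := IsLocalization.injective L
    (M := Submonoid.powers s) (powers_le_nonZeroDivisors_of_noZeroDivisors hs)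
  constructor
  · rintro ⟨h, h0, hq⟩
    refine ⟨algebraMap B L h, by rwa [Ne, map_eq_zero_iff _ hinj], fun Q _ hQ => ?_⟩
    exact (isRegularLocalRing_localization_comap_iff (Submonoid.powers s) Q).mp (hq _ hQ)
  · rintro ⟨h, h0, hq⟩
    obtain ⟨b, t, hb⟩ := IsLocalization.exists_mk'_eq (Submonoid.powers s) h
    have hb0 : b ≠ 0 := by
      rintro rfl
      exact h0 (by rw [← hb, IsLocalization.mk'_zero])
    refine ⟨b * s, mul_ne_zero hb0 hs, fun q hqp hbs => ?_⟩
    have hsq : s ∉ q := fun h => hbs (Ideal.mul_mem_left _ _ h)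
    have hbq : b ∉ q := fun h => hbs (Ideal.mul_mem_right _ _ h)
    have hdisj : Disjoint (Submonoid.powers s : Set B) q := by
      rw [Set.disjoint_left]
      rintro _ ⟨m, rfl⟩ hm
      exact hsq (hqp.mem_of_pow_mem m hm)
    have hQ := IsLocalization.isPrime_of_isPrime_disjoint (Submonoid.powers s) L q hqp hdisj
    have hcomap : (q.map (algebraMap B L)).comap (algebraMap B L) = q :=
      IsLocalization.under_map_of_isPrime_disjoint (Submonoid.powers s) L hqp hdisj
    have hreg := hq (q.map (algebraMap B L)) (fun hmem => hbq (by
      rw [← hcomap, Ideal.mem_comap]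
      have := Ideal.mul_mem_left _ (algebraMap B L t) hmem
      rwa [← hb, IsLocalization.mk'_spec'] at this))
    rw [← isRegularLocalRing_localization_comap_iff (Submonoid.powers s)] at hreg
    have key : ∀ (q' : Ideal B) [q'.IsPrime], q' = q →
        IsRegularLocalRing (Localization.AtPrime q') →
        IsRegularLocalRing (Localization.AtPrime q) := by
      rintro q' _ rfl h
      exact h
    exact key _ hcomap hreg

lemma isRegularRing_of_away {B L : Type*} [CommRing B] [CommRing L] [Algebra B L] (s : B)
    [IsLocalization.Away s L] [IsNoetherianRing L] (hq : ∀ (q : Ideal B) [q.IsPrime], s ∉ q →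
      IsRegularLocalRing (Localization.AtPrime q)) : IsRegularRing L := by
  rw [isRegularRing_iff]
  intro Q hQ
  rw [← isRegularLocalRing_localization_comap_iff (Submonoid.powers s)]
  exact hq _ fun hmem => hQ.ne_top (Ideal.eq_top_of_isUnit_mem _ hmem
    (IsLocalization.Away.algebraMap_isUnit s))

/-- Inverting `s` identifies the two rings, and generic regularity of a domain is insensitive to
inverting a nonzero element. -/
lemma genericallyRegular_iff_of_denominators {B C : Type*} [CommRing B] [CommRing C] [IsDomain B]
    [IsDomain C] [Algebra B C] (hinj : Function.Injective (algebraMap B C)) {s : B} (hs : s ≠ 0)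
    (h : ∀ c : C, ∃ (n : ℕ) (b : B), algebraMap B C b = algebraMap B C s ^ n * c) :
    GenericallyRegular B ↔ GenericallyRegular C := by
  have hs' : algebraMap B C s ≠ 0 := by rwa [Ne, map_eq_zero_iff _ hinj]
  let L := Localization.Away (algebraMap B C s)
  have hCL : Function.Injective (algebraMap C L) := IsLocalization.injective L
    (M := Submonoid.powers (algebraMap B C s)) (powers_le_nonZeroDivisors_of_noZeroDivisors hs')
  have hL : IsLocalization.Away s L := by
    refine (isLocalization_iff _ _).mpr ⟨?_, ?_, ?_⟩
    · rintro ⟨_, n, rfl⟩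
      rw [map_pow, IsScalarTower.algebraMap_apply B C L]
      exact (IsLocalization.Away.algebraMap_isUnit (S := L) (algebraMap B C s)).pow n
    · intro z
      obtain ⟨⟨c, ⟨_, n, rfl⟩⟩, hc⟩ := IsLocalization.surj (Submonoid.powers (algebraMap B C s)) z
      obtain ⟨m, b, hb⟩ := h c
      refine ⟨⟨b, ⟨s ^ (n + m), n + m, rfl⟩⟩, ?_⟩
      simp only [IsScalarTower.algebraMap_apply B C L, hb, map_mul, ← hc, map_pow]
      ring
    · intro x y hxy
      refine ⟨1, ?_⟩
      rw [IsScalarTower.algebraMap_apply B C L, IsScalarTower.algebraMap_apply B C L] at hxy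
      rw [hinj (hCL hxy)]
  rw [genericallyRegular_away_iff (L := L) hs, ← genericallyRegular_away_iff (L := L) hs']

/-! ### Finitely generated models of a field -/

section Models

variable {k : Type*} {K : Type u} [Field k] [Field K] [Algebra k K]

/-- A finitely generated subalgebra with fraction field `K`. -/
structure IsModel (B : Subalgebra k K) : Prop where
  fg : B.FG
  closure_eq : Subfield.closure (B : Set K) = ⊤

lemma IsModel.exists_eq_div {B : Subalgebra k K} (hB : IsModel B) (x : K) :
    ∃ a ∈ B, ∃ b ∈ B, b ≠ 0 ∧ x = a / b := by
  have hx : x ∈ Subfield.closure (B : Set K) := by rw [hB.closure_eq]; trivial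
  have hB' : Subring.closure (B : Set K) = B.toSubring := Subring.closure_eq B.toSubring
  obtain ⟨a, ha, b, hb, rfl⟩ := Subfield.mem_closure_iff.mp hx
  rw [hB'] at ha hb
  by_cases hb0 : b = 0
  · exact ⟨0, zero_mem B, 1, one_mem B, one_ne_zero, by simp [hb0]⟩
  · exact ⟨a, ha, b, hb, hb0, rfl⟩

lemma IsModel.mono {B C : Subalgebra k K} (hB : IsModel B) (hBC : B ≤ C) (hC : C.FG) :
    IsModel C :=
  ⟨hC, top_le_iff.mp (hB.closure_eq ▸ Subfield.closure_mono hBC)⟩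

/-- The elements carried into `B` by some power of `s` form a subalgebra, so only generators need
checking. -/
lemma exists_pow_mul_mem_of_mem_sup {B C : Subalgebra k K} {s : K} (hs : s ∈ B) {T : Set K}
    (hT : ∀ t ∈ T, ∃ n : ℕ, s ^ n * t ∈ B) (hC : C ≤ B ⊔ Algebra.adjoin k T) {c : K}
    (hc : c ∈ C) : ∃ n : ℕ, s ^ n * c ∈ B := by
  let D : Subalgebra k K :=
    { carrier := {c | ∃ n : ℕ, s ^ n * c ∈ B}
      mul_mem' := by
        rintro a b ⟨n, hn⟩ ⟨m, hm⟩
        refine ⟨n + m, ?_⟩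
        have := mul_mem hn hm
        rwa [show s ^ n * a * (s ^ m * b) = s ^ (n + m) * (a * b) by ring] at this
      add_mem' := by
        rintro a b ⟨n, hn⟩ ⟨m, hm⟩
        refine ⟨n + m, ?_⟩
        have := add_mem (mul_mem (pow_mem hs m) hn) (mul_mem (pow_mem hs n) hm)
        rwa [show s ^ m * (s ^ n * a) + s ^ n * (s ^ m * b) = s ^ (n + m) * (a + b) by ring] at this
      algebraMap_mem' := fun r => ⟨0, by simp⟩ }
  have hD : B ⊔ Algebra.adjoin k T ≤ D :=
    sup_le (fun b hb => ⟨0, by simpa using hb⟩) (Algebra.adjoin_le hT)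
  exact hD (hC hc)

lemma IsModel.exists_denominator {B : Subalgebra k K} (hB : IsModel B) (T : Finset K) :
    ∃ s ∈ B, s ≠ 0 ∧ ∀ t ∈ T, s * t ∈ B := by
  classical
  induction T using Finset.induction_on with
  | empty => exact ⟨1, one_mem B, one_ne_zero, by simp⟩
  | insert t T _ ih =>
    obtain ⟨s, hs, hs0, hsT⟩ := ih
    obtain ⟨a, ha, b, hb, hb0, rfl⟩ := hB.exists_eq_div t
    refine ⟨s * b, mul_mem hs hb, mul_ne_zero hs0 hb0, fun t ht => ?_⟩
    rcases Finset.mem_insert.mp ht with rfl | ht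
    · rw [mul_assoc, mul_div_cancel₀ _ hb0]
      exact mul_mem hs ha
    · rw [mul_right_comm]
      exact mul_mem (hsT t ht) hb

lemma IsModel.genericallyRegular_iff_of_le {B C : Subalgebra k K} (hB : IsModel B)
    (hC : IsModel C) (hBC : B ≤ C) : GenericallyRegular B ↔ GenericallyRegular C := by
  obtain ⟨T, hT⟩ := hC.fg
  obtain ⟨s, hs, hs0, hsT⟩ := hB.exists_denominator T
  let : Algebra B C := (Subalgebra.inclusion hBC).toAlgebra
  refine genericallyRegular_iff_of_denominators (Subalgebra.inclusion_injective hBC) (s := ⟨s, hs⟩)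
    (fun h => hs0 (congrArg Subtype.val h)) fun c => ?_
  obtain ⟨n, hn⟩ := exists_pow_mul_mem_of_mem_sup hs (T := T)
    (fun t ht => ⟨1, by simpa using hsT t ht⟩) (hT ▸ le_sup_right) c.2
  exact ⟨n, ⟨_, hn⟩, Subtype.ext rfl⟩

/-- Both models are compared with `B ⊔ C`. Generic regularity thus becomes a property of the field
`K` over `k`, to be moved along field extensions. -/
lemma IsModel.genericallyRegular_iff {B C : Subalgebra k K} (hB : IsModel B)
    (hC : IsModel C) : GenericallyRegular B ↔ GenericallyRegular C := by
  have h := hB.mono le_sup_left (hB.fg.sup hC.fg)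
  rw [hB.genericallyRegular_iff_of_le h le_sup_left, hC.genericallyRegular_iff_of_le h le_sup_right]

lemma isNoetherianRing_of_fg {B : Subalgebra k K} (hB : B.FG) : IsNoetherianRing B := by
  have : Algebra.FiniteType k B := B.fg_iff_finiteType.mp hB
  exact Algebra.FiniteType.isNoetherianRing k B

variable (k K) in
/-- `K` is the fraction field of a finitely generated generically regular algebra. -/
def HasRegularModel : Prop := ∃ B : Subalgebra k K, IsModel B ∧ GenericallyRegular B

lemma HasRegularModel.genericallyRegular (h : HasRegularModel k K) {B : Subalgebra k K}
    (hB : IsModel B) : GenericallyRegular B := by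
  obtain ⟨C, hC, hreg⟩ := h
  exact (hC.genericallyRegular_iff hB).mp hreg

lemma isLocalization_away_of_inv_mem {B C : Subalgebra k K} [Algebra B C]
    (hBC : ∀ b : B, (algebraMap B C b : K) = b) {s : K} (hs : s ∈ B)
    (hs0 : s ≠ 0) (hinv : s⁻¹ ∈ C) (hC : C ≤ B ⊔ Algebra.adjoin k {s⁻¹}) :
    IsLocalization.Away (⟨s, hs⟩ : B) C := by
  refine (isLocalization_iff _ _).mpr ⟨?_, ?_, ?_⟩
  · rintro ⟨t, n, hn⟩
    have hn' : (t : K) = s ^ n := (congrArg Subtype.val hn).symm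
    refine IsUnit.of_mul_eq_one (⟨s⁻¹, hinv⟩ ^ n) (Subtype.ext ?_)
    rw [MulMemClass.coe_mul, hBC, SubmonoidClass.coe_pow, hn', ← mul_pow, mul_inv_cancel₀ hs0,
      one_pow]
    rfl
  · intro z
    obtain ⟨n, hn⟩ := exists_pow_mul_mem_of_mem_sup hs (T := {s⁻¹})
      (by rintro _ rfl; exact ⟨1, by rw [pow_one, mul_inv_cancel₀ hs0]; exact one_mem B⟩)
      hC z.2
    refine ⟨⟨⟨s ^ n * z, hn⟩, ⟨⟨s ^ n, pow_mem hs n⟩, n, Subtype.ext rfl⟩⟩, Subtype.ext ?_⟩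
    rw [MulMemClass.coe_mul, hBC, hBC]
    exact mul_comm _ _
  · intro x y hxy
    refine ⟨1, ?_⟩
    rw [show x = y from Subtype.ext (by rw [← hBC x, hxy, hBC])]

lemma IsModel.exists_isRegularRing_of {B : Subalgebra k K} (hB : IsModel B) {s : K} (hs : s ∈ B)
    (hs0 : s ≠ 0) (hq : ∀ (q : Ideal B) [q.IsPrime], (⟨s, hs⟩ : B) ∉ q →
      IsRegularLocalRing (Localization.AtPrime q)) :
    ∃ C : Subalgebra k K, B ≤ C ∧ IsModel C ∧ IsRegularRing C := by
  have hfg : (Algebra.adjoin k {s⁻¹}).FG := ⟨{s⁻¹}, by rw [Finset.coe_singleton]⟩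
  have hinv : s⁻¹ ∈ B ⊔ Algebra.adjoin k {s⁻¹} :=
    (le_sup_right : _ ≤ B ⊔ Algebra.adjoin k {s⁻¹}) (Algebra.subset_adjoin rfl)
  obtain ⟨C, hC⟩ : ∃ C, C = B ⊔ Algebra.adjoin k {s⁻¹} := ⟨_, rfl⟩
  have hle : B ≤ C := hC ▸ le_sup_left
  have hCfg : C.FG := hC ▸ hB.fg.sup hfg
  rw [← hC] at hinv
  refine ⟨C, hle, hB.mono hle hCfg, ?_⟩
  have := isNoetherianRing_of_fg hCfg
  algebraize [(Subalgebra.inclusion hle).toRingHom]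
  have hloc : IsLocalization.Away (⟨s, hs⟩ : B) C :=
    isLocalization_away_of_inv_mem (fun _ => rfl) hs hs0 hinv hC.le
  exact isRegularRing_of_away (⟨s, hs⟩ : B) hq

lemma HasRegularModel.exists_isRegularRing (h : HasRegularModel k K) (T : Finset K) :
    ∃ B : Subalgebra k K, IsModel B ∧ IsRegularRing B ∧ (T : Set K) ⊆ B := by
  obtain ⟨B, hB, -⟩ := id h
  have hB1 := hB.mono (C := B ⊔ Algebra.adjoin k T) le_sup_left
    (hB.fg.sup (Subalgebra.fg_adjoin_finset T))
  have hT : (T : Set K) ⊆ (B ⊔ Algebra.adjoin k (T : Set K) : Subalgebra k K) :=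
    fun t ht => (le_sup_right : _ ≤ B ⊔ Algebra.adjoin k (T : Set K)) (Algebra.subset_adjoin ht)
  obtain ⟨⟨s, hs⟩, hs0, hq⟩ := h.genericallyRegular hB1
  obtain ⟨C, hC, hC1, hC2⟩ := hB1.exists_isRegularRing_of hs (fun h => hs0 (Subtype.ext h)) hq
  exact ⟨C, hC1, hC2, hT.trans hC⟩

end Models
end GenericRegularity

/-! ### Regular models along separable and purely inseparable extensions -/

section GenericRegularityFieldExtensions

open Polynomial IntermediateField

lemma isRegularLocalRing_of_isLocalization {S L : Type*} [CommRing S] [CommRing L] [Algebra S L]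
    (N : Submonoid S) [IsLocalization N L] [IsLocalRing L] {h b : S} (hb : b ∈ N) (hdvd : h ∣ b)
    (hq : ∀ (q : Ideal S) [q.IsPrime], h ∉ q → IsRegularLocalRing (Localization.AtPrime q)) :
    IsRegularLocalRing L := by
  have hreg : IsRegularLocalRing (Localization.AtPrime (IsLocalRing.maximalIdeal L)) := by
    rw [← isRegularLocalRing_localization_comap_iff N]
    exact hq _ fun hmem => hmem
      (isUnit_of_dvd_unit (_root_.map_dvd (algebraMap S L) hdvd) (IsLocalization.map_units L (⟨b, hb⟩ : N)))
  have e := IsLocalization.atUnits L (IsLocalRing.maximalIdeal L).primeCompl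
    (S := Localization.AtPrime (IsLocalRing.maximalIdeal L))
    (fun x hx => not_not.mp hx)
  exact IsRegularLocalRing.of_ringEquiv e.symm.toRingEquiv

/-- By integrality the ideal `(h)` upstairs contracts to a nonzero ideal, so some nonzero `b` in `B`
controls where the extension is regular. At primes of `B` avoiding `b`, regularity descends along
the `p`-th root. -/
lemma genericallyRegular_of_adjoin_pthRoot {B : Type u} [CommRing B] [IsDomain B]
    [IsNoetherianRing B] {p : ℕ} (hp : p.Prime) [CharP B p] (c : B)
    [IsDomain (AdjoinRoot (X ^ p - C c : B[X]))]
    (h : GenericallyRegular (AdjoinRoot (X ^ p - C c : B[X]))) : GenericallyRegular B := by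
  obtain ⟨h, h0, hq⟩ := h
  have hmon : (X ^ p - C c : B[X]).Monic := monic_X_pow_sub_C c hp.ne_zero
  have := hmon.finite_adjoinRoot
  have hbot : (Ideal.span {h}).comap (algebraMap B (AdjoinRoot (X ^ p - C c : B[X]))) ≠ ⊥ :=
    Ideal.comap_ne_bot_of_integral_mem h0 (Ideal.mem_span_singleton_self h)
      (Algebra.IsIntegral.isIntegral h)
  obtain ⟨b, hb, hb0⟩ := Submodule.exists_mem_ne_zero_of_ne_bot hbot
  refine ⟨b, hb0, fun q _ hbq => ?_⟩
  let R := Localization.AtPrime q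
  have hinj : Function.Injective (algebraMap B R) :=
    IsLocalization.injective R q.primeCompl_le_nonZeroDivisors
  have : CharP R p := charP_of_injective_algebraMap hinj p
  let c' : R := algebraMap B R c
  have hmap : (Ideal.span {(X ^ p - C c : B[X])}).map (mapRingHom (algebraMap B R)) =
      Ideal.span {(X ^ p - C c' : R[X])} := by
    rw [Ideal.map_span, Set.image_singleton]
    simp [c']
  let : Algebra B[X] R[X] := Polynomial.algebra B R
  have : IsLocalization (q.primeCompl.map C) R[X] := Polynomial.isLocalization _ _
  have key : ∀ I : Ideal R[X], (Ideal.span {(X ^ p - C c : B[X])}).map (algebraMap B[X] R[X]) = I →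
      IsLocalRing (R[X] ⧸ I) → IsRegularLocalRing (R[X] ⧸ I) := by
    rintro _ rfl hloc
    exact isRegularLocalRing_of_isLocalization (S := B[X] ⧸ Ideal.span {(X ^ p - C c : B[X])})
      (Algebra.algebraMapSubmonoid (B[X] ⧸ Ideal.span {(X ^ p - C c : B[X])})
        (q.primeCompl.map (C : B →+* B[X]))) (h := h) (b := Ideal.Quotient.mk _ (C b))
      ⟨C b, ⟨b, hbq, rfl⟩, rfl⟩ (Ideal.mem_span_singleton.mp (Ideal.mem_comap.mp hb)) hq
  have hloc : IsLocalRing (AdjoinRoot (X ^ p - C c' : R[X])) := isLocalRing_adjoin_pthRoot hp c'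
  have hreg : IsRegularLocalRing (AdjoinRoot (X ^ p - C c' : R[X])) := key _ hmap hloc
  have : IsNoetherianRing R := IsLocalization.isNoetherianRing q.primeCompl R inferInstance
  exact isRegularLocalRing_of_adjoin_pthRoot hp c'

variable {k : Type*} {K K' : Type u} [Field k] [Field K] [Field K'] [Algebra k K] [Algebra k K']
  [Algebra K K'] [IsScalarTower k K K']

/-- When the minimal polynomial of `a` has coefficients in `B`, the subalgebra `B[a]` is `B[X]/(g)`:
divisibility by the monic `g` can be tested over `K`. -/
lemma IsModel.exists_adjoinRoot {B : Subalgebra k K} (hB : IsModel B) {a : K'} (ha : K⟮a⟯ = ⊤)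
    {g : B[X]} (hg : g.Monic) (hgm : g.map (algebraMap B K) = minpoly K a) :
    ∃ C : Subalgebra k K', IsModel C ∧ Nonempty (AdjoinRoot g ≃+* C) := by
  let i : B →ₐ[k] K' := (IsScalarTower.toAlgHom k K K').comp B.val
  have heval : ∀ f : B[X], f.eval₂ (i : B →+* K') a = aeval a (f.map (algebraMap B K)) := by
    intro f
    rw [aeval_def, eval₂_map]
    rfl
  have h0 : g.eval₂ (i : B →+* K') a = 0 := by rw [heval, hgm, minpoly.aeval]
  let φ := AdjoinRoot.liftAlgHom g i a h0
  have hinj : Function.Injective φ := by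
    rw [injective_iff_map_eq_zero]
    intro x hx
    obtain ⟨f, rfl⟩ := AdjoinRoot.mk_surjective x
    rw [AdjoinRoot.liftAlgHom_mk] at hx
    rw [AdjoinRoot.mk_eq_zero, ← map_dvd_map (algebraMap B K) Subtype.val_injective hg, hgm]
    exact minpoly.dvd K a (by rw [← heval]; exact hx)
  have hfin : Algebra.FiniteType k B := B.fg_iff_finiteType.mp hB.fg
  refine ⟨φ.range, ⟨?_, ?_⟩, ⟨(AlgEquiv.ofInjective φ hinj).toRingEquiv⟩⟩
  · rw [← Algebra.map_top]
    exact Subalgebra.FG.map φ (Algebra.FiniteType.out (R := k) (A := AdjoinRoot g))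
  · rw [← top_le_iff]
    intro x _
    have hx : x ∈ K⟮a⟯ := by rw [ha]; trivial
    have hle : K⟮a⟯.toSubfield ≤ Subfield.closure (φ.range : Set K') := by
      refine Subfield.closure_le.mpr (Set.union_subset ?_ ?_)
      · rintro _ ⟨y, rfl⟩
        have hle : Subfield.closure (B : Set K) ≤
            (Subfield.closure (φ.range : Set K')).comap (algebraMap K K') := by
          refine Subfield.closure_le.mpr fun b hb => ?_
          exact Subfield.subset_closure ⟨AdjoinRoot.of g ⟨b, hb⟩,
            AdjoinRoot.liftAlgHom_of g i a h0 ⟨b, hb⟩⟩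
        exact hle (by rw [hB.closure_eq]; trivial)
      · rintro _ rfl
        exact Subfield.subset_closure ⟨AdjoinRoot.root g, AdjoinRoot.liftAlgHom_root g i _ h0⟩
    exact hle hx

/-- Enlarge a regular model until it contains the coefficients of the minimal polynomial of a
primitive element. Adjoining that element is then étale where the derivative is invertible, and the
derivative is nonzero by separability. -/
lemma HasRegularModel.of_isSeparable [FiniteDimensional K K'] [Algebra.IsSeparable K K']
    (h : HasRegularModel k K) : HasRegularModel k K' := by
  obtain ⟨a, ha⟩ := Field.exists_primitive_element K K'
  obtain ⟨B, hB, hreg, hT⟩ := h.exists_isRegularRing (minpoly K a).coeffs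
  have hint : IsIntegral K a := Algebra.IsIntegral.isIntegral a
  obtain ⟨g, hgm, -, hg⟩ := lifts_and_natDegree_eq_and_monic (f := algebraMap B K)
    ((lifts_iff_coeffs_subset_range _).mpr fun c hc => ⟨⟨c, hT hc⟩, rfl⟩) (minpoly.monic hint)
  obtain ⟨C, hC, ⟨e⟩⟩ := hB.exists_adjoinRoot ha hg hgm
  refine ⟨C, hC, GenericallyRegular.of_ringEquiv e ⟨AdjoinRoot.mk g (derivative g), ?_,
    fun q _ hq => isRegularLocalRing_adjoinRoot g q hq⟩⟩
  rw [Ne, AdjoinRoot.mk_eq_zero]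
  intro hdvd
  have h1 := Polynomial.map_dvd (algebraMap B K) hdvd
  rw [← derivative_map, hgm] at h1
  have h2 := (Algebra.IsSeparable.isSeparable K a).aeval_derivative_ne_zero (minpoly.aeval K a)
  obtain ⟨r, hr⟩ := h1
  exact h2 (by rw [hr, map_mul, minpoly.aeval, zero_mul])

lemma exists_models_pthRoot {p : ℕ} (hp : p.Prime) [CharP K p]
    (hmod : ∃ B : Subalgebra k K, IsModel B) {a : K'} {c : K} (hac : a ^ p = algebraMap K K' c)
    (ha : K⟮a⟯ = ⊤) (hnot : a ∉ Set.range (algebraMap K K')) :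
    ∃ B : Subalgebra k K, IsModel B ∧ ∃ C : Subalgebra k K', IsModel C ∧
      (GenericallyRegular C → GenericallyRegular B) := by
  obtain ⟨B₀, hB₀⟩ := hmod
  obtain ⟨B, hB, hcB⟩ : ∃ B : Subalgebra k K, IsModel B ∧ c ∈ B :=
    ⟨B₀ ⊔ Algebra.adjoin k {c}, hB₀.mono le_sup_left
      (hB₀.fg.sup ⟨{c}, by rw [Finset.coe_singleton]⟩),
      (le_sup_right : _ ≤ B₀ ⊔ Algebra.adjoin k {c}) (Algebra.subset_adjoin rfl)⟩
  have : CharP K' p := charP_of_injective_algebraMap (algebraMap K K').injective p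
  have : ExpChar K' p := .prime hp
  have hirr : Irreducible (X ^ p - C c : K[X]) := by
    refine X_pow_sub_C_irreducible_of_prime hp fun b hb => hnot ⟨b, ?_⟩
    refine frobenius_inj K' p ?_
    rw [frobenius_def, frobenius_def, ← map_pow, hb, hac]
  have hmin : X ^ p - C c = minpoly K a := minpoly.eq_of_irreducible_of_monic hirr
    (by simp [hac]) (monic_X_pow_sub_C c hp.ne_zero)
  let c' : B := ⟨c, hcB⟩
  have hmon : (X ^ p - C c' : B[X]).Monic := monic_X_pow_sub_C c' hp.ne_zero
  obtain ⟨C', hC', ⟨e⟩⟩ := hB.exists_adjoinRoot ha hmon (by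
    rw [← hmin, Polynomial.map_sub, Polynomial.map_pow, map_X, map_C]
    rfl)
  refine ⟨B, hB, C', hC', fun h => ?_⟩
  have : IsDomain (AdjoinRoot (X ^ p - C c' : B[X])) := e.toMulEquiv.isDomain
  have : CharP B p := (algebraMap B K).charP Subtype.val_injective p
  have := isNoetherianRing_of_fg hB.fg
  exact genericallyRegular_of_adjoin_pthRoot hp c' (h.of_ringEquiv e.symm)

lemma hasRegularModel_of_surjective (hsurj : Function.Surjective (algebraMap K K'))
    (hmod : ∃ B : Subalgebra k K, IsModel B) (h : HasRegularModel k K') : HasRegularModel k K := by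
  obtain ⟨B, hB⟩ := hmod
  let φ := IsScalarTower.toAlgHom k K K'
  have hC : IsModel (B.map φ) := by
    refine ⟨hB.fg.map φ, ?_⟩
    rw [Subalgebra.coe_map]
    change Subfield.closure ((algebraMap K K') '' _) = ⊤
    rw [← RingHom.map_field_closure, hB.closure_eq, ← top_le_iff]
    intro x _
    obtain ⟨y, rfl⟩ := hsurj x
    exact ⟨y, trivial, rfl⟩
  let e := B.equivMapOfInjective φ (algebraMap K K').injective
  exact ⟨B, hB, (h.genericallyRegular hC).of_ringEquiv e.symm.toRingEquiv⟩

/-- Induction on the degree: a nontrivial extension contains some `a ∉ K` with `a^q ∈ K`, and the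
regular model descends first to `K(a)` and then through one `p`-th root to `K`. -/
lemma HasRegularModel.of_isPurelyInseparable (q : ℕ) : ∀ (d : ℕ) (K : Type u) [Field K]
    [Algebra k K] [Algebra K K'] [IsScalarTower k K K'] [ExpChar K q] [FiniteDimensional K K']
    [IsPurelyInseparable K K'], Module.finrank K K' ≤ d → (∃ B : Subalgebra k K, IsModel B) →
    HasRegularModel k K' → HasRegularModel k K := by
  intro d
  induction d with
  | zero =>
    intro K _ _ _ _ _ _ _ hd
    exact absurd hd (Nat.not_le.mpr Module.finrank_pos)
  | succ d ih =>
    intro K _ _ _ _ hq _ _ hd hmod h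
    by_cases hsurj : Function.Surjective (algebraMap K K')
    · exact hasRegularModel_of_surjective hsurj hmod h
    · rw [Function.Surjective] at hsurj
      push Not at hsurj
      obtain ⟨x, hx⟩ := hsurj
      have hx' : x ∉ Set.range (algebraMap K K') := fun ⟨y, hy⟩ => hx y hy
      have hex := IsPurelyInseparable.pow_mem K q x
      classical
      obtain ⟨n, hn⟩ : ∃ n, Nat.find hex = n + 1 :=
        Nat.exists_eq_succ_of_ne_zero fun h0 => hx' (by
          have := Nat.find_spec hex
          rw [h0] at this
          simpa using this)
      -- The exponent `n + 1` is the least that brings `x` into `K`, so `a` is still outside `K`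
      -- while `a^q` is inside.
      obtain ⟨a, rfl⟩ : ∃ a, a = x ^ q ^ n := ⟨_, rfl⟩
      set a := x ^ q ^ n with ha
      have hanot : a ∉ Set.range (algebraMap K K') := Nat.find_min hex (by omega)
      obtain ⟨c, hc⟩ : a ^ q ∈ (algebraMap K K').range := by
        have := Nat.find_spec hex
        rwa [hn, pow_succ, pow_mul] at this
      rcases hq with _ | ⟨hp⟩
      · exact absurd ⟨c, by simpa using hc⟩ hanot
      · let K₁ := K⟮a⟯
        have hcharp : CharP K₁ q := charP_of_injective_algebraMap (algebraMap K K₁).injective q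
        have : ExpChar K₁ q := .prime hp
        have hgen : K⟮AdjoinSimple.gen K a⟯ = (⊤ : IntermediateField K K₁) := by
          apply lift_injective K₁
          rw [lift_adjoin_simple, lift_top]
          rfl
        have : IsScalarTower k K₁ K' :=
          .of_algebraMap_eq fun _ => rfl
        have hmul := Module.finrank_mul_finrank K K₁ K'
        have h1 : 1 < Module.finrank K K₁ := by
          refine lt_of_le_of_ne Module.finrank_pos fun h1 => hanot ?_
          have := finrank_adjoin_simple_eq_one_iff.mp h1.symm
          rwa [mem_bot] at this
        have h2 : Module.finrank K₁ K' ≤ d := by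
          have : 0 < Module.finrank K₁ K' := Module.finrank_pos
          nlinarith
        obtain ⟨B, hB, C', hC', himp⟩ := exists_models_pthRoot (K' := K₁) hp hmod
          (a := AdjoinSimple.gen K a) (c := c) (Subtype.ext hc.symm) hgen (by
            rintro ⟨y, hy⟩
            exact hanot ⟨y, congrArg Subtype.val hy⟩)
        have h3 := ih K₁ h2 ⟨C', hC'⟩ h
        exact ⟨B, hB, himp (h3.genericallyRegular hC')⟩

lemma hasRegularModel_of_algebraicIndependent {k k' L : Type u} [Field k] [Field k'] [Field L]
    [Algebra k k'] [Algebra k L] [Algebra k' L] [IsScalarTower k k' L] [FiniteDimensional k k']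
    {n : ℕ} {s : Fin n → L} (hs : AlgebraicIndependent k' s)
    (htop : IntermediateField.adjoin k' (Set.range s) = ⊤) : HasRegularModel k L := by
  let φ : MvPolynomial (Fin n) k' →ₐ[k] L := (MvPolynomial.aeval s).restrictScalars k
  have hft : Algebra.FiniteType k (MvPolynomial (Fin n) k') :=
    Algebra.FiniteType.trans (S := k') inferInstance inferInstance
  refine ⟨φ.range, ⟨?_, ?_⟩, ?_⟩
  · rw [← Algebra.map_top]
    exact Subalgebra.FG.map φ hft.out
  · rw [← top_le_iff]
    intro x _
    have hx : x ∈ IntermediateField.adjoin k' (Set.range s) := by rw [htop]; trivial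
    refine (Subfield.closure_mono (s := Set.range (algebraMap k' L) ∪ Set.range s) ?_ :
      _ ≤ Subfield.closure (φ.range : Set L)) hx
    rintro _ (⟨y, rfl⟩ | ⟨i, rfl⟩)
    · exact ⟨MvPolynomial.C y, MvPolynomial.aeval_C s y⟩
    · exact ⟨MvPolynomial.X i, MvPolynomial.aeval_X s i⟩
  · have hreg : IsRegularRing (MvPolynomial (Fin n) k') := inferInstance
    exact GenericallyRegular.of_ringEquiv (AlgEquiv.ofInjective φ hs).toRingEquiv
      ⟨1, one_ne_zero, fun q hq _ => hreg.isRegularLocalRing_localization q⟩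

end GenericRegularityFieldExtensions

/-! ### Generic regularity over an arbitrary field -/

section GenericRegularity

open Polynomial IntermediateField

section RadicalExtension

variable {k K Ω : Type u} [Field k] [Field K] [Field Ω] [Algebra k K] [Algebra k Ω] [Algebra K Ω]
  [IsScalarTower k K Ω] (ρ : Ω ≃+* Ω)

/-- The extension of `k` generated by the images of finitely many elements of `k`. -/
abbrev radicalField (A : Finset k) : IntermediateField k Ω :=
  adjoin k ((fun a => ρ (algebraMap k Ω a)) '' (A : Set k))

/-- Here `ρ` will be an inverse power of Frobenius. It turns a rational function in `t` into one in
`ρ(t)` with coefficients in `ρ(k)`, and only finitely many coefficients occur, so a finite extension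
of `k` suffices. -/
lemma exists_radicalField {n : ℕ} (t : Fin n → K) (T : Finset K)
    (hT : ∀ c ∈ T, c ∈ adjoin k (Set.range t)) : ∃ A : Finset k, ∀ c ∈ T,
      ρ (algebraMap K Ω c) ∈ adjoin (radicalField ρ A)
        (Set.range fun i => ρ (algebraMap K Ω (t i))) := by
  classical
  have hmono : ∀ {A B : Finset k}, A ⊆ B → ∀ x : Ω,
      x ∈ adjoin (radicalField ρ A) (Set.range fun i => ρ (algebraMap K Ω (t i))) →
      x ∈ adjoin (radicalField ρ B) (Set.range fun i => ρ (algebraMap K Ω (t i))) := by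
    intro A B hAB x hx
    have hle : radicalField (Ω := Ω) ρ A ≤ radicalField ρ B :=
      adjoin.mono _ _ _ (Set.image_mono hAB)
    refine (Subfield.closure_mono (Set.union_subset_union_left _ ?_) : _ ≤ Subfield.closure _) hx
    rintro _ ⟨y, rfl⟩
    exact ⟨⟨y, hle y.2⟩, rfl⟩
  have hsingle : ∀ c ∈ adjoin k (Set.range t), ∃ A : Finset k,
      ρ (algebraMap K Ω c) ∈ adjoin (radicalField ρ A)
        (Set.range fun i => ρ (algebraMap K Ω (t i))) := by
    intro c hc
    induction hc using adjoin_induction with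
    | mem x hx =>
      obtain ⟨i, rfl⟩ := hx
      exact ⟨∅, subset_adjoin _ _ ⟨i, rfl⟩⟩
    | algebraMap x =>
      refine ⟨{x}, ?_⟩
      rw [← IsScalarTower.algebraMap_apply k K Ω]
      exact IntermediateField.algebraMap_mem _ (⟨_, subset_adjoin _ _ ⟨x, by simp, rfl⟩⟩ :
        radicalField (Ω := Ω) ρ {x})
    | add x y _ _ hx hy =>
      obtain ⟨A, hA⟩ := hx
      obtain ⟨B, hB⟩ := hy
      refine ⟨A ∪ B, ?_⟩
      rw [map_add, map_add]
      exact add_mem (hmono Finset.subset_union_left _ hA) (hmono Finset.subset_union_right _ hB)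
    | inv x _ hx =>
      obtain ⟨A, hA⟩ := hx
      exact ⟨A, by rw [map_inv₀, map_inv₀]; exact inv_mem hA⟩
    | mul x y _ _ hx hy =>
      obtain ⟨A, hA⟩ := hx
      obtain ⟨B, hB⟩ := hy
      refine ⟨A ∪ B, ?_⟩
      rw [map_mul, map_mul]
      exact mul_mem (hmono Finset.subset_union_left _ hA) (hmono Finset.subset_union_right _ hB)
  induction T using Finset.induction_on with
  | empty => exact ⟨∅, by simp⟩
  | insert c T _ ih =>
    obtain ⟨A, hA⟩ := ih fun c hc => hT c (Finset.mem_insert_of_mem hc)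
    obtain ⟨B, hB⟩ := hsingle c (hT c (Finset.mem_insert_self _ _))
    refine ⟨A ∪ B, fun d hd => ?_⟩
    rcases Finset.mem_insert.mp hd with rfl | hd
    · exact hmono Finset.subset_union_right _ hB
    · exact hmono Finset.subset_union_left _ (hA d hd)

end RadicalExtension

/-- Applying `ρ` to the separable minimal polynomial of `z` gives a separable polynomial that kills
`ρ(z)`. Only its coefficients, not all of `ρ(F)`, have to lie in `L`. -/
lemma isSeparable_of_minpoly_map {F K Ω : Type*} [Field F] [Field K] [Field Ω] [Algebra F K]
    [Algebra K Ω] (ρ : Ω ≃+* Ω) {z : K} (hz : IsSeparable F z) {L : Type*} [Field L] [Algebra L Ω]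
    (hc : ∀ c ∈ (minpoly F z).coeffs, ρ (algebraMap K Ω (algebraMap F K c)) ∈
      (algebraMap L Ω).range) : IsSeparable L (ρ (algebraMap K Ω z)) := by
  let σ : F →+* Ω := ((ρ : Ω →+* Ω).comp (algebraMap K Ω)).comp (algebraMap F K)
  obtain ⟨Q, hQ⟩ : (minpoly F z).map σ ∈ lifts (algebraMap L Ω) := by
    rw [lifts_iff_coeff_lifts]
    intro n
    rw [coeff_map]
    by_cases h0 : (minpoly F z).coeff n = 0
    · exact ⟨0, by rw [h0, map_zero, map_zero]⟩
    · exact hc _ (coeff_mem_coeffs h0)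
  rw [coe_mapRingHom] at hQ
  have hsep : Q.Separable := by
    rw [← separable_map (algebraMap L Ω), hQ]
    exact Separable.map hz
  refine hsep.of_dvd (minpoly.dvd L _ ?_)
  rw [aeval_def, ← Polynomial.eval_map, hQ, Polynomial.eval_map]
  have h1 := hom_eval₂ (minpoly F z) (algebraMap F K) ((ρ : Ω →+* Ω).comp (algebraMap K Ω)) z
  rw [← aeval_def, minpoly.aeval, map_zero] at h1
  exact h1.symm

lemma exists_pow_mem_separableClosure {F K : Type*} [Field F] [Field K] [Algebra F K]
    [Algebra.IsAlgebraic F K] (q : ℕ) [ExpChar F q] (Y : Finset K) :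
    ∃ N : ℕ, ∀ y ∈ Y, IsSeparable F (y ^ q ^ N) := by
  classical
  have : ExpChar (separableClosure F K) q :=
    expChar_of_injective_algebraMap (algebraMap F _).injective q
  choose n hn using fun y : K => IsPurelyInseparable.pow_mem (separableClosure F K) q y
  refine ⟨Y.sup n, fun y hy => ?_⟩
  rw [← mem_separableClosure_iff]
  obtain ⟨x, hx⟩ := hn y
  have hle : n y ≤ Y.sup n := Finset.le_sup hy
  rw [← Nat.add_sub_cancel' hle, pow_add, pow_mul, ← hx]
  exact pow_mem x.2 _

/-- Noether normalization makes `K` algebraic over `k(t)`, possibly inseparably, but the `q^N`-th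
powers of the generators are separable for large `N`. Taking `q^N`-th roots in an algebraic closure,
the generators themselves become separable over `L = k'(t^{1/q^N})` with `k'` finite over `k`. The
field `L` has a polynomial ring as model, the field `K'` they generate over `L` gets a regular model
by separable ascent, and `K'` is finite purely inseparable over `K`, so the model descends. -/
theorem hasRegularModel_of_finiteType (k : Type u) {A K : Type u} [Field k] [CommRing A] [IsDomain A]
    [Algebra k A] [Algebra.FiniteType k A] [Field K] [Algebra A K] [IsFractionRing A K]
    [Algebra k K] [IsScalarTower k A K] : HasRegularModel k K := by
  classical
  obtain ⟨d, g, hginj, hgfin⟩ := exists_finite_inj_algHom_of_fg k A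
  have hAK : Function.Injective (algebraMap A K) := IsFractionRing.injective A K
  let t : Fin d → K := fun i => algebraMap A K (g (MvPolynomial.X i))
  have htg : MvPolynomial.aeval t = (IsScalarTower.toAlgHom k A K).comp g :=
    MvPolynomial.algHom_ext fun i => by simp [t]
  have ht : AlgebraicIndependent k t := by
    rw [AlgebraicIndependent, htg]
    exact hAK.comp hginj
  let L₀ := adjoin k (Set.range t)
  have halgA : ∀ a : A, IsIntegral L₀ (algebraMap A K a) := by
    intro a
    obtain ⟨P, hP, hPa⟩ := hgfin.to_isIntegral a
    have hmem : ∀ f : MvPolynomial (Fin d) k, algebraMap A K (g f) ∈ L₀ := by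
      intro f
      have : algebraMap A K (g f) = MvPolynomial.aeval t f := by rw [htg]; rfl
      rw [this]
      exact algebra_adjoin_le_adjoin k _ (by
        rw [Algebra.adjoin_range_eq_range_aeval]; exact ⟨f, rfl⟩)
    let σ : MvPolynomial (Fin d) k →+* L₀ :=
      ((algebraMap A K).comp (g : MvPolynomial (Fin d) k →+* A)).codRestrict L₀ hmem
    refine ⟨P.map σ, hP.map σ, ?_⟩
    rw [eval₂_map]
    have := hom_eval₂ P (g : MvPolynomial (Fin d) k →+* A) (algebraMap A K) a
    rw [show eval₂ (g : MvPolynomial (Fin d) k →+* A) a P = 0 from hPa, map_zero] at this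
    exact this.symm
  have halg : Algebra.IsAlgebraic L₀ K := by
    refine ⟨fun x => ?_⟩
    obtain ⟨a, b, -, rfl⟩ := IsFractionRing.div_surjective (A := A) x
    rw [div_eq_mul_inv]
    exact IsAlgebraic.mul (halgA a).isAlgebraic (halgA b).isAlgebraic.inv
  let q := ringExpChar k
  have hqk : ExpChar k q := inferInstance
  have : ExpChar K q := expChar_of_injective_algebraMap (algebraMap k K).injective q
  have : ExpChar L₀ q := expChar_of_injective_algebraMap (algebraMap k L₀).injective q
  obtain ⟨Y₀, hY₀⟩ := Algebra.FiniteType.out (R := k) (A := A)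
  let Y : Finset K := Y₀.image (algebraMap A K)
  obtain ⟨N, hN⟩ := exists_pow_mem_separableClosure (F := L₀) q Y
  let Ω := AlgebraicClosure K
  have : ExpChar Ω q := expChar_of_injective_algebraMap (algebraMap K Ω).injective q
  let ρ : Ω ≃+* Ω := (iterateFrobeniusEquiv Ω q N).symm
  have hρ : ∀ x, ρ x ^ q ^ N = x := fun x => (iterateFrobeniusEquiv Ω q N).apply_symm_apply x
  have hρpow : ∀ x, ρ (x ^ q ^ N) = x := fun x => (iterateFrobeniusEquiv Ω q N).symm_apply_apply x
  let T : Finset K := Y.biUnion fun y => (minpoly L₀ (y ^ q ^ N)).coeffs.image (algebraMap L₀ K)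
  obtain ⟨A', hA'⟩ := exists_radicalField (Ω := Ω) ρ t T (by
    intro c hc
    obtain ⟨y, -, hc⟩ := Finset.mem_biUnion.mp hc
    obtain ⟨c, -, rfl⟩ := Finset.mem_image.mp hc
    exact c.2)
  let k' := radicalField (Ω := Ω) ρ A'
  let s : Fin d → Ω := fun i => ρ (algebraMap K Ω (t i))
  let L := adjoin k' (Set.range s)
  have hYsep : ∀ y ∈ Y, IsSeparable L (algebraMap K Ω y) := by
    intro y hy
    have := isSeparable_of_minpoly_map (L := L) ρ (hN y hy) (fun c hc => by
      exact ⟨⟨_, hA' _ (Finset.mem_biUnion.mpr ⟨y, hy, Finset.mem_image_of_mem _ hc⟩)⟩, rfl⟩)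
    rwa [map_pow, hρpow] at this
  let Y' : Set Ω := algebraMap K Ω '' Y
  let K' := adjoin L Y'
  have hY'sep : ∀ y ∈ Y', IsSeparable L y := by
    rintro _ ⟨y, hy, rfl⟩
    exact hYsep y hy
  have : Finite Y' := (Y.finite_toSet.image _).to_subtype
  have hk' : FiniteDimensional k k' := by
    have : Finite ((fun a => ρ (algebraMap k Ω a)) '' (A' : Set k)) :=
      (A'.finite_toSet.image _).to_subtype
    refine finiteDimensional_adjoin ?_
    rintro _ ⟨a, -, rfl⟩
    refine IsIntegral.of_pow (n := q ^ N) (pow_pos (expChar_pos k q) N) ?_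
    rw [hρ]
    exact isIntegral_algebraMap
  have hsind : AlgebraicIndependent k' s := by
    -- Independence passes from `k` to the algebraic extension `k'`. Over `k`, the power `q^N` of
    -- Frobenius turns a relation between the roots into one between the `t i`.
    refine AlgebraicIndependent.extendScalars (R := k) k' ?_
    have hcomp : (iterateFrobenius Ω q N).comp (MvPolynomial.aeval s : _ →ₐ[k] Ω).toRingHom =
        (algebraMap K Ω).comp ((MvPolynomial.aeval t : _ →ₐ[k] K).toRingHom.comp
          (MvPolynomial.map (iterateFrobenius k q N))) := by
      refine MvPolynomial.ringHom_ext (fun a => ?_) fun i => ?_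
      · simp [iterateFrobenius_def, IsScalarTower.algebraMap_apply k K Ω]
      · simp [iterateFrobenius_def, s, hρ]
    refine Function.Injective.of_comp (f := iterateFrobenius Ω q N) ?_
    have h0 : Function.Injective ((MvPolynomial.aeval t : _ →ₐ[k] K).toRingHom.comp
        (MvPolynomial.map (iterateFrobenius k q N))) := by
      rw [RingHom.coe_comp]
      exact Function.Injective.comp (show Function.Injective (MvPolynomial.aeval t) from ht) (MvPolynomial.map_injective _ (iterateFrobenius k q N).injective)
    have h1 := (algebraMap K Ω).injective.comp h0
    rw [← RingHom.coe_comp] at h1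
    rw [← hcomp] at h1
    exact h1
  have hL : HasRegularModel k L := by
    let s' : Fin d → L := fun i => ⟨s i, subset_adjoin _ _ ⟨i, rfl⟩⟩
    have hs' : AlgebraicIndependent k' s' := hsind.of_comp (f := L.val)
    refine hasRegularModel_of_algebraicIndependent hs' ?_
    apply lift_injective L
    rw [lift_adjoin, lift_top, ← Set.range_comp]
    rfl
  have : Algebra.IsSeparable L K' := (isSeparable_adjoin_iff_isSeparable L Ω).mpr hY'sep
  have : FiniteDimensional L K' := finiteDimensional_adjoin fun y hy => (hY'sep y hy).isIntegral
  let : Algebra k K' := ((algebraMap L K').comp (algebraMap k L)).toAlgebra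
  have : IsScalarTower k L K' := .of_algebraMap_eq fun _ => rfl
  have : IsScalarTower k L Ω := .of_algebraMap_eq fun _ => rfl
  have hK' : HasRegularModel k K' := hL.of_isSeparable
  have hmod : IsModel (K := K) (Algebra.adjoin k (Y : Set K)) := by
    refine ⟨Subalgebra.fg_adjoin_finset Y, ?_⟩
    rw [← top_le_iff]
    intro x _
    have hA : ∀ a : A, algebraMap A K a ∈ Algebra.adjoin k (Y : Set K) := by
      intro a
      have ha : a ∈ Algebra.adjoin k (Y₀ : Set A) := by rw [hY₀]; trivial
      have : IsScalarTower.toAlgHom k A K a ∈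
          (Algebra.adjoin k (Y₀ : Set A)).map (IsScalarTower.toAlgHom k A K) := ⟨a, ha, rfl⟩
      rw [AlgHom.map_adjoin] at this
      simpa [Y] using this
    obtain ⟨a, b, -, rfl⟩ := IsFractionRing.div_surjective (A := A) x
    exact div_mem (Subfield.subset_closure (hA a)) (Subfield.subset_closure (hA b))
  have hKK' : ∀ x : K, algebraMap K Ω x ∈ K' := by
    intro x
    have hx : x ∈ Subfield.closure (Algebra.adjoin k (Y : Set K) : Set K) := by
      rw [hmod.closure_eq]; trivial
    refine (Subfield.closure_le (t := K'.toSubfield.comap (algebraMap K Ω))).mpr ?_ hx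
    have hle : Algebra.adjoin k (Y : Set K) ≤ (K'.toSubalgebra.restrictScalars k).comap
        (IsScalarTower.toAlgHom k K Ω) :=
      Algebra.adjoin_le fun y hy => subset_adjoin L Y' ⟨y, hy, rfl⟩
    exact hle
  let : Algebra K K' := ((algebraMap K Ω).codRestrict K' hKK').toAlgebra
  have : IsScalarTower k K K' := .of_algebraMap_eq fun x => Subtype.ext
    (IsScalarTower.algebraMap_apply k K Ω x)
  have : IsPurelyInseparable K K' := by
    rw [isPurelyInseparable_iff_pow_mem K q]
    intro x
    refine ⟨N, ?_⟩
    -- The elements whose `q^N`-th power lies in `K` form a field, and it contains all generators of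
    -- `K'`.
    let S : Subfield Ω := (algebraMap K Ω).fieldRange.comap (iterateFrobenius Ω q N)
    have h1 : (k' : Set Ω) ⊆ S := by
      refine Subfield.closure_le.mpr (Set.union_subset ?_ ?_)
      · rintro _ ⟨a, rfl⟩
        exact ⟨algebraMap k K a ^ q ^ N, by
          rw [map_pow, ← IsScalarTower.algebraMap_apply]; rfl⟩
      · rintro _ ⟨a, -, rfl⟩
        exact ⟨algebraMap k K a, by
          rw [← IsScalarTower.algebraMap_apply, iterateFrobenius_def, hρ]⟩
    have h2 : (L : Set Ω) ⊆ S := by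
      refine Subfield.closure_le.mpr (Set.union_subset ?_ ?_)
      · rintro _ ⟨a, rfl⟩
        exact h1 a.2
      · rintro _ ⟨i, rfl⟩
        exact ⟨t i, by rw [iterateFrobenius_def, hρ]⟩
    have h3 : (K' : Set Ω) ⊆ S := by
      refine Subfield.closure_le.mpr (Set.union_subset ?_ ?_)
      · rintro _ ⟨a, rfl⟩
        exact h2 a.2
      · rintro _ ⟨y, -, rfl⟩
        exact ⟨y ^ q ^ N, by rw [map_pow]; rfl⟩
    obtain ⟨z, hz⟩ := h3 x.2
    exact ⟨z, Subtype.ext hz⟩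
  have : Algebra.EssFiniteType k' L :=
    essFiniteType_iff.mpr (fg_adjoin_of_finite (Set.finite_range s))
  have : Algebra.EssFiniteType k L := Algebra.EssFiniteType.comp k k' L
  have : Algebra.EssFiniteType k K' := Algebra.EssFiniteType.comp k L K'
  have : Algebra.EssFiniteType K K' := Algebra.EssFiniteType.of_comp k K K'
  have : FiniteDimensional K K' := Algebra.finite_of_essFiniteType_of_isAlgebraic
  exact HasRegularModel.of_isPurelyInseparable q _ K le_rfl ⟨_, hmod⟩ hK'

theorem genericallyRegular_of_finiteType (k : Type u) {A : Type u} [Field k] [CommRing A]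
    [IsDomain A] [Algebra k A] [Algebra.FiniteType k A] : GenericallyRegular A := by
  let K := FractionRing A
  let φ := IsScalarTower.toAlgHom k A K
  have hinj : Function.Injective φ := IsFractionRing.injective A K
  refine GenericallyRegular.of_ringEquiv (AlgEquiv.ofInjective φ hinj).symm.toRingEquiv
    ((hasRegularModel_of_finiteType k (A := A) (K := K)).genericallyRegular ⟨?_, ?_⟩)
  · rw [← Algebra.map_top]
    exact Subalgebra.FG.map φ (Algebra.FiniteType.out (R := k) (A := A))
  · rw [← top_le_iff]
    intro x _
    obtain ⟨a, b, -, rfl⟩ := IsFractionRing.div_surjective (A := A) x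
    exact div_mem (Subfield.subset_closure ⟨a, rfl⟩) (Subfield.subset_closure ⟨b, rfl⟩)

end GenericRegularity

/-! ### Generic behaviour along an irreducible closed subset -/

section GenericAlong

open IsLocalRing

/-- Noetherian induction on the closed set `V(J)`: neighbourhoods of its generic points leave the
smaller closed sets `V(p + (h p))`. With it, statements valid near each point along its closure
become statements about finitely many strata. -/
lemma exists_finite_primes_cover {A : Type*} [CommRing A] [IsNoetherianRing A]
    (h : PrimeSpectrum A → A) (hh : ∀ p, h p ∉ p.asIdeal) :
    ∃ F : Set (PrimeSpectrum A), F.Finite ∧ ∀ q, ∃ p ∈ F, p ≤ q ∧ h p ∉ q.asIdeal := by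
  suffices H : ∀ J : Ideal A, ∃ F : Set (PrimeSpectrum A), F.Finite ∧
      ∀ q : PrimeSpectrum A, J ≤ q.asIdeal → ∃ p ∈ F, p ≤ q ∧ h p ∉ q.asIdeal by
    obtain ⟨F, hF, hF'⟩ := H ⊥
    exact ⟨F, hF, fun q => hF' q bot_le⟩
  intro J
  induction J using IsNoetherian.induction with
  | hgt J ih =>
    have hfin : {p : PrimeSpectrum A | p.asIdeal ∈ Ideal.minimalPrimes J}.Finite :=
      (Ideal.finite_minimalPrimes_of_isNoetherianRing A J).preimage
        fun p _ q _ hpq => PrimeSpectrum.ext hpq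
    have hex : ∀ p : PrimeSpectrum A, ∃ F : Set (PrimeSpectrum A), F.Finite ∧
        (p.asIdeal ∈ Ideal.minimalPrimes J → ∀ q : PrimeSpectrum A, p ≤ q → h p ∈ q.asIdeal →
          ∃ p' ∈ F, p' ≤ q ∧ h p' ∉ q.asIdeal) := by
      intro p
      by_cases hp : p.asIdeal ∈ Ideal.minimalPrimes J
      · obtain ⟨F, hF, hF'⟩ := ih (p.asIdeal ⊔ Ideal.span {h p})
          (lt_of_le_of_lt hp.1.2 (left_lt_sup.mpr (by simpa using hh p)))
        exact ⟨F, hF, fun _ q hpq hq => hF' q (sup_le hpq (by simpa using hq))⟩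
      · exact ⟨∅, Set.finite_empty, fun h => absurd h hp⟩
    choose F hF hF' using hex
    refine ⟨_ ∪ ⋃ p ∈ {p : PrimeSpectrum A | p.asIdeal ∈ Ideal.minimalPrimes J}, F p,
      hfin.union (hfin.biUnion fun p _ => hF p), fun q hq => ?_⟩
    obtain ⟨p, hp, hpq⟩ := Ideal.exists_minimalPrimes_le hq
    let p' : PrimeSpectrum A := ⟨p, hp.1.1⟩
    by_cases hhq : h p' ∈ q.asIdeal
    · obtain ⟨p'', hp'', h2⟩ := hF' p' hp q hpq hhq
      exact ⟨p'', Or.inr (Set.mem_biUnion (show p' ∈ _ from hp) hp''), h2⟩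
    · exact ⟨p', Or.inl hp, hpq, hhq⟩

/-- A set of primes which locally along each irreducible closed subset contains at most its
generic point is finite. -/
lemma finite_of_generic {A : Type*} [CommRing A] [IsNoetherianRing A]
    (Bad : PrimeSpectrum A → Prop) (h : ∀ p : PrimeSpectrum A, ∃ h ∉ p.asIdeal,
      ∀ q : PrimeSpectrum A, p < q → h ∉ q.asIdeal → ¬ Bad q) : {q | Bad q}.Finite := by
  choose h hh hbad using h
  obtain ⟨F, hF, hF'⟩ := exists_finite_primes_cover h hh
  refine hF.subset fun q hq => ?_
  obtain ⟨p, hp, hpq, hhq⟩ := hF' q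
  rcases hpq.eq_or_lt with rfl | hlt
  · exact hp
  · exact absurd hq (hbad p q hlt hhq)

lemma exists_mul_eq_zero_of_fg {A : Type*} [CommRing A] {N : Ideal A} (hN : N.FG) (p : Ideal A)
    [p.IsPrime] (h : ∀ a ∈ N, algebraMap A (Localization.AtPrime p) a = 0) :
    ∃ h ∉ p, ∀ a ∈ N, h * a = 0 := by
  classical
  obtain ⟨S, rfl⟩ := hN
  have hex : ∀ a : A, ∃ t, t ∉ p ∧ (a ∈ S → t * a = 0) := by
    intro a
    by_cases ha : a ∈ S
    · obtain ⟨t, ht⟩ := (IsLocalization.map_eq_zero_iff p.primeCompl _ a).mp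
        (h a (Ideal.subset_span ha))
      exact ⟨t, t.2, fun _ => ht⟩
    · exact ⟨1, p.primeCompl.one_mem, fun h => absurd h ha⟩
  choose t ht hta using hex
  refine ⟨∏ a ∈ S, t a, fun hmem => ?_, fun a ha => ?_⟩
  · obtain ⟨a, -, ha⟩ := (Ideal.IsPrime.prod_mem_iff (hp := ‹p.IsPrime›)).mp hmem
    exact ht a ha
  · induction ha using Submodule.span_induction with
    | mem a ha =>
      rw [← Finset.mul_prod_erase S t ha, mul_right_comm, hta a ha, zero_mul]
    | zero => exact mul_zero _
    | add a b _ _ ha hb => rw [mul_add, ha, hb, add_zero]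
    | smul r a _ ha => rw [smul_eq_mul, mul_left_comm, ha, mul_zero]

lemma exists_isSMulRegular_localization {A : Type*} [CommRing A] [IsNoetherianRing A] {x : A}
    {p : Ideal A} [p.IsPrime]
    (hx : IsSMulRegular (Localization.AtPrime p) (algebraMap A (Localization.AtPrime p) x)) :
    ∃ h ∉ p, ∀ (q : Ideal A) [q.IsPrime], h ∉ q →
      IsSMulRegular (Localization.AtPrime q) (algebraMap A (Localization.AtPrime q) x) := by
  let J : Ideal A := LinearMap.ker (LinearMap.mulLeft A x)
  obtain ⟨h, hp, hJ⟩ := exists_mul_eq_zero_of_fg (IsNoetherian.noetherian J) p fun a ha => by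
    rw [isSMulRegular_iff_right_eq_zero_of_smul] at hx
    refine hx _ ?_
    rw [smul_eq_mul, ← map_mul, show x * a = 0 from ha, map_zero]
  refine ⟨h, hp, fun q _ hq => ?_⟩
  rw [isSMulRegular_iff_right_eq_zero_of_smul]
  intro z hz
  obtain ⟨a, s, rfl⟩ := IsLocalization.exists_mk'_eq q.primeCompl z
  rw [smul_eq_mul, IsLocalization.mul_mk'_eq_mk'_of_mul, IsLocalization.mk'_eq_zero_iff] at hz
  obtain ⟨t, ht⟩ := hz
  rw [IsLocalization.mk'_eq_zero_iff]
  refine ⟨⟨h, hq⟩ * t, ?_⟩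
  rw [Submonoid.coe_mul, mul_assoc]
  exact hJ _ (show x * (t * a) = 0 by rw [← ht]; ring)

lemma exists_quotient_prime {A : Type u} [CommRing A] (I : Ideal A) {q : Ideal A} [q.IsPrime]
    (hI : I ≤ q) : ∃ (Q : Ideal (A ⧸ I)) (_ : Q.IsPrime), Q.comap (Ideal.Quotient.mk I) = q ∧
      Nonempty (Localization.AtPrime Q ≃+*
        Localization.AtPrime q ⧸ I.map (algebraMap A (Localization.AtPrime q))) := by
  have hker : RingHom.ker (Ideal.Quotient.mk I) ≤ q := by rwa [Ideal.mk_ker]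
  have hQ := Ideal.map_isPrime_of_surjective Ideal.Quotient.mk_surjective hker
  have hc : (q.map (Ideal.Quotient.mk I)).comap (Ideal.Quotient.mk I) = q := by
    rw [Ideal.comap_map_of_surjective' _ Ideal.Quotient.mk_surjective, sup_eq_left.mpr hker]
  have key : ∀ (q' : Ideal A) [q'.IsPrime] (Q : Ideal (A ⧸ I)) [Q.IsPrime],
      Q.comap (Ideal.Quotient.mk I) = q' → Nonempty (Localization.AtPrime Q ≃+*
        Localization.AtPrime q' ⧸ I.map (algebraMap A (Localization.AtPrime q'))) := by
    rintro _ _ Q _ rfl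
    exact nonempty_localization_quotient_equiv I Q
  exact ⟨_, hQ, hc, key q _ hc⟩

lemma exists_mem_span_eq {A : Type*} [CommRing A] {p : Ideal A} [p.IsPrime]
    {z : Localization.AtPrime p} (hz : z ∈ maximalIdeal (Localization.AtPrime p)) :
    ∃ a ∈ p, Associated z (algebraMap A (Localization.AtPrime p) a) := by
  obtain ⟨a, s, rfl⟩ := IsLocalization.exists_mk'_eq p.primeCompl z
  refine ⟨a, (IsLocalization.AtPrime.mk'_mem_maximal_iff _ p a s).mp hz,
    (IsLocalization.map_units (Localization.AtPrime p) s).unit, ?_⟩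
  rw [IsUnit.unit_spec, IsLocalization.mk'_spec]

/-- Generators of the maximal ideal of the quotient lift, and adding `x` costs one more generator; a
nonzerodivisor accounts for at least one more dimension. -/
lemma isRegularLocalRing_of_quotient {R : Type*} [CommRing R] [IsLocalRing R] [IsNoetherianRing R]
    {x : R} (hx : x ∈ maximalIdeal R) (hreg : IsSMulRegular R x)
    (h : IsRegularLocalRing (R ⧸ Ideal.span {x})) : IsRegularLocalRing R := by
  classical
  obtain ⟨T, -, hT, hcard⟩ := exists_finset_span_eq_maximalIdeal
    (maximalIdeal (R ⧸ Ideal.span {x}) : Set (R ⧸ Ideal.span {x})) (Ideal.span_eq _)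
  have hdim := (isRegularLocalRing_iff _).mp h
  rw [← hcard] at hdim
  have hle := ringKrullDim_quotient_succ_le_of_nonZeroDivisor (r := x)
    (mem_nonZeroDivisors_iff_right.mpr fun y hy => isSMulRegular_iff_right_eq_zero_of_smul.mp
      hreg y (by rw [smul_eq_mul, mul_comm]; exact hy))
  choose g hg using Ideal.Quotient.mk_surjective (I := Ideal.span {x})
  refine isRegularLocalRing_of_span_le (insert x (T.image g)) ?_ ?_
  · refine le_antisymm ?_ ?_
    · rw [Ideal.span_le]
      intro y hy
      rcases Finset.mem_insert.mp hy with rfl | hy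
      · exact hx
      · obtain ⟨t, ht, rfl⟩ := Finset.mem_image.mp hy
        have : Ideal.Quotient.mk (Ideal.span {x}) (g t) ∈ maximalIdeal (R ⧸ Ideal.span {x}) := by
          rw [hg, ← hT]
          exact Ideal.subset_span ht
        exact fun hu => this (hu.map _)
    · intro y hy
      have h1 : Ideal.Quotient.mk (Ideal.span {x}) y ∈ (Ideal.span (T.image g : Set R)).map
          (Ideal.Quotient.mk (Ideal.span {x})) := by
        rw [Ideal.map_span]
        have : Ideal.Quotient.mk (Ideal.span {x}) '' (T.image g : Set R) = T := by
          rw [Finset.coe_image, Set.image_image]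
          simp [hg]
        rw [this, hT, maximalIdeal_quotient]
        exact Ideal.mem_map_of_mem _ hy
      obtain ⟨z, hz, hzy⟩ := (Ideal.mem_map_iff_of_surjective _ Ideal.Quotient.mk_surjective).mp h1
      have h2 : y - z ∈ Ideal.span {x} := (Ideal.Quotient.mk_eq_mk_iff_sub_mem _ _).mp hzy.symm
      rw [Finset.coe_insert, Ideal.span_insert]
      have := Submodule.add_mem_sup h2 hz
      rwa [sub_add_cancel] at this
  · refine le_trans ?_ hle
    rw [← hdim]
    exact_mod_cast (Finset.card_insert_le _ _).trans
      (Nat.add_le_add_right Finset.card_image_le 1)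

lemma succ_le_depth_of_quotient {R : Type*} [CommRing R] [IsLocalRing R]
    {x : R} (hx : x ∈ maximalIdeal R) (hreg : IsSMulRegular R x)
    [IsLocalRing (R ⧸ Ideal.span {x})] {n : ℕ} (h : (n : ℕ∞) ≤ depth (R ⧸ Ideal.span {x})) :
    ((n + 1 : ℕ) : ℕ∞) ≤ depth R := by
  obtain ⟨rs, hlen, hm, hrs⟩ := exists_isRegular_of_le_depth h
  obtain ⟨ss, rfl⟩ : ∃ ss : List R, ss.map (Ideal.Quotient.mk (Ideal.span {x})) = rs :=
    List.map_surjective_iff.mpr Ideal.Quotient.mk_surjective rs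
  have := le_depth_of_isWeaklyRegular (x :: ss) (fun r hr => ?_)
    ((isWeaklyRegular_cons_quotient_iff x ss).mpr ⟨hreg, hrs⟩)
  · simpa [← hlen] using this
  · rcases List.mem_cons.mp hr with rfl | hr
    · exact hx
    · exact fun hu => hm _ (List.mem_map_of_mem hr) (hu.map _)

lemma exists_isSMulRegular_of_succ_le_depth {R : Type*} [CommRing R] [IsLocalRing R]
    [IsNoetherianRing R] {n : ℕ}
    (h : ((n + 1 : ℕ) : ℕ∞) ≤ depth R) : ∃ x ∈ maximalIdeal R, IsSMulRegular R x := by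
  obtain ⟨rs, hlen, hm, hrs⟩ := exists_isRegular_of_le_depth h
  match rs, hlen with
  | x :: ss, _ => exact ⟨x, hm x (by simp), ((isWeaklyRegular_cons_quotient_iff x ss).mp hrs).1⟩

lemma isSMulRegular_of_associated {R : Type*} [CommRing R] {x y : R} (h : Associated x y)
    (hx : IsSMulRegular R x) : IsSMulRegular R y := by
  obtain ⟨w, rfl⟩ := h
  exact hx.mul (w.isUnit.isSMulRegular R)

lemma isSMulRegular_of_notMem_associatedPrimes {A : Type*} [CommRing A] [IsNoetherianRing A]
    {q : Ideal A} [q.IsPrime] {y : A} (h : ∀ P ∈ associatedPrimes A A, P ≤ q → y ∉ P) :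
    IsSMulRegular (Localization.AtPrime q) (algebraMap A (Localization.AtPrime q) y) := by
  rw [isSMulRegular_iff_right_eq_zero_of_smul]
  intro z hz
  by_contra hz0
  have : IsNoetherianRing (Localization.AtPrime q) :=
    IsLocalization.isNoetherianRing q.primeCompl _ inferInstance
  obtain ⟨P, hP, hzP⟩ := exists_le_isAssociatedPrime_of_isNoetherianRing
    (Localization.AtPrime q) z hz0
  have hP' := Module.associatedPrimes.comap_mem_associatedPrimes_of_mem_associatedPrimes_of_isLocalizedModule_of_fg
    (M := A) q.primeCompl (Algebra.linearMap A (Localization.AtPrime q)) P hP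
    (IsNoetherian.noetherian _)
  refine h _ hP' ?_ (Ideal.mem_comap.mpr (hzP ?_))
  · intro a ha
    have := IsLocalRing.le_maximalIdeal hP.isPrime.ne_top (Ideal.mem_comap.mp ha)
    exact (IsLocalization.AtPrime.to_map_mem_maximal_iff _ q a).mp this
  · rw [Submodule.mem_colon_singleton]
    simpa using hz

end GenericAlong

/-! ### Spreading out regularity and depth along the closure of a point -/

section GenericRegularDepth

open IsLocalRing RingTheory.Sequence

lemma exists_ringKrullDim_eq_natCast (R : Type*) [CommRing R] [IsLocalRing R]
    [IsNoetherianRing R] : ∃ n : ℕ, ringKrullDim R = n := by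
  rw [← IsLocalRing.maximalIdeal_height_eq_ringKrullDim]
  obtain ⟨n, hn⟩ := ENat.ne_top_iff_exists.mp
    (Ideal.height_ne_top (I := maximalIdeal R) (IsLocalRing.maximalIdeal.isMaximal R).ne_top)
  exact ⟨n, by rw [← hn]; rfl⟩

lemma exists_mem_notMem_maximalIdeal_sq {R : Type*} [CommRing R] [IsLocalRing R]
    [IsNoetherianRing R] (h : 0 < ringKrullDim R) :
    ∃ x ∈ maximalIdeal R, x ∉ maximalIdeal R ^ 2 := by
  by_contra! hcon
  have hbot : maximalIdeal R = ⊥ := Submodule.eq_bot_of_le_smul_of_le_jacobson_bot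
    (maximalIdeal R) (maximalIdeal R) (IsNoetherian.noetherian _)
    (fun x hx => by rw [smul_eq_mul, ← pow_two]; exact hcon x hx)
    (IsLocalRing.maximalIdeal_le_jacobson _)
  exact h.ne' (ringKrullDim_eq_zero_of_isField (IsLocalRing.isField_iff_maximalIdeal_eq.mpr hbot))

lemma exists_notMem_of_finite {A : Type*} [CommRing A] {S : Set (Ideal A)} (hS : S.Finite)
    (p : Ideal A) [p.IsPrime] (h : ∀ P ∈ S, ¬ P ≤ p) : ∃ t ∉ p, ∀ P ∈ S, t ∈ P := by
  induction S, hS using Set.Finite.induction_on with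
  | empty => exact ⟨1, p.primeCompl.one_mem, by simp⟩
  | insert _ _ ih =>
    obtain ⟨t, ht, htS⟩ := ih fun P hP => h P (Set.mem_insert_of_mem _ hP)
    obtain ⟨s, hs, hsp⟩ := Set.not_subset.mp (h _ (Set.mem_insert _ _))
    refine ⟨t * s, p.primeCompl.mul_mem ht hsp, fun P hP => ?_⟩
    rcases Set.mem_insert_iff.mp hP with rfl | hP
    · exact Ideal.mul_mem_left _ _ hs
    · exact Ideal.mul_mem_right _ _ (htS P hP)

/-- The inductive step common to the three spreading-out theorems. A neighbourhood of `Q` in `A/(a)`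
lifts to one of `p`, shrunk so that `a` remains regular at nearby points of the closure of `p`. -/
lemma exists_quotient_step {A : Type u} [CommRing A] [IsNoetherianRing A] {a : A} {p : Ideal A}
    [p.IsPrime] (ha : a ∈ p)
    (hreg : IsSMulRegular (Localization.AtPrime p) (algebraMap A (Localization.AtPrime p) a)) :
    ∃ (Q : Ideal (A ⧸ Ideal.span {a})) (_ : Q.IsPrime),
      Nonempty (Localization.AtPrime Q ≃+* Localization.AtPrime p ⧸
        Ideal.span {algebraMap A (Localization.AtPrime p) a}) ∧
      ∀ g ∉ Q, ∃ h ∉ p, ∀ (q : Ideal A) [q.IsPrime], p ≤ q → h ∉ q →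
        IsSMulRegular (Localization.AtPrime q) (algebraMap A (Localization.AtPrime q) a) ∧
        ∃ (Q' : Ideal (A ⧸ Ideal.span {a})) (_ : Q'.IsPrime), Q ≤ Q' ∧ (p < q → Q < Q') ∧ g ∉ Q' ∧
          Nonempty (Localization.AtPrime Q' ≃+* Localization.AtPrime q ⧸
            Ideal.span {algebraMap A (Localization.AtPrime q) a}) := by
  obtain ⟨Q, hQ, hQp, ⟨e⟩⟩ := exists_quotient_prime (Ideal.span {a}) (q := p)
    ((Ideal.span_singleton_le_iff_mem _).mpr ha)
  rw [Ideal.map_span, Set.image_singleton] at e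
  refine ⟨Q, hQ, ⟨e⟩, fun g hg => ?_⟩
  obtain ⟨g, rfl⟩ := Ideal.Quotient.mk_surjective g
  obtain ⟨h, hp, hh⟩ := exists_isSMulRegular_localization hreg
  refine ⟨g * h, p.primeCompl.mul_mem (show g ∉ p by rw [← hQp]; exact hg) hp, fun q _ hpq hq => ?_⟩
  refine ⟨hh q fun hm => hq (Ideal.mul_mem_left _ _ hm), ?_⟩
  obtain ⟨Q', hQ', hQq, ⟨e'⟩⟩ := exists_quotient_prime (Ideal.span {a}) (q := q)
    ((Ideal.span_singleton_le_iff_mem _).mpr (hpq ha))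
  rw [Ideal.map_span, Set.image_singleton] at e'
  have hle : Q ≤ Q' := by
    rw [← Ideal.comap_le_comap_iff_of_surjective (Ideal.Quotient.mk (Ideal.span {a}))
      Ideal.Quotient.mk_surjective, hQp, hQq]
    exact hpq
  refine ⟨Q', hQ', hle, fun hlt => lt_of_le_of_ne hle ?_, fun hm => hq ?_, ⟨e'⟩⟩
  · rintro rfl
    exact hlt.ne (hQp.symm.trans hQq)
  · exact Ideal.mul_mem_right _ _ (by rw [← hQq]; exact hm)

/-- The regular locus of an algebra of finite type over a field contains a neighbourhood of each of
its points, along the closure of that point. -/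
theorem exists_generic_regular (k : Type u) [Field k] (s : ℕ) : ∀ {A : Type u} [CommRing A]
    [Algebra k A] [Algebra.FiniteType k A] (p : Ideal A) [p.IsPrime],
    IsRegularLocalRing (Localization.AtPrime p) → ringKrullDim (Localization.AtPrime p) = s →
    ∃ h ∉ p, ∀ (q : Ideal A) [q.IsPrime], p ≤ q → h ∉ q →
      IsRegularLocalRing (Localization.AtPrime q) := by
  induction s with
  | zero =>
    intro A _ _ _ p _ hreg hdim
    have : IsNoetherianRing A := Algebra.FiniteType.isNoetherianRing k A
    obtain ⟨T, -, hT, hcard⟩ := exists_finset_span_eq_maximalIdeal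
      (maximalIdeal (Localization.AtPrime p) : Set (Localization.AtPrime p)) (Ideal.span_eq _)
    have hdim' := (isRegularLocalRing_iff _).mp hreg
    rw [hdim, ← hcard] at hdim'
    have hT0 : T = ∅ := Finset.card_eq_zero.mp (by exact_mod_cast hdim')
    -- In dimension zero `A_p` is a field, so one `h ∉ p` kills the whole ideal `p`. Where `h` is
    -- invertible, `A` and `A/p` have the same local rings, and generic regularity of the domain
    -- `A/p` applies.
    obtain ⟨h, hp, hh⟩ := exists_mul_eq_zero_of_fg (IsNoetherian.noetherian p) p fun a ha => by
      have := (IsLocalization.AtPrime.to_map_mem_maximal_iff (Localization.AtPrime p) p a).mpr ha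
      rwa [← hT, hT0, Finset.coe_empty, Ideal.span_empty] at this
    obtain ⟨g, hg, hgq⟩ := genericallyRegular_of_finiteType k (A := A ⧸ p)
    obtain ⟨g, rfl⟩ := Ideal.Quotient.mk_surjective g
    have hgp : g ∉ p := fun hm => hg (Ideal.Quotient.eq_zero_iff_mem.mpr hm)
    refine ⟨g * h, p.primeCompl.mul_mem hgp hp, fun q _ hpq hq => ?_⟩
    obtain ⟨Q, hQ, hQq, ⟨e⟩⟩ := exists_quotient_prime p hpq
    have hregQ := hgq Q fun hm => hq (Ideal.mul_mem_right _ _ (by rw [← hQq]; exact hm))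
    have hbot : p.map (algebraMap A (Localization.AtPrime q)) = ⊥ := by
      rw [Ideal.map_eq_bot_iff_le_ker]
      intro a ha
      rw [RingHom.mem_ker, IsLocalization.map_eq_zero_iff q.primeCompl]
      exact ⟨⟨h, fun hm => hq (Ideal.mul_mem_left _ _ hm)⟩, hh a ha⟩
    exact IsRegularLocalRing.of_ringEquiv
      ((e.trans (Ideal.quotEquivOfEq hbot)).trans (RingEquiv.quotientBot _))
  | succ s ih =>
    intro A _ _ _ p _ hreg hdim
    have : IsNoetherianRing A := Algebra.FiniteType.isNoetherianRing k A
    obtain ⟨z, hz, hz2⟩ := exists_mem_notMem_maximalIdeal_sq (R := Localization.AtPrime p)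
      (by rw [hdim]; exact_mod_cast Nat.succ_pos s)
    obtain ⟨a, ha, haz⟩ := exists_mem_span_eq hz
    have ham := Ideal.mem_of_dvd _ haz.dvd hz
    have ham2 : algebraMap A (Localization.AtPrime p) a ∉ _ := fun h =>
      hz2 (Ideal.mem_of_dvd _ haz.symm.dvd h)
    obtain ⟨hqreg, hqdim⟩ := ringKrullDim_quotient_of_regular ham ham2
    have hdom := isDomain_of_isRegularLocalRing (Localization.AtPrime p)
    have ha0 : algebraMap A (Localization.AtPrime p) a ≠ 0 := fun h => ham2 (h ▸ zero_mem _)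
    obtain ⟨Q, hQ, ⟨e⟩, hstep⟩ := exists_quotient_step ha
      (isSMulRegular_iff_right_eq_zero_of_smul.mpr fun m hm => (mul_eq_zero.mp hm).resolve_left ha0)
    have hs : ringKrullDim (Localization.AtPrime Q) = s := by
      rw [ringKrullDim_eq_of_ringEquiv e]
      rw [hdim] at hqdim
      exact le_antisymm (le_of_add_one_le_add_one hqdim.le) (le_of_add_one_le_add_one hqdim.ge)
    obtain ⟨g, hg, hgQ⟩ := ih Q (IsRegularLocalRing.of_ringEquiv e.symm) hs
    obtain ⟨h, hp, hh⟩ := hstep g hg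
    refine ⟨h, hp, fun q _ hpq hq => ?_⟩
    obtain ⟨hreg', Q', hQ', hle, -, hgQ', ⟨e'⟩⟩ := hh q hpq hq
    have := hgQ Q' hle hgQ'
    have : IsNoetherianRing (Localization.AtPrime q) :=
      IsLocalization.isNoetherianRing q.primeCompl _ inferInstance
    exact isRegularLocalRing_of_quotient
      ((IsLocalization.AtPrime.to_map_mem_maximal_iff _ q a).mpr (hpq ha)) hreg'
      (IsRegularLocalRing.of_ringEquiv e')

/-- On a neighbourhood of a point, along its closure, the depth jumps. -/
theorem exists_generic_depth (b : ℕ) : ∀ {A : Type u} [CommRing A] [IsNoetherianRing A]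
    (p : Ideal A) [p.IsPrime], (b : ℕ∞) ≤ depth (Localization.AtPrime p) →
    ∃ h ∉ p, ∀ (q : Ideal A) [q.IsPrime], p < q → h ∉ q →
      ((b + 1 : ℕ) : ℕ∞) ≤ depth (Localization.AtPrime q) := by
  induction b with
  | zero =>
    intro A _ _ p _ _
    -- Remove the associated primes not contained in `p`. Those remaining inside `q` are contained
    -- in `p`, hence do not contain `q`, and prime avoidance yields an element of `q` that is
    -- regular at `q`.
    have hfin := associatedPrimes.finite A A
    obtain ⟨h, hp, hh⟩ := exists_notMem_of_finite
      (hfin.subset (Set.sep_subset (associatedPrimes A A) fun P => ¬ P ≤ p)) p fun P hP => hP.2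
    refine ⟨h, hp, fun q _ hpq hq => ?_⟩
    obtain ⟨y, hyq, hy⟩ : ∃ y ∈ q, ∀ P ∈ associatedPrimes A A, P ≤ q → y ∉ P := by
      by_contra! hcon
      have := (Ideal.subset_union_prime_finite (f := id) (I := q)
        (hfin.subset (Set.sep_subset (associatedPrimes A A) fun P => P ≤ q)) 0 0
        fun P hP _ _ => hP.1.isPrime).mp fun y hy => by
          obtain ⟨P, hP, hPq, hyP⟩ := hcon y hy
          exact Set.mem_biUnion (x := P) ⟨hP, hPq⟩ hyP
      obtain ⟨P, ⟨hP, hPq⟩, hqP⟩ := this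
      have : ¬ P ≤ p := fun h => (hpq.trans_le (hqP.trans h)).false
      exact hq (hPq (hh P ⟨hP, this⟩))
    have hreg := isSMulRegular_of_notMem_associatedPrimes hy
    have := le_depth_of_isWeaklyRegular [algebraMap A (Localization.AtPrime q) y]
      (by simpa using (IsLocalization.AtPrime.to_map_mem_maximal_iff _ q y).mpr hyq)
      ((isWeaklyRegular_singleton_iff _ _).mpr hreg)
    simpa using this
  | succ b ih =>
    intro A _ _ p _ hb
    have : IsNoetherianRing (Localization.AtPrime p) :=
      IsLocalization.isNoetherianRing p.primeCompl _ inferInstance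
    obtain ⟨z, hz, hzreg⟩ := exists_isSMulRegular_of_succ_le_depth hb
    obtain ⟨a, ha, haz⟩ := exists_mem_span_eq hz
    have hareg := isSMulRegular_of_associated haz hzreg
    have ham := Ideal.mem_of_dvd _ haz.dvd hz
    obtain ⟨Q, hQ, ⟨e⟩, hstep⟩ := exists_quotient_step ha hareg
    have := nontrivial_quotient_span_singleton ham
    have hQb : (b : ℕ∞) ≤ depth (Localization.AtPrime Q) := by
      rw [depth_eq_of_ringEquiv e]
      exact le_depth_quotient ham hareg hb
    obtain ⟨g, hg, hgQ⟩ := ih Q hQb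
    obtain ⟨h, hp, hh⟩ := hstep g hg
    refine ⟨h, hp, fun q _ hpq hq => ?_⟩
    obtain ⟨hreg', Q', hQ', -, hlt, hgQ', ⟨e'⟩⟩ := hh q hpq.le hq
    have h1 := hgQ Q' (hlt hpq) hgQ'
    have ham' := (IsLocalization.AtPrime.to_map_mem_maximal_iff (Localization.AtPrime q) q a).mpr
      (hpq.le ha)
    have := nontrivial_quotient_span_singleton ham'
    rw [depth_eq_of_ringEquiv e'] at h1
    exact succ_le_depth_of_quotient ham' hreg' h1

lemma isWeaklyRegular_of_exact {R : Type*} [CommRing R] (rs : List R) :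
    ∀ {M₁ M₂ M₃ : Type u} [AddCommGroup M₁] [AddCommGroup M₂] [AddCommGroup M₃] [Module R M₁]
      [Module R M₂] [Module R M₃] {f : M₁ →ₗ[R] M₂} {g : M₂ →ₗ[R] M₃}, Function.Injective f →
      Function.Exact f g → Function.Surjective g → IsWeaklyRegular M₁ rs →
      IsWeaklyRegular M₃ rs → IsWeaklyRegular M₂ rs := by
  induction rs with
  | nil => intros; exact .nil _ _
  | cons x rs ih =>
    intro M₁ M₂ M₃ _ _ _ _ _ _ f g hf hfg hg h₁ h₃
    rw [isWeaklyRegular_cons_iff] at h₁ h₃ ⊢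
    refine ⟨?_, ih ?_ (QuotSMulTop.map_exact x hfg hg) (QuotSMulTop.map_surjective x hg) h₁.2 h₃.2⟩
    · rw [isSMulRegular_iff_right_eq_zero_of_smul]
      intro m hm
      have h0 := isSMulRegular_iff_right_eq_zero_of_smul.mp h₃.1 (g m)
        (by rw [← map_smul, hm, map_zero])
      obtain ⟨m', rfl⟩ := (hfg m).mp h0
      rw [← map_smul, map_eq_zero_iff f hf] at hm
      rw [isSMulRegular_iff_right_eq_zero_of_smul.mp h₁.1 m' hm, map_zero]
    · have h0 : Function.Exact (0 : M₁ →ₗ[R] M₁) f :=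
        (LinearMap.exact_zero_iff_injective M₁ f).mpr hf
      have := QuotSMulTop.map_first_exact_on_four_term_exact_of_isSMulRegular_last h0 hfg h₃.1
      rw [map_zero] at this
      exact (LinearMap.exact_zero_iff_injective _ _).mp this

lemma isWeaklyRegular_of_subsingleton {R : Type*} [CommRing R] (rs : List R) :
    ∀ (M : Type u) [AddCommGroup M] [Module R M] [Subsingleton M], IsWeaklyRegular M rs := by
  induction rs with
  | nil => intros; exact .nil _ _
  | cons x rs ih =>
    intro M _ _ _
    rw [isWeaklyRegular_cons_iff]
    exact ⟨fun _ _ _ => Subsingleton.elim _ _, ih _⟩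

end GenericRegularDepth

/-! ### Spreading out Cohen-Macaulayness, and finiteness of the bad points -/

section GenericCohenMacaulay

open IsLocalRing RingTheory.Sequence

/-- Dévissage of `M` into pieces `A/p'`. Those with `p' = p` are regular by assumption on the
sequence, those with `p' ⊄ p` vanish near `p`, and `p' < p` is excluded by the support. Weak
regularity is stable under extensions. -/
lemma exists_generic_isWeaklyRegular {A : Type u} [CommRing A] [IsNoetherianRing A] (p : Ideal A)
    [hp : p.IsPrime] (M : Type u) [AddCommGroup M] [Module A M] [Module.Finite A M] :
    (∀ p' : PrimeSpectrum A, p'.asIdeal < p → p' ∉ Module.support A M) →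
    ∃ h ∉ p, ∀ (q : Ideal A) [q.IsPrime], h ∉ q → ∀ rs : List (Localization q.primeCompl),
      IsWeaklyRegular (LocalizedModule q.primeCompl (A ⧸ p)) rs →
      IsWeaklyRegular (LocalizedModule q.primeCompl M) rs := by
  induction ‹Module.Finite A M› using
    IsNoetherianRing.induction_on_isQuotientEquivQuotientPrime A with
  | subsingleton N =>
    refine fun _ => ⟨1, p.primeCompl.one_mem, fun q _ _ rs _ => ?_⟩
    have : Subsingleton (LocalizedModule q.primeCompl N) :=
      LocalizedModule.subsingleton_iff.mpr fun m => ⟨1, q.primeCompl.one_mem, Subsingleton.elim _ _⟩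
    exact isWeaklyRegular_of_subsingleton rs _
  | quotient N p' f =>
    intro hN
    by_cases hle : p'.asIdeal ≤ p
    · rcases hle.eq_or_lt with heq | hlt
      · refine ⟨1, p.primeCompl.one_mem, fun q _ _ rs h => ?_⟩
        let f' : N ≃ₗ[A] A ⧸ p := f.trans (Submodule.quotEquivOfEq _ _ heq)
        let e := LinearEquiv.ofBijective (LocalizedModule.map q.primeCompl (f' : N →ₗ[A] A ⧸ p))
          ⟨LocalizedModule.map_injective _ _ f'.injective,
            LocalizedModule.map_surjective _ _ f'.surjective⟩
        exact (e.isWeaklyRegular_congr rs).mpr h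
      · refine absurd ?_ (hN p' hlt)
        rw [f.support_eq, Module.support_eq_zeroLocus, Ideal.annihilator_quotient]
        exact (PrimeSpectrum.mem_zeroLocus _ _).mpr le_rfl
    · obtain ⟨h, hh, hhp⟩ := Set.not_subset.mp hle
      refine ⟨h, hhp, fun q _ hq rs _ => ?_⟩
      have : Subsingleton (LocalizedModule q.primeCompl N) := by
        refine LocalizedModule.subsingleton_iff.mpr fun m => ⟨h, hq, f.injective ?_⟩
        rw [map_smul, map_zero]
        obtain ⟨x, hx⟩ := Ideal.Quotient.mk_surjective (f m)
        rw [← hx, ← Ideal.Quotient.mk_eq_mk, ← Submodule.Quotient.mk_smul,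
          Submodule.Quotient.mk_eq_zero]
        exact Ideal.mul_mem_right _ _ hh
      exact isWeaklyRegular_of_subsingleton rs _
  | exact N₁ N₂ N₃ f g hf hg hfg h₁ h₃ =>
    intro hN
    rw [Module.support_of_exact hfg hf hg] at hN
    obtain ⟨t₁, ht₁, H₁⟩ := h₁ fun p' hp' hmem => hN p' hp' (Or.inl hmem)
    obtain ⟨t₃, ht₃, H₃⟩ := h₃ fun p' hp' hmem => hN p' hp' (Or.inr hmem)
    refine ⟨t₁ * t₃, p.primeCompl.mul_mem ht₁ ht₃, fun q _ hq rs hrs => ?_⟩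
    exact isWeaklyRegular_of_exact rs (f := LocalizedModule.map q.primeCompl f)
      (g := LocalizedModule.map q.primeCompl g) (LocalizedModule.map_injective _ _ hf)
      (LocalizedModule.map_exact _ _ _ hfg) (LocalizedModule.map_surjective _ _ hg)
      (H₁ q (fun h => hq (Ideal.mul_mem_right _ _ h)) rs hrs)
      (H₃ q (fun h => hq (Ideal.mul_mem_left _ _ h)) rs hrs)

/-- Near `p` the domain `A/p` is regular, so a local ring of it has a regular sequence of full
length. Dévissage makes a lift of this sequence regular on `A`, whose local ring there has the same
dimension. -/
lemma exists_generic_ringKrullDim_le_depth_of_minimal (k : Type u) [Field k] {A : Type u}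
    [CommRing A] [Algebra k A] [Algebra.FiniteType k A] (p : Ideal A) [hp : p.IsPrime]
    (hmin : ∀ p' : Ideal A, p'.IsPrime → ¬ p' < p) :
    ∃ h ∉ p, ∀ (q : Ideal A) [q.IsPrime], p ≤ q → h ∉ q →
      ringKrullDim (Localization.AtPrime q) ≤ (depth (Localization.AtPrime q) : WithBot ℕ∞) := by
  have : IsNoetherianRing A := Algebra.FiniteType.isNoetherianRing k A
  obtain ⟨h₁, hh₁, H₁⟩ := exists_generic_isWeaklyRegular p A
    fun p' hp' => absurd hp' (hmin _ p'.2)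
  obtain ⟨h₂, hh₂, H₂⟩ := exists_notMem_of_finite
    ((Ideal.finite_minimalPrimes_of_isNoetherianRing A ⊥).subset
      (Set.sep_subset _ fun P => ¬ P ≤ p)) p fun P hP => hP.2
  obtain ⟨g, hg, hgq⟩ := genericallyRegular_of_finiteType k (A := A ⧸ p)
  obtain ⟨g, rfl⟩ := Ideal.Quotient.mk_surjective g
  have hgp : g ∉ p := fun hm => hg (Ideal.Quotient.eq_zero_iff_mem.mpr hm)
  refine ⟨h₁ * h₂ * g, p.primeCompl.mul_mem (p.primeCompl.mul_mem hh₁ hh₂) hgp,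
    fun q _ hpq hq => ?_⟩
  have hq₁ : h₁ ∉ q := fun h => hq (Ideal.mul_mem_right _ _ (Ideal.mul_mem_right _ _ h))
  have hq₂ : h₂ ∉ q := fun h => hq (Ideal.mul_mem_right _ _ (Ideal.mul_mem_left _ _ h))
  obtain ⟨Q, hQ, hQq, ⟨e⟩⟩ := exists_quotient_prime p hpq
  have hregQ := hgq Q fun hm => hq (Ideal.mul_mem_left _ _ (by rw [← hQq]; exact hm))
  let R := Localization.AtPrime q
  let I : Ideal R := p.map (algebraMap A R)
  have hregI : IsRegularLocalRing (R ⧸ I) := IsRegularLocalRing.of_ringEquiv e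
  obtain ⟨rs, hm, hrs, hlen⟩ := exists_isWeaklyRegular_of_isRegularLocalRing (R ⧸ I)
  obtain ⟨ss, rfl⟩ : ∃ ss : List R, ss.map (Ideal.Quotient.mk I) = rs :=
    List.map_surjective_iff.mpr Ideal.Quotient.mk_surjective rs
  have h1 : IsWeaklyRegular (R ⧸ I) ss :=
    (isWeaklyRegular_map_algebraMap_iff (R ⧸ I) (R ⧸ I) ss).mp hrs
  let e1 : LocalizedModule q.primeCompl (A ⧸ p) ≃ₗ[R] R ⧸ I :=
    (LocalizedModule.equivTensorProduct q.primeCompl (A ⧸ p)).trans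
      (Algebra.TensorProduct.quotIdealMapEquivTensorQuot R p).toLinearEquiv.symm
  let e2 : LocalizedModule q.primeCompl A ≃ₗ[R] R :=
    (LocalizedModule.equivTensorProduct q.primeCompl A).trans
      (TensorProduct.AlgebraTensorModule.rid A R R)
  have h2 : IsWeaklyRegular R ss := (e2.isWeaklyRegular_congr ss).mp
    (H₁ q hq₁ ss ((e1.isWeaklyRegular_congr ss).mpr h1))
  have h3 := le_depth_of_isWeaklyRegular ss (fun r hr hu =>
    hm _ (List.mem_map_of_mem hr) (hu.map (Ideal.Quotient.mk I))) h2
  -- Inverting `h₂` leaves `p` as the only minimal prime below `q`, so dividing by `p` removes no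
  -- prime of `A_q`.
  have h4 : ringKrullDim R ≤ ringKrullDim (R ⧸ I) := by
    rw [ringKrullDim_quotient]
    have hall : ∀ P : PrimeSpectrum R, P ∈ PrimeSpectrum.zeroLocus (I : Set R) := by
      intro P
      rw [PrimeSpectrum.mem_zeroLocus, SetLike.coe_subset_coe, Ideal.map_le_iff_le_comap]
      obtain ⟨P', hP', hP'P⟩ := Ideal.exists_minimalPrimes_le
        (bot_le : ⊥ ≤ P.asIdeal.comap (algebraMap A R))
      have hP'q : P' ≤ q := by
        refine hP'P.trans fun a ha => ?_
        exact (IsLocalization.AtPrime.to_map_mem_maximal_iff R q a).mp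
          (IsLocalRing.le_maximalIdeal P.2.ne_top ha)
      have hP'p : P' ≤ p := by
        by_contra hcon
        exact hq₂ (hP'q (H₂ P' ⟨hP', hcon⟩))
      rcases hP'p.eq_or_lt with rfl | hlt
      · exact hP'P
      · exact absurd hlt (hmin P' hP'.1.1)
    exact Order.krullDim_le_of_strictMono (fun P => ⟨P, hall P⟩) fun _ _ h => h
  refine h4.trans ?_
  rw [← hlen, List.length_map]
  exact_mod_cast h3

/-- An algebra of finite type over a field is Cohen-Macaulay on a neighbourhood of each of its
Cohen-Macaulay points, along the closure of that point. -/
theorem exists_generic_ringKrullDim_le_depth (k : Type u) [Field k] (s : ℕ) : ∀ {A : Type u}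
    [CommRing A] [Algebra k A] [Algebra.FiniteType k A] (p : Ideal A) [p.IsPrime],
    ringKrullDim (Localization.AtPrime p) ≤ s → (s : ℕ∞) ≤ depth (Localization.AtPrime p) →
    ∃ h ∉ p, ∀ (q : Ideal A) [q.IsPrime], p ≤ q → h ∉ q →
      ringKrullDim (Localization.AtPrime q) ≤ (depth (Localization.AtPrime q) : WithBot ℕ∞) := by
  induction s with
  | zero =>
    intro A _ _ _ p _ hdim _
    have : IsNoetherianRing A := Algebra.FiniteType.isNoetherianRing k A
    refine exists_generic_ringKrullDim_le_depth_of_minimal k p fun p' hp' hlt => ?_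
    rw [IsLocalization.AtPrime.ringKrullDim_eq_height p] at hdim
    have h1 := Ideal.height_strict_mono_of_isPrime hlt
    have h2 : p.height ≤ 0 := by exact_mod_cast hdim
    exact not_lt_zero (h1.trans_le h2)
  | succ s ih =>
    intro A _ _ _ p _ hdim hdep
    have : IsNoetherianRing A := Algebra.FiniteType.isNoetherianRing k A
    have : IsNoetherianRing (Localization.AtPrime p) :=
      IsLocalization.isNoetherianRing p.primeCompl _ inferInstance
    obtain ⟨z, hz, hzreg⟩ := exists_isSMulRegular_of_succ_le_depth hdep
    obtain ⟨a, ha, haz⟩ := exists_mem_span_eq hz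
    have hareg := isSMulRegular_of_associated haz hzreg
    have ham := Ideal.mem_of_dvd _ haz.dvd hz
    obtain ⟨Q, hQ, ⟨e⟩, hstep⟩ := exists_quotient_step ha hareg
    have := nontrivial_quotient_span_singleton ham
    have hQb : (s : ℕ∞) ≤ depth (Localization.AtPrime Q) := by
      rw [depth_eq_of_ringEquiv e]
      exact le_depth_quotient ham hareg hdep
    have hQdim : ringKrullDim (Localization.AtPrime Q) ≤ s := by
      rw [ringKrullDim_eq_of_ringEquiv e]
      refine le_of_add_one_le_add_one (le_trans
        (ringKrullDim_quotient_succ_le_of_nonZeroDivisor (mem_nonZeroDivisors_iff_right.mpr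
          fun y hy => isSMulRegular_iff_right_eq_zero_of_smul.mp hareg y ?_)) hdim)
      rw [smul_eq_mul, mul_comm]
      exact hy
    obtain ⟨g, hg, hgQ⟩ := ih Q hQdim hQb
    obtain ⟨h, hp, hh⟩ := hstep g hg
    refine ⟨h, hp, fun q _ hpq hq => ?_⟩
    obtain ⟨hreg', Q', hQ', hle, -, hgQ', ⟨e'⟩⟩ := hh q hpq hq
    have h1 := hgQ Q' hle hgQ'
    have : IsNoetherianRing (Localization.AtPrime q) :=
      IsLocalization.isNoetherianRing q.primeCompl _ inferInstance
    have ham' := (IsLocalization.AtPrime.to_map_mem_maximal_iff (Localization.AtPrime q) q a).mpr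
      (hpq ha)
    have := nontrivial_quotient_span_singleton ham'
    obtain ⟨n, hn⟩ := exists_ringKrullDim_eq_natCast (Localization.AtPrime Q')
    rw [hn, depth_eq_of_ringEquiv e'] at h1
    have h2 := succ_le_depth_of_quotient ham' hreg' (n := n) (by exact_mod_cast h1)
    refine (ringKrullDim_le_quotient_add_one ham').trans ?_
    rw [← ringKrullDim_eq_of_ringEquiv e', hn]
    exact_mod_cast h2

lemma height_add_one_le_of_lt {A : Type*} [CommRing A] [IsNoetherianRing A] {p q : Ideal A}
    [p.IsPrime] [q.IsPrime] (h : p < q) : p.height + 1 ≤ q.height :=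
  Order.add_one_le_of_lt (Ideal.height_strict_mono_of_isPrime h)

/-- If `A` is regular in codimension `a`, then its singular points of codimension at most `a + 1`
are finitely many. -/
theorem finite_singular (k : Type u) [Field k] {A : Type u} [CommRing A] [Algebra k A]
    [Algebra.FiniteType k A] (a : ℕ) (hR : ∀ q : PrimeSpectrum A,
      ringKrullDim (Localization.AtPrime q.asIdeal) ≤ a →
        IsRegularLocalRing (Localization.AtPrime q.asIdeal)) :
    {q : PrimeSpectrum A | ringKrullDim (Localization.AtPrime q.asIdeal) ≤ (a + 1 : ℕ) ∧
      ¬ IsRegularLocalRing (Localization.AtPrime q.asIdeal)}.Finite := by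
  have : IsNoetherianRing A := Algebra.FiniteType.isNoetherianRing k A
  refine finite_of_generic _ fun p => ?_
  by_cases hp : IsRegularLocalRing (Localization.AtPrime p.asIdeal)
  · obtain ⟨s, hs⟩ := exists_ringKrullDim_eq_natCast (Localization.AtPrime p.asIdeal)
    obtain ⟨h, hh, hq⟩ := exists_generic_regular k s p.asIdeal hp hs
    exact ⟨h, hh, fun q hpq hhq hbad => hbad.2 (hq q.asIdeal hpq.le hhq)⟩
  -- If `p` is singular, no shrinking is needed: a bad `q` strictly above `p` would force height at
  -- most `a` on `p`, against `R_a`.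
  · refine ⟨1, p.asIdeal.primeCompl.one_mem, fun q hpq _ hbad => hp (hR p ?_)⟩
    have h1 := hbad.1
    rw [IsLocalization.AtPrime.ringKrullDim_eq_height q.asIdeal] at h1
    rw [IsLocalization.AtPrime.ringKrullDim_eq_height p.asIdeal]
    have h2 := (height_add_one_le_of_lt (p := p.asIdeal) (q := q.asIdeal) hpq).trans
      (show q.asIdeal.height ≤ (a + 1 : ℕ) by exact_mod_cast h1)
    rw [Nat.cast_add, Nat.cast_one] at h2
    exact_mod_cast (ENat.add_le_add_iff_right ENat.one_ne_top).mp h2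

/-- If `A` satisfies Serre's condition `S_b`, then `S_{b+1}` fails at finitely many points. -/
theorem finite_not_satisfiesS (k : Type u) [Field k] {A : Type u} [CommRing A] [Algebra k A]
    [Algebra.FiniteType k A] (b : ℕ) (hS : ∀ q : PrimeSpectrum A,
      min (b : WithBot ℕ∞) (ringKrullDim (Localization.AtPrime q.asIdeal)) ≤
        (depth (Localization.AtPrime q.asIdeal) : WithBot ℕ∞)) :
    {q : PrimeSpectrum A |
      ¬ min ((b + 1 : ℕ) : WithBot ℕ∞) (ringKrullDim (Localization.AtPrime q.asIdeal)) ≤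
        (depth (Localization.AtPrime q.asIdeal) : WithBot ℕ∞)}.Finite := by
  have : IsNoetherianRing A := Algebra.FiniteType.isNoetherianRing k A
  refine finite_of_generic _ fun p => ?_
  obtain ⟨s, hs⟩ := exists_ringKrullDim_eq_natCast (Localization.AtPrime p.asIdeal)
  rcases min_le_iff.mp (hS p) with hb | hd
  · obtain ⟨h, hh, hq⟩ := exists_generic_depth b p.asIdeal (by exact_mod_cast hb)
    refine ⟨h, hh, fun q hpq hhq hbad => hbad (min_le_of_left_le ?_)⟩
    exact_mod_cast hq q.asIdeal hpq hhq
  · obtain ⟨h, hh, hq⟩ := exists_generic_ringKrullDim_le_depth k s p.asIdeal hs.le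
      (by rw [hs] at hd; exact_mod_cast hd)
    exact ⟨h, hh, fun q hpq hhq hbad => hbad (min_le_of_right_le (hq q.asIdeal hpq.le hhq))⟩

end GenericCohenMacaulay
-- Serre's criteria for reduced and normal rings
section Serre

open IsLocalRing

lemma not_one_le_depth {R : Type*} [CommRing R] [IsLocalRing R] [IsNoetherianRing R] {x : R}
    (hx : x ≠ 0) (h : ∀ y ∈ maximalIdeal R, y * x = 0) : ¬ ((0 + 1 : ℕ) : ℕ∞) ≤ depth R := by
  intro hd
  obtain ⟨y, hy, hreg⟩ := exists_isSMulRegular_of_succ_le_depth hd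
  exact hx (hreg.right_eq_zero_of_smul (h y hy))

lemma ringKrullDim_le_of_min_le_depth {R : Type*} [CommRing R] [IsLocalRing R]
    [IsNoetherianRing R] {b : ℕ}
    (h : min ((b + 1 : ℕ) : WithBot ℕ∞) (ringKrullDim R) ≤ (depth R : WithBot ℕ∞))
    (hd : ¬ ((b + 1 : ℕ) : ℕ∞) ≤ depth R) : ringKrullDim R ≤ b := by
  obtain ⟨m, hm⟩ := exists_ringKrullDim_eq_natCast R
  rw [hm] at h ⊢
  by_contra hlt
  have : b + 1 ≤ m := by
    have : ¬ m ≤ b := fun h' => hlt (by exact_mod_cast h')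
    omega
  rw [min_eq_left (by exact_mod_cast this)] at h
  exact hd (by exact_mod_cast h)

/-- The annihilator of `a` lies in an associated prime `P`. Since `A_P` has depth zero, `S₁` gives
it dimension zero. So vanishing can be tested at primes of height zero. -/
lemma exists_prime_of_ne_zero {A : Type*} [CommRing A] [IsNoetherianRing A]
    (hS : ∀ (q : Ideal A) [q.IsPrime], min ((0 + 1 : ℕ) : WithBot ℕ∞)
      (ringKrullDim (Localization.AtPrime q)) ≤ (depth (Localization.AtPrime q) : WithBot ℕ∞))
    {a : A} (ha : a ≠ 0) : ∃ (P : Ideal A) (_ : P.IsPrime),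
      ringKrullDim (Localization.AtPrime P) ≤ (0 : ℕ) ∧ ∀ s, s * a = 0 → s ∈ P := by
  obtain ⟨P, hP, haP⟩ := exists_le_isAssociatedPrime_of_isNoetherianRing A a ha
  rw [isAssociatedPrime_iff] at hP
  obtain ⟨hP, x, hx⟩ := hP
  have hx' : ∀ s, s * x = 0 ↔ s ∈ P := fun s => by
    rw [hx, Submodule.mem_colon_singleton]; simp
  refine ⟨P, hP, ringKrullDim_le_of_min_le_depth (hS P) (not_one_le_depth
    (x := algebraMap A (Localization.AtPrime P) x) ?_ ?_), fun s hs => haP ?_⟩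
  · intro h0
    obtain ⟨⟨s, hs⟩, hs'⟩ := (IsLocalization.map_eq_zero_iff P.primeCompl _ _).mp h0
    exact hs ((hx' s).mp hs')
  · intro y hy
    obtain ⟨p, hp, w, hw⟩ := exists_mem_span_eq hy
    have h1 : algebraMap A (Localization.AtPrime P) p *
        algebraMap A (Localization.AtPrime P) x = 0 := by
      rw [← map_mul, (hx' p).mpr hp, map_zero]
    rw [← hw, mul_right_comm] at h1
    exact (w.isUnit.mul_left_eq_zero).mp h1
  · rw [Submodule.mem_colon_singleton]; simpa using hs

/-- The same argument in `A/(b)`: at an associated prime of `(b)` the quotient has depth zero, so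
`A_P` has depth at most one, and `S₂` gives height at most one. So membership in `(b)` can be tested
in codimension one. -/
lemma exists_prime_of_notMem_span {A : Type*} [CommRing A] [IsNoetherianRing A]
    (hS : ∀ (q : Ideal A) [q.IsPrime], min ((1 + 1 : ℕ) : WithBot ℕ∞)
      (ringKrullDim (Localization.AtPrime q)) ≤ (depth (Localization.AtPrime q) : WithBot ℕ∞))
    {a b : A} (hb : b ∈ nonZeroDivisors A) (ha : a ∉ Ideal.span {b}) :
    ∃ (P : Ideal A) (_ : P.IsPrime), ringKrullDim (Localization.AtPrime P) ≤ (1 : ℕ) ∧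
      ∀ s, s * a ∈ Ideal.span {b} → s ∈ P := by
  have ha' : Ideal.Quotient.mk (Ideal.span {b}) a ≠ 0 := by
    rwa [Ne, Ideal.Quotient.eq_zero_iff_mem]
  obtain ⟨P, hP, haP⟩ := exists_le_isAssociatedPrime_of_isNoetherianRing A _ ha'
  rw [isAssociatedPrime_iff] at hP
  obtain ⟨hP, x, hx⟩ := hP
  obtain ⟨x, rfl⟩ := Ideal.Quotient.mk_surjective x
  have key : ∀ s x : A, s ∈ (⊥ : Submodule A (A ⧸ Ideal.span {b})).colon
      {Ideal.Quotient.mk (Ideal.span {b}) x} ↔ s * x ∈ Ideal.span {b} := fun s x => by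
    rw [Submodule.mem_colon_singleton, Submodule.mem_bot, ← Ideal.Quotient.eq_zero_iff_mem]
    rfl
  have hx' : ∀ s, s * x ∈ Ideal.span {b} ↔ s ∈ P := fun s => by rw [hx, key]
  have hbP : b ∈ P := (hx' b).mp (Ideal.mul_mem_right _ _ (Ideal.mem_span_singleton_self b))
  refine ⟨P, hP, ringKrullDim_le_of_min_le_depth (hS P) fun hd => ?_,
    fun s hs => haP ((key s a).mpr hs)⟩
  set L := Localization.AtPrime P
  have hbL : algebraMap A L b ∈ maximalIdeal L :=
    (IsLocalization.AtPrime.to_map_mem_maximal_iff L P b).mpr hbP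
  have hreg : IsSMulRegular L (algebraMap A L b) := by
    have := IsLocalization.map_nonZeroDivisors_le P.primeCompl L
      (Submonoid.mem_map_of_mem (algebraMap A L) hb)
    exact isSMulRegular_iff_right_eq_zero_of_smul.mpr fun z hz =>
      (mem_nonZeroDivisors_iff.mp this).1 z hz
  have : Nontrivial (L ⧸ Ideal.span {algebraMap A L b}) :=
    nontrivial_quotient_span_singleton hbL
  have hd1 := le_depth_quotient hbL hreg hd
  refine not_one_le_depth (x := Ideal.Quotient.mk _ (algebraMap A L x)) ?_ ?_ hd1
  · rw [Ne, Ideal.Quotient.eq_zero_iff_mem, ← Set.image_singleton, ← Ideal.map_span,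
      IsLocalization.algebraMap_mem_map_algebraMap_iff P.primeCompl]
    rintro ⟨s, hs, hs'⟩
    exact hs ((hx' s).mp hs')
  · intro y hy
    rw [maximalIdeal_quotient] at hy
    obtain ⟨y, hy', rfl⟩ := (Ideal.mem_map_iff_of_surjective _ Ideal.Quotient.mk_surjective).mp hy
    obtain ⟨p, hp, w, hw⟩ := exists_mem_span_eq (p := P) hy'
    rw [← map_mul, Ideal.Quotient.eq_zero_iff_mem]
    have h1 : algebraMap A L p * algebraMap A L x ∈ Ideal.span {algebraMap A L b} := by
      rw [← map_mul, ← Set.image_singleton, ← Ideal.map_span]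
      exact Ideal.mem_map_of_mem _ ((hx' p).mpr hp)
    rw [← hw, mul_right_comm] at h1
    exact (Ideal.unit_mul_mem_iff_mem _ w.isUnit).mp (by rwa [mul_comm] at h1)

lemma isField_of_isRegularLocalRing {R : Type*} [CommRing R] [IsRegularLocalRing R]
    (h : ringKrullDim R ≤ (0 : ℕ)) : IsField R := by
  have := isDomain_of_isRegularLocalRing R
  rw [isField_iff_maximalIdeal_eq]
  have h1 := (isRegularLocalRing_iff R).mp inferInstance
  rw [← h1] at h
  have h2 : (maximalIdeal R).spanFinrank = 0 := by
    have : (maximalIdeal R).spanFinrank ≤ 0 := by exact_mod_cast h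
    omega
  exact (Submodule.spanFinrank_eq_zero_iff_eq_bot (IsNoetherian.noetherian _)).mp h2

lemma isIntegrallyClosed_of_isRegularLocalRing {R : Type*} [CommRing R] [IsRegularLocalRing R]
    [IsDomain R] (h : ringKrullDim R ≤ (1 : ℕ)) : IsIntegrallyClosed R := by
  have h1 := (IsRegularLocalRing.iff_finrank_cotangentSpace R).mp inferInstance
  rw [← h1] at h
  have h2 : Module.finrank (ResidueField R) (CotangentSpace R) ≤ 1 := by exact_mod_cast h
  have h3 : _ ↔ (IsIntegrallyClosed R ∧ _) :=
    (tfae_of_isNoetherianRing_of_isLocalRing_of_isDomain R).out 5 3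
  exact (h3.mp h2).1

/-- A Noetherian ring satisfying `R₀` and `S₁` is reduced. -/
theorem isReduced_of_R0_S1 {A : Type*} [CommRing A] [IsNoetherianRing A]
    (hR : ∀ (q : Ideal A) [q.IsPrime], ringKrullDim (Localization.AtPrime q) ≤ (0 : ℕ) →
      IsRegularLocalRing (Localization.AtPrime q))
    (hS : ∀ (q : Ideal A) [q.IsPrime], min ((0 + 1 : ℕ) : WithBot ℕ∞)
      (ringKrullDim (Localization.AtPrime q)) ≤ (depth (Localization.AtPrime q) : WithBot ℕ∞)) :
    IsReduced A := by
  refine ⟨fun a ha => ?_⟩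
  by_contra ha0
  obtain ⟨P, hP, hdim, hP'⟩ := exists_prime_of_ne_zero hS ha0
  have := hR P hdim
  have := isDomain_of_isRegularLocalRing (Localization.AtPrime P)
  have h0 := (ha.map (algebraMap A (Localization.AtPrime P))).eq_zero
  obtain ⟨⟨s, hs⟩, hs'⟩ := (IsLocalization.map_eq_zero_iff P.primeCompl _ _).mp h0
  exact hs (hP' s hs')

lemma min_le_min_of_le {x d : WithBot ℕ∞} {a b : ℕ} (h : a ≤ b)
    (h1 : min (b : WithBot ℕ∞) d ≤ x) : min (a : WithBot ℕ∞) d ≤ x :=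
  (min_le_min_right _ (by exact_mod_cast h)).trans h1

/-- A Noetherian local ring satisfying `R₁` and `S₂` is a domain. -/
theorem isDomain_of_R1_S2 {A : Type*} [CommRing A] [IsNoetherianRing A] [IsLocalRing A]
    (hR : ∀ (q : Ideal A) [q.IsPrime], ringKrullDim (Localization.AtPrime q) ≤ (1 : ℕ) →
      IsRegularLocalRing (Localization.AtPrime q))
    (hS : ∀ (q : Ideal A) [q.IsPrime], min ((1 + 1 : ℕ) : WithBot ℕ∞)
      (ringKrullDim (Localization.AtPrime q)) ≤ (depth (Localization.AtPrime q) : WithBot ℕ∞)) :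
    IsDomain A := by
  have hR0 : ∀ (q : Ideal A) [q.IsPrime], ringKrullDim (Localization.AtPrime q) ≤ (0 : ℕ) →
      IsRegularLocalRing (Localization.AtPrime q) :=
    fun q _ h => hR q (h.trans (by exact_mod_cast Nat.zero_le 1))
  have hS1 : ∀ (q : Ideal A) [q.IsPrime], min ((0 + 1 : ℕ) : WithBot ℕ∞)
      (ringKrullDim (Localization.AtPrime q)) ≤ (depth (Localization.AtPrime q) : WithBot ℕ∞) :=
    fun q _ => min_le_min_of_le (by omega) (hS q)
  have hred := isReduced_of_R0_S1 hR0 hS1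
  suffices NoZeroDivisors A from NoZeroDivisors.to_isDomain A
  refine ⟨fun {s t} hst => ?_⟩
  by_contra! hne
  obtain ⟨hs, ht⟩ := hne
  let I : Ideal A := LinearMap.ker (LinearMap.mulLeft A s)
  let J : Ideal A := Module.annihilator A I
  have hI : ∀ i, i ∈ I ↔ s * i = 0 := fun i => by simp [I]
  have hJ : ∀ j ∈ J, ∀ i ∈ I, j * i = 0 := fun j hj i hi => by
    have := Module.mem_annihilator.mp hj ⟨i, hi⟩
    exact congrArg Subtype.val this
  have hsJ : s ∈ J := Module.mem_annihilator.mpr fun i => Subtype.ext ((hI _).mp i.2)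
  -- Otherwise `I + J` would lie in a prime of height zero. The local ring there is a field in which
  -- `s` vanishes, so some element outside the prime kills `s`, hence belongs to `I`.
  have hnzd : ∃ b ∈ I ⊔ J, b ∈ nonZeroDivisors A := by
    by_contra! hcon
    obtain ⟨P, hPA, hP⟩ : ∃ P ∈ associatedPrimes A A, I ⊔ J ≤ P :=
      ((I ⊔ J).subset_union_prime_finite (associatedPrimes.finite A A) (f := id) 0 0
        fun _ h _ _ ↦ h.1).1 <| by
        intro z hz
        have : z ∈ ⋃ p ∈ associatedPrimes A A, (p : Set A) := by
          rw [biUnion_associatedPrimes_eq_compl_nonZeroDivisors]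
          exact hcon z hz
        simpa using this
    have hPp := hPA.isPrime
    obtain ⟨-, x, hx⟩ := isAssociatedPrime_iff.mp hPA
    have hx0 : x ≠ 0 := by
      rintro rfl
      exact hPp.ne_top (by rw [hx]; ext; simp [Submodule.mem_colon_singleton])
    obtain ⟨P', hP', hdim, hxP'⟩ := exists_prime_of_ne_zero hS1 hx0
    have hPP' : P ≤ P' := fun z hz => hxP' z (by
      rw [hx, Submodule.mem_colon_singleton] at hz; simpa using hz)
    have := hR0 P' hdim
    have hf := isField_of_isRegularLocalRing hdim
    let := hf.toField
    have hs0 : algebraMap A (Localization.AtPrime P') s = 0 := by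
      by_contra h0
      have hu : IsUnit (algebraMap A (Localization.AtPrime P') s) := Ne.isUnit h0
      exact ((IsLocalization.AtPrime.isUnit_to_map_iff _ P' s).mp hu)
        (hPP' (hP (Ideal.mem_sup_right hsJ)))
    obtain ⟨⟨w, hw⟩, hw'⟩ := (IsLocalization.map_eq_zero_iff P'.primeCompl _ _).mp hs0
    exact hw (hPP' (hP (Ideal.mem_sup_left ((hI w).mpr (by rw [mul_comm]; exact hw')))))
  obtain ⟨b, hbIJ, hb⟩ := hnzd
  obtain ⟨i, hi, j, hj, rfl⟩ := Submodule.mem_sup.mp hbIJ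
  have hji := hJ j hj i hi
  -- Because `i j = 0`, the fraction `i / (i + j)` is idempotent. It belongs to `A`: in codimension
  -- one the local rings are domains, so `i` or `j` vanishes there.
  have hmem : i ∈ Ideal.span {i + j} := by
    by_contra hcon
    obtain ⟨P, hP, hdim, hP'⟩ := exists_prime_of_notMem_span hS hb hcon
    have := hR P hdim
    have := isDomain_of_isRegularLocalRing (Localization.AtPrime P)
    have h0 : algebraMap A (Localization.AtPrime P) j *
      algebraMap A (Localization.AtPrime P) i = 0 := by rw [← map_mul, hji, map_zero]
    rcases mul_eq_zero.mp h0 with h0 | h0 <;>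
    obtain ⟨⟨w, hw⟩, hw'⟩ := (IsLocalization.map_eq_zero_iff P.primeCompl _ _).mp h0 <;>
    simp only at hw'
    · refine hw (hP' w (Ideal.mem_span_singleton.mpr ⟨w, ?_⟩))
      linear_combination -hw'
    · exact hw (hP' w (by rw [hw']; exact zero_mem _))
  obtain ⟨e, he⟩ := Ideal.mem_span_singleton.mp hmem
  have hcancel : ∀ z, (i + j) * z = 0 → z = 0 := fun z hz =>
    (mem_nonZeroDivisors_iff.mp hb).1 z hz
  have hidem : e * (1 - e) = 0 := by
    apply hcancel; apply hcancel
    linear_combination (i + (i + j) * e - (i + j)) * he + hji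
  -- In a local ring the idempotent is `0` or `1`; the nonzerodivisor `i + j` then equals `j` or
  -- `i`, and it kills `t` or `s` respectively.
  rcases IsLocalRing.isUnit_or_isUnit_one_sub_self e with hu | hu
  · have he1 : 1 - e = 0 := (hu.mul_right_eq_zero).mp hidem
    have he2 : e = 1 := by linear_combination -he1
    have hj0 : j = 0 := by rw [he2] at he; linear_combination -he
    exact hs (hcancel s (by rw [hj0, add_zero, mul_comm]; exact (hI i).mp hi))
  · have he0 : e = 0 := (hu.mul_left_eq_zero).mp hidem
    have hi0 : i = 0 := by rw [he, he0, mul_zero]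
    exact ht (hcancel t (by rw [hi0, zero_add]; exact hJ j hj t ((hI t).mpr hst)))

/-- A Noetherian domain satisfying `R₁` and `S₂` is integrally closed. -/
theorem isIntegrallyClosed_of_R1_S2 {A : Type*} [CommRing A] [IsNoetherianRing A] [IsDomain A]
    (hR : ∀ (q : Ideal A) [q.IsPrime], ringKrullDim (Localization.AtPrime q) ≤ (1 : ℕ) →
      IsRegularLocalRing (Localization.AtPrime q))
    (hS : ∀ (q : Ideal A) [q.IsPrime], min ((1 + 1 : ℕ) : WithBot ℕ∞)
      (ringKrullDim (Localization.AtPrime q)) ≤ (depth (Localization.AtPrime q) : WithBot ℕ∞)) :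
    IsIntegrallyClosed A := by
  rw [isIntegrallyClosed_iff (FractionRing A)]
  intro x hx
  obtain ⟨a, b, hb, rfl⟩ := IsFractionRing.div_surjective (A := A) x
  have hb0 : algebraMap A (FractionRing A) b ≠ 0 :=
    IsFractionRing.to_map_ne_zero_of_mem_nonZeroDivisors hb
  -- Membership is tested at primes of height at most one, whose local rings are regular and hence
  -- integrally closed.
  have hmem : a ∈ Ideal.span {b} := by
    by_contra hcon
    obtain ⟨P, hP, hdim, hP'⟩ := exists_prime_of_notMem_span hS hb hcon
    have := hR P hdim
    have hic := isIntegrallyClosed_of_isRegularLocalRing hdim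
    let : Algebra (Localization.AtPrime P) (FractionRing A) :=
      (IsLocalization.lift (M := P.primeCompl) (g := algebraMap A (FractionRing A))
        (fun y => (Ne.isUnit (by
          rw [Ne, FaithfulSMul.algebraMap_eq_zero_iff]
          rintro h0
          exact y.2 (h0 ▸ P.zero_mem))))).toAlgebra
    have : IsScalarTower A (Localization.AtPrime P) (FractionRing A) :=
      IsScalarTower.of_algebraMap_eq fun y => (IsLocalization.lift_eq _ y).symm
    have : IsFractionRing (Localization.AtPrime P) (FractionRing A) :=
      IsFractionRing.isFractionRing_of_isDomain_of_isLocalization P.primeCompl _ _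
    obtain ⟨y, hy⟩ := (isIntegrallyClosed_iff (FractionRing A)).mp
      hic (hx.tower_top (A := Localization.AtPrime P))
    obtain ⟨⟨c, s⟩, hc⟩ := IsLocalization.surj P.primeCompl y
    have hc' := congrArg (algebraMap _ (FractionRing A)) hc
    rw [map_mul, hy, ← IsScalarTower.algebraMap_apply, ← IsScalarTower.algebraMap_apply] at hc'
    refine s.2 (hP' _ (Ideal.mem_span_singleton.mpr ⟨c, ?_⟩))
    apply IsFractionRing.injective A (FractionRing A)
    rw [map_mul, map_mul, ← hc']
    field_simp
  obtain ⟨c, rfl⟩ := Ideal.mem_span_singleton.mp hmem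
  exact ⟨c, by rw [map_mul]; field_simp⟩

lemma one_le_depth_of_notMem_associatedPrimes {R : Type*} [CommRing R] [IsLocalRing R]
    [IsNoetherianRing R] (h : maximalIdeal R ∉ associatedPrimes R R) :
    ((1 : ℕ) : ℕ∞) ≤ depth R := by
  obtain ⟨y, hy, hreg⟩ : ∃ y ∈ maximalIdeal R, y ∈ nonZeroDivisors R := by
    by_contra! hcon
    obtain ⟨P, hPA, hP⟩ : ∃ P ∈ associatedPrimes R R, maximalIdeal R ≤ P :=
      ((maximalIdeal R).subset_union_prime_finite (associatedPrimes.finite R R) (f := id) 0 0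
        fun _ h _ _ ↦ h.1).1 <| by
        intro z hz
        have : z ∈ ⋃ p ∈ associatedPrimes R R, (p : Set R) := by
          rw [biUnion_associatedPrimes_eq_compl_nonZeroDivisors]
          exact hcon z hz
        simpa using this
    exact h ((IsLocalRing.eq_maximalIdeal ((maximalIdeal.isMaximal R).eq_of_le
      hPA.isPrime.ne_top hP ▸ maximalIdeal.isMaximal R)) ▸ hPA)
  have hreg' : IsSMulRegular R y := isSMulRegular_iff_right_eq_zero_of_smul.mpr
    fun z hz => (mem_nonZeroDivisors_iff.mp hreg).1 z hz
  have := le_depth_of_isWeaklyRegular [y] (by simpa using hy)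
    (by simpa [RingTheory.Sequence.isWeaklyRegular_cons_iff] using hreg')
  exact_mod_cast this

/-- A reduced Noetherian local ring satisfies `S₁`. -/
theorem min_one_le_depth_of_isReduced {R : Type*} [CommRing R] [IsLocalRing R]
    [IsNoetherianRing R] [IsReduced R] :
    min ((1 : ℕ) : WithBot ℕ∞) (ringKrullDim R) ≤ (depth R : WithBot ℕ∞) := by
  by_cases h : maximalIdeal R ∈ associatedPrimes R R
  -- If `𝔪` is the annihilator of `x`, then `x ∈ 𝔪` would give `x² = 0`; so `x` is a unit and the
  -- ring is a field.
  · obtain ⟨-, x, hx⟩ := isAssociatedPrime_iff.mp h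
    have hx' : ∀ s, s * x = 0 ↔ s ∈ maximalIdeal R := fun s => by
      rw [hx, Submodule.mem_colon_singleton]; simp
    have hx0 : x ∉ maximalIdeal R := by
      intro hxm
      have : x = 0 := by
        have := (hx' x).mpr hxm
        exact (show IsNilpotent x from ⟨2, by rw [pow_two, this]⟩).eq_zero
      rw [this] at hx'
      exact (maximalIdeal.isMaximal R).ne_top ((Ideal.eq_top_iff_one _).mpr ((hx' 1).mp (by simp)))
    have hf : IsField R := by
      rw [isField_iff_maximalIdeal_eq, eq_bot_iff]
      intro s hs
      exact ((notMem_maximalIdeal.mp hx0).mul_left_eq_zero).mp ((hx' s).mpr hs)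
    rw [ringKrullDim_eq_zero_of_isField hf]
    exact (min_le_right _ _).trans (by exact_mod_cast bot_le)
  · refine (min_le_left _ _).trans ?_
    exact_mod_cast one_le_depth_of_notMem_associatedPrimes h

lemma isField_of_isReduced {R : Type*} [CommRing R] [IsLocalRing R] [IsReduced R]
    (h : ringKrullDim R ≤ (0 : ℕ)) : IsField R := by
  have : Ring.KrullDimLE 0 R := by
    rw [Ring.krullDimLE_iff]; exact h
  rw [isField_iff_maximalIdeal_eq, eq_bot_iff]
  intro x hx
  exact ((Ring.KrullDimLE.isNilpotent_iff_mem_maximalIdeal).mpr hx).eq_zero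

lemma isRegularLocalRing_of_isField {R : Type*} [CommRing R] (h : IsField R) :
    IsRegularLocalRing R := by
  let := h.toField
  infer_instance

lemma isRegularLocalRing_of_maximalIdeal_isPrincipal {R : Type*} [CommRing R] [IsLocalRing R]
    [IsNoetherianRing R] [IsDomain R] (h : (maximalIdeal R).IsPrincipal) :
    IsRegularLocalRing R ∧ ringKrullDim R ≤ (1 : ℕ) := by
  have h3 : _ ↔ IsPrincipalIdealRing R :=
    (tfae_of_isNoetherianRing_of_isLocalRing_of_isDomain R).out 4 0
  have := h3.mp h
  exact ⟨inferInstance, Ring.krullDimLE_iff.mp inferInstance⟩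

/-- A Noetherian integrally closed local domain satisfies `R₁`. -/
theorem isRegularLocalRing_of_isIntegrallyClosed {R : Type*} [CommRing R] [IsLocalRing R]
    [IsNoetherianRing R] [IsDomain R] (hR : IsIntegrallyClosed R)
    (h : ringKrullDim R ≤ (1 : ℕ)) : IsRegularLocalRing R := by
  have h1 : Ring.KrullDimLE 1 R := Ring.krullDimLE_iff.mpr h
  have h3 : _ ↔ (maximalIdeal R).IsPrincipal :=
    (tfae_of_isNoetherianRing_of_isLocalRing_of_isDomain R).out 3 4
  exact (isRegularLocalRing_of_maximalIdeal_isPrincipal (h3.mp ⟨hR, fun P hP hP' =>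
    eq_maximalIdeal (Ring.krullDimLE_one_iff_of_noZeroDivisors.mp h1 P hP hP')⟩)).1

/-- A Noetherian integrally closed local domain satisfies `S₂`. -/
theorem min_two_le_depth_of_isIntegrallyClosed {R : Type*} [CommRing R] [IsLocalRing R]
    [IsNoetherianRing R] [IsDomain R] (hR : IsIntegrallyClosed R) :
    min ((2 : ℕ) : WithBot ℕ∞) (ringKrullDim R) ≤ (depth R : WithBot ℕ∞) := by
  by_cases hdim : ringKrullDim R ≤ (1 : ℕ)
  · have := isRegularLocalRing_of_isIntegrallyClosed hR hdim
    exact (min_le_right _ _).trans (ringKrullDim_le_depth_of_isRegularLocalRing R)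
  refine (min_le_left _ _).trans ?_
  obtain ⟨x, hx, hx0⟩ : ∃ x ∈ maximalIdeal R, x ≠ 0 := by
    by_contra! hcon
    have hf := isField_iff_maximalIdeal_eq.mpr ((eq_bot_iff).mpr hcon)
    rw [ringKrullDim_eq_zero_of_isField hf] at hdim
    exact hdim (by exact_mod_cast Nat.zero_le 1)
  have : Nontrivial (R ⧸ Ideal.span {x}) := nontrivial_quotient_span_singleton hx
  have hreg : IsSMulRegular R x := isSMulRegular_iff_right_eq_zero_of_smul.mpr
    fun z hz => (mul_eq_zero.mp hz).resolve_left hx0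
  suffices h : maximalIdeal (R ⧸ Ideal.span {x}) ∉
      associatedPrimes (R ⧸ Ideal.span {x}) (R ⧸ Ideal.span {x}) by
    have h2 : ((2 : ℕ) : ℕ∞) ≤ depth R :=
      succ_le_depth_of_quotient hx hreg (one_le_depth_of_notMem_associatedPrimes h)
    exact WithBot.coe_le_coe.mpr h2
  intro hass
  obtain ⟨-, y, hy⟩ := isAssociatedPrime_iff.mp hass
  obtain ⟨y, rfl⟩ := Ideal.Quotient.mk_surjective y
  have hmy : ∀ s ∈ maximalIdeal R, x ∣ s * y := fun s hs => by
    rw [← Ideal.mem_span_singleton, ← Ideal.Quotient.eq_zero_iff_mem, map_mul]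
    have : Ideal.Quotient.mk (Ideal.span {x}) s ∈ maximalIdeal (R ⧸ Ideal.span {x}) := by
      rw [maximalIdeal_quotient]; exact Ideal.mem_map_of_mem _ hs
    rw [hy, Submodule.mem_colon_singleton] at this
    simpa using this
  have hyx : ¬ x ∣ y := fun hd => by
    rw [← Ideal.mem_span_singleton, ← Ideal.Quotient.eq_zero_iff_mem] at hd
    rw [hd] at hy
    refine (maximalIdeal.isMaximal (R ⧸ Ideal.span {x})).ne_top ?_
    rw [hy]; ext; simp [Submodule.mem_colon_singleton]
  choose! u hu using hmy
  -- The fraction `y / x` multiplies `𝔪` into `R`, by `s ↦ u s`. If it hits a unit, `𝔪` is principal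
  -- and the dimension is at most one. Otherwise it preserves `𝔪`, is integral, and lies in `R`, so
  -- that `x` divides `y`.
  by_cases hunit : ∃ s ∈ maximalIdeal R, IsUnit (u s)
  · obtain ⟨s, hs, hus⟩ := hunit
    refine hdim (isRegularLocalRing_of_maximalIdeal_isPrincipal ⟨s, le_antisymm ?_ ?_⟩).2
    · intro t ht
      refine Ideal.mem_span_singleton.mpr ?_
      rw [← hus.dvd_mul_right]
      refine ⟨u t, mul_left_cancel₀ hx0 ?_⟩
      linear_combination s * hu t ht - t * hu s hs
    · exact (Ideal.span_singleton_le_iff_mem _).mpr hs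
  · push Not at hunit
    let K := FractionRing R
    have hxK : algebraMap R K x ≠ 0 := by rwa [Ne, FaithfulSMul.algebraMap_eq_zero_iff]
    have hint : IsIntegral R (algebraMap R K y / algebraMap R K x) := by
      refine isIntegral_of_smul_mem_submodule
        (Submodule.map (Algebra.linearMap R K) (maximalIdeal R)) ?_ ?_ _ ?_
      · rw [Submodule.ne_bot_iff]
        exact ⟨_, ⟨x, hx, rfl⟩, hxK⟩
      · exact Submodule.FG.map _ (IsNoetherian.noetherian _)
      · rintro _ ⟨s, hs, rfl⟩
        refine ⟨u s, (mem_maximalIdeal _).mpr (hunit s hs), ?_⟩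
        have := congrArg (algebraMap R K) (hu s hs)
        rw [map_mul, map_mul] at this
        simp only [Algebra.linearMap_apply, smul_eq_mul]
        rw [div_mul_eq_mul_div, eq_div_iff hxK]
        linear_combination -this
    obtain ⟨z, hz⟩ := (isIntegrallyClosed_iff K).mp hR hint
    refine hyx ⟨z, IsFractionRing.injective R K ?_⟩
    rw [map_mul, hz, mul_comm, div_mul_cancel₀ _ hxK]

end Serre
-- Generic vectors and open subsets of linear systems
section Generic

open MvPolynomial

lemma eval_smul_of_isHomogeneous {σ : Type*} {k : Type*} [CommRing k] {Q : MvPolynomial σ k}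
    {e : ℕ} (hQ : Q.IsHomogeneous e) (t : k) (c : σ → k) :
    eval (t • c) Q = t ^ e * eval c Q := by
  rw [eval_eq, eval_eq, Finset.mul_sum]
  refine Finset.sum_congr rfl fun d hd => ?_
  have h1 : d.degree = e := by
    by_contra h
    exact (mem_support_iff.mp hd) (hQ.coeff_eq_zero h)
  have h2 : ∏ i ∈ d.support, t ^ d i = t ^ e := by
    rw [Finset.prod_pow_eq_pow_sum, ← h1]; rfl
  simp only [Pi.smul_apply, smul_eq_mul, mul_pow, Finset.prod_mul_distrib, h2]
  ring

/-- As a polynomial in `t`, the value `P(t c)` has the `e`-th homogeneous component at `c` as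
coefficient of `t^e`. This allows inhomogeneous polynomial conditions on projective points. -/
lemma exists_eval_smul_ne_zero {σ : Type*} {k : Type*} [Field k] [Infinite k]
    {P : MvPolynomial σ k} {e : ℕ} {c : σ → k} (h : eval c (homogeneousComponent e P) ≠ 0) :
    ∃ t : k, t ≠ 0 ∧ eval (t • c) P ≠ 0 := by
  let F : Polynomial k := ∑ i ∈ Finset.range (P.totalDegree + 1),
    Polynomial.monomial i (eval c (homogeneousComponent i P))
  have hF : ∀ t, F.eval t = eval (t • c) P := fun t => by
    conv_rhs => rw [← P.sum_homogeneousComponent]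
    rw [map_sum, Polynomial.eval_finsetSum]
    refine Finset.sum_congr rfl fun i _ => ?_
    rw [Polynomial.eval_monomial, eval_smul_of_isHomogeneous (homogeneousComponent_isHomogeneous i P),
      mul_comm]
  have hF0 : F ≠ 0 := by
    intro h0
    have := congrArg (fun G => Polynomial.coeff G e) h0
    simp only [F, Polynomial.finsetSum_coeff, Polynomial.coeff_monomial, Polynomial.coeff_zero,
      Finset.sum_ite_eq', Finset.mem_range] at this
    rw [if_pos] at this
    · exact h this
    · by_contra hlt
      rw [homogeneousComponent_eq_zero _ _ (by omega), map_zero] at h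
      exact h rfl
  by_contra! hcon
  refine hF0 ?_
  have : Polynomial.X * F = 0 := Polynomial.funext fun t => by
    rw [Polynomial.eval_mul, Polynomial.eval_X, Polynomial.eval_zero, hF]
    by_cases ht : t = 0
    · rw [ht, zero_mul]
    · rw [hcon t ht, mul_zero]
  exact (mul_eq_zero.mp this).resolve_left Polynomial.X_ne_zero

lemma mem_basicOpen_rationalPoint {ι : Type v} {k : Type u} [Field k] {c : ι → k} (hc : c ≠ 0)
    {Q : MvPolynomial ι k} {e : ℕ} (hQ : Q.IsHomogeneous e) :
    rationalPoint c hc ∈ Proj.basicOpen (MvPolynomial.homogeneousSubmodule ι k) Q ↔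
      eval c Q ≠ 0 := by
  rw [Proj.mem_basicOpen]
  refine not_congr ?_
  have : Q ∈ (rationalPoint c hc).asHomogeneousIdeal ↔
    Q ∈ (RingHom.ker (MvPolynomial.eval c)).homogeneousCore
      (MvPolynomial.homogeneousSubmodule ι k) := Iff.rfl
  rw [this]
  constructor
  · exact fun h => Ideal.toIdeal_homogeneousCore_le _ _ h
  · intro h
    exact Ideal.mem_homogeneousCore_of_homogeneous_of_mem ⟨e, hQ⟩ h

/-- A nonzero form of positive degree in infinitely many points defines a nonempty dense open
subset of projective space. -/
lemma nonempty_and_dense_basicOpen {ι : Type v} {k : Type u} [Field k] [Infinite k]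
    {Q : MvPolynomial ι k} {e : ℕ} (hQ : Q.IsHomogeneous e) (he : 0 < e) (hQ0 : Q ≠ 0) :
    (Proj.basicOpen (MvPolynomial.homogeneousSubmodule ι k) Q : Set (projSpace ι k)).Nonempty ∧
      Dense (Proj.basicOpen (MvPolynomial.homogeneousSubmodule ι k) Q :
        Set (projSpace ι k)) := by
  have key : ∀ {R : MvPolynomial ι k} {i : ℕ}, R.IsHomogeneous i → R ≠ 0 →
      ∃ c, ∃ hc : c ≠ 0, rationalPoint c hc ∈
        Proj.basicOpen (MvPolynomial.homogeneousSubmodule ι k) R ∧ rationalPoint c hc ∈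
        Proj.basicOpen (MvPolynomial.homogeneousSubmodule ι k) Q := fun {R i} hR hR0 => by
    obtain ⟨c, hc⟩ : ∃ c, eval c (R * Q) ≠ 0 := by
      by_contra! h
      exact mul_ne_zero hR0 hQ0 (MvPolynomial.funext fun x => by rw [h x, map_zero])
    rw [map_mul] at hc
    have hc0 : c ≠ 0 := by
      rintro rfl
      have := eval_smul_of_isHomogeneous hQ 0 (0 : ι → k)
      rw [zero_smul, zero_pow he.ne', zero_mul] at this
      exact (right_ne_zero_of_mul hc) this
    exact ⟨c, hc0, (mem_basicOpen_rationalPoint hc0 hR).mpr (left_ne_zero_of_mul hc),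
      (mem_basicOpen_rationalPoint hc0 hQ).mpr (right_ne_zero_of_mul hc)⟩
  constructor
  · obtain ⟨c, hc, -, h⟩ := key hQ hQ0
    exact ⟨_, h⟩
  · rw [dense_iff_inter_open]
    rintro V hV ⟨x, hx⟩
    obtain ⟨_, ⟨_, ⟨R, rfl⟩, rfl⟩, hxR, hRV⟩ := (Proj.isBasis_basicOpen
      (MvPolynomial.homogeneousSubmodule ι k)).exists_subset_of_mem_open hx hV
    rw [SetLike.mem_coe, Proj.basicOpen_eq_iSup_proj, TopologicalSpace.Opens.mem_iSup] at hxR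
    obtain ⟨i, hi⟩ := hxR
    have hsub : Proj.basicOpen (MvPolynomial.homogeneousSubmodule ι k)
        (GradedRing.proj (MvPolynomial.homogeneousSubmodule ι k) i R) ≤
        Proj.basicOpen (MvPolynomial.homogeneousSubmodule ι k) R := by
      rw [Proj.basicOpen_eq_iSup_proj _ R]
      exact le_iSup (fun i => Proj.basicOpen (MvPolynomial.homogeneousSubmodule ι k)
        (GradedRing.proj (MvPolynomial.homogeneousSubmodule ι k) i R)) i
    have hhom : (GradedRing.proj (MvPolynomial.homogeneousSubmodule ι k) i R).IsHomogeneous i := by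
      rw [GradedRing.proj_apply]
      exact (DirectSum.decompose (MvPolynomial.homogeneousSubmodule ι k) R i).2
    obtain ⟨c, hc, h1, h2⟩ := key hhom (by
      intro h0
      rw [h0, Proj.basicOpen_zero] at hi
      exact hi)
    exact ⟨_, hRV (hsub h1), h2⟩

/-- The polynomial functions on a vector space. -/
def polyFun (k : Type*) (V : Type*) [Field k] [AddCommGroup V] [Module k V] :
    Subalgebra k (V → k) :=
  Algebra.adjoin k (Set.range fun φ : V →ₗ[k] k => (φ : V → k))

lemma linearMap_mem_polyFun {k : Type*} {V : Type*} [Field k] [AddCommGroup V] [Module k V]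
    (φ : V →ₗ[k] k) : (φ : V → k) ∈ polyFun k V :=
  Algebra.subset_adjoin ⟨φ, rfl⟩

/-- A set of vectors that contains the complement of the zeros of a nonzero polynomial function. -/
def IsGeneric (k : Type*) {V : Type*} [Field k] [AddCommGroup V] [Module k V] (S : Set V) : Prop :=
  ∃ g ∈ polyFun k V, g ≠ 0 ∧ ∀ v, g v ≠ 0 → v ∈ S

section

variable {k : Type*} {V : Type*} [Field k] [AddCommGroup V] [Module k V]

lemma exists_mvPolynomial_of_mem_polyFun [Module.Finite k V] {ι : Type*} (b : Module.Basis ι k V)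
    {g : V → k} (hg : g ∈ polyFun k V) :
    ∃ P : MvPolynomial ι k, ∀ v, g v = eval (fun i => b.repr v i) P := by
  have hfin : Finite ι := Module.Finite.finite_basis b
  have := Fintype.ofFinite ι
  induction hg using Algebra.adjoin_induction with
  | mem x hx =>
    obtain ⟨φ, rfl⟩ := hx
    refine ⟨∑ i, C (φ (b i)) * X i, fun v => ?_⟩
    have := congrArg φ (b.sum_repr v)
    rw [map_sum] at this
    simp only [← this]
    simp [map_sum, mul_comm]
  | algebraMap r => exact ⟨C r, fun v => by simp⟩
  | add x y _ _ hx hy =>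
    obtain ⟨P, hP⟩ := hx
    obtain ⟨Q, hQ⟩ := hy
    exact ⟨P + Q, fun v => by simp [hP, hQ]⟩
  | mul x y _ _ hx hy =>
    obtain ⟨P, hP⟩ := hx
    obtain ⟨Q, hQ⟩ := hy
    exact ⟨P * Q, fun v => by simp [hP, hQ]⟩

lemma eval_repr_mem_polyFun {ι : Type*} (b : Module.Basis ι k V) (P : MvPolynomial ι k) :
    (fun v => eval (fun i => b.repr v i) P) ∈ polyFun k V := by
  induction P using MvPolynomial.induction_on with
  | C a =>
    convert (polyFun k V).algebraMap_mem a using 1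
    ext; simp
  | add p q hp hq =>
    convert add_mem hp hq using 1
    ext; simp
  | mul_X p i hp =>
    convert mul_mem hp (linearMap_mem_polyFun (b.coord i)) using 1
    ext; simp

lemma IsGeneric.mono {S T : Set V} (h : IsGeneric k S) (hST : S ⊆ T) : IsGeneric k T := by
  obtain ⟨g, hg, h0, hS⟩ := h
  exact ⟨g, hg, h0, fun v hv => hST (hS v hv)⟩

lemma isGeneric_of_mvPolynomial [Infinite k] [Module.Finite k V] {ι : Type*}
    (b : Module.Basis ι k V)
    {P : MvPolynomial ι k} (hP : P ≠ 0) {S : Set V}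
    (h : ∀ v, eval (fun i => b.repr v i) P ≠ 0 → v ∈ S) : IsGeneric k S := by
  refine ⟨_, eval_repr_mem_polyFun b P, fun h0 => hP (MvPolynomial.funext fun c => ?_), h⟩
  have hfin : Finite ι := Module.Finite.finite_basis b
  have := congrFun h0 (b.equivFun.symm c)
  have h2 : ∀ i, b.repr (b.equivFun.symm c) i = c i := fun i =>
    congrFun (b.equivFun.apply_symm_apply c) i
  simp only [h2] at this
  rw [this]; simp

lemma IsGeneric.inter [Infinite k] [Module.Finite k V] {S T : Set V} (hS : IsGeneric k S)
    (hT : IsGeneric k T) : IsGeneric k (S ∩ T) := by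
  obtain ⟨g, hg, g0, hS⟩ := hS
  obtain ⟨h, hh, h0, hT⟩ := hT
  obtain ⟨P, hP⟩ := exists_mvPolynomial_of_mem_polyFun (Module.Basis.ofVectorSpace k V) hg
  obtain ⟨Q, hQ⟩ := exists_mvPolynomial_of_mem_polyFun (Module.Basis.ofVectorSpace k V) hh
  have hP0 : P ≠ 0 := by
    rintro rfl
    exact g0 (funext fun v => by simp [hP v])
  have hQ0 : Q ≠ 0 := by
    rintro rfl
    exact h0 (funext fun v => by simp [hQ v])
  refine isGeneric_of_mvPolynomial (Module.Basis.ofVectorSpace k V) (mul_ne_zero hP0 hQ0)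
    fun v hv => ?_
  rw [map_mul, ← hP, ← hQ] at hv
  exact ⟨hS v (left_ne_zero_of_mul hv), hT v (right_ne_zero_of_mul hv)⟩

lemma isGeneric_univ : IsGeneric k (Set.univ : Set V) :=
  ⟨1, one_mem _, one_ne_zero, fun _ _ => trivial⟩

lemma isGeneric_forall_mem [Infinite k] [Module.Finite k V] {α : Type*} {s : Set α} (hs : s.Finite)
    {p : α → V → Prop} (h : ∀ i ∈ s, IsGeneric k {v | p i v}) :
    IsGeneric k {v | ∀ i ∈ s, p i v} := by
  induction s, hs using Set.Finite.induction_on with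
  | empty => exact isGeneric_univ.mono fun v _ => by simp
  | insert _ _ ih =>
    refine ((h _ (Set.mem_insert _ _)).inter
      (ih fun i hi => h i (Set.mem_insert_of_mem _ hi))).mono ?_
    rintro v ⟨h1, h2⟩ i hi
    rcases hi with rfl | hi
    exacts [h1, h2 i hi]

lemma isGeneric_notMem_submodule {W : Submodule k V} {v : V} (hv : v ∉ W) :
    IsGeneric k {v | v ∉ W} := by
  obtain ⟨φ, hφ, hle⟩ := W.exists_le_ker_of_lt_top (lt_top_iff_ne_top.mpr fun h => hv (h ▸ trivial))
  refine ⟨φ, linearMap_mem_polyFun φ, fun h => hφ (LinearMap.ext fun v => congrFun h v),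
    fun w hw hwW => hw (hle hwW)⟩

/-- Linear maps to an algebra: a linear form not contained in an ideal at one vector. -/
lemma isGeneric_notMem_ideal {A : Type*} [CommRing A] [Algebra k A] (l : V →ₗ[k] A) (I : Ideal A)
    {v : V} (hv : l v ∉ I) : IsGeneric k {v | l v ∉ I} :=
  isGeneric_notMem_submodule (W := (I.restrictScalars k).comap l) hv

end

/-- A generic set of vectors contains, up to scaling, all rational points of a nonempty dense open
subset of the linear system. -/
theorem IsGeneric.exists_opens {k : Type u} {V : Type u} [Field k] [Infinite k] [AddCommGroup V]
    [Module k V] [Module.Finite k V] [Nontrivial V] {S : Set V} (hS : IsGeneric k S) :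
    ∃ U : (linearSystem k V).Opens, (U : Set (linearSystem k V)).Nonempty ∧
      Dense (U : Set (linearSystem k V)) ∧
      ∀ (v : V) (hv : v ≠ 0), linearSystemPoint v hv ∈ U → ∃ c : k, c ≠ 0 ∧ c • v ∈ S := by
  obtain ⟨g, hg, g0, hS⟩ := hS
  obtain ⟨P, hP⟩ := exists_mvPolynomial_of_mem_polyFun (Module.Basis.ofVectorSpace k V) hg
  have hP0 : P ≠ 0 := by
    rintro rfl
    exact g0 (funext fun v => by simp [hP v])
  obtain ⟨e, he⟩ : ∃ e, homogeneousComponent e P ≠ 0 := by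
    by_contra! h
    exact hP0 (by rw [← P.sum_homogeneousComponent]; simp [h])
  obtain ⟨j⟩ : Nonempty (Module.Basis.ofVectorSpaceIndex k V) :=
    (Module.Basis.ofVectorSpace k V).index_nonempty
  -- The factor `X j` only makes the degree positive when `e = 0`.
  have hQ : (homogeneousComponent e P * X j).IsHomogeneous (e + 1) :=
    (homogeneousComponent_isHomogeneous e P).mul (isHomogeneous_X k j)
  obtain ⟨h1, h2⟩ := nonempty_and_dense_basicOpen hQ e.succ_pos (mul_ne_zero he (X_ne_zero j))
  refine ⟨_, h1, h2, fun v hv hvU => ?_⟩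
  have h3 := (mem_basicOpen_rationalPoint _ hQ).mp hvU
  rw [map_mul] at h3
  obtain ⟨t, ht, ht'⟩ := exists_eval_smul_ne_zero (left_ne_zero_of_mul h3)
  refine ⟨t, ht, hS _ ?_⟩
  rw [hP]
  convert ht' using 3
  ext i; simp

end Generic
-- Derivations dual to coordinate functions
section CoordinateDerivations

open scoped KaehlerDifferential
open Cardinal

/-- A finitely generated field extension generated by `τ` has as many derivations dual to some
members of `τ` as its transcendence degree. -/
theorem exists_dual_derivations (k : Type u) {K : Type u} [Field k] [Field K] [Algebra k K]
    [Algebra.EssFiniteType k K] {N : ℕ} (τ : Fin N → K)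
    (hτ : IntermediateField.adjoin k (Set.range τ) = ⊤) :
    ∃ (J : Type) (_ : Fintype J) (_ : DecidableEq J) (a : J → Fin N) (D : J → Derivation k K K),
      (∀ i j, D i (τ (a j)) = if i = j then 1 else 0) ∧
        Algebra.trdeg k K ≤ (Fintype.card J : Cardinal) := by
  classical
  -- The differentials of the generators span `Ω_{K/k}`; a basis chosen among them has the required
  -- dual derivations.
  obtain ⟨J, a, ha, hspan, hli⟩ := exists_linearIndependent' K
    (fun j => KaehlerDifferential.D k K (τ j))
  have : Finite J := Finite.of_injective a ha
  have := Fintype.ofFinite J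
  have htop : ⊤ ≤ Submodule.span K (Set.range ((fun j => KaehlerDifferential.D k K (τ j)) ∘ a)) := by
    rw [hspan, ← KaehlerDifferential.span_range_derivation, Submodule.span_le]
    rintro _ ⟨x, rfl⟩
    have hx : x ∈ IntermediateField.adjoin k (Set.range τ) := hτ ▸ trivial
    induction hx using IntermediateField.adjoin_induction with
    | mem x hx =>
      obtain ⟨j, rfl⟩ := hx
      exact Submodule.subset_span ⟨j, rfl⟩
    | algebraMap x => simp
    | add x y _ _ hx hy => rw [map_add]; exact add_mem hx hy
    | inv x _ hx =>
      rw [Derivation.leibniz_inv]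
      exact Submodule.smul_mem _ _ hx
    | mul x y _ _ hx hy =>
      rw [Derivation.leibniz]
      exact add_mem (Submodule.smul_mem _ _ hy) (Submodule.smul_mem _ _ hx)
  let b := Module.Basis.mk hli htop
  refine ⟨J, inferInstance, inferInstance, a,
    fun i => (b.coord i).compDer (KaehlerDifferential.D k K), fun i j => ?_, ?_⟩
  · have : KaehlerDifferential.D k K (τ (a j)) = b j := by simp [b]
    change b.coord i (KaehlerDifferential.D k K (τ (a j))) = _
    rw [this, Module.Basis.coord_apply, b.repr_self, Finsupp.single_apply]
    simp only [eq_comm]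
  -- All differentials over `F` vanish, so `K` is unramified and thus algebraic over `F`. In
  -- positive characteristic `J` may exceed the transcendence degree, which does no harm: more
  -- derivations give more conditions.
  · let F := IntermediateField.adjoin k (Set.range (τ ∘ a))
    have hsub : Subsingleton Ω[K⁄F] := by
      have hz : KaehlerDifferential.map k F K K = 0 := by
        refine b.ext fun j => ?_
        have hmem : τ (a j) ∈ F := IntermediateField.subset_adjoin _ _ ⟨j, rfl⟩
        have : b j = KaehlerDifferential.D k K (τ (a j)) := by simp [b]
        rw [this, KaehlerDifferential.map_D]
        exact (KaehlerDifferential.D F K).map_algebraMap ⟨_, hmem⟩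
      refine ⟨fun x y => ?_⟩
      obtain ⟨x, rfl⟩ := KaehlerDifferential.map_surjective k F K x
      obtain ⟨y, rfl⟩ := KaehlerDifferential.map_surjective k F K y
      rw [hz]; rfl
    have hunr : Algebra.FormallyUnramified F K := ⟨hsub⟩
    have : Algebra.EssFiniteType F K := Algebra.EssFiniteType.of_comp k F K
    have hsep : Algebra.IsSeparable F K := (Algebra.FormallyUnramified.iff_isSeparable F K).mp hunr
    have halg : Algebra.IsAlgebraic F K := inferInstance
    have halg' : Algebra.IsAlgebraic (Algebra.adjoin k (Set.range (τ ∘ a))) K := by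
      open scoped IntermediateField.algebraAdjoinAdjoin in
      exact (IsFractionRing.comap_isAlgebraic_iff (K := F)).mpr halg
    refine (Algebra.IsAlgebraic.trdeg_le_cardinalMk k (Set.range (τ ∘ a))).trans ?_
    have := Cardinal.mk_range_le_lift (f := τ ∘ a)
    simpa using this

/-- A common denominator of the derivatives of finitely many generators makes the derivation
preserve `B`. The free factor `c` serves to bring several derivations to one denominator. -/
lemma exists_descended_derivation (k : Type*) {B K : Type*} [Field k] [CommRing B] [IsDomain B]
    [Algebra k B] [Algebra.FiniteType k B] [Field K] [Algebra B K] [Algebra k K]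
    [IsScalarTower k B K] [IsFractionRing B K] (D : Derivation k K K) :
    ∃ (h : B), h ≠ 0 ∧ ∀ c : B, ∃ D' : Derivation k B B,
      ∀ b, algebraMap B K (D' b) = algebraMap B K (c * h) * D (algebraMap B K b) := by
  classical
  obtain ⟨s, hs⟩ := (Algebra.FiniteType.out : (⊤ : Subalgebra k B).FG)
  obtain ⟨h, hh⟩ := IsLocalization.exist_integer_multiples_of_finset (nonZeroDivisors B)
    (s.image fun b => D (algebraMap B K b))
  have hinj := IsFractionRing.injective B K
  refine ⟨h, nonZeroDivisors.ne_zero h.2, fun c => ?_⟩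
  have hrange : ∀ b, ∃ z, algebraMap B K z = algebraMap B K (c * h) * D (algebraMap B K b) := by
    intro b
    have hb : b ∈ Algebra.adjoin k (s : Set B) := hs ▸ trivial
    induction hb using Algebra.adjoin_induction with
    | mem x hx =>
      obtain ⟨z, hz⟩ := hh _ (Finset.mem_image_of_mem _ hx)
      rw [Algebra.smul_def] at hz
      exact ⟨c * z, by rw [map_mul, hz, map_mul, mul_assoc]⟩
    | algebraMap r =>
      exact ⟨0, by rw [← IsScalarTower.algebraMap_apply, D.map_algebraMap, map_zero, mul_zero]⟩
    | add x y _ _ hx hy =>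
      obtain ⟨z, hz⟩ := hx
      obtain ⟨w, hw⟩ := hy
      exact ⟨z + w, by rw [map_add, map_add, map_add, hz, hw, mul_add]⟩
    | mul x y _ _ hx hy =>
      obtain ⟨z, hz⟩ := hx
      obtain ⟨w, hw⟩ := hy
      refine ⟨x * w + y * z, ?_⟩
      rw [map_mul _ x y, D.leibniz, map_add, map_mul _ x w, map_mul _ y z, hz, hw]
      simp only [smul_eq_mul]; ring
  choose f hf using hrange
  let L : B →ₗ[k] B :=
    { toFun := f
      map_add' := fun x y => hinj (by rw [map_add, hf, hf, hf, map_add, map_add, mul_add])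
      map_smul' := fun r x => hinj (by
        have hs : ∀ z : B, algebraMap B K (r • z) = r • algebraMap B K z := fun z =>
          map_smul (IsScalarTower.toAlgHom k B K) r z
        rw [RingHom.id_apply, hs, hf, hf, hs, D.map_smul, mul_smul_comm]) }
  refine ⟨Derivation.mk' L fun x y => hinj ?_, hf⟩
  change algebraMap B K (f (x * y)) = algebraMap B K (x * f y + y * f x)
  rw [map_add, map_mul _ x, map_mul _ y, hf, hf, hf, map_mul _ x y, D.leibniz]
  simp only [smul_eq_mul]; ring

end CoordinateDerivations

/-! ### The dimension count for incidence conditions -/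

section DimensionCount

open Cardinal MvPolynomial Algebra

/-- More linear conditions than the dimension of `Spec B` have no common zero for general
parameters. -/
lemma exists_mvPolynomial_of_trdeg_lt (k : Type u) {B K : Type u} [Field k] [CommRing B]
    [IsDomain B] [Algebra k B] [Field K] [Algebra B K] [Algebra k K]
    [IsScalarTower k B K] [IsFractionRing B K] {ι : Type} [Fintype ι] {κ : Type u} [Fintype κ]
    (hcard : Algebra.trdeg k K < (Fintype.card ι : Cardinal)) (E : ι → κ → B) {H : B}
    (hH : H ≠ 0) : ∃ P : MvPolynomial (ι ⊕ κ) k, P ≠ 0 ∧ ∀ (q : Ideal B) [q.IsPrime], H ∉ q →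
      ∀ (a : ι → k) (m : κ → k), (∀ i, a i • H + ∑ l, m l • E i l ∈ q) →
        eval (Sum.elim a m) P = 0 := by
  let L := Localization.Away H
  have hle : Submonoid.powers H ≤ nonZeroDivisors B :=
    powers_le_nonZeroDivisors_of_noZeroDivisors hH
  have : IsDomain L := IsLocalization.isDomain_localization hle
  have hLK : Algebra.trdeg k L ≤ Algebra.trdeg k K := by
    let g : L →ₐ[B] K := IsLocalization.liftAlgHom (M := Submonoid.powers H)
      (f := Algebra.ofId B K) fun y => by
        have : (y : B) ≠ 0 := nonZeroDivisors.ne_zero (hle y.2)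
        exact Ne.isUnit (by simpa [Algebra.ofId_apply] using this)
    refine trdeg_le_of_injective (g.restrictScalars k) ?_
    have hinj : Function.Injective (IsLocalization.lift (M := Submonoid.powers H) (S := L)
        (g := algebraMap B K) fun y => Ne.isUnit (by
          have : (y : B) ≠ 0 := nonZeroDivisors.ne_zero (hle y.2)
          simpa using this)) := by
      rw [IsLocalization.lift_injective_iff]
      intro x y
      rw [(IsLocalization.injective L hle).eq_iff, (IsFractionRing.injective B K).eq_iff]
    exact hinj
  let u : L := IsLocalization.Away.invSelf H
  have hu : algebraMap B L H * u = 1 := IsLocalization.Away.mul_invSelf H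
  -- On the incidence locus the conditions are solved for `a i = -∑ (E i l / H) m l`, with `m` free.
  -- These `|ι| + |κ|` functions live in a ring of smaller transcendence degree, so a nonzero
  -- polynomial relates them.
  let Y : ι ⊕ κ → MvPolynomial κ L :=
    Sum.elim (fun i => -∑ l, C (u * algebraMap B L (E i l)) * X l) X
  have hdep : ¬ AlgebraicIndependent k Y := by
    intro hind
    have h1 := hind.lift_cardinalMk_le_trdeg
    have h2 : Algebra.trdeg k (MvPolynomial κ L) = Algebra.trdeg k L + Fintype.card κ := by
      rw [← trdeg_add_eq (R := k) (S := L), MvPolynomial.trdeg_of_isDomain]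
      simp
    rw [h2] at h1
    have h3 : Algebra.trdeg k L + (Fintype.card κ : Cardinal.{u}) <
        (Fintype.card ι : Cardinal.{u}) + Fintype.card κ := by
      have hlt := hLK.trans_lt hcard
      obtain ⟨t, ht⟩ := Cardinal.lt_aleph0.mp (hlt.trans (Cardinal.natCast_lt_aleph0))
      rw [ht] at hlt ⊢
      have : t < Fintype.card ι := by exact_mod_cast hlt
      exact_mod_cast Nat.add_lt_add_right this _
    refine absurd h1 (not_le.mpr ?_)
    simpa using h3
  rw [algebraicIndependent_iff] at hdep
  push Not at hdep
  obtain ⟨P, hP, hP0⟩ := hdep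
  refine ⟨P, hP0, fun q _ hHq a m ham => ?_⟩
  -- Specializing at `q` and at `m` sends `Y` to `(a, m)`, because the conditions hold in the
  -- residue field; the relation between the `Y` therefore holds for `(a, m)`.
  let F := FractionRing (B ⧸ q)
  let π : B →ₐ[k] F := (IsScalarTower.toAlgHom k (B ⧸ q) F).comp (Ideal.Quotient.mkₐ k q)
  have hπ : ∀ x, π x = 0 ↔ x ∈ q := fun x => by
    change algebraMap (B ⧸ q) F (Ideal.Quotient.mk q x) = 0 ↔ _
    rw [FaithfulSMul.algebraMap_eq_zero_iff, Ideal.Quotient.eq_zero_iff_mem]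
  have hπH : IsUnit (π H) := Ne.isUnit (by rwa [Ne, hπ])
  let φ : L →+* F := IsLocalization.Away.lift H (g := (π : B →+* F)) hπH
  have hφ : ∀ x, φ (algebraMap B L x) = π x := fun x => IsLocalization.Away.lift_eq H hπH x
  have hφu : π H * φ u = 1 := by rw [← hφ, ← map_mul, hu, map_one]
  let ψ : MvPolynomial κ L →+* F := eval₂Hom φ fun l => algebraMap k F (m l)
  have hψk : ∀ c : k, ψ (algebraMap k _ c) = algebraMap k F c := fun c => by
    rw [IsScalarTower.algebraMap_apply k L, MvPolynomial.algebraMap_eq, eval₂Hom_C,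
      IsScalarTower.algebraMap_apply k B L, hφ, π.commutes]
  have hψY : ∀ i, ψ (Y i) = algebraMap k F (Sum.elim a m i) := by
    rintro (i | l)
    · have h1 := (hπ _).mpr (ham i)
      simp only [map_add, map_sum, map_smul] at h1
      simp only [Algebra.smul_def] at h1
      simp only [Y, Sum.elim_inl, map_neg, map_sum, map_mul, ψ, coe_eval₂Hom, eval₂_C, eval₂_X,
        hφ]
      have h2 : ∑ x, φ u * π (E i x) * algebraMap k F (m x) =
          φ u * ∑ x, algebraMap k F (m x) * π (E i x) := by
        rw [Finset.mul_sum]; exact Finset.sum_congr rfl fun _ _ => by ring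
      rw [h2]
      linear_combination (-φ u) * h1 + algebraMap k F (a i) * hφu
    · simp [Y, ψ]
  have h0 : ψ (aeval Y P) = algebraMap k F (eval (Sum.elim a m) P) := by
    have : (ψ.comp (aeval Y).toRingHom) = (algebraMap k F).comp (eval (Sum.elim a m)) := by
      apply MvPolynomial.ringHom_ext
      · intro c; simpa using hψk c
      · intro i; simpa using hψY i
    exact RingHom.congr_fun this P
  rw [hP, map_zero] at h0
  exact (FaithfulSMul.algebraMap_eq_zero_iff k F).mp h0.symm

end DimensionCount
-- Bertini's theorem for linear systems of functions
section GenericRegularity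

/-- Bertini's theorem at the generic point of `Spec B`: sections that separate tangent directions
generically have generically regular zero loci. -/
theorem exists_generic_mul_notMem_sq (k : Type u) [Field k] [Infinite k] {B : Type u} [CommRing B]
    [IsDomain B] [Algebra k B] [Algebra.FiniteType k B] {V : Type u} [AddCommGroup V] [Module k V]
    [Module.Finite k V] (l : V →ₗ[k] B) {N : ℕ} (τ : Fin N → B) {v₀ : V} (hv₀ : l v₀ ≠ 0)
    (hv : ∀ j, ∃ v, l v = l v₀ * τ j)
    (hτ : ∀ b : B, ∃ s ∈ Algebra.adjoin k (Set.range τ), ∃ t ∈ Algebra.adjoin k (Set.range τ),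
      s ≠ 0 ∧ s * b = t) :
    ∃ h : B, h ≠ 0 ∧ IsGeneric k {v | ∀ (q : Ideal B) [q.IsPrime], h ∉ q → ∀ s ∉ q,
      s * l v ∉ q ^ 2} := by
  let K := FractionRing B
  have hinj := IsFractionRing.injective B K
  have : Algebra.EssFiniteType B K := Algebra.EssFiniteType.of_isLocalization K (nonZeroDivisors B)
  have : Algebra.EssFiniteType k K := Algebra.EssFiniteType.comp k B K
  have hadj : IntermediateField.adjoin k (Set.range (algebraMap B K ∘ τ)) = ⊤ := by
    rw [eq_top_iff]
    rintro x -
    have hsub : ∀ b ∈ Algebra.adjoin k (Set.range τ), algebraMap B K b ∈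
        IntermediateField.adjoin k (Set.range (algebraMap B K ∘ τ)) := by
      intro b hb
      have h1 : algebraMap B K b ∈ (Algebra.adjoin k (Set.range τ)).map
          (IsScalarTower.toAlgHom k B K) := ⟨b, hb, rfl⟩
      rw [AlgHom.map_adjoin, ← Set.range_comp] at h1
      exact IntermediateField.algebra_adjoin_le_adjoin k _ h1
    have hall : ∀ b, algebraMap B K b ∈
        IntermediateField.adjoin k (Set.range (algebraMap B K ∘ τ)) := by
      intro b
      obtain ⟨s, hs, t, ht, hs0, hst⟩ := hτ b
      have hs0' : algebraMap B K s ≠ 0 := by rwa [Ne, FaithfulSMul.algebraMap_eq_zero_iff]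
      have : algebraMap B K b = algebraMap B K t / algebraMap B K s := by
        rw [eq_div_iff hs0', ← map_mul, mul_comm, hst]
      rw [this]
      exact div_mem (hsub t ht) (hsub s hs)
    obtain ⟨b, c, -, rfl⟩ := IsFractionRing.div_surjective (A := B) x
    exact div_mem (hall b) (hall c)
  obtain ⟨J, _, _, a, D, hD, htr⟩ := exists_dual_derivations k _ hadj
  choose h hh D' hD' using fun j => exists_descended_derivation k (B := B) (D j)
  have hprod : ∀ j, ∃ c, c * h j = ∏ i, h i := fun j => by
    obtain ⟨c, hc⟩ := Finset.dvd_prod_of_mem h (Finset.mem_univ j)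
    exact ⟨c, by rw [hc, mul_comm]⟩
  choose c hc using hprod
  set H₀ := ∏ i, h i with hH₀
  have hH0 : H₀ ≠ 0 := Finset.prod_ne_zero_iff.mpr fun i _ => hh i
  have hDτ : ∀ i j, D' i (c i) (τ (a j)) = if i = j then H₀ else 0 := fun i j => by
    apply hinj
    rw [hD', hc]
    have := hD i j
    rw [Function.comp_apply] at this
    rw [this]
    split_ifs <;> simp
  choose w hw using hv
  -- With `g = l v / l v₀` and `D_j` the dual derivations, `E (some j) v` is `(l v₀)² H₀ D_j g` and
  -- `E none v` is `(l v₀)² H₀ (g - ∑ τ D_j g)`. On `v₀` and the vectors `w`, where `g` is `1` or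
  -- one of the `τ`, these conditions form the scalar matrix `H`, as the dimension count requires.
  let E : Option J → V →ₗ[k] B := fun o => match o with
    | some j => LinearMap.mulLeft k (l v₀) ∘ₗ (D' j (c j)).toLinearMap ∘ₗ l -
        LinearMap.mulLeft k (D' j (c j) (l v₀)) ∘ₗ l
    | none => LinearMap.mulLeft k (l v₀ * H₀) ∘ₗ l - ∑ j, LinearMap.mulLeft k (τ (a j)) ∘ₗ
        (LinearMap.mulLeft k (l v₀) ∘ₗ (D' j (c j)).toLinearMap ∘ₗ l -
        LinearMap.mulLeft k (D' j (c j) (l v₀)) ∘ₗ l)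
  have hEs : ∀ j v, E (some j) v = l v₀ * D' j (c j) (l v) - D' j (c j) (l v₀) * l v :=
    fun j v => rfl
  have hEn : ∀ v, E none v = l v₀ * H₀ * l v -
      ∑ j, τ (a j) * (l v₀ * D' j (c j) (l v) - D' j (c j) (l v₀) * l v) := fun v => by
    simp [E, mul_assoc]
  let y : Option J → V := fun o => match o with
    | some j => w (a j)
    | none => v₀
  let H := l v₀ * l v₀ * H₀
  have hH : H ≠ 0 := mul_ne_zero (mul_ne_zero hv₀ hv₀) hH0
  have hEss : ∀ i j, E (some i) (w (a j)) = if i = j then H else 0 := fun i j => by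
    rw [hEs, hw, Derivation.leibniz, hDτ]
    simp only [smul_eq_mul, H]
    split_ifs <;> ring
  have hEy : ∀ i j, E i (y j) = if i = j then H else 0 := by
    rintro (_ | i) (_ | j)
    · simp only [y, hEn, if_true, H]
      rw [Finset.sum_eq_zero fun j _ => by ring]
      ring
    · simp only [y, hEn, reduceCtorEq, if_false, H]
      simp only [← hEs, hEss, mul_ite, mul_zero]
      rw [Finset.sum_ite_eq' Finset.univ j, if_pos (Finset.mem_univ j), hw]
      ring
    · simp only [y, hEs, reduceCtorEq, if_false]
      ring
    · simp only [y, hEss, Option.some.injEq]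
  have hli : LinearIndependent k y := by
    rw [Fintype.linearIndependent_iff]
    intro g hg i
    have h1 := congrArg (E i) hg
    simp only [map_sum, map_smul, map_zero, hEy, smul_ite, smul_zero, Finset.sum_ite_eq,
      Finset.mem_univ, if_true] at h1
    exact (smul_eq_zero.mp h1).resolve_right hH
  let b := Module.Basis.sumExtend hli
  have hfin := Module.Finite.finite_basis b
  have : Fintype (Module.Basis.sumExtendIndex hli) := by
    have := Finite.sum_right (Option J) (β := Module.Basis.sumExtendIndex hli)
    exact Fintype.ofFinite _
  -- Vanishing of the function itself is the extra condition that exceeds the dimension.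
  have hcard : Algebra.trdeg k K < (Fintype.card (Option J) : Cardinal) := by
    refine htr.trans_lt ?_
    rw [Fintype.card_option]
    exact_mod_cast Nat.lt_succ_self _
  obtain ⟨P, hP0, hP⟩ := exists_mvPolynomial_of_trdeg_lt k hcard
    (fun i (l : Module.Basis.sumExtendIndex hli) => E i (b (Sum.inr l))) hH
  refine ⟨H, hH, isGeneric_of_mvPolynomial b hP0 fun v hv q _ hHq s hs hsq => hv ?_⟩
  have hlq : l v ∈ q := ((‹q.IsPrime›.mem_or_mem (Ideal.pow_le_self two_ne_zero hsq))).resolve_left hs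
  have hDq : ∀ j, D' j (c j) (l v) ∈ q := fun j =>
    Derivation.mem_of_mul_mem_sq (D' j (c j)) q (by simpa using hs) (by simpa using hlq)
      (by simpa using hsq)
  have hEq : ∀ j, E (some j) v ∈ q := fun j => by
    rw [hEs]
    exact sub_mem (Ideal.mul_mem_left _ _ (hDq j)) (Ideal.mul_mem_left _ _ hlq)
  have hEall : ∀ i, E i v ∈ q := by
    rintro (_ | j)
    · rw [hEn]
      exact sub_mem (Ideal.mul_mem_left _ _ hlq)
        (sum_mem fun j _ => Ideal.mul_mem_left _ _ (by rw [← hEs]; exact hEq j))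
    · exact hEq j
  have hby : ∀ i, b (Sum.inl i) = y i := fun i => by
    simp only [b, Module.Basis.sumExtend, Module.Basis.reindex_apply, Module.Basis.extend_apply_self]
    rfl
  have := hP q hHq (fun i => b.repr v (Sum.inl i)) (fun i => b.repr v (Sum.inr i)) fun i => by
    have h1 := congrArg (E i) (b.sum_repr v)
    rw [map_sum, Fintype.sum_sum_type] at h1
    simp only [map_smul, hby, hEy, smul_ite, smul_zero, Finset.sum_ite_eq,
      Finset.mem_univ, if_true] at h1
    rw [h1]
    exact hEall i
  rw [← this]
  congr 2
  ext i
  rcases i with i | i <;> rfl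

/-- Bertini's theorem: general members of a linear system of functions have regular zero loci
at regular points outside of the base locus, provided that the system separates tangent
directions. -/
theorem isGeneric_mul_notMem_sq (k : Type u) [Field k] [Infinite k] {A : Type u} [CommRing A]
    [Algebra k A] [Algebra.FiniteType k A] {V : Type u} [AddCommGroup V] [Module k V]
    [Module.Finite k V] (l : V →ₗ[k] A) {N : ℕ} (τ : Fin N → A)
    (h₁ : ∀ (p : Ideal A) [p.IsPrime], (∃ v, l v ∉ p) →
      ∃ v₀, l v₀ ∉ p ∧ ∀ j, ∃ v, l v = l v₀ * τ j)
    (h₂ : ∀ (p : Ideal A) [p.IsPrime] (b : A), ∃ s ∈ Algebra.adjoin k (Set.range τ),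
      ∃ t ∈ Algebra.adjoin k (Set.range τ), s ∉ p ∧ s * b - t ∈ p) :
    IsGeneric k {v | ∀ (q : Ideal A) [q.IsPrime], (∃ v, l v ∉ q) → ∀ s ∉ q, s * l v ∉ q ^ 2} := by
  have : IsNoetherianRing A := Algebra.FiniteType.isNoetherianRing k A
  have key : ∀ p : PrimeSpectrum A, ∃ h ∉ p.asIdeal, IsGeneric k {v | ∀ (q : Ideal A) [q.IsPrime],
      p.asIdeal ≤ q → h ∉ q → (∃ v, l v ∉ q) → ∀ s ∉ q, s * l v ∉ q ^ 2} := by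
    intro p
    by_cases hp : ∃ v, l v ∉ p.asIdeal
    · obtain ⟨v₀, hv₀, hv⟩ := h₁ p.asIdeal hp
      let π := Ideal.Quotient.mkₐ k p.asIdeal
      have hπ : ∀ x, π x = 0 ↔ x ∈ p.asIdeal := fun x => Ideal.Quotient.eq_zero_iff_mem
      have hπs : Function.Surjective π := Ideal.Quotient.mk_surjective
      have hmap : ∀ x ∈ Algebra.adjoin k (Set.range τ), π x ∈
          Algebra.adjoin k (Set.range (π ∘ τ)) := fun x hx => by
        have h1 : π x ∈ (Algebra.adjoin k (Set.range τ)).map π := ⟨x, hx, rfl⟩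
        rwa [AlgHom.map_adjoin, ← Set.range_comp] at h1
      have : Algebra.FiniteType k (A ⧸ p.asIdeal) := Algebra.FiniteType.of_surjective π hπs
      obtain ⟨h, hh, hgen⟩ := exists_generic_mul_notMem_sq k (π.toLinearMap ∘ₗ l) (π ∘ τ)
        (v₀ := v₀) (by simpa [hπ] using hv₀) (fun j => by
          obtain ⟨v, hv⟩ := hv j
          exact ⟨v, by simp [hv]⟩) (fun b => by
          obtain ⟨b, rfl⟩ := hπs b
          obtain ⟨s, hs, t, ht, hsp, hst⟩ := h₂ p.asIdeal b
          refine ⟨π s, hmap s hs, π t, hmap t ht, by rwa [Ne, hπ], ?_⟩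
          rw [← map_mul, ← sub_eq_zero, ← map_sub, hπ]
          exact hst)
      obtain ⟨h, rfl⟩ := hπs h
      refine ⟨h, by rwa [Ne, hπ] at hh, hgen.mono fun v hv q _ hpq hhq _ s hs hsq => ?_⟩
      have hker : RingHom.ker (Ideal.Quotient.mk p.asIdeal) ≤ q := by rwa [Ideal.mk_ker]
      have hq : (q.map (Ideal.Quotient.mk p.asIdeal)).IsPrime :=
        Ideal.map_isPrime_of_surjective Ideal.Quotient.mk_surjective hker
      have hmem : ∀ x, π x ∈ q.map (Ideal.Quotient.mk p.asIdeal) ↔ x ∈ q := fun x => by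
        rw [← Ideal.mem_comap]
        have : (q.map (Ideal.Quotient.mk p.asIdeal)).comap (Ideal.Quotient.mk p.asIdeal) = q := by
          rw [Ideal.comap_map_of_surjective _ Ideal.Quotient.mk_surjective, sup_eq_left]
          exact hker
        exact Ideal.ext_iff.mp this x
      refine hv (q.map (Ideal.Quotient.mk p.asIdeal)) (by rwa [hmem]) (π s) (by rwa [hmem]) ?_
      -- Membership in `q²` survives reduction modulo `p`, so the result for `A/p` is stronger than
      -- what is needed for `A`.
      have := Ideal.mem_map_of_mem (Ideal.Quotient.mk p.asIdeal) hsq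
      rw [Ideal.map_pow] at this
      rw [map_mul] at this
      exact this
    · exact ⟨1, (Ideal.ne_top_iff_one _).mp p.2.ne_top, isGeneric_univ.mono fun v _ q _ hpq _ hq =>
        absurd (hq.imp fun v hv hvp => hv (hpq hvp)) hp⟩
  choose h hh hgen using key
  obtain ⟨F, hF, hcover⟩ := exists_finite_primes_cover h hh
  refine (isGeneric_forall_mem hF fun p _ => hgen p).mono fun v hv q _ hq => ?_
  obtain ⟨p, hpF, hpq, hhq⟩ := hcover ⟨q, inferInstance⟩
  exact hv p hpF q hpq hhq hq

end GenericRegularity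
-- Heights of closed points
section EquiHeight

/-- Polynomial rings over a field are Jacobson, so a maximal ideal contracts to a maximal ideal in
one variable fewer, and each variable contributes one to the height. -/
lemma le_height_of_isMaximal_mvPolynomial (k : Type*) [Field k] : ∀ (s : ℕ)
    (P : Ideal (MvPolynomial (Fin s) k)) [P.IsMaximal], (s : ℕ∞) ≤ P.height := by
  intro s
  induction s with
  | zero => intro P _; simp
  | succ s ih =>
    intro P hP
    let e := (MvPolynomial.finSuccEquiv k s).toRingEquiv
    let Q : Ideal (Polynomial (MvPolynomial (Fin s) k)) := P.comap (e.symm : _ →+* _)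
    have hQ : Q.IsMaximal := Ideal.comap_isMaximal_of_surjective _ e.symm.surjective
    have hp : (Q.comap (Polynomial.C)).IsMaximal := Polynomial.isMaximal_comap_C_of_isJacobsonRing Q
    have : Q.LiesOver (Q.comap Polynomial.C) := ⟨rfl⟩
    have h1 := Polynomial.height_eq_height_add_one (Q.comap Polynomial.C) Q
    have h2 : Q.height = P.height := RingEquiv.height_comap e.symm P
    rw [← h2, h1]
    push_cast
    gcongr
    exact ih _

/-- All closed points of an integral scheme of finite type over a field have the same height. -/
theorem ringKrullDim_le_height_of_isMaximal (k : Type*) {B : Type*} [Field k] [CommRing B]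
    [IsDomain B] [Algebra k B] [Algebra.FiniteType k B] (P : Ideal B) [P.IsMaximal] :
    ringKrullDim B ≤ (P.height : WithBot ℕ∞) := by
  have : IsNoetherianRing B := Algebra.FiniteType.isNoetherianRing k B
  obtain ⟨s, g, hinj, hint⟩ := exists_integral_inj_algHom_of_fg k B
  let := g.toRingHom.toAlgebra
  have : Algebra.IsIntegral (MvPolynomial (Fin s) k) B := ⟨hint⟩
  have : FaithfulSMul (MvPolynomial (Fin s) k) B :=
    (faithfulSMul_iff_algebraMap_injective _ _).mpr hinj
  have hp : (P.comap (algebraMap (MvPolynomial (Fin s) k) B)).IsMaximal :=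
    Ideal.isMaximal_comap_of_isIntegral_of_isMaximal P
  have : P.LiesOver (P.comap (algebraMap (MvPolynomial (Fin s) k) B)) := ⟨rfl⟩
  -- Going down holds over the polynomial ring of Noether normalization, so the height of `P` is at
  -- least that of the maximal ideal below it.
  have h1 := Ideal.height_eq_height_add_of_liesOver_of_hasGoingDown
    (P.comap (algebraMap (MvPolynomial (Fin s) k) B)) P
  refine (ringKrullDim_le_of_isIntegral (R := MvPolynomial (Fin s) k)).trans ?_
  rw [MvPolynomial.ringKrullDim_of_isNoetherianRing, ringKrullDim_eq_zero_of_field, zero_add]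
  have h2 := le_height_of_isMaximal_mvPolynomial k s
    (P.comap (algebraMap (MvPolynomial (Fin s) k) B))
  rw [h1]
  have h3 := h2.trans (le_self_add (a := (P.comap (algebraMap (MvPolynomial (Fin s) k) B)).height)
    (b := (P.map (Ideal.Quotient.mk ((P.comap (algebraMap (MvPolynomial (Fin s) k) B)).map
      (algebraMap (MvPolynomial (Fin s) k) B)))).height))
  rw [Nat.card_eq_fintype_card, Fintype.card_fin]
  exact WithBot.coe_le_coe.mpr h3

end EquiHeight

/-! ### Norms as polynomial functions -/

section Norm

variable {k : Type*} {V : Type*} [Field k] [AddCommGroup V] [Module k V]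

/-- The algebra of polynomial functions with values in a `k`-algebra. -/
lemma comp_mem_polyFun_of_mem_adjoin {K : Type*} [CommRing K] [Algebra k K] {F : V → K}
    (hF : F ∈ Algebra.adjoin K (Set.range fun (φ : V →ₗ[k] k) v => algebraMap k K (φ v)))
    (m : K →ₗ[k] k) : (fun v => m (F v)) ∈ polyFun k V := by
  rw [← Subalgebra.mem_toSubmodule, Algebra.adjoin_eq_span] at hF
  induction hF using Submodule.span_induction generalizing m with
  | mem x hx =>
    obtain ⟨g, hg, rfl⟩ : ∃ g ∈ polyFun k V, (fun v => algebraMap k K (g v)) = x := by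
      induction hx using Submonoid.closure_induction with
      | mem x hx =>
        obtain ⟨φ, rfl⟩ := hx
        exact ⟨φ, linearMap_mem_polyFun φ, rfl⟩
      | one => exact ⟨1, one_mem _, by ext; simp⟩
      | mul x y _ _ hx hy =>
        obtain ⟨g, hg, rfl⟩ := hx
        obtain ⟨h, hh, rfl⟩ := hy
        exact ⟨g * h, mul_mem hg hh, by ext; simp⟩
    have : (fun v => m (algebraMap k K (g v))) = m 1 • g := by
      ext v
      rw [Algebra.algebraMap_eq_smul_one, map_smul]
      simp [mul_comm]
    rw [this]
    exact Subalgebra.smul_mem _ hg _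
  | zero =>
    convert zero_mem (polyFun k V) using 1
    ext; simp
  | add x y _ _ hx hy =>
    convert add_mem (hx m) (hy m) using 1
    ext; simp
  | smul c x _ hx => exact hx (m ∘ₗ LinearMap.mulLeft k c)

lemma linearMap_mem_adjoin [Module.Finite k V] {K : Type*} [CommRing K] [Algebra k K]
    (l : V →ₗ[k] K) :
    (l : V → K) ∈ Algebra.adjoin K (Set.range fun (φ : V →ₗ[k] k) v => algebraMap k K (φ v)) := by
  let b := Module.finBasis k V
  have : (l : V → K) = ∑ i, l (b i) • fun v => algebraMap k K (b.coord i v) := by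
    ext v
    have := congrArg l (b.sum_repr v)
    rw [map_sum] at this
    rw [← this]
    simp [Algebra.smul_def, mul_comm]
  rw [this]
  exact sum_mem fun i _ => Subalgebra.smul_mem _ (Algebra.subset_adjoin (Set.mem_range_self (b.coord i))) _

/-- The norm is a determinant whose entries are linear in `v`; a `k`-linear form then extracts
scalar polynomial functions from its values in `K`. -/
lemma comp_norm_mem_polyFun [Module.Finite k V] {K L : Type*} [Field K] [Algebra k K] [Field L]
    [Algebra K L] [Algebra k L] [IsScalarTower k K L] [Module.Finite K L] (l : V →ₗ[k] L)
    (m : K →ₗ[k] k) : (fun v => m (Algebra.norm K (l v))) ∈ polyFun k V := by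
  refine comp_mem_polyFun_of_mem_adjoin (F := fun v => Algebra.norm K (l v)) ?_ m
  let b := Module.finBasis K L
  have hentry : ∀ i j, (fun v => Algebra.leftMulMatrix b (l v) i j) ∈
      Algebra.adjoin K (Set.range fun (φ : V →ₗ[k] k) v => algebraMap k K (φ v)) := fun i j =>
    linearMap_mem_adjoin
      { toFun := fun v => Algebra.leftMulMatrix b (l v) i j
        map_add' := fun x y => by rw [map_add, map_add, Matrix.add_apply]
        map_smul' := fun c x => by
          rw [map_smul, algebra_compatible_smul K c (l x), map_smul, Matrix.smul_apply,
            RingHom.id_apply, algebraMap_smul] }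
  have : (fun v => Algebra.norm K (l v)) = ∑ σ : Equiv.Perm (Fin (Module.finrank K L)),
      ((Equiv.Perm.sign σ : ℤ) : K) • ∏ i, fun v => Algebra.leftMulMatrix b (l v) (σ i) i := by
    ext v
    rw [Algebra.norm_eq_matrix_det b, Matrix.det_apply']
    simp
  rw [this]
  exact sum_mem fun σ _ => Subalgebra.smul_mem _ (prod_mem fun i _ => hentry _ _) _

end Norm

/-! ### Generic members have zeros -/

section Nonunit

/-- A general member of a linear system of functions has a zero if one nonzero member has. -/
theorem isGeneric_not_isUnit (k : Type*) {B V : Type*} [Field k] [CommRing B] [IsDomain B]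
    [Algebra k B] [Algebra.FiniteType k B] [AddCommGroup V] [Module k V] [Module.Finite k V]
    (l : V →ₗ[k] B) {v₀ : V} (hv₀ : l v₀ ≠ 0) (hu : ¬ IsUnit (l v₀)) :
    IsGeneric k {v | ¬ IsUnit (l v)} := by
  obtain ⟨s, g, hinj, hfin⟩ := exists_finite_inj_algHom_of_fg k B
  let S := MvPolynomial (Fin s) k
  let := g.toRingHom.toAlgebra
  have : IsScalarTower k S B := IsScalarTower.of_algebraMap_eq fun x => (g.commutes x).symm
  have : Module.Finite S B := hfin
  have : FaithfulSMul S B := (faithfulSMul_iff_algebraMap_injective _ _).mpr hinj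
  let K := FractionRing S
  let L := FractionRing B
  let : Algebra K L := FractionRing.liftAlgebra S L
  have : IsScalarTower S K L := FractionRing.isScalarTower_liftAlgebra S L
  have : IsScalarTower k K L := IsScalarTower.of_algebraMap_eq fun x => by
    rw [IsScalarTower.algebraMap_apply k S K, ← IsScalarTower.algebraMap_apply S K L,
      IsScalarTower.algebraMap_apply S B L, ← IsScalarTower.algebraMap_apply k S B,
      ← IsScalarTower.algebraMap_apply k B L]
  have : Algebra.IsAlgebraic B L :=
    (IsFractionRing.comap_isAlgebraic_iff (K := L)).mpr inferInstance
  have : Algebra.IsAlgebraic S L := Algebra.IsAlgebraic.trans S B L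
  have : Algebra.IsAlgebraic K L := IsFractionRing.comap_isAlgebraic_iff.mp this
  have : Algebra.EssFiniteType B L :=
    Algebra.EssFiniteType.of_isLocalization L (nonZeroDivisors B)
  have : Algebra.EssFiniteType S L := Algebra.EssFiniteType.comp S B L
  have : Algebra.EssFiniteType K L := Algebra.EssFiniteType.of_comp S K L
  have : Module.Finite K L := Algebra.finite_of_essFiniteType_of_isAlgebraic
  let l' : V →ₗ[k] L := (IsScalarTower.toAlgHom k B L).toLinearMap ∘ₗ l
  have hint : ∀ b : B, ∃ c : S, algebraMap S K c = Algebra.norm K (algebraMap B L b) := fun b => by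
    have h1 : IsIntegral S (algebraMap B L b) := (Algebra.IsIntegral.isIntegral b).algebraMap
    exact IsIntegrallyClosed.isIntegral_iff.mp (Algebra.isIntegral_norm K h1)
  -- The norm of a unit is a unit of the polynomial ring `S`, hence a constant.
  have hunit : ∀ b : B, IsUnit b → ∃ c : k, algebraMap k K c = Algebra.norm K (algebraMap B L b) := by
    rintro _ ⟨b, rfl⟩
    obtain ⟨c, hc⟩ := hint b
    obtain ⟨d, hd⟩ := hint (b⁻¹ : Bˣ)
    have hcd : c * d = 1 := by
      apply IsFractionRing.injective S K
      rw [map_mul, hc, hd, ← map_mul, ← map_mul, Units.mul_inv, map_one, map_one, map_one]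
    obtain ⟨r, -, hr⟩ := MvPolynomial.isUnit_iff_eq_C_of_isReduced.mp (IsUnit.of_mul_eq_one d hcd)
    refine ⟨r, ?_⟩
    rw [← hc, hr, IsScalarTower.algebraMap_apply k S K, MvPolynomial.algebraMap_eq]
  have hnotmem : Algebra.norm K (l' v₀) ∉ (Submodule.span k {(1 : K)}) := by
    intro hmem
    obtain ⟨r, hr⟩ := Submodule.mem_span_singleton.mp hmem
    rw [← Algebra.algebraMap_eq_smul_one] at hr
    have hint₀ : IsIntegral S (l v₀) := Algebra.IsIntegral.isIntegral _
    have hne : l' v₀ ≠ 0 := by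
      change algebraMap B L (l v₀) ≠ 0
      rwa [Ne, FaithfulSMul.algebraMap_eq_zero_iff]
    have hr0 : r ≠ 0 := by
      rintro rfl
      rw [map_zero] at hr
      exact hne (Algebra.norm_eq_zero_iff.mp hr.symm)
    let c := (minpoly S (l v₀)).coeff 0
    have hc : (minpoly K (l' v₀)).coeff 0 = algebraMap S K c := by
      have := minpoly.isIntegrallyClosed_eq_field_fractions K L hint₀
      change (minpoly K (algebraMap B L (l v₀))).coeff 0 = _
      rw [this, Polynomial.coeff_map]
    -- Up to sign the norm is a positive power of the constant coefficient `c` of the minimal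
    -- polynomial. If the norm is a nonzero constant, then `c` is a unit.
    obtain ⟨t, ht⟩ : c ∣ MvPolynomial.C r := by
      let Ω := AlgebraicClosure L
      have hsplit : ((minpoly K (l' v₀)).map (algebraMap K Ω)).Splits := IsAlgClosed.splits _
      have h1 := Algebra.norm_eq_prod_roots Ω hsplit
      have h2 := hsplit.coeff_zero_eq_prod_roots_of_monic ((minpoly.monic
        (Algebra.IsIntegral.isIntegral (l' v₀))).map _)
      rw [Polynomial.coeff_map, hc] at h2
      have h3 : algebraMap K Ω (algebraMap S K c) * (-1) ^
          ((minpoly K (l' v₀)).map (algebraMap K Ω)).natDegree =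
          ((minpoly K (l' v₀)).aroots Ω).prod := by
        rw [h2, mul_right_comm, ← mul_pow, neg_one_mul, neg_neg, one_pow, one_mul,
          Polynomial.aroots_def]
      rw [← h3, ← hr, mul_pow] at h1
      have hpos : Module.finrank (IntermediateField.adjoin K {l' v₀}) L ≠ 0 :=
        Module.finrank_pos.ne'
      obtain ⟨e, he⟩ := Nat.exists_eq_succ_of_ne_zero hpos
      rw [he] at h1
      refine ⟨c ^ e * ((-1) ^ ((minpoly K (l' v₀)).map (algebraMap K Ω)).natDegree) ^ (e + 1), ?_⟩
      apply IsFractionRing.injective S K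
      apply (algebraMap K Ω).injective
      rw [← MvPolynomial.algebraMap_eq, ← IsScalarTower.algebraMap_apply k S K, h1]
      simp only [map_mul, map_pow, map_neg, map_one]
      rw [Nat.succ_eq_add_one, pow_succ _ e]
      ring
    have hcu : IsUnit (algebraMap S B c) := by
      refine IsUnit.map _ (isUnit_of_dvd_unit ⟨t, ht⟩ ?_)
      exact (Ne.isUnit hr0).map _
    -- The minimal equation exhibits `l v₀` as a divisor of its constant coefficient, so it would be
    -- a unit.
    have haeval := minpoly.aeval S (l v₀)
    rw [← Polynomial.X_mul_divX_add (minpoly S (l v₀)), map_add, map_mul, Polynomial.aeval_X,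
      Polynomial.aeval_C] at haeval
    refine hu (isUnit_of_dvd_unit ⟨-Polynomial.aeval (l v₀) (minpoly S (l v₀)).divX, ?_⟩ hcu)
    linear_combination haeval
  -- A linear form that kills the constants but not the norm of `l v₀` yields the polynomial
  -- function, which vanishes at every `v` with `l v` a unit.
  obtain ⟨m, hm0, hm⟩ := Submodule.exists_le_ker_of_notMem hnotmem
  refine ⟨_, comp_norm_mem_polyFun l' m, fun h => hm0 (congrFun h v₀), fun v hv hvu => hv ?_⟩
  obtain ⟨c, hc⟩ := hunit _ hvu
  exact hm (show Algebra.norm K (l' v) ∈ Submodule.span k {(1 : K)} from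
    Submodule.mem_span_singleton.mpr ⟨c, by rw [← Algebra.algebraMap_eq_smul_one]; exact hc⟩)

end Nonunit
/-! ### Dehomogenization and the charts of projective space -/

section Charts

open MvPolynomial

variable {k : Type u} [Field k] {n : ℕ}

lemma eval₂_mul_of_isHomogeneous {σ R S : Type*} [CommRing R] [CommRing S] {Q : MvPolynomial σ R}
    {e : ℕ} (hQ : Q.IsHomogeneous e) (φ : R →+* S) (t : S) (c : σ → S) :
    eval₂ φ (fun j => t * c j) Q = t ^ e * eval₂ φ c Q := by
  rw [eval₂_eq, eval₂_eq, Finset.mul_sum]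
  refine Finset.sum_congr rfl fun d hd => ?_
  have h1 : d.degree = e := by
    by_contra h
    exact (mem_support_iff.mp hd) (hQ.coeff_eq_zero h)
  have h2 : ∏ i ∈ d.support, t ^ d i = t ^ e := by
    rw [Finset.prod_pow_eq_pow_sum, ← h1]; rfl
  simp only [mul_pow, Finset.prod_mul_distrib, h2]
  ring

/-- The coordinate `x_l`, as a form of degree one. -/
def coordinate (n : ℕ) (k : Type u) [Field k] (l : Fin (n + 1)) :
    homogeneousSubmodule (Fin (n + 1)) k 1 := ⟨X l, X_mem l⟩

/-- The product of two forms. -/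
def mulForm {d e : ℕ} (f : homogeneousSubmodule (Fin (n + 1)) k d)
    (g : homogeneousSubmodule (Fin (n + 1)) k e) :
    homogeneousSubmodule (Fin (n + 1)) k (d + e) :=
  ⟨f.1 * g.1, IsHomogeneous.mul f.2 g.2⟩

lemma val_dehomogenize_mul {d : ℕ} (f : homogeneousSubmodule (Fin (n + 1)) k d)
    (j : Fin (n + 1)) :
    (dehomogenize f j).val *
        algebraMap (MvPolynomial (Fin (n + 1)) k) (Localization.Away (X j)) (X j) ^ d =
      algebraMap _ (Localization.Away (X j : MvPolynomial (Fin (n + 1)) k)) f.1 := by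
  rw [dehomogenize, HomogeneousLocalization.Away.val_mk, Localization.mk_eq_mk', ← map_pow]
  exact IsLocalization.mk'_spec _ _ _

lemma isUnit_algebraMap_X_pow (j : Fin (n + 1)) (d : ℕ) :
    IsUnit (algebraMap (MvPolynomial (Fin (n + 1)) k)
      (Localization.Away (X j : MvPolynomial (Fin (n + 1)) k)) (X j) ^ d) :=
  (IsLocalization.Away.algebraMap_isUnit (X j)).pow d

lemma dehomogenize_mul {d e : ℕ} (f : homogeneousSubmodule (Fin (n + 1)) k d)
    (g : homogeneousSubmodule (Fin (n + 1)) k e) (j : Fin (n + 1)) :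
    dehomogenize (mulForm f g) j = dehomogenize f j * dehomogenize g j := by
  apply HomogeneousLocalization.val_injective
  refine (isUnit_algebraMap_X_pow j (d + e)).mul_left_injective ?_
  beta_reduce
  rw [val_dehomogenize_mul, HomogeneousLocalization.val_mul, pow_add, mul_mul_mul_comm,
    val_dehomogenize_mul, val_dehomogenize_mul, ← map_mul]
  rfl

lemma dehomogenize_coordinate_self (j : Fin (n + 1)) :
    dehomogenize (coordinate n k j) j = 1 := by
  apply HomogeneousLocalization.val_injective
  refine (isUnit_algebraMap_X_pow j 1).mul_left_injective ?_
  beta_reduce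
  rw [val_dehomogenize_mul, HomogeneousLocalization.val_one, one_mul, pow_one]
  rfl

lemma exists_dehomogenize_eq (j : Fin (n + 1))
    (r : HomogeneousLocalization.Away (homogeneousSubmodule (Fin (n + 1)) k) (X j)) :
    ∃ (d : ℕ) (f : homogeneousSubmodule (Fin (n + 1)) k d), dehomogenize f j = r := by
  obtain ⟨d, a, ha, h⟩ := HomogeneousLocalization.Away.mk_surjective _ (X_mem j) r
  exact ⟨d, ⟨a, by simpa only [smul_eq_mul, mul_one] using ha⟩, h⟩

/-- The constants in the degree `0` part of `k[x][1 / x_j]`. -/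
def coeffMap (n : ℕ) (k : Type u) [Field k] (j : Fin (n + 1)) :
    k →+* HomogeneousLocalization.Away (homogeneousSubmodule (Fin (n + 1)) k) (X j) :=
  (HomogeneousLocalization.fromZeroRingHom _ _).comp
    (algebraMap k (homogeneousSubmodule (Fin (n + 1)) k 0))

lemma val_coeffMap (j : Fin (n + 1)) (c : k) :
    (coeffMap n k j c).val = algebraMap _ _ (C c : MvPolynomial (Fin (n + 1)) k) := rfl

lemma coeffMap_eq_mk (j : Fin (n + 1)) (c : k) :
    HomogeneousLocalization.Away.mk _ (X_mem j) 0 (MvPolynomial.C c) (C_mem c) =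
      coeffMap n k j c := by
  apply HomogeneousLocalization.val_injective
  rw [val_coeffMap, HomogeneousLocalization.Away.val_mk, ← Localization.mk_one_eq_algebraMap]
  congr 1

/-- By homogeneity, dividing by `x_j ^ d` amounts to substituting `x_l / x_j` for `x_l`. It follows
that these ratios generate the ring of the chart. -/
lemma dehomogenize_eq_eval₂ {d : ℕ} (f : homogeneousSubmodule (Fin (n + 1)) k d)
    (j : Fin (n + 1)) :
    dehomogenize f j =
      eval₂ (coeffMap n k j) (fun l => dehomogenize (coordinate n k l) j) f.1 := by
  apply HomogeneousLocalization.val_injective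
  set L := Localization.Away (X j : MvPolynomial (Fin (n + 1)) k)
  set ψ := algebraMap (HomogeneousLocalization.Away (homogeneousSubmodule (Fin (n + 1)) k) (X j)) L
  change _ = ψ _
  rw [hom_eval₂]
  have h1 : IsUnit (algebraMap (MvPolynomial (Fin (n + 1)) k) L (X j)) :=
    IsLocalization.Away.algebraMap_isUnit (X j)
  obtain ⟨u, hu⟩ := h1
  have h2 : ∀ l, ψ (dehomogenize (coordinate n k l) j) =
      (↑u⁻¹ : L) * algebraMap (MvPolynomial (Fin (n + 1)) k) L (X l) := by
    intro l
    change (dehomogenize (coordinate n k l) j).val = _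
    have h := val_dehomogenize_mul (coordinate n k l) j
    rw [pow_one, ← hu] at h
    rw [mul_comm, Units.eq_mul_inv_iff_mul_eq, h]
    rfl
  have h3 : ψ.comp (coeffMap n k j) = (algebraMap (MvPolynomial (Fin (n + 1)) k) L).comp C := rfl
  have h4 := hom_eval₂ f.1 C (algebraMap (MvPolynomial (Fin (n + 1)) k) L) X
  rw [eval₂_eta] at h4
  rw [funext h2, eval₂_mul_of_isHomogeneous f.2, h3]
  refine (isUnit_algebraMap_X_pow j d).mul_left_injective ?_
  beta_reduce
  rw [val_dehomogenize_mul, h4, ← hu, mul_right_comm, ← mul_pow]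
  simp

lemma chartMap_bijective (j : Fin (n + 1)) : Function.Bijective (chartMap n k j) :=
  (Proj.basicOpenIsoAway _ (X j) (X_mem (k := k) j) one_pos).commRingCatIsoToRingEquiv.bijective

lemma chartSection_mul {d e : ℕ} (f : homogeneousSubmodule (Fin (n + 1)) k d)
    (g : homogeneousSubmodule (Fin (n + 1)) k e) (j : Fin (n + 1)) :
    chartSection (mulForm f g) j = chartSection f j * chartSection g j := by
  rw [chartSection, dehomogenize_mul, map_mul]; rfl

lemma chartSection_coordinate_self (j : Fin (n + 1)) :
    chartSection (coordinate n k j) j = 1 := by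
  rw [chartSection, dehomogenize_coordinate_self, map_one]

lemma exists_chartSection_eq (j : Fin (n + 1)) (r : Γ(PP n k, (chart n k j).1)) :
    ∃ (d : ℕ) (f : homogeneousSubmodule (Fin (n + 1)) k d), chartSection f j = r := by
  obtain ⟨a, rfl⟩ := (chartMap_bijective j).2 r
  obtain ⟨d, f, rfl⟩ := exists_dehomogenize_eq j a
  exact ⟨d, f, rfl⟩

/-- The constants in the ring of regular functions on the chart `D₊(x_j)`. -/
def chartCoeff (n : ℕ) (k : Type u) [Field k] (j : Fin (n + 1)) :
    k →+* Γ(PP n k, (chart n k j).1) :=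
  (chartMap n k j).comp (coeffMap n k j)

lemma chartSection_eq_eval₂ {d : ℕ} (f : homogeneousSubmodule (Fin (n + 1)) k d)
    (j : Fin (n + 1)) :
    chartSection f j =
      eval₂ (chartCoeff n k j) (fun l => chartSection (coordinate n k l) j) f.1 := by
  rw [chartSection, dehomogenize_eq_eval₂, hom_eval₂]; rfl

lemma chartSection_add {d : ℕ} (f g : homogeneousSubmodule (Fin (n + 1)) k d)
    (j : Fin (n + 1)) : chartSection (f + g) j = chartSection f j + chartSection g j := by
  rw [chartSection, dehomogenize_add, map_add]; rfl

lemma chartSection_smul {d : ℕ} (c : k) (f : homogeneousSubmodule (Fin (n + 1)) k d)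
    (j : Fin (n + 1)) : chartSection (c • f) j = chartCoeff n k j c * chartSection f j := by
  rw [chartSection, dehomogenize_smul, map_mul, coeffMap_eq_mk]; rfl

lemma chartCoeff_finiteType (j : Fin (n + 1)) : (chartCoeff n k j).FiniteType := by
  let φ : MvPolynomial (Fin (n + 1)) k →+* Γ(PP n k, (chart n k j).1) :=
    eval₂Hom (chartCoeff n k j) (fun l => chartSection (coordinate n k l) j)
  have h : φ.comp C = chartCoeff n k j := by ext; simp [φ]
  rw [← h]
  refine RingHom.FiniteType.comp_surjective (f := C) ?_ fun r => ?_
  · exact (RingHom.finiteType_algebraMap (A := k) (B := MvPolynomial (Fin (n + 1)) k)).mpr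
      inferInstance
  · obtain ⟨d, f, rfl⟩ := exists_chartSection_eq j r
    exact ⟨f.1, (chartSection_eq_eval₂ f j).symm⟩

instance (j : Fin (n + 1)) : IsNoetherianRing Γ(PP n k, (chart n k j).1) := by
  algebraize [chartCoeff n k j]
  have : Algebra.FiniteType k Γ(PP n k, (chart n k j).1) := chartCoeff_finiteType j
  exact Algebra.FiniteType.isNoetherianRing k _

lemma iSup_chart (n : ℕ) (k : Type u) [Field k] : ⨆ j, (chart n k j).1 = ⊤ := by
  refine Proj.iSup_basicOpen_eq_top' _ _ (fun j => ⟨1, X_mem j⟩) ?_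
  refine top_le_iff.mp fun p _ => ?_
  induction p using MvPolynomial.induction_on with
  | C a =>
    exact Subalgebra.algebraMap_mem (Algebra.adjoin (homogeneousSubmodule (Fin (n + 1)) k 0) _)
      (⟨C a, isHomogeneous_C _ a⟩ : homogeneousSubmodule (Fin (n + 1)) k 0)
  | add p q hp hq => exact add_mem (hp trivial) (hq trivial)
  | mul_X p i hp => exact mul_mem (hp trivial) (Algebra.subset_adjoin ⟨i, rfl⟩)

instance : AlgebraicGeometry.IsNoetherian (PP n k) :=
  (isNoetherian_iff_of_finite_iSup_eq_top (iSup_chart n k)).mpr fun j =>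
    inferInstanceAs (IsNoetherianRing Γ(PP n k, (chart n k j).1))

end Charts
-- Transition between charts
section Overlaps

open MvPolynomial

variable {k : Type u} [Field k] {n : ℕ}

instance (x : PP n k) : x.asHomogeneousIdeal.toIdeal.IsPrime := x.isPrime

lemma val_chartSection_mul {d : ℕ} (f : homogeneousSubmodule (Fin (n + 1)) k d)
    (j : Fin (n + 1)) (x : PP n k) (hx : x ∈ (chart n k j).1) :
    ((chartSection f j).1 ⟨x, hx⟩ :
        HomogeneousLocalization.AtPrime _ x.asHomogeneousIdeal.toIdeal).val *
      algebraMap (MvPolynomial (Fin (n + 1)) k)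
        (Localization.AtPrime x.asHomogeneousIdeal.toIdeal) (X j) ^ d =
      algebraMap (MvPolynomial (Fin (n + 1)) k)
        (Localization.AtPrime x.asHomogeneousIdeal.toIdeal) f.1 := by
  have h := ProjectiveSpectrum.Proj.awayToSection_apply _ (X j) (dehomogenize f j) ⟨x, hx⟩
  have h1 : ((chartSection f j).1 ⟨x, hx⟩ :
      HomogeneousLocalization.AtPrime _ x.asHomogeneousIdeal.toIdeal).val = _ := h
  rw [h1]
  have h2 := congrArg (IsLocalization.map (M := Submonoid.powers (X j))
      (T := x.asHomogeneousIdeal.toIdeal.primeCompl)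
      (Localization.AtPrime x.asHomogeneousIdeal.toIdeal) (RingHom.id _)
      (Submonoid.powers_le.mpr hx)) (val_dehomogenize_mul f j)
  rw [map_mul, map_pow, IsLocalization.map_eq, IsLocalization.map_eq] at h2
  exact h2

lemma isUnit_algebraMap_X {j : Fin (n + 1)} {x : PP n k} (hx : x ∈ (chart n k j).1) :
    IsUnit (algebraMap (MvPolynomial (Fin (n + 1)) k)
        (Localization.AtPrime x.asHomogeneousIdeal.toIdeal) (X j)) :=
  (IsLocalization.AtPrime.isUnit_to_map_iff _ x.asHomogeneousIdeal.toIdeal _).mpr hx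

/-- The transition rule `f / x_j^d = (x_l / x_j)^d · f / x_l^d`; sections of `Proj` are families of
germs, so it is checked in each homogeneous localization. -/
lemma map_chartSection_eq {d : ℕ} (f : homogeneousSubmodule (Fin (n + 1)) k d)
    (j l : Fin (n + 1)) {V : (PP n k).Opens} (hj : V ≤ (chart n k j).1)
    (hl : V ≤ (chart n k l).1) :
    (PP n k).presheaf.map (homOfLE hj).op (chartSection f j) =
      (PP n k).presheaf.map (homOfLE hj).op (chartSection (coordinate n k l) j) ^ d *
        (PP n k).presheaf.map (homOfLE hl).op (chartSection f l) := by
  have key : ∀ (x : PP n k) (hx : x ∈ V),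
      ((chartSection f j).1 ⟨x, hj hx⟩ :
        HomogeneousLocalization.AtPrime _ x.asHomogeneousIdeal.toIdeal) =
      ((chartSection (coordinate n k l) j).1 ⟨x, hj hx⟩ :
        HomogeneousLocalization.AtPrime _ x.asHomogeneousIdeal.toIdeal) ^ d *
      ((chartSection f l).1 ⟨x, hl hx⟩ :
        HomogeneousLocalization.AtPrime _ x.asHomogeneousIdeal.toIdeal) := by
    intro x hx
    apply HomogeneousLocalization.val_injective
    have ha := val_chartSection_mul f j x (hj hx)
    have hb := val_chartSection_mul (coordinate n k l) j x (hj hx)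
    have hc := val_chartSection_mul f l x (hl hx)
    refine ((isUnit_algebraMap_X (hj hx)).pow d).mul_left_injective ?_
    beta_reduce
    rw [ha, HomogeneousLocalization.val_mul, HomogeneousLocalization.val_pow, mul_right_comm,
      ← mul_pow]
    rw [pow_one] at hb
    rw [hb, mul_comm, ← hc]
    rfl
  exact Subtype.ext (funext fun x => key x.1 x.2)

lemma basicOpen_chartSection_le (j l : Fin (n + 1)) :
    (PP n k).basicOpen (chartSection (coordinate n k j) l) ≤ (chart n k j).1 := by
  intro x hx
  have hxl : x ∈ (chart n k l).1 := (PP n k).basicOpen_le _ hx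
  rw [Scheme.mem_basicOpen _ _ _ hxl] at hx
  have h1 := hx.map (Proj.stalkIso' (homogeneousSubmodule (Fin (n + 1)) k) x)
  have h2 := Proj.stalkIso'_germ (homogeneousSubmodule (Fin (n + 1)) k) (chart n k l).1 x hxl
    (chartSection (coordinate n k j) l)
  have h3 : IsUnit ((chartSection (coordinate n k j) l).1 ⟨x, hxl⟩ :
      HomogeneousLocalization.AtPrime _ x.asHomogeneousIdeal.toIdeal) := h2 ▸ h1
  have h4 := (HomogeneousLocalization.isUnit_iff_isUnit_val _
    x.asHomogeneousIdeal.toIdeal _).mpr h3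
  have h5 := h4.mul (isUnit_algebraMap_X hxl |>.pow 1)
  rw [val_chartSection_mul] at h5
  exact (IsLocalization.AtPrime.isUnit_to_map_iff _ x.asHomogeneousIdeal.toIdeal _).mp h5

end Overlaps

/-! ### Pullbacks of ideal sheaves -/

section Comap

variable {X Y : Scheme.{u}}

lemma map_ideal_le_ideal_comap (I : Y.IdealSheafData) (f : X ⟶ Y) (U : X.affineOpens)
    (V : Y.affineOpens) (h : U.1 ≤ f ⁻¹ᵁ V.1) :
    (I.ideal V).map (f.appLE V.1 U.1 h).hom ≤ (I.comap f).ideal U := by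
  rw [Ideal.map_le_iff_le_comap]
  intro s hs
  have h1 := (Scheme.IdealSheafData.le_map_iff_comap_le (f := f) (J := I)).mpr le_rfl
  have h2 := Scheme.Hom.ideal_ker_le _ V (h1 V hs)
  rw [RingHom.mem_ker] at h2
  rw [Ideal.mem_comap, ← Scheme.IdealSheafData.ker_subschemeι_app, RingHom.mem_ker]
  have h3 : (f.appLE V.1 U.1 h ≫ (I.comap f).subschemeι.app U.1) =
      ((I.comap f).subschemeι ≫ f).app V.1 ≫
        (I.comap f).subscheme.presheaf.map
          (homOfLE (X := (I.comap f).subscheme.Opens) (fun x hx => h hx)).op := by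
    rw [Scheme.Hom.app_eq_appLE, Scheme.Hom.appLE_comp_appLE]
    rfl
  have h4 := congr($(h3).hom s)
  simp only [CommRingCat.hom_comp, RingHom.comp_apply] at h4 h2
  rw [h4, h2, map_zero]

lemma fromSpec_appLE_top {U : X.Opens} (hU : IsAffineOpen U)
    (e : (⊤ : (Spec Γ(X, U)).Opens) ≤ hU.fromSpec ⁻¹ᵁ U) :
    hU.fromSpec.appLE U ⊤ e = (Scheme.ΓSpecIso _).inv := by
  rw [Scheme.Hom.appLE, IsAffineOpen.fromSpec_app_self, Category.assoc, ← Functor.map_comp]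
  exact (congrArg _ (CategoryTheory.Functor.map_id _ _)).trans (Category.comp_id _)

/-- The closed subscheme of `U` defined by the extended ideal maps into the subscheme of `I`, so by
the adjunction of `comap` and `map` the pulled-back ideal vanishes on it. -/
lemma ideal_comap_le_map_ideal (I : Y.IdealSheafData) (f : X ⟶ Y) (U : X.affineOpens)
    (V : Y.affineOpens) (h : U.1 ≤ f ⁻¹ᵁ V.1) :
    (I.comap f).ideal U ≤ (I.ideal V).map (f.appLE V.1 U.1 h).hom := by
  set J := (I.ideal V).map (f.appLE V.1 U.1 h).hom
  let c : Spec (.of (Γ(X, U.1) ⧸ J)) ⟶ X :=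
    Spec.map (CommRingCat.ofHom (Ideal.Quotient.mk J)) ≫ U.2.fromSpec
  let g : Spec (.of (Γ(X, U.1) ⧸ J)) ⟶ Spec (.of (Γ(Y, V.1) ⧸ I.ideal V)) :=
    Spec.map (CommRingCat.ofHom (Ideal.quotientMap J (f.appLE V.1 U.1 h).hom
      Ideal.le_comap_map))
  have h1 : c ≫ f = (g ≫ I.subschemeCover.f V) ≫ I.subschemeι := by
    have e1 : I.subschemeCover.f V ≫ I.subschemeι =
        Spec.map (CommRingCat.ofHom (Ideal.Quotient.mk (I.ideal V))) ≫
          IsAffineOpen.fromSpec V.2 :=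
      (I.subschemeCover_map_subschemeι V).trans (I.glueDataObjι_ι V)
    have e2 := IsAffineOpen.SpecMap_appLE_fromSpec f V.2 U.2 h
    have e3 : CommRingCat.ofHom (Ideal.Quotient.mk (I.ideal V)) ≫
        CommRingCat.ofHom (Ideal.quotientMap J (f.appLE V.1 U.1 h).hom Ideal.le_comap_map) =
        f.appLE V.1 U.1 h ≫ CommRingCat.ofHom (Ideal.Quotient.mk J) := rfl
    calc c ≫ f = Spec.map (CommRingCat.ofHom (Ideal.Quotient.mk J)) ≫
          (IsAffineOpen.fromSpec U.2 ≫ f) := Category.assoc _ _ _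
      _ = Spec.map (CommRingCat.ofHom (Ideal.Quotient.mk J)) ≫
          (Spec.map (f.appLE V.1 U.1 h) ≫ IsAffineOpen.fromSpec V.2) := by rw [e2]
      _ = Spec.map (f.appLE V.1 U.1 h ≫ CommRingCat.ofHom (Ideal.Quotient.mk J)) ≫
          IsAffineOpen.fromSpec V.2 := by rw [Spec.map_comp, Category.assoc]
      _ = g ≫ (Spec.map (CommRingCat.ofHom (Ideal.Quotient.mk (I.ideal V))) ≫
          IsAffineOpen.fromSpec V.2) := by rw [← e3, Spec.map_comp, Category.assoc]
      _ = _ := by rw [← e1]; exact (Category.assoc _ _ _).symm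
  have h2 : I.comap f ≤ c.ker := by
    rw [← Scheme.IdealSheafData.le_map_iff_comap_le, Scheme.IdealSheafData.map_ker, h1]
    exact (Scheme.IdealSheafData.ker_subschemeι I).ge.trans (Scheme.Hom.le_ker_comp _ _)
  intro s hs
  have h3 := Scheme.Hom.ideal_ker_le _ U (h2 U hs)
  have hU : IsAffineOpen U.1 := U.2
  rw [RingHom.mem_ker] at h3
  have e0 : (⊤ : (Spec (.of (Γ(X, U.1) ⧸ J))).Opens) ≤ c ⁻¹ᵁ U.1 := by
    intro x _
    change U.2.fromSpec _ ∈ U.1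
    rw [← SetLike.mem_coe, ← IsAffineOpen.range_fromSpec U.2]
    exact ⟨_, rfl⟩
  have e1 : c.appLE U.1 ⊤ e0 =
      CommRingCat.ofHom (Ideal.Quotient.mk J) ≫ (Scheme.ΓSpecIso _).inv := by
    rw [← Scheme.Hom.appLE_comp_appLE _ _ U.1 ⊤ ⊤
      (hU.fromSpec_preimage_self).ge le_rfl, fromSpec_appLE_top,
      Scheme.ΓSpecIso_inv_naturality]
    exact congrArg _ (Scheme.Hom.app_eq_appLE _).symm
  have e2 : c.appLE U.1 ⊤ e0 s = 0 := by
    rw [Scheme.Hom.appLE, CommRingCat.comp_apply]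
    exact (congrArg _ h3).trans (map_zero _)
  rw [e1, CommRingCat.comp_apply] at e2
  rw [← Ideal.Quotient.eq_zero_iff_mem]
  exact (Scheme.ΓSpecIso _).symm.commRingCatIsoToRingEquiv.injective (e2.trans (map_zero _).symm)

lemma ideal_comap (I : Y.IdealSheafData) (f : X ⟶ Y) (U : X.affineOpens)
    (V : Y.affineOpens) (h : U.1 ≤ f ⁻¹ᵁ V.1) :
    (I.comap f).ideal U = (I.ideal V).map (f.appLE V.1 U.1 h).hom :=
  le_antisymm (ideal_comap_le_map_ideal I f U V h) (map_ideal_le_ideal_comap I f U V h)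

end Comap
/-! ### Ideals of hypersurfaces -/

section Hypersurface

open MvPolynomial

variable {k : Type u} [Field k] {n : ℕ}

instance (j : Fin (n + 1)) : IsNoetherianRing
    (HomogeneousLocalization.Away (homogeneousSubmodule (Fin (n + 1)) k) (X j)) :=
  isNoetherianRing_of_ringEquiv Γ(PP n k, (chart n k j).1)
    (RingEquiv.ofBijective _ (chartMap_bijective j)).symm

lemma awayToSection_awayι_appLE {σ : Type*} {A : Type u} [CommRing A] [SetLike σ A]
    [AddSubgroupClass σ A] (𝒜 : ℕ → σ) [GradedRing 𝒜] (f : A) {m : ℕ} (hf : f ∈ 𝒜 m)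
    (hm : 0 < m) (e : ⊤ ≤ Proj.awayι 𝒜 f hf hm ⁻¹ᵁ Proj.basicOpen 𝒜 f) :
    Proj.awayToSection 𝒜 f ≫ (Proj.awayι 𝒜 f hf hm).appLE (Proj.basicOpen 𝒜 f) ⊤ e =
      (Scheme.ΓSpecIso _).inv := by
  have h1 : (Proj.awayι 𝒜 f hf hm).appLE (Proj.basicOpen 𝒜 f) ⊤ e =
      (Proj.basicOpen 𝒜 f).topIso.inv ≫ (Proj.basicOpenIsoSpec 𝒜 f hf hm).inv.appTop := by
    have h2 : (Proj.basicOpen 𝒜 f).ι.appLE (Proj.basicOpen 𝒜 f) ⊤ (by simp) =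
        (Proj.basicOpen 𝒜 f).topIso.inv := by
      rw [Scheme.Opens.ι_appLE, Scheme.Opens.topIso_inv]
      rfl
    refine (Scheme.Hom.appLE_comp_appLE (Proj.basicOpenIsoSpec 𝒜 f hf hm).inv
      (Proj.basicOpen 𝒜 f).ι _ ⊤ ⊤ (by simp) le_rfl).symm.trans ?_
    rw [h2]
    exact congrArg _ (Scheme.Hom.app_eq_appLE _).symm
  have h3 := Proj.basicOpenToSpec_app_top 𝒜 f
  have h4 : (Proj.basicOpenIsoSpec 𝒜 f hf hm).hom.appTop ≫
      (Proj.basicOpenIsoSpec 𝒜 f hf hm).inv.appTop = 𝟙 _ := by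
    rw [← Scheme.Hom.comp_appTop, Iso.inv_hom_id, Scheme.Hom.id_appTop]
  rw [Proj.basicOpenIsoSpec_hom] at h4
  have h5 : Proj.awayToSection 𝒜 f ≫ (Proj.basicOpen 𝒜 f).topIso.inv =
      (Scheme.ΓSpecIso _).inv ≫ (Proj.basicOpenToSpec 𝒜 f).appTop := by
    rw [Iso.eq_inv_comp]
    exact h3.symm
  rw [h1, ← Category.assoc, h5, Category.assoc, h4, Category.comp_id]

/-- The inclusion of an affine piece of a hypersurface. -/
def hypersurfacePiece {d : ℕ} (f : homogeneousSubmodule (Fin (n + 1)) k d) (j : Fin (n + 1)) :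
    Spec (.of (HomogeneousLocalization.Away (homogeneousSubmodule (Fin (n + 1)) k) (X j) ⧸
      Ideal.span {dehomogenize f j})) ⟶ PP n k :=
  Spec.map (CommRingCat.ofHom (Ideal.Quotient.mk (Ideal.span {dehomogenize f j}))) ≫
      Proj.awayι _ (MvPolynomial.X j) (X_mem j) one_pos

lemma hypersurface_eq {d : ℕ} (f : homogeneousSubmodule (Fin (n + 1)) k d) :
    hypersurface f = ⨅ j, (hypersurfacePiece f j).ker := rfl

instance {d : ℕ} (f : homogeneousSubmodule (Fin (n + 1)) k d) (j : Fin (n + 1)) :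
    QuasiCompact (hypersurfacePiece f j) := by
  infer_instance

lemma top_le_preimage_hypersurfacePiece {d : ℕ} (f : homogeneousSubmodule (Fin (n + 1)) k d)
    (j : Fin (n + 1)) : ⊤ ≤ hypersurfacePiece f j ⁻¹ᵁ (chart n k j).1 := by
  intro x _
  have h := Proj.opensRange_awayι (homogeneousSubmodule (Fin (n + 1)) k) (X j) (X_mem j) one_pos
  change hypersurfacePiece f j x ∈ Proj.basicOpen (homogeneousSubmodule (Fin (n + 1)) k) (X j)
  rw [← h]
  exact ⟨_, rfl⟩

lemma chartMap_hypersurfacePiece_appLE {d : ℕ} (f : homogeneousSubmodule (Fin (n + 1)) k d)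
    (j : Fin (n + 1)) (a) :
    (hypersurfacePiece f j).appLE (chart n k j).1 ⊤ (top_le_preimage_hypersurfacePiece f j)
      (chartMap n k j a) =
    (Scheme.ΓSpecIso (.of (_ ⧸ Ideal.span {dehomogenize f j}))).inv
      (Ideal.Quotient.mk (Ideal.span {dehomogenize f j}) a) := by
  set q := CommRingCat.ofHom (Ideal.Quotient.mk (Ideal.span {dehomogenize f j}))
  have e : ⊤ ≤ Proj.awayι (homogeneousSubmodule (Fin (n + 1)) k) (X j) (X_mem j) one_pos ⁻¹ᵁ
      Proj.basicOpen (homogeneousSubmodule (Fin (n + 1)) k) (X j) := by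
    rw [← Proj.opensRange_awayι _ _ (X_mem j) one_pos, Scheme.Hom.preimage_opensRange]
  have h1 := awayToSection_awayι_appLE (homogeneousSubmodule (Fin (n + 1)) k) (X j) (X_mem j)
    one_pos e
  have h2 : (hypersurfacePiece f j).appLE (chart n k j).1 ⊤
      (top_le_preimage_hypersurfacePiece f j) =
      (Proj.awayι (homogeneousSubmodule (Fin (n + 1)) k) (X j) (X_mem j) one_pos).appLE
        (Proj.basicOpen (homogeneousSubmodule (Fin (n + 1)) k) (X j)) ⊤ e ≫
        (Spec.map q).appTop := by
    refine (Scheme.Hom.appLE_comp_appLE (Spec.map q) (Proj.awayι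
      (homogeneousSubmodule (Fin (n + 1)) k) (X j) (X_mem j) one_pos) _ ⊤ ⊤ e le_rfl).symm.trans ?_
    exact congrArg _ (Scheme.Hom.app_eq_appLE _).symm
  have h3 : Proj.awayToSection (homogeneousSubmodule (Fin (n + 1)) k) (X j) ≫
      (hypersurfacePiece f j).appLE (chart n k j).1 ⊤
      (top_le_preimage_hypersurfacePiece f j) = q ≫ (Scheme.ΓSpecIso _).inv := by
    rw [h2, Scheme.ΓSpecIso_inv_naturality, ← h1, Category.assoc]
  exact congr($(h3).hom a)

lemma hypersurfacePiece_ker_ideal_self {d : ℕ} (f : homogeneousSubmodule (Fin (n + 1)) k d)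
    (j : Fin (n + 1)) :
    (hypersurfacePiece f j).ker.ideal (chart n k j) ≤ Ideal.span {chartSection f j} := by
  intro s hs
  obtain ⟨a, rfl⟩ := (chartMap_bijective j).2 s
  have h1 := Scheme.Hom.ideal_ker_le _ _ hs
  rw [RingHom.mem_ker] at h1
  have h2 : (hypersurfacePiece f j).appLE (chart n k j).1 ⊤
      (top_le_preimage_hypersurfacePiece f j) (chartMap n k j a) = 0 := by
    rw [Scheme.Hom.appLE, CommRingCat.comp_apply]
    exact (congrArg _ h1).trans (map_zero _)
  rw [chartMap_hypersurfacePiece_appLE] at h2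
  have h3 := (Scheme.ΓSpecIso _).symm.commRingCatIsoToRingEquiv.injective
    (h2.trans (map_zero _).symm)
  have h4 := Ideal.mem_map_of_mem (chartMap n k j) (Ideal.Quotient.eq_zero_iff_mem.mp h3)
  rwa [Ideal.map_span, Set.image_singleton] at h4

lemma chartSection_mem_hypersurfacePiece_ker {d : ℕ}
    (f : homogeneousSubmodule (Fin (n + 1)) k d) (j l : Fin (n + 1)) :
    chartSection f j ∈ (hypersurfacePiece f l).ker.ideal (chart n k j) := by
  rw [Scheme.Hom.ker_apply, RingHom.mem_ker]
  set g := hypersurfacePiece f l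
  have hg := top_le_preimage_hypersurfacePiece f l
  set V : (PP n k).Opens := (chart n k j).1 ⊓ (chart n k l).1
  have hV : g ⁻¹ᵁ (chart n k j).1 ≤ g ⁻¹ᵁ V := fun x hx => ⟨hx, hg trivial⟩
  have h1 : g.app (chart n k j).1 = (PP n k).presheaf.map
      (homOfLE (inf_le_left : V ≤ (chart n k j).1)).op ≫ g.appLE V _ hV := by
    rw [Scheme.Hom.map_appLE, Scheme.Hom.app_eq_appLE]
  have h2 := map_chartSection_eq f j l (V := V) inf_le_left inf_le_right
  have h3 : (PP n k).presheaf.map (homOfLE (inf_le_right : V ≤ (chart n k l).1)).op ≫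
      g.appLE V _ hV = g.appLE (chart n k l).1 ⊤ hg ≫
        (Spec _).presheaf.map (homOfLE (le_top : g ⁻¹ᵁ (chart n k j).1 ≤ ⊤)).op := by
    rw [Scheme.Hom.map_appLE, Scheme.Hom.appLE_map]
  have h4 : g.appLE (chart n k l).1 ⊤ hg (chartSection f l) = 0 := by
    refine (chartMap_hypersurfacePiece_appLE f l _).trans ?_
    rw [Ideal.Quotient.eq_zero_iff_mem.mpr (Ideal.mem_span_singleton_self _)]
    exact map_zero _
  have h5 := congr($(h3).hom (chartSection f l))
  have h6 : g.appLE V _ hV ((PP n k).presheaf.map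
      (homOfLE (inf_le_left : V ≤ (chart n k j).1)).op (chartSection f j)) = 0 := by
    rw [h2, map_mul]
    refine mul_eq_zero_of_right _ (h5.trans ?_)
    rw [CommRingCat.hom_comp, RingHom.comp_apply]
    exact (congrArg _ h4).trans (map_zero _)
  rw [h1]
  exact h6

/-- The piece over the chart itself gives one inclusion. For the other, the equation must vanish on
the pieces over all other charts too, which is the transition rule. -/
lemma ideal_hypersurface {d : ℕ} (f : homogeneousSubmodule (Fin (n + 1)) k d)
    (j : Fin (n + 1)) :
    (hypersurface f).ideal (chart n k j) = Ideal.span {chartSection f j} := by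
  rw [hypersurface_eq, Scheme.IdealSheafData.ideal_iInf, iInf_apply]
  refine le_antisymm ((iInf_le _ j).trans (hypersurfacePiece_ker_ideal_self f j)) ?_
  rw [Ideal.span_singleton_le_iff_mem, Submodule.mem_iInf]
  exact fun l => chartSection_mem_hypersurfacePiece_ker f j l

lemma hypersurface_smul {d : ℕ} {c : k} (hc : c ≠ 0)
    (f : homogeneousSubmodule (Fin (n + 1)) k d) : hypersurface (c • f) = hypersurface f := by
  refine Scheme.IdealSheafData.ext_of_iSup_eq_top (chart n k) (iSup_chart n k) fun j => ?_
  rw [ideal_hypersurface, ideal_hypersurface, chartSection_smul,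
    Ideal.span_singleton_mul_left_unit ((IsUnit.mk0 c hc).map _)]

end Hypersurface

/-! ### Forms generating an ideal sheaf -/

section Generation

open MvPolynomial

variable {k : Type u} [Field k] {n : ℕ}

/-- The form `x_j ^ a`. -/
def powForm (n : ℕ) (k : Type u) [Field k] (j : Fin (n + 1)) (a : ℕ) :
    homogeneousSubmodule (Fin (n + 1)) k a :=
  ⟨X j ^ a, isHomogeneous_X_pow j a⟩

lemma chartSection_powForm (j l : Fin (n + 1)) (a : ℕ) :
    chartSection (powForm n k j a) l = chartSection (coordinate n k j) l ^ a := by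
  rw [chartSection_eq_eval₂, powForm]; simp

/-- The equation vanishes along `Z` on the overlap of the two charts, where `x_j / x_l` is
invertible; a power of it clears the denominators. -/
lemma exists_pow_mul_chartSection_mem (Z : (PP n k).IdealSheafData) {d : ℕ} (j l : Fin (n + 1))
    (f : homogeneousSubmodule (Fin (n + 1)) k d)
    (hf : chartSection f j ∈ Z.ideal (chart n k j)) :
    ∃ N, chartSection (coordinate n k j) l ^ N * chartSection f l ∈ Z.ideal (chart n k l) := by
  set x := chartSection (coordinate n k j) l
  have hl : IsAffineOpen (chart n k l).1 := (chart n k l).2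
  let W : (PP n k).affineOpens := (PP n k).affineBasicOpen (U := chart n k l) x
  have hWl : W.1 ≤ (chart n k l).1 := (PP n k).basicOpen_le x
  have hWj : W.1 ≤ (chart n k j).1 := basicOpen_chartSection_le j l
  have h1 : (PP n k).presheaf.map (homOfLE hWl).op (chartSection f l) ∈ Z.ideal W := by
    rw [map_chartSection_eq f l j hWl hWj]
    exact Ideal.mul_mem_left _ _ (Z.ideal_le_comap_ideal (U := W) (V := chart n k j) hWj hf)
  rw [← Z.map_ideal (U := W) (V := chart n k l) hWl] at h1
  have := hl.isLocalization_basicOpen x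
  have h2 : (PP n k).presheaf.map (homOfLE hWl).op (chartSection f l) ∈
    (Z.ideal (chart n k l)).map
      (algebraMap Γ(PP n k, (chart n k l).1) Γ(PP n k, (PP n k).basicOpen x)) := h1
  obtain ⟨⟨s, ⟨_, N, rfl⟩⟩, h3⟩ :=
    (IsLocalization.mem_map_algebraMap_iff (.powers x) Γ(PP n k, (PP n k).basicOpen x)).mp h2
  have h4 : algebraMap Γ(PP n k, (chart n k l).1) Γ(PP n k, (PP n k).basicOpen x)
      (chartSection f l * x ^ N) = algebraMap _ _ s.1 := by
    rw [map_mul]; exact h3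
  obtain ⟨⟨_, N', rfl⟩, h5⟩ := (IsLocalization.eq_iff_exists (.powers x) _).mp h4
  refine ⟨N' + N, ?_⟩
  rw [pow_add, mul_assoc, mul_comm (x ^ N)]
  exact h5 ▸ Ideal.mul_mem_left _ _ s.2

/-- Multiplying a form by a high power of `x_j` makes it vanish along `Z` on the other charts and
leaves its dehomogenization at `x_j` unchanged. This also raises the degree freely. -/
lemma exists_form_chartSection_eq (Z : (PP n k).IdealSheafData) (j : Fin (n + 1))
    {r : Γ(PP n k, (chart n k j).1)} (hr : r ∈ Z.ideal (chart n k j)) :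
    ∃ e, ∀ d ≥ e, ∃ f ∈ formsThrough Z d, chartSection f j = r := by
  obtain ⟨D, G, rfl⟩ := exists_chartSection_eq j r
  choose N hN using fun l => exists_pow_mul_chartSection_mem Z j l G hr
  refine ⟨(Finset.univ.sup N) + D, fun d hd => ?_⟩
  obtain ⟨a, rfl⟩ : ∃ a, d = a + D := ⟨d - D, by omega⟩
  refine ⟨mulForm (powForm n k j a) G, fun l => ?_, ?_⟩
  · rw [chartSection_mul, chartSection_powForm]
    have h1 : N l ≤ a := (Finset.le_sup (Finset.mem_univ l)).trans (by omega)
    obtain ⟨b, rfl⟩ := Nat.exists_eq_add_of_le h1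
    rw [pow_add, mul_comm (_ ^ N l), mul_assoc]
    exact Ideal.mul_mem_left _ _ (hN l)
  · rw [chartSection_mul, chartSection_powForm, chartSection_coordinate_self, one_pow, one_mul]

lemma exists_span_chartSection_eq (Z : (PP n k).IdealSheafData) :
    ∃ e, ∀ d ≥ e, ∀ j, Ideal.span
      (Set.range fun f : formsThrough Z d => chartSection f.1 j) = Z.ideal (chart n k j) := by
  have h1 : ∀ j, ∃ e, ∀ d ≥ e, Z.ideal (chart n k j) ≤
      Ideal.span (Set.range fun f : formsThrough Z d => chartSection f.1 j) := by
    intro j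
    obtain ⟨S, hS⟩ := IsNoetherian.noetherian (Z.ideal (chart n k j))
    have h2 : ∀ r : S, ∃ e, ∀ d ≥ e, ∃ f ∈ formsThrough Z d, chartSection f j = r.1 :=
      fun r => exists_form_chartSection_eq Z j (hS ▸ Ideal.subset_span r.2)
    choose e he using h2
    refine ⟨Finset.univ.sup e, fun d hd => ?_⟩
    rw [← hS]
    refine Ideal.span_le.mpr fun r hr => ?_
    obtain ⟨f, hf, hfr⟩ := he ⟨r, hr⟩ d ((Finset.le_sup (Finset.mem_univ _)).trans hd)
    exact Ideal.subset_span ⟨⟨f, hf⟩, hfr⟩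
  choose e he using h1
  refine ⟨Finset.univ.sup e, fun d hd j => le_antisymm ?_
    (he j d ((Finset.le_sup (Finset.mem_univ j)).trans hd))⟩
  rw [Ideal.span_le]
  rintro _ ⟨f, rfl⟩
  exact f.2 j

instance (d : ℕ) : Module.Finite k (homogeneousSubmodule (Fin (n + 1)) k d) :=
  Module.Finite.iff_fg.mpr (homogeneousSubmodule_fg _ _ d)

instance (Z : (PP n k).IdealSheafData) (d : ℕ) : Module.Finite k (formsThrough Z d) :=
  inferInstance

end Generation
/-! ### Points of affine opens as prime ideals -/

section Points

variable {X Y : Scheme.{u}}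

/-- The prime ideal of the ring of functions on an affine open that corresponds to a point. -/
def primeAt (U : X.affineOpens) {x : X} (hx : x ∈ U.1) : Ideal Γ(X, U.1) :=
  (IsAffineOpen.primeIdealOf U.2 ⟨x, hx⟩).asIdeal

instance (U : X.affineOpens) {x : X} (hx : x ∈ U.1) : (primeAt U hx).IsPrime :=
  (IsAffineOpen.primeIdealOf U.2 ⟨x, hx⟩).isPrime

lemma mem_primeAt_iff (U : X.affineOpens) {x : X} (hx : x ∈ U.1) (a : Γ(X, U.1)) :
    a ∈ primeAt U hx ↔ x ∉ X.basicOpen a := by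
  have hU : IsAffineOpen U.1 := U.2
  have h1 := hU.fromSpec_preimage_basicOpen a
  have h2 := hU.fromSpec_primeIdealOf ⟨x, hx⟩
  have h3 : hU.primeIdealOf ⟨x, hx⟩ ∈ hU.fromSpec ⁻¹ᵁ X.basicOpen a ↔ x ∈ X.basicOpen a := by
    change hU.fromSpec _ ∈ X.basicOpen a ↔ _
    rw [h2]
  rw [← not_iff_not, not_not, ← h3, h1]
  rfl

lemma notMem_primeAt_iff (U : X.affineOpens) {x : X} (hx : x ∈ U.1) (a : Γ(X, U.1)) :
    a ∉ primeAt U hx ↔ IsUnit (X.presheaf.germ U.1 x hx a) := by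
  rw [mem_primeAt_iff, not_not, Scheme.mem_basicOpen _ _ _ hx]

lemma exists_primeAt_eq (U : X.affineOpens) (p : Ideal Γ(X, U.1)) [hp : p.IsPrime] :
    ∃ (x : X) (hx : x ∈ U.1), primeAt U hx = p := by
  have hU : IsAffineOpen U.1 := U.2
  obtain ⟨x, hx⟩ := (TopCat.homeoOfIso (Scheme.forgetToTop.mapIso hU.isoSpec)).surjective
    ⟨p, hp⟩
  exact ⟨x.1, x.2, congrArg PrimeSpectrum.asIdeal hx⟩

lemma primeAt_injective (U : X.affineOpens) {x y : X} (hx : x ∈ U.1) (hy : y ∈ U.1)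
    (h : primeAt U hx = primeAt U hy) : x = y := by
  have hU : IsAffineOpen U.1 := U.2
  have h1 := hU.fromSpec_primeIdealOf ⟨x, hx⟩
  have h2 := hU.fromSpec_primeIdealOf ⟨y, hy⟩
  have h3 : hU.primeIdealOf ⟨x, hx⟩ = hU.primeIdealOf ⟨y, hy⟩ := PrimeSpectrum.ext h
  rw [h3] at h1
  exact h1.symm.trans h2

lemma mem_support_iff_ideal_le (I : X.IdealSheafData) (U : X.affineOpens) {x : X}
    (hx : x ∈ U.1) : x ∈ I.support ↔ I.ideal U ≤ primeAt U hx := by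
  rw [Scheme.IdealSheafData.mem_support_iff_of_mem (U := U) hx, Scheme.mem_zeroLocus_iff]
  exact forall₂_congr fun a _ => (mem_primeAt_iff U hx a).symm

lemma isLocalization_stalk_primeAt (U : X.affineOpens) {x : X} (hx : x ∈ U.1) :
    letI := (X.presheaf.germ U.1 x hx).hom.toAlgebra
    IsLocalization.AtPrime (X.presheaf.stalk x) (primeAt U hx) :=
  IsAffineOpen.isLocalization_stalk U.2 ⟨x, hx⟩

lemma nonempty_stalk_equiv (U : X.affineOpens) {x : X} (hx : x ∈ U.1) :
    Nonempty (X.presheaf.stalk x ≃+* Localization.AtPrime (primeAt U hx)) := by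
  let := (X.presheaf.germ U.1 x hx).hom.toAlgebra
  have := isLocalization_stalk_primeAt U hx
  exact ⟨(IsLocalization.algEquiv (primeAt U hx).primeCompl (X.presheaf.stalk x)
    (Localization.AtPrime (primeAt U hx))).toRingEquiv⟩

lemma comap_primeAt (f : X ⟶ Y) (U : X.affineOpens) (V : Y.affineOpens)
    (h : U.1 ≤ f ⁻¹ᵁ V.1) {x : X} (hx : x ∈ U.1) :
    (primeAt U hx).comap (f.appLE V.1 U.1 h).hom = primeAt V (h hx) :=
  congrArg PrimeSpectrum.asIdeal
    (IsAffineOpen.comap_primeIdealOf_appLE V.1 V.2 U.1 U.2 h hx)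

/-- An immersion need not be closed on `U`, so functions on `U` need not be restrictions from the
chart. Surjectivity on stalks still makes them fractions of restrictions near each point. -/
lemma exists_mul_mul_eq_of_surjectiveOnStalks (f : X ⟶ Y) [SurjectiveOnStalks f]
    (U : X.affineOpens) (V : Y.affineOpens) (h : U.1 ≤ f ⁻¹ᵁ V.1) (p : Ideal Γ(X, U.1))
    [p.IsPrime] (b : Γ(X, U.1)) :
    ∃ s t : Γ(Y, V.1), ∃ c ∉ p, f.appLE V.1 U.1 h s ∉ p ∧
      c * (f.appLE V.1 U.1 h s * b) = c * f.appLE V.1 U.1 h t := by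
  obtain ⟨x, hx, rfl⟩ := exists_primeAt_eq U p
  have hfx : f x ∈ V.1 := h hx
  let := (Y.presheaf.germ V.1 (f x) hfx).hom.toAlgebra
  have hloc := isLocalization_stalk_primeAt V hfx
  let := (X.presheaf.germ U.1 x hx).hom.toAlgebra
  have hloc' := isLocalization_stalk_primeAt U hx
  obtain ⟨y, hy⟩ := f.stalkMap_surjective x (X.presheaf.germ U.1 x hx b)
  obtain ⟨⟨t, s⟩, hts⟩ := IsLocalization.surj (primeAt V hfx).primeCompl y
  have hg : ∀ r : Γ(Y, V.1), f.stalkMap x (Y.presheaf.germ V.1 (f x) hfx r) =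
      X.presheaf.germ U.1 x hx (f.appLE V.1 U.1 h r) := by
    intro r
    rw [Scheme.Hom.germ_stalkMap_apply, Scheme.Hom.appLE, CommRingCat.comp_apply,
      TopCat.Presheaf.germ_res_apply]
  have hs : f.appLE V.1 U.1 h s.1 ∉ primeAt U hx := by
    exact fun h0 => s.2 ((comap_primeAt f U V h hx).le h0)
  have h1 : X.presheaf.germ U.1 x hx (f.appLE V.1 U.1 h s.1 * b) =
      X.presheaf.germ U.1 x hx (f.appLE V.1 U.1 h t) := by
    have h2 := congrArg (f.stalkMap x) hts
    rw [map_mul, hy] at h2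
    change _ * f.stalkMap x (Y.presheaf.germ V.1 (f x) hfx s.1) =
      f.stalkMap x (Y.presheaf.germ V.1 (f x) hfx t) at h2
    rw [hg, hg] at h2
    rw [map_mul, mul_comm, h2]
  obtain ⟨c, hc⟩ := (IsLocalization.eq_iff_exists (primeAt U hx).primeCompl
    (X.presheaf.stalk x)).mp h1
  exact ⟨s.1, t, c.1, c.2, hs, hc⟩

lemma exists_mul_sub_mem_of_surjectiveOnStalks (f : X ⟶ Y) [SurjectiveOnStalks f]
    (U : X.affineOpens) (V : Y.affineOpens) (h : U.1 ≤ f ⁻¹ᵁ V.1) (p : Ideal Γ(X, U.1))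
    [p.IsPrime] (b : Γ(X, U.1)) :
    ∃ s t : Γ(Y, V.1), f.appLE V.1 U.1 h s ∉ p ∧
      f.appLE V.1 U.1 h s * b - f.appLE V.1 U.1 h t ∈ p := by
  obtain ⟨s, t, c, hc, hs, h1⟩ := exists_mul_mul_eq_of_surjectiveOnStalks f U V h p b
  have h3 : c * (f.appLE V.1 U.1 h s * b - f.appLE V.1 U.1 h t) ∈ p := by
    rw [mul_sub, h1, sub_self]; exact zero_mem _
  exact ⟨s, t, hs, (Ideal.IsPrime.mem_or_mem inferInstance h3).resolve_left hc⟩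

end Points

/-! ### Restriction of forms to affine opens -/

section Restriction

variable {k : Type u} [Field k] {n : ℕ} {X : Scheme.{u}} (i : X ⟶ PP n k)

/-- The restriction of functions on a chart to an affine open of `X`. -/
def restr (U : X.affineOpens) (j : Fin (n + 1)) (h : U.1 ≤ i ⁻¹ᵁ (chart n k j).1) :
    Γ(PP n k, (chart n k j).1) →+* Γ(X, U.1) := (i.appLE (chart n k j).1 U.1 h).hom

variable {i} {U : X.affineOpens} {j : Fin (n + 1)} (h : U.1 ≤ i ⁻¹ᵁ (chart n k j).1)

/-- The `k`-algebra structure on the functions on an affine open of `X`. -/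
abbrev sectionsAlgebra : Algebra k Γ(X, U.1) := ((restr i U j h).comp (chartCoeff n k j)).toAlgebra

/-- The restriction of forms to an affine open of `X`, after dehomogenization. -/
def restrForm (Z : (PP n k).IdealSheafData) (d : ℕ) :
    letI := sectionsAlgebra h
    formsThrough Z d →ₗ[k] Γ(X, U.1) :=
  letI := sectionsAlgebra h
  { toFun f := restr i U j h (chartSection f.1 j)
    map_add' f g := by
      rw [Submodule.coe_add, chartSection_add, map_add]
    map_smul' c f := by
      rw [Submodule.coe_smul, chartSection_smul, map_mul, Algebra.smul_def]; rfl }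

lemma restrForm_apply (Z : (PP n k).IdealSheafData) (d : ℕ) (f : formsThrough Z d) :
    letI := sectionsAlgebra h
    restrForm h Z d f = restr i U j h (chartSection f.1 j) := rfl

lemma sectionsAlgebra_finiteType [LocallyOfFiniteType i] :
    letI := sectionsAlgebra h
    Algebra.FiniteType k Γ(X, U.1) :=
  RingHom.FiniteType.comp (i.finiteType_appLE (chart n k j).2 U.2 h) (chartCoeff_finiteType j)

lemma isNoetherianRing_sections (h : U.1 ≤ i ⁻¹ᵁ (chart n k j).1) [LocallyOfFiniteType i] :
    IsNoetherianRing Γ(X, U.1) := by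
  let := sectionsAlgebra h
  have := sectionsAlgebra_finiteType h
  exact Algebra.FiniteType.isNoetherianRing k _

lemma ideal_comap_hypersurface {d : ℕ}
    (f : MvPolynomial.homogeneousSubmodule (Fin (n + 1)) k d) :
    ((hypersurface f).comap i).ideal U = Ideal.span {restr i U j h (chartSection f j)} := by
  rw [ideal_comap _ i U (chart n k j) h, ideal_hypersurface, Ideal.map_span, Set.image_singleton]
  rfl

lemma mem_support_comap_hypersurface {d : ℕ}
    (f : MvPolynomial.homogeneousSubmodule (Fin (n + 1)) k d) {x : X} (hx : x ∈ U.1) :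
    x ∈ ((hypersurface f).comap i).support ↔
      restr i U j h (chartSection f j) ∈ primeAt U hx := by
  rw [mem_support_iff_ideal_le _ U hx, ideal_comap_hypersurface h, Ideal.span_singleton_le_iff_mem]

lemma restr_mem_adjoin (r : Γ(PP n k, (chart n k j).1)) :
    letI := sectionsAlgebra h
    restr i U j h r ∈ Algebra.adjoin k
      (Set.range fun l => restr i U j h (chartSection (coordinate n k l) j)) := by
  let := sectionsAlgebra h
  obtain ⟨d, f, rfl⟩ := exists_chartSection_eq j r
  rw [chartSection_eq_eval₂, MvPolynomial.hom_eval₂]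
  change MvPolynomial.eval₂ (algebraMap k Γ(X, U.1)) _ _ ∈ _
  rw [← MvPolynomial.aeval_def, Algebra.adjoin_range_eq_range_aeval]
  exact ⟨_, rfl⟩

lemma notMem_support_iff (Z : (PP n k).IdealSheafData) {d : ℕ} (hd : ∀ j, Ideal.span
      (Set.range fun f : formsThrough Z d => chartSection f.1 j) = Z.ideal (chart n k j))
    {x : X} (hx : x ∈ U.1) :
    i x ∉ Z.support ↔ ∃ f : formsThrough Z d,
      restr i U j h (chartSection f.1 j) ∉ primeAt U hx := by
  rw [mem_support_iff_ideal_le Z (chart n k j) (h hx), ← hd j, Ideal.span_le,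
    ← comap_primeAt i U (chart n k j) h hx, Set.range_subset_iff, not_forall]
  rfl

/-- Forms `x_l w`, with `w` of degree `d` through `Z` and nonzero at the point, have ratios `x_l /
x_j`. So the forms of degree `1 + d` separate tangent directions outside `Z`. -/
theorem isGeneric_restr_mul_notMem_sq [Infinite k] [IsImmersion i]
    (Z : (PP n k).IdealSheafData) {d : ℕ} (hd : ∀ j, Ideal.span
      (Set.range fun f : formsThrough Z d => chartSection f.1 j) = Z.ideal (chart n k j))
    (hd' : ∀ j, Ideal.span (Set.range fun f : formsThrough Z (1 + d) => chartSection f.1 j) =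
      Z.ideal (chart n k j)) :
    IsGeneric k {f : formsThrough Z (1 + d) | ∀ (x : X) (hx : x ∈ U.1), i x ∉ Z.support →
      ∀ s ∉ primeAt U hx, s * restr i U j h (chartSection f.1 j) ∉ primeAt U hx ^ 2} := by
  let := sectionsAlgebra h
  have := sectionsAlgebra_finiteType h
  refine (isGeneric_mul_notMem_sq k (restrForm h Z (1 + d))
    (fun l => restr i U j h (chartSection (coordinate n k l) j)) ?_ ?_).mono ?_
  · intro p _ hp
    obtain ⟨x, hx, rfl⟩ := exists_primeAt_eq U p
    obtain ⟨w, hw⟩ := (notMem_support_iff h Z hd hx).mp ((notMem_support_iff h Z hd' hx).mpr hp)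
    have key : ∀ l, ∃ v : formsThrough Z (1 + d), chartSection v.1 j =
        chartSection (coordinate n k l) j * chartSection w.1 j := by
      intro l
      refine ⟨⟨mulForm (coordinate n k l) w.1, fun l' => ?_⟩, chartSection_mul _ _ _⟩
      rw [chartSection_mul]
      exact Ideal.mul_mem_left _ _ (w.2 l')
    obtain ⟨v₀, hv₀⟩ := key j
    rw [chartSection_coordinate_self, one_mul] at hv₀
    refine ⟨v₀, ?_, fun l => ?_⟩
    · rwa [restrForm_apply, hv₀]
    · obtain ⟨v, hv⟩ := key l
      exact ⟨v, by rw [restrForm_apply, restrForm_apply, hv, hv₀, map_mul, mul_comm]⟩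
  · intro p _ b
    obtain ⟨s, t, hs, ht⟩ := exists_mul_sub_mem_of_surjectiveOnStalks i U (chart n k j) h p b
    exact ⟨_, restr_mem_adjoin h s, _, restr_mem_adjoin h t, hs, ht⟩
  · intro f hf x hx hxZ s hs
    exact hf (primeAt U hx) ((notMem_support_iff h Z hd' hx).mp hxZ) s hs

end Restriction
-- Specializations, and points with trivial local rings
section Specialization

variable {X Y : Scheme.{u}}

lemma primeAt_le_of_specializes (U : X.affineOpens) {x y : X} (hx : x ∈ U.1) (hy : y ∈ U.1)
    (h : y ⤳ x) : primeAt U hy ≤ primeAt U hx := by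
  intro a ha
  rw [mem_primeAt_iff] at ha ⊢
  exact fun hxa => ha (h.mem_open (X.basicOpen a).2 hxa)

lemma specializes_of_primeAt_le (U : X.affineOpens) {x y : X} (hx : x ∈ U.1) (hy : y ∈ U.1)
    (h : primeAt U hy ≤ primeAt U hx) : y ⤳ x := by
  have hU : IsAffineOpen U.1 := U.2
  have h1 : hU.primeIdealOf ⟨y, hy⟩ ⤳ hU.primeIdealOf ⟨x, hx⟩ :=
    (PrimeSpectrum.le_iff_specializes _ _).mp h
  have h2 := h1.map hU.fromSpec.continuous
  rwa [hU.fromSpec_primeIdealOf, hU.fromSpec_primeIdealOf] at h2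

lemma exists_mul_eq_zero_of_isField_stalk (U : X.affineOpens) {x : X} (hx : x ∈ U.1)
    (h : IsField (X.presheaf.stalk x)) {a : Γ(X, U.1)} (ha : a ∈ primeAt U hx) :
    ∃ s ∉ primeAt U hx, s * a = 0 := by
  let := (X.presheaf.germ U.1 x hx).hom.toAlgebra
  have := isLocalization_stalk_primeAt U hx
  have h1 : algebraMap Γ(X, U.1) (X.presheaf.stalk x) a = 0 := by
    by_contra h0
    obtain ⟨b, hb⟩ := h.mul_inv_cancel h0
    exact (notMem_primeAt_iff U hx a).mpr (IsUnit.of_mul_eq_one _ hb) ha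
  obtain ⟨s, hs⟩ := (IsLocalization.map_eq_zero_iff (primeAt U hx).primeCompl _ a).mp h1
  exact ⟨s.1, s.2, hs⟩

/-- A closed point whose local ring is a field is a whole component of dimension zero. -/
lemma not_isField_stalk {m : ℕ} (hm : 1 ≤ m)
    (hX : ∀ C ∈ irreducibleComponents X, topologicalKrullDim C = (m : WithBot ℕ∞)) {x : X}
    (hx : IsClosed {x}) : ¬ IsField (X.presheaf.stalk x) := by
  intro h
  obtain ⟨U, hU, hxU, -⟩ := exists_isAffineOpen_mem_and_subset
    (TopologicalSpace.Opens.mem_top x)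
  let U' : X.affineOpens := ⟨U, hU⟩
  have hirr := isIrreducible_irreducibleComponent (x := x)
  set η := hirr.genericPoint
  have hη : closure {η} = irreducibleComponent x := by
    rw [hirr.genericPoint_closure_eq, isClosed_irreducibleComponent.closure_eq]
  have h1 : η ⤳ x := by
    rw [specializes_iff_mem_closure, hη]; exact mem_irreducibleComponent
  have hηU : η ∈ U := h1.mem_open U.2 hxU
  have hp : (primeAt U' hηU).IsPrime := (IsAffineOpen.primeIdealOf hU ⟨η, hηU⟩).isPrime
  have h2 : primeAt U' hxU ≤ primeAt U' hηU := by
    intro a ha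
    obtain ⟨s, hs, hsa⟩ := exists_mul_eq_zero_of_isField_stalk U' hxU h ha
    refine (hp.mem_or_mem
      (hsa ▸ zero_mem _ : s * a ∈ primeAt U' hηU)).resolve_left fun h3 => ?_
    exact hs (primeAt_le_of_specializes U' hxU hηU h1 h3)
  have h3 : η = x := primeAt_injective U' hηU hxU
    (le_antisymm (primeAt_le_of_specializes U' hxU hηU h1) h2)
  have h4 : irreducibleComponent x = {x} := by rw [← hη, h3, hx.closure_eq]
  have h5 := hX _ (irreducibleComponent_mem_irreducibleComponents x)
  rw [h4] at h5
  have h6 := topologicalKrullDim_zero_of_discreteTopology ({x} : Set X)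
  rw [h5] at h6
  have h7 : m ≤ 0 := by exact_mod_cast h6
  omega

lemma exists_mul_eq_zero_of_isArtinianRing {B : Type*} [CommRing B] [IsArtinianRing B]
    [_root_.IsReduced B] (p : Ideal B) [p.IsPrime] {a : B} (ha : a ∈ p) :
    ∃ s ∉ p, s * a = 0 := by
  have h0 : ringKrullDim (Localization.AtPrime p) ≤ (0 : ℕ) := by
    have : IsArtinianRing (Localization.AtPrime p) := inferInstance
    exact Ring.krullDimLE_iff.mp (isArtinianRing_iff_krullDimLE_zero.mp this)
  have h1 : IsField (Localization.AtPrime p) := isField_of_isReduced h0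
  have h2 : algebraMap B (Localization.AtPrime p) a = 0 := by
    by_contra h0
    obtain ⟨b, hb⟩ := h1.mul_inv_cancel h0
    exact (IsLocalization.AtPrime.isUnit_to_map_iff _ p a).mp (IsUnit.of_mul_eq_one _ hb) ha
  obtain ⟨s, hs⟩ := (IsLocalization.map_eq_zero_iff p.primeCompl _ a).mp h2
  exact ⟨s.1, s.2, hs⟩

/-- The local rings of a reduced Artinian scheme are fields, so near such a point the ideal sheaf is
the full ideal of the point. -/
lemma exists_mul_mem_ideal_of_isReduced (I : Y.IdealSheafData)
    [AlgebraicGeometry.IsReduced I.subscheme] [IsLocallyArtinian I.subscheme] (V : Y.affineOpens)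
    {y : Y} (hy : y ∈ V.1) (hyI : y ∈ I.support) {a : Γ(Y, V.1)} (ha : a ∈ primeAt V hy) :
    ∃ s ∉ primeAt V hy, s * a ∈ I.ideal V := by
  have hr := I.range_subschemeι
  obtain ⟨z, rfl⟩ : y ∈ Set.range I.subschemeι := by rw [hr]; exact hyI
  have hV : IsAffineOpen V.1 := V.2
  let W : I.subscheme.affineOpens := ⟨I.subschemeι ⁻¹ᵁ V.1, hV.preimage I.subschemeι⟩
  have hz : z ∈ W.1 := hy
  have h1 := comap_primeAt I.subschemeι W V le_rfl hz
  rw [Scheme.Hom.appLE_eq_app] at h1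
  have : IsArtinianRing Γ(I.subscheme, W.1) := IsLocallyArtinian.isArtinianRing_presheaf_obj W
  have hp : (primeAt W hz).IsPrime := (IsAffineOpen.primeIdealOf W.2 ⟨z, hz⟩).isPrime
  have ha' : I.subschemeι.app V.1 a ∈ primeAt W hz := h1.ge ha
  obtain ⟨t, ht, hta⟩ := exists_mul_eq_zero_of_isArtinianRing (primeAt W hz) ha'
  obtain ⟨s, rfl⟩ := I.subschemeι_app_surjective V t
  refine ⟨s, fun hs => ht (h1.ge hs), ?_⟩
  rw [← I.ker_subschemeι_app V, RingHom.mem_ker, map_mul]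
  exact hta

lemma isLocallyArtinian_of_isFinite {k : Type u} [Field k] (f : Y ⟶ Spec (.of k)) [IsFinite f] :
    IsArtinianScheme Y := by
  have : IsAffine Y := isAffine_of_isAffineHom f
  have h1 := f.finite_appTop
  have : IsArtinianRing Γ(Spec (.of k), ⊤) :=
    (Scheme.ΓSpecIso (.of k)).symm.commRingCatIsoToRingEquiv.surjective.isArtinianRing
  let := f.appTop.hom.toAlgebra
  have : Module.Finite Γ(Spec (.of k), ⊤) Γ(Y, ⊤) := h1
  have : IsArtinianRing Γ(Y, ⊤) := IsArtinianRing.of_finite Γ(Spec (.of k), ⊤) _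
  have : IsLocallyArtinian Y := .of_isImmersion Y.isoSpec.hom
  exact {}

end Specialization
-- The behaviour of forms at the points of `Z`
section BasePoints

variable {k : Type u} [Field k] {n m : ℕ} {X : Scheme.{u}}

lemma isNoetherian_of_isImmersion (i : X ⟶ PP n k) [IsImmersion i] :
    AlgebraicGeometry.IsNoetherian X := by
  have := LocallyOfFiniteType.isLocallyNoetherian i
  have : TopologicalSpace.NoetherianSpace X := i.isEmbedding.isInducing.noetherianSpace
  exact {}

lemma exists_affineOpen_le_chart (i : X ⟶ PP n k) (x : X) : ∃ (U : X.affineOpens) (j : Fin (n + 1)),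
    U.1 ≤ i ⁻¹ᵁ (chart n k j).1 ∧ x ∈ U.1 := by
  obtain ⟨j, hj⟩ := TopologicalSpace.Opens.mem_iSup.mp
    ((iSup_chart n k).ge (TopologicalSpace.Opens.mem_top (i x)))
  obtain ⟨U, hU, hxU, h⟩ := exists_isAffineOpen_mem_and_subset
    (show x ∈ i ⁻¹ᵁ (chart n k j).1 from hj)
  exact ⟨⟨U, hU⟩, j, h, hxU⟩

lemma exists_finite_affine_cover (i : X ⟶ PP n k) [IsImmersion i] :
    ∃ (t : Set X) (U : X → X.affineOpens) (j : X → Fin (n + 1)),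
    t.Finite ∧ (∀ y, (U y).1 ≤ i ⁻¹ᵁ (chart n k (j y)).1) ∧ ∀ x, ∃ y ∈ t, x ∈ (U y).1 := by
  have := isNoetherian_of_isImmersion i
  choose U j h hx using exists_affineOpen_le_chart i
  obtain ⟨t, ht⟩ := CompactSpace.elim_nhds_subcover (fun x => ((U x).1 : Set X))
    (fun x => (U x).1.2.mem_nhds (hx x))
  refine ⟨t, U, j, t.finite_toSet, h, fun x => ?_⟩
  have h1 := ht.ge (Set.mem_univ x)
  obtain ⟨y, hy, hxy⟩ := Set.mem_iUnion₂.mp h1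
  exact ⟨y, hy, hxy⟩

variable {i : X ⟶ PP n k} {Z : (PP n k).IdealSheafData}

lemma restr_eq_zero_of_mem_ker {U : X.affineOpens} {j : Fin (n + 1)}
    (h : U.1 ≤ i ⁻¹ᵁ (chart n k j).1) {s : Γ(PP n k, (chart n k j).1)}
    (hs : s ∈ i.ker.ideal (chart n k j)) : restr i U j h s = 0 := by
  have h1 := Scheme.Hom.ideal_ker_le _ _ hs
  rw [RingHom.mem_ker] at h1
  change i.appLE _ _ h s = 0
  rw [Scheme.Hom.appLE, CommRingCat.comp_apply]
  exact (congrArg _ h1).trans (map_zero _)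

lemma mem_support_sup_ker {x : X} (hx : i x ∈ Z.support) : i x ∈ (Z ⊔ i.ker).support := by
  obtain ⟨j, hj⟩ := TopologicalSpace.Opens.mem_iSup.mp
    ((iSup_chart n k).ge (TopologicalSpace.Opens.mem_top (i x)))
  rw [mem_support_iff_ideal_le _ (chart n k j) hj, Scheme.IdealSheafData.ideal_sup]
  exact sup_le ((mem_support_iff_ideal_le _ (chart n k j) hj).mp hx)
    ((mem_support_iff_ideal_le _ (chart n k j) hj).mp (i.range_subset_ker_support ⟨x, rfl⟩))

lemma isGeneric_notMem_support [Infinite k] {d : ℕ} (hd : ∀ j, Ideal.span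
      (Set.range fun f : formsThrough Z d => chartSection f.1 j) = Z.ideal (chart n k j))
    {x : X} (hx : i x ∉ Z.support) :
    IsGeneric k {f : formsThrough Z d | x ∉ ((hypersurface f.1).comap i).support} := by
  obtain ⟨U, j, h, hxU⟩ := exists_affineOpen_le_chart i x
  let := sectionsAlgebra h
  obtain ⟨v, hv⟩ := (notMem_support_iff h Z hd hxU).mp hx
  refine (isGeneric_notMem_ideal (restrForm h Z d) (primeAt U hxU) hv).mono fun f hf => ?_
  rw [Set.mem_ofPred_eq, mem_support_comap_hypersurface h _ hxU]
  exact hf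

variable [IsImmersion i]

lemma mem_regularLocus_of_mem_support
    (hZreg : ((Z ⊔ i.ker).support : Set (PP n k)) ⊆ i '' regularLocus X) {x : X}
    (hx : i x ∈ Z.support) : x ∈ regularLocus X := by
  obtain ⟨y, hy, hyx⟩ := hZreg (mem_support_sup_ker hx)
  rwa [← i.isEmbedding.injective hyx]

lemma finite_setOf_mem_support (hZ : IsArtinianScheme (Z ⊔ i.ker).subscheme) :
    {x : X | i x ∈ Z.support}.Finite := by
  have h1 : ((Z ⊔ i.ker).support : Set (PP n k)).Finite := by
    rw [← Scheme.IdealSheafData.range_subschemeι]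
    exact Set.finite_range _
  exact (h1.preimage i.isEmbedding.injective.injOn).subset fun x hx => mem_support_sup_ker hx

lemma isClosed_singleton_of_mem_support (hZ : IsArtinianScheme (Z ⊔ i.ker).subscheme) {x : X}
    (hx : i x ∈ Z.support) : IsClosed {x} := by
  obtain ⟨z, hz⟩ : i x ∈ Set.range (Z ⊔ i.ker).subschemeι := by
    rw [Scheme.IdealSheafData.range_subschemeι]; exact mem_support_sup_ker hx
  have h1 : IsClosed {i x} := by
    rw [← hz, ← Set.image_singleton]
    exact (Z ⊔ i.ker).subschemeι.isClosedEmbedding.isClosedMap _ (isClosed_discrete _)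
  have h2 := h1.preimage i.continuous
  rwa [← Set.image_singleton, Set.preimage_image_eq _ i.isEmbedding.injective] at h2

/-- The ideal of `Z` together with `i.ker` is the ideal of the reduced point `i x`, and `i.ker`
restricts to zero on `X`. So `Z` alone generates the maximal ideal of the local ring of `X` at `x`.
-/
lemma exists_mul_mem_map_of_mem_support (hZ : IsArtinianScheme (Z ⊔ i.ker).subscheme)
    (hZred : AlgebraicGeometry.IsReduced (Z ⊔ i.ker).subscheme) {x : X} (hx : i x ∈ Z.support)
    {U : X.affineOpens} {j : Fin (n + 1)} (h : U.1 ≤ i ⁻¹ᵁ (chart n k j).1) (hxU : x ∈ U.1)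
    {a : Γ(X, U.1)} (ha : a ∈ primeAt U hxU) :
    ∃ s ∉ primeAt U hxU, s * a ∈ (Z.ideal (chart n k j)).map (restr i U j h) := by
  obtain ⟨s, t, c, hc, hs, hst⟩ :=
    exists_mul_mul_eq_of_surjectiveOnStalks i U (chart n k j) h (primeAt U hxU) a
  have hix : i x ∈ (chart n k j).1 := h hxU
  have hcomap := comap_primeAt i U (chart n k j) h hxU
  have ht : t ∈ primeAt (chart n k j) hix := by
    refine hcomap.le ?_
    rw [Ideal.mem_comap]
    refine (Ideal.IsPrime.mem_or_mem (I := primeAt U hxU) inferInstance ?_).resolve_left hc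
    change c * i.appLE _ _ h t ∈ _
    rw [← hst]
    exact Ideal.mul_mem_left _ _ (Ideal.mul_mem_left _ _ ha)
  obtain ⟨s', hs', hst'⟩ := exists_mul_mem_ideal_of_isReduced (Z ⊔ i.ker) (chart n k j) hix
    (mem_support_sup_ker hx) ht
  have hs'' : restr i U j h s' ∉ primeAt U hxU := fun h0 => hs' (hcomap.le h0)
  refine ⟨c * restr i U j h s' * restr i U j h s, ?_, ?_⟩
  · intro h0
    rcases Ideal.IsPrime.mem_or_mem inferInstance h0 with h1 | h1
    · rcases Ideal.IsPrime.mem_or_mem inferInstance h1 with h2 | h2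
      · exact hc h2
      · exact hs'' h2
    · exact hs h1
  · have h1 : c * restr i U j h s' * restr i U j h s * a = c * restr i U j h (s' * t) := by
      have hst2 : c * (restr i U j h s * a) = c * restr i U j h t := hst
      rw [map_mul]
      linear_combination (restr i U j h s') * hst2
    rw [h1]
    refine Ideal.mul_mem_left _ _ ?_
    rw [Scheme.IdealSheafData.ideal_sup] at hst'
    obtain ⟨y, hy, w, hw, hyw⟩ := Submodule.mem_sup.mp hst'
    rw [← hyw, map_add, restr_eq_zero_of_mem_ker h hw, add_zero]
    exact Ideal.mem_map_of_mem _ hy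

lemma isField_localization_of_le_sq {A : Type*} [CommRing A] [IsNoetherianRing A] (p : Ideal A)
    [p.IsPrime] (h : ∀ a ∈ p, ∃ s ∉ p, s * a ∈ p ^ 2) : IsField (Localization.AtPrime p) := by
  have : IsNoetherianRing (Localization.AtPrime p) :=
    IsLocalization.isNoetherianRing p.primeCompl _ inferInstance
  rw [IsLocalRing.isField_iff_maximalIdeal_eq]
  refine Submodule.eq_bot_of_le_smul_of_le_jacobson_bot (IsLocalRing.maximalIdeal _) _
    (IsNoetherian.noetherian _) ?_ (IsLocalRing.maximalIdeal_le_jacobson _)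
  rw [smul_eq_mul, ← pow_two]
  conv_lhs => rw [← Localization.AtPrime.map_eq_maximalIdeal]
  rw [Ideal.map_le_iff_le_comap]
  intro a ha
  exact (algebraMap_mem_maximalIdeal_sq_iff p a).mpr (h a ha)

/-- If all forms through `Z` were in `𝔪_x²`, then `𝔪_x = 𝔪_x²`, and the local ring would be a field
by Nakayama; this is impossible at a closed point of a scheme of positive pure dimension. Failure at
one form is a generic condition. -/
lemma isGeneric_mul_notMem_sq_of_mem_support [Infinite k] (hm : 1 ≤ m)
    (hX : ∀ C ∈ irreducibleComponents X, topologicalKrullDim C = (m : WithBot ℕ∞))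
    (hZ : IsArtinianScheme (Z ⊔ i.ker).subscheme)
    (hZred : AlgebraicGeometry.IsReduced (Z ⊔ i.ker).subscheme) {d : ℕ} (hd : ∀ j, Ideal.span
      (Set.range fun f : formsThrough Z d => chartSection f.1 j) = Z.ideal (chart n k j))
    {x : X} (hx : i x ∈ Z.support) {U : X.affineOpens} {j : Fin (n + 1)}
    (h : U.1 ≤ i ⁻¹ᵁ (chart n k j).1) (hxU : x ∈ U.1) :
    IsGeneric k {f : formsThrough Z d | ∀ s ∉ primeAt U hxU,
      s * restr i U j h (chartSection f.1 j) ∉ primeAt U hxU ^ 2} := by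
  let := sectionsAlgebra h
  have := isNoetherianRing_sections h
  set p := primeAt U hxU
  set I := (IsLocalRing.maximalIdeal (Localization.AtPrime p) ^ 2).comap
    (algebraMap Γ(X, U.1) (Localization.AtPrime p))
  have hI : ∀ a, a ∈ I ↔ ∃ s ∉ p, s * a ∈ p ^ 2 := algebraMap_mem_maximalIdeal_sq_iff p
  have hv : ∃ v : formsThrough Z d, restrForm h Z d v ∉ I := by
    by_contra! hcon
    refine not_isField_stalk hm hX (isClosed_singleton_of_mem_support hZ hx) ?_
    obtain ⟨e⟩ := nonempty_stalk_equiv U hxU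
    refine MulEquiv.isField (isField_localization_of_le_sq p fun a ha => ?_) e.toMulEquiv
    obtain ⟨s, hs, hsa⟩ := exists_mul_mem_map_of_mem_support hZ hZred hx h hxU ha
    have h1 : (Z.ideal (chart n k j)).map (restr i U j h) ≤ I := by
      rw [← hd j, Ideal.map_le_iff_le_comap, Ideal.span_le]
      rintro _ ⟨v, rfl⟩
      exact hcon v
    obtain ⟨s', hs', h2⟩ := (hI _).mp (h1 hsa)
    refine ⟨s' * s, fun h0 => ?_, by rwa [mul_assoc]⟩
    exact (Ideal.IsPrime.mem_or_mem inferInstance h0).elim hs' hs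
  obtain ⟨v, hv⟩ := hv
  refine (isGeneric_notMem_ideal (restrForm h Z d) I hv).mono fun f hf s hs h0 => ?_
  exact hf ((hI _).mpr ⟨s, hs, h0⟩)

end BasePoints
/-! ### The local rings of a closed subscheme that is locally cut out by one function -/

lemma nonempty_localization_equiv_of_surjective {A B : Type u} [CommRing A] [CommRing B]
    {φ : A →+* B} (hφ : Function.Surjective φ) (Q : Ideal B) [Q.IsPrime] (P : Ideal A) [P.IsPrime]
    (hP : Q.comap φ = P) {a : A} (ha : RingHom.ker φ = Ideal.span {a}) :
    Nonempty (Localization.AtPrime Q ≃+* Localization.AtPrime P ⧸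
      Ideal.span {algebraMap A (Localization.AtPrime P) a}) := by
  let e : A ⧸ Ideal.span {a} ≃+* B :=
    (Ideal.quotEquivOfEq ha.symm).trans (RingHom.quotientKerEquivOfSurjective hφ)
  have he : (Q.comap (e : A ⧸ Ideal.span {a} →+* B)).comap (Ideal.Quotient.mk _) = P := hP
  subst he
  obtain ⟨e₁⟩ := nonempty_localization_quotient_equiv (Ideal.span {a})
    (Q.comap (e : A ⧸ Ideal.span {a} →+* B))
  refine ⟨(Localization.localRingEquiv _ Q e rfl).symm.trans (e₁.trans
    (Ideal.quotEquivOfEq ?_))⟩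
  rw [Ideal.map_span, Set.image_singleton]

section Divisor

variable {X : Scheme.{u}} {I : X.IdealSheafData}

lemma nonempty_stalk_subscheme_equiv (y : I.subscheme) (U : X.affineOpens)
    (hy : I.subschemeι y ∈ U.1) {a : Γ(X, U.1)} (ha : I.ideal U = Ideal.span {a}) :
    Nonempty (I.subscheme.presheaf.stalk y ≃+* Localization.AtPrime (primeAt U hy) ⧸
      Ideal.span {algebraMap Γ(X, U.1) (Localization.AtPrime (primeAt U hy)) a}) := by
  have hU : IsAffineOpen U.1 := U.2
  let W : I.subscheme.affineOpens := ⟨I.subschemeι ⁻¹ᵁ U.1, hU.preimage I.subschemeι⟩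
  have hyW : y ∈ W.1 := hy
  have h1 := comap_primeAt I.subschemeι W U le_rfl hyW
  rw [Scheme.Hom.appLE_eq_app] at h1
  have hp : (primeAt W hyW).IsPrime := (IsAffineOpen.primeIdealOf W.2 ⟨y, hyW⟩).isPrime
  obtain ⟨e⟩ := nonempty_stalk_equiv W hyW
  obtain ⟨e'⟩ := nonempty_localization_equiv_of_surjective (I.subschemeι_app_surjective U)
    (primeAt W hyW) (primeAt U hy) h1 ((I.ker_subschemeι_app U).trans ha)
  exact ⟨e.trans e'⟩

lemma subschemeι_mem_support (y : I.subscheme) : I.subschemeι y ∈ I.support :=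
  I.range_subschemeι.le ⟨y, rfl⟩

lemma algebraMap_mem_maximalIdeal_of_mem_support {x : X} (hx : x ∈ I.support) (U : X.affineOpens)
    (hxU : x ∈ U.1) {a : Γ(X, U.1)} (ha : I.ideal U = Ideal.span {a}) :
    algebraMap Γ(X, U.1) (Localization.AtPrime (primeAt U hxU)) a ∈
      IsLocalRing.maximalIdeal (Localization.AtPrime (primeAt U hxU)) := by
  rw [← Localization.AtPrime.map_eq_maximalIdeal]
  refine Ideal.mem_map_of_mem _ ((mem_support_iff_ideal_le I U hxU).mp hx ?_)
  rw [ha]; exact Ideal.mem_span_singleton_self a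

lemma isRegularLocalRing_stalk_subscheme (y : I.subscheme) (U : X.affineOpens)
    (hy : I.subschemeι y ∈ U.1) {a : Γ(X, U.1)} (ha : I.ideal U = Ideal.span {a})
    (h : ∀ s ∉ primeAt U hy, s * a ∉ primeAt U hy ^ 2)
    (hreg : I.subschemeι y ∈ regularLocus X) : y ∈ regularLocus I.subscheme := by
  have h2 : IsRegularLocalRing (X.presheaf.stalk (I.subschemeι y)) := hreg
  obtain ⟨e⟩ := nonempty_stalk_equiv U hy
  have := IsRegularLocalRing.of_ringEquiv e
  obtain ⟨e'⟩ := nonempty_stalk_subscheme_equiv y U hy ha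
  have := isRegularLocalRing_quotient
    (algebraMap_mem_maximalIdeal_of_mem_support (subschemeι_mem_support y) U hy ha)
    (fun h0 => by
      obtain ⟨s, hs, hsa⟩ := (algebraMap_mem_maximalIdeal_sq_iff _ a).mp h0
      exact h s hs hsa)
  exact IsRegularLocalRing.of_ringEquiv e'.symm

lemma ringKrullDim_stalk_subscheme_add_one_le (y : I.subscheme) (U : X.affineOpens)
    (hy : I.subschemeι y ∈ U.1) {a : Γ(X, U.1)} (ha : I.ideal U = Ideal.span {a})
    (h : IsSMulRegular (Localization.AtPrime (primeAt U hy))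
      (algebraMap Γ(X, U.1) (Localization.AtPrime (primeAt U hy)) a)) :
    ringKrullDim (I.subscheme.presheaf.stalk y) + 1 ≤
      ringKrullDim (X.presheaf.stalk (I.subschemeι y)) := by
  obtain ⟨e⟩ := nonempty_stalk_equiv U hy
  obtain ⟨e'⟩ := nonempty_stalk_subscheme_equiv y U hy ha
  rw [ringKrullDim_eq_of_ringEquiv e, ringKrullDim_eq_of_ringEquiv e']
  refine ringKrullDim_quotient_succ_le_of_nonZeroDivisor ?_
  rw [mem_nonZeroDivisors_iff_right]
  intro z hz
  refine h ?_
  simp only [smul_eq_mul, mul_zero]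
  rwa [mul_comm]

variable [IsLocallyNoetherian X]

lemma ringKrullDim_stalk_le_stalk_subscheme_add_one (y : I.subscheme) (U : X.affineOpens)
    (hy : I.subschemeι y ∈ U.1) {a : Γ(X, U.1)} (ha : I.ideal U = Ideal.span {a}) :
    ringKrullDim (X.presheaf.stalk (I.subschemeι y)) ≤
      ringKrullDim (I.subscheme.presheaf.stalk y) + 1 := by
  obtain ⟨e⟩ := nonempty_stalk_equiv U hy
  have : IsNoetherianRing (Localization.AtPrime (primeAt U hy)) :=
    isNoetherianRing_of_ringEquiv _ e
  obtain ⟨e'⟩ := nonempty_stalk_subscheme_equiv y U hy ha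
  rw [ringKrullDim_eq_of_ringEquiv e, ringKrullDim_eq_of_ringEquiv e']
  exact ringKrullDim_le_quotient_add_one
    (algebraMap_mem_maximalIdeal_of_mem_support (subschemeι_mem_support y) U hy ha)

/-- Dividing by the equation lowers the dimension by at least one and the depth by at most one, so
`S_{b+1}` upstairs leaves `S_b`. -/
lemma min_le_depth_stalk_subscheme (y : I.subscheme) (U : X.affineOpens)
    (hy : I.subschemeι y ∈ U.1) {a : Γ(X, U.1)} (ha : I.ideal U = Ideal.span {a})
    (h : IsSMulRegular (Localization.AtPrime (primeAt U hy))
      (algebraMap Γ(X, U.1) (Localization.AtPrime (primeAt U hy)) a)) {b : ℕ}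
    (hb : min ((b + 1 : ℕ) : WithBot ℕ∞) (ringKrullDim (X.presheaf.stalk (I.subschemeι y))) ≤
      (depth (X.presheaf.stalk (I.subschemeι y)) : WithBot ℕ∞)) :
    min (b : WithBot ℕ∞) (ringKrullDim (I.subscheme.presheaf.stalk y)) ≤
      (depth (I.subscheme.presheaf.stalk y) : WithBot ℕ∞) := by
  have hdim := ringKrullDim_stalk_subscheme_add_one_le y U hy ha h
  obtain ⟨e⟩ := nonempty_stalk_equiv U hy
  have : IsNoetherianRing (Localization.AtPrime (primeAt U hy)) :=
    isNoetherianRing_of_ringEquiv _ e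
  obtain ⟨e'⟩ := nonempty_stalk_subscheme_equiv y U hy ha
  have : IsNoetherianRing (I.subscheme.presheaf.stalk y) := isNoetherianRing_of_ringEquiv _ e'.symm
  have : IsLocalRing (Localization.AtPrime (primeAt U hy) ⧸
    Ideal.span {algebraMap Γ(X, U.1) (Localization.AtPrime (primeAt U hy)) a}) :=
    e'.isLocalRing
  rw [depth_eq_of_ringEquiv e']
  rw [depth_eq_of_ringEquiv e] at hb
  obtain ⟨r, hr⟩ := exists_ringKrullDim_eq_natCast (I.subscheme.presheaf.stalk y)
  rw [hr] at hdim ⊢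
  have h1 : ((min b r + 1 : ℕ) : ℕ∞) ≤ depth (Localization.AtPrime (primeAt U hy)) := by
    refine WithBot.coe_le_coe.mp (le_trans (le_min ?_ (le_trans ?_ hdim)) hb)
    · exact_mod_cast Nat.succ_le_succ (min_le_left b r)
    · exact_mod_cast Nat.succ_le_succ (min_le_right b r)
  have h2 := le_depth_quotient
    (algebraMap_mem_maximalIdeal_of_mem_support (subschemeι_mem_support y) U hy ha) h h1
  refine le_trans (le_of_eq ?_) (WithBot.coe_le_coe.mpr h2)
  norm_cast

end Divisor
/-! ### Dimension and irreducible closed subsets -/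

section Dimension

open TopologicalSpace

lemma krullDim_Iic_le_topologicalKrullDim {X : Type*} [TopologicalSpace X]
    (C : IrreducibleCloseds X) : Order.krullDim (Set.Iic C) ≤ topologicalKrullDim (C : Set X) := by
  have himg : ∀ D : Set.Iic C, Subtype.val '' (Subtype.val ⁻¹' (D.1 : Set X) : Set (C : Set X)) =
      (D.1 : Set X) := fun D =>
    (Subtype.image_preimage_coe _ _).trans (Set.inter_eq_right.mpr D.2)
  have hirr : ∀ D : Set.Iic C,
      IsIrreducible (Subtype.val ⁻¹' (D.1 : Set X) : Set (C : Set X)) := by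
    intro D
    refine ⟨?_, ?_⟩
    · obtain ⟨x, hx⟩ := D.1.isIrreducible.1
      exact ⟨⟨x, D.2 hx⟩, hx⟩
    · rintro _ _ ⟨u, hu, rfl⟩ ⟨v, hv, rfl⟩ ⟨x, hx, hxu⟩ ⟨y, hy, hyv⟩
      obtain ⟨z, hz, hzuv⟩ := D.1.isIrreducible.2 u v hu hv ⟨x, hx, hxu⟩ ⟨y, hy, hyv⟩
      exact ⟨⟨z, D.2 hz⟩, hz, hzuv⟩
  refine Order.krullDim_le_of_strictMono (fun D => ⟨_, hirr D,
    D.1.isClosed.preimage continuous_subtype_val⟩) (Monotone.strictMono_of_injective ?_ ?_)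
  · intro D E h x hx
    exact h hx
  · intro D E h
    have h1 : (Subtype.val ⁻¹' (D.1 : Set X) : Set (C : Set X)) =
      (Subtype.val ⁻¹' (E.1 : Set X) : Set (C : Set X)) := congrArg IrreducibleCloseds.carrier h
    refine Subtype.ext (SetLike.coe_injective ?_)
    rw [← himg D, h1, himg E]

lemma height_le_topologicalKrullDim {X : Type*} [TopologicalSpace X]
    (C : IrreducibleCloseds X) : (Order.height C : WithBot ℕ∞) ≤ topologicalKrullDim (C : Set X) :=
  (Order.height_eq_krullDim_Iic C).trans_le (krullDim_Iic_le_topologicalKrullDim C)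

/-- A closed subset without irreducible components of the whole space has smaller dimension. -/
lemma topologicalKrullDim_le_sub_one {X Y : Type*} [TopologicalSpace X] [TopologicalSpace Y]
    {f : Y → X} (hf : Topology.IsClosedEmbedding f) {m : ℕ}
    (hX : ∀ C ∈ irreducibleComponents X, topologicalKrullDim C = (m : WithBot ℕ∞))
    (h : ∀ C ∈ irreducibleComponents X, ¬ C ⊆ Set.range f) :
    topologicalKrullDim Y ≤ ((m - 1 : ℕ) : WithBot ℕ∞) := by
  rw [topologicalKrullDim, Order.krullDim_eq_iSup_height]
  refine iSup_le fun D => ?_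
  set D' := IrreducibleCloseds.map f hf.continuous D
  obtain ⟨C, hC, hDC⟩ :=
    exists_mem_irreducibleComponents_subset_of_isIrreducible _ D'.isIrreducible
  let C' : IrreducibleCloseds X := ⟨C, hC.1, isClosed_of_mem_irreducibleComponents C hC⟩
  have hlt : D' < C' := by
    refine lt_of_le_of_ne hDC fun h0 => h C hC ?_
    have h1 : C = (D' : Set X) := congrArg IrreducibleCloseds.carrier h0.symm
    rw [h1, IrreducibleCloseds.coe_map]
    exact hf.isClosed_range.closure_subset_iff.mpr (Set.image_subset_range _ _)
  have h1 := Order.height_le_height_apply_of_strictMono _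
    (IrreducibleCloseds.map_strictMono_of_isInducing hf.isInducing) D
  have h2 := Order.height_add_one_le hlt
  have h3 : Order.height C' ≤ m :=
    WithBot.coe_le_coe.mp ((height_le_topologicalKrullDim C').trans_eq (hX C hC))
  have h4 : Order.height D + 1 ≤ m := (add_le_add_left h1 1).trans (h2.trans h3)
  have h5 : Order.height D ≤ (m - 1 : ℕ) := by
    lift Order.height D to ℕ using (ne_top_of_le_ne_top (ENat.natCast_ne_top m)
      (le_self_add.trans h4)) with r
    have h6 : r + 1 ≤ m := by exact_mod_cast h4
    exact_mod_cast Nat.le_sub_one_of_lt h6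
  exact WithBot.coe_le_coe.mpr h5

/-- The dimension of a component is computed on an affine open. -/
lemma exists_affineOpen_le_ringKrullDim {X : Scheme.{u}} {C : Set X} (hC : IsIrreducible C)
    (hC' : IsClosed C) {m : ℕ} (hm : topologicalKrullDim C = (m : WithBot ℕ∞)) :
    ∃ x ∈ C, ∀ (U : X.affineOpens), x ∈ U.1 → ∀ hη : hC.genericPoint ∈ U.1,
      (m : WithBot ℕ∞) ≤ ringKrullDim (Γ(X, U.1) ⧸ primeAt U hη) := by
  obtain ⟨l, hl⟩ := Order.le_krullDim_iff.mp (hm.ge.trans_eq rfl)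
  let g : ↥C → X := Subtype.val
  have hg : Topology.IsClosedEmbedding g := hC'.isClosedEmbedding_subtypeVal
  let D : Fin (l.length + 1) → IrreducibleCloseds X :=
    fun r => IrreducibleCloseds.map g hg.continuous (l r)
  have hD : StrictMono D := (IrreducibleCloseds.map_strictMono_of_isInducing hg.isInducing).comp
    l.strictMono
  have hDC : ∀ r, (D r : Set X) ⊆ C := by
    intro r
    refine hC'.closure_subset_iff.mpr ?_
    rintro _ ⟨z, -, rfl⟩
    exact z.2
  let y : Fin (l.length + 1) → X := fun r => (D r).isIrreducible.genericPoint
  have hy : ∀ r, closure {y r} = (D r : Set X) := fun r => by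
    rw [(D r).isIrreducible.genericPoint_closure_eq, (D r).isClosed.closure_eq]
  have hη' : closure {hC.genericPoint} = C := by
    rw [hC.genericPoint_closure_eq, hC'.closure_eq]
  have hmem : ∀ r, y r ∈ (D r : Set X) := fun r => hy r ▸ subset_closure rfl
  -- The point is the generic point of the smallest member of a longest chain. Every open set
  -- containing it contains the generic points of the whole chain.
  refine ⟨y 0, hDC 0 (hmem 0), fun U hU hη => ?_⟩
  have hspec : ∀ r, y r ⤳ y 0 := fun r => by
    rw [specializes_iff_mem_closure, hy]
    exact hD.monotone (Fin.zero_le r) (hmem 0)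
  have hyU : ∀ r, y r ∈ U.1 := fun r => (hspec r).mem_open U.1.2 hU
  have hηy : ∀ r, hC.genericPoint ⤳ y r := fun r => by
    rw [specializes_iff_mem_closure, hη']
    exact hDC r (hmem r)
  rw [ringKrullDim_quotient, ← Order.krullDim_orderDual]
  have hp : ∀ r, (primeAt U (hyU r)).IsPrime := fun r =>
    (IsAffineOpen.primeIdealOf U.2 ⟨y r, hyU r⟩).isPrime
  let q : Fin (l.length + 1) → (PrimeSpectrum.zeroLocus (primeAt U hη : Set Γ(X, U.1)))ᵒᵈ :=
    fun r => OrderDual.toDual ⟨⟨primeAt U (hyU r), hp r⟩,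
      primeAt_le_of_specializes U (hyU r) hη (hηy r)⟩
  have hq : StrictMono q := by
    refine Monotone.strictMono_of_injective ?_ ?_
    · intro r s hrs
      refine primeAt_le_of_specializes U (hyU r) (hyU s) ?_
      rw [specializes_iff_mem_closure, hy]
      exact hD.monotone hrs (hmem r)
    · intro r s hrs
      have h1 : primeAt U (hyU r) = primeAt U (hyU s) :=
        congrArg PrimeSpectrum.asIdeal (congrArg Subtype.val hrs)
      have h2 := primeAt_injective U (hyU r) (hyU s) h1
      refine hD.injective (SetLike.coe_injective ?_)
      rw [← hy, ← hy, h2]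
  rw [← hl]
  exact Order.le_krullDim_iff.mpr ⟨LTSeries.mk l.length q hq, rfl⟩

lemma ringKrullDim_stalk_le_topologicalKrullDim {X : Scheme.{u}} (x : X) :
    ringKrullDim (X.presheaf.stalk x) ≤ topologicalKrullDim X := by
  rw [ringKrullDim_stalk_eq_coheight]
  let := specializationOrder X
  rw [topologicalKrullDim, Order.krullDim_eq_of_orderIso (irreducibleSetEquivPoints (α := X))]
  exact Order.coheight_le_krullDim x

end Dimension
-- The lower bound for the dimension of a section
section LowerBound

variable {k : Type u} [Field k] {n m : ℕ} {X : Scheme.{u}} {i : X ⟶ PP n k} [IsImmersion i]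
  {Z : (PP n k).IdealSheafData}

lemma genericPoint_notMem_support (hm : 1 ≤ m) (hZ : IsArtinianScheme (Z ⊔ i.ker).subscheme)
    {C : Set X} (hC : IsIrreducible C) (hC' : IsClosed C)
    (hdim : topologicalKrullDim C = (m : WithBot ℕ∞)) : i hC.genericPoint ∉ Z.support := by
  intro h
  have h1 : C = {hC.genericPoint} := by
    rw [← (isClosed_singleton_of_mem_support hZ h).closure_eq, hC.genericPoint_closure_eq,
      hC'.closure_eq]
  rw [h1] at hdim
  have h6 := topologicalKrullDim_zero_of_discreteTopology ({hC.genericPoint} : Set X)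
  rw [hdim] at h6
  have h7 : m ≤ 0 := by exact_mod_cast h6
  omega

lemma ringKrullDim_le_of_comap {A : Type u} [CommRing A] (p : Ideal A) (M : Ideal (A ⧸ p))
    [M.IsPrime] {q : Ideal A} [q.IsPrime] (hq : q = M.comap (Ideal.Quotient.mk p)) :
    (M.height : WithBot ℕ∞) ≤ ringKrullDim (Localization.AtPrime q) := by
  subst hq
  obtain ⟨e⟩ := nonempty_localization_quotient_equiv p M
  rw [← IsLocalization.AtPrime.ringKrullDim_eq_height M (Localization.AtPrime M),
    ringKrullDim_eq_of_ringEquiv e]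
  exact ringKrullDim_quotient_le _

/-- A function separating `q` from `p` is, near `q`, a fraction of restrictions from the chart; its
numerator is a dehomogenized form. -/
lemma exists_restr_mem_notMem {U : X.affineOpens} {j : Fin (n + 1)}
    (h : U.1 ≤ i ⁻¹ᵁ (chart n k j).1) {p q : Ideal Γ(X, U.1)} [p.IsPrime] [q.IsPrime]
    (hpq : p < q) : ∃ (D : ℕ) (G : MvPolynomial.homogeneousSubmodule (Fin (n + 1)) k D),
      restr i U j h (chartSection G j) ∈ q ∧ restr i U j h (chartSection G j) ∉ p := by
  obtain ⟨b, hbq, hbp⟩ := Set.exists_of_ssubset hpq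
  obtain ⟨s, t, c, hc, hs, hst⟩ :=
    exists_mul_mul_eq_of_surjectiveOnStalks i U (chart n k j) h q b
  obtain ⟨D, G, hG⟩ := exists_chartSection_eq j t
  refine ⟨D, G, ?_, ?_⟩
  · rw [hG]
    refine (Ideal.IsPrime.mem_or_mem (I := q) inferInstance ?_).resolve_left hc
    change c * i.appLE _ _ h t ∈ _
    rw [← hst]
    exact Ideal.mul_mem_left _ _ (Ideal.mul_mem_left _ _ hbq)
  · rw [hG]
    intro h0
    have h1 : c * (i.appLE _ _ h s * b) ∈ p := by
      rw [hst]; exact Ideal.mul_mem_left _ _ h0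
    rcases Ideal.IsPrime.mem_or_mem inferInstance h1 with h2 | h2
    · exact hc (hpq.le h2)
    · rcases Ideal.IsPrime.mem_or_mem inferInstance h2 with h3 | h3
      · exact hs (hpq.le h3)
      · exact hbp h3

/-- On an affine piece of a component with its full dimension, a generic form is not a unit, so it
vanishes at a closed point of that piece. All closed points there have the height of the full
dimension. -/
theorem exists_isGeneric_le_ringKrullDim [Infinite k] [Nonempty X] (hm : 1 ≤ m)
    (hX : ∀ C ∈ irreducibleComponents X, topologicalKrullDim C = (m : WithBot ℕ∞))
    (hZ : IsArtinianScheme (Z ⊔ i.ker).subscheme) {e : ℕ} (he : ∀ d ≥ e, ∀ j, Ideal.span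
      (Set.range fun f : formsThrough Z d => chartSection f.1 j) = Z.ideal (chart n k j)) :
    ∃ d₁, ∀ d ≥ d₁, IsGeneric k {f : formsThrough Z d |
      ∃ x ∈ ((hypersurface f.1).comap i).support,
        (m : WithBot ℕ∞) ≤ ringKrullDim (X.presheaf.stalk x)} := by
  obtain ⟨x₀⟩ := ‹Nonempty X›
  obtain ⟨C, hC⟩ : ∃ C, C ∈ irreducibleComponents X :=
    ⟨_, irreducibleComponent_mem_irreducibleComponents x₀⟩
  have hCc := isClosed_of_mem_irreducibleComponents C hC
  have hηZ := genericPoint_notMem_support hm hZ hC.1 hCc (hX C hC)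
  obtain ⟨x, hxC, hx⟩ := exists_affineOpen_le_ringKrullDim hC.1 hCc (hX C hC)
  obtain ⟨U, j, h, hxU⟩ := exists_affineOpen_le_chart i x
  have hηU : hC.1.genericPoint ∈ U.1 := by
    have h1 : hC.1.genericPoint ⤳ x := by
      rwa [specializes_iff_mem_closure, hC.1.genericPoint_closure_eq, hCc.closure_eq]
    exact h1.mem_open U.1.2 hxU
  have hdim := hx U hxU hηU
  set p := primeAt U hηU
  let := sectionsAlgebra h
  have := sectionsAlgebra_finiteType h
  have hB : ¬ IsField (Γ(X, U.1) ⧸ p) := by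
    intro h0
    rw [ringKrullDim_eq_zero_of_isField h0] at hdim
    have h7 : m ≤ 0 := by exact_mod_cast hdim
    omega
  obtain ⟨b, hb0, hbu⟩ := Ring.exists_not_isUnit_of_not_isField hB
  obtain ⟨M, hM, hbM⟩ := exists_max_ideal_of_mem_nonunits hbu
  have hpq : p < M.comap (Ideal.Quotient.mk p) := by
    refine lt_of_le_of_ne (fun a ha => ?_) fun h0 => hb0 ?_
    · rw [Ideal.mem_comap, Ideal.Quotient.eq_zero_iff_mem.mpr ha]; exact zero_mem _
    · obtain ⟨b, rfl⟩ := Ideal.Quotient.mk_surjective b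
      rw [Ideal.Quotient.eq_zero_iff_mem, h0]; exact hbM
  obtain ⟨D, G, hGq, hGp⟩ := exists_restr_mem_notMem h hpq
  refine ⟨e + D, fun d hd => ?_⟩
  obtain ⟨d', hd', rfl⟩ : ∃ d', e ≤ d' ∧ d = d' + D := ⟨d - D, by omega, by omega⟩
  obtain ⟨w, hw⟩ := (notMem_support_iff h Z (he d' hd') hηU).mp hηZ
  -- A nonzero nonunit on the component: `w` is a form through `Z` that is nonzero at the generic
  -- point, and `G` vanishes at the chosen closed point.
  let v₀ : formsThrough Z (d' + D) := ⟨mulForm w.1 G, fun l => by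
    rw [chartSection_mul]; exact Ideal.mul_mem_right _ _ (w.2 l)⟩
  have hv₀ : restr i U j h (chartSection v₀.1 j) =
      restr i U j h (chartSection w.1 j) * restr i U j h (chartSection G j) := by
    rw [← map_mul, ← chartSection_mul]
  let l : formsThrough Z (d' + D) →ₗ[k] Γ(X, U.1) ⧸ p :=
    (Ideal.Quotient.mkₐ k p).toLinearMap ∘ₗ restrForm h Z (d' + D)
  have hl : ∀ v, l v = Ideal.Quotient.mk p (restr i U j h (chartSection v.1 j)) := fun v => rfl
  refine (isGeneric_not_isUnit k l (v₀ := v₀) ?_ ?_).mono ?_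
  · rw [hl, Ne, Ideal.Quotient.eq_zero_iff_mem, hv₀]
    exact fun h0 => (Ideal.IsPrime.mem_or_mem inferInstance h0).elim hw hGp
  · intro hu
    refine hM.ne_top (Ideal.eq_top_of_isUnit_mem _ ?_ hu)
    rw [hl, ← Ideal.mem_comap, hv₀]
    exact Ideal.mul_mem_left _ _ hGq
  · intro f hf
    obtain ⟨N, hN, hfN⟩ := exists_max_ideal_of_mem_nonunits hf
    obtain ⟨z, hz, hzN⟩ := exists_primeAt_eq U (N.comap (Ideal.Quotient.mk p))
    refine ⟨z, ?_, ?_⟩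
    · rw [mem_support_comap_hypersurface h _ hz, hzN]
      exact hfN
    · obtain ⟨e⟩ := nonempty_stalk_equiv U hz
      rw [ringKrullDim_eq_of_ringEquiv e]
      have h1 := ringKrullDim_le_of_comap p N hzN
      have h2 := ringKrullDim_le_height_of_isMaximal k N
      exact hdim.trans (h2.trans h1)

end LowerBound
/-! ### Finite sets of points to be avoided -/

section Finite

variable {k : Type u} [Field k] {n m : ℕ} {X : Scheme.{u}}

/-- A point of an affine open as a point of the prime spectrum. -/
def specPoint (U : X.affineOpens) {x : X} (hx : x ∈ U.1) : PrimeSpectrum Γ(X, U.1) :=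
  ⟨primeAt U hx, inferInstance⟩

lemma exists_specPoint_eq (U : X.affineOpens) (q : PrimeSpectrum Γ(X, U.1)) :
    ∃ (x : X) (hx : x ∈ U.1), specPoint U hx = q := by
  obtain ⟨x, hx, h⟩ := exists_primeAt_eq U q.asIdeal
  exact ⟨x, hx, PrimeSpectrum.ext h⟩

lemma finite_of_specPoint_mem (U : X.affineOpens) {P : X → Prop}
    {Q : Set (PrimeSpectrum Γ(X, U.1))} (hQ : Q.Finite)
    (h : ∀ x, P x → ∀ hx : x ∈ U.1, specPoint U hx ∈ Q) : {x | x ∈ U.1 ∧ P x}.Finite := by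
  refine Set.Finite.of_finite_image (f := fun x => {q | ∃ hx : x ∈ U.1, specPoint U hx = q})
    ((hQ.image fun q => ({q} : Set _)).subset ?_) ?_
  · rintro _ ⟨x, ⟨hx, hPx⟩, rfl⟩
    exact ⟨specPoint U hx, h x hPx hx, by ext q; simp [hx, eq_comm]⟩
  · rintro x ⟨hx, -⟩ y ⟨hy, -⟩ hxy
    obtain ⟨hy', h1⟩ := (Set.ext_iff.mp hxy (specPoint U hx)).mp ⟨hx, rfl⟩
    exact primeAt_injective U hx hy (congrArg PrimeSpectrum.asIdeal h1.symm)

lemma finite_of_forall_affineOpen (i : X ⟶ PP n k) [IsImmersion i] {P : X → Prop}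
    (h : ∀ (U : X.affineOpens) (j : Fin (n + 1)), U.1 ≤ i ⁻¹ᵁ (chart n k j).1 →
      {x | x ∈ U.1 ∧ P x}.Finite) : {x | P x}.Finite := by
  obtain ⟨t, U, j, ht, hU, hc⟩ := exists_finite_affine_cover i
  refine (ht.biUnion fun y _ => h (U y) (j y) (hU y)).subset fun x hx => ?_
  obtain ⟨y, hy, hxy⟩ := hc x
  exact Set.mem_biUnion hy ⟨hxy, hx⟩

lemma finite_singular_stalk (i : X ⟶ PP n k) [IsImmersion i] {a : ℕ}
    (hR : IsRegularInCodim a X) :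
    {x : X | ringKrullDim (X.presheaf.stalk x) ≤ ((a + 1 : ℕ) : WithBot ℕ∞) ∧
      x ∉ regularLocus X}.Finite := by
  refine finite_of_forall_affineOpen i fun U j h => ?_
  let := sectionsAlgebra h
  have := sectionsAlgebra_finiteType h
  refine finite_of_specPoint_mem U (finite_singular k a ?_) ?_
  · intro q hq
    obtain ⟨x, hx, rfl⟩ := exists_specPoint_eq U q
    obtain ⟨e⟩ := nonempty_stalk_equiv U hx
    have h1 : IsRegularLocalRing (X.presheaf.stalk x) :=
      hR x ((ringKrullDim_eq_of_ringEquiv e).trans_le hq)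
    exact IsRegularLocalRing.of_ringEquiv e
  · rintro x ⟨h1, h2⟩ hx
    obtain ⟨e⟩ := nonempty_stalk_equiv U hx
    refine ⟨(ringKrullDim_eq_of_ringEquiv e).ge.trans h1, fun h3 => h2 ?_⟩
    have h4 : IsRegularLocalRing (Localization.AtPrime (primeAt U hx)) := h3
    exact IsRegularLocalRing.of_ringEquiv e.symm

lemma finite_not_satisfiesS_stalk (i : X ⟶ PP n k) [IsImmersion i] {b : ℕ}
    (hS : SatisfiesS b X) :
    {x : X | ¬ min ((b + 1 : ℕ) : WithBot ℕ∞) (ringKrullDim (X.presheaf.stalk x)) ≤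
      (depth (X.presheaf.stalk x) : WithBot ℕ∞)}.Finite := by
  refine finite_of_forall_affineOpen i fun U j h => ?_
  let := sectionsAlgebra h
  have := sectionsAlgebra_finiteType h
  refine finite_of_specPoint_mem U (finite_not_satisfiesS k b ?_) ?_
  · intro q
    obtain ⟨x, hx, rfl⟩ := exists_specPoint_eq U q
    obtain ⟨e⟩ := nonempty_stalk_equiv U hx
    have h1 := hS x
    rw [ringKrullDim_eq_of_ringEquiv e, depth_eq_of_ringEquiv e] at h1
    exact h1
  · intro x h1 hx h2
    obtain ⟨e⟩ := nonempty_stalk_equiv U hx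
    rw [ringKrullDim_eq_of_ringEquiv e, depth_eq_of_ringEquiv e] at h1
    exact h1 h2

lemma finite_associated (U : X.affineOpens) [IsNoetherianRing Γ(X, U.1)] :
    {x | ∃ hx : x ∈ U.1, primeAt U hx ∈ associatedPrimes Γ(X, U.1) Γ(X, U.1)}.Finite := by
  have h1 : (PrimeSpectrum.asIdeal ⁻¹' (associatedPrimes Γ(X, U.1) Γ(X, U.1))).Finite :=
    (associatedPrimes.finite _ _).preimage fun p _ q _ h => PrimeSpectrum.ext h
  refine (finite_of_specPoint_mem U (P := fun x => ∃ hx : x ∈ U.1,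
    primeAt U hx ∈ associatedPrimes Γ(X, U.1) Γ(X, U.1)) h1 ?_).subset ?_
  · rintro x ⟨hx, h⟩ hx'
    exact h
  · rintro x ⟨hx, h⟩
    exact ⟨hx, hx, h⟩

/-- In a domain, `𝔪 b = 0` with `b ≠ 0` forces `𝔪 = 0`. This keeps associated points of `X` away
from `Z`, where the local rings are regular. -/
lemma isField_stalk_of_mem_associatedPrimes (U : X.affineOpens) [IsNoetherianRing Γ(X, U.1)]
    {x : X} (hx : x ∈ U.1) (h : primeAt U hx ∈ associatedPrimes Γ(X, U.1) Γ(X, U.1))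
    [IsDomain (X.presheaf.stalk x)] : IsField (X.presheaf.stalk x) := by
  let := (X.presheaf.germ U.1 x hx).hom.toAlgebra
  have := isLocalization_stalk_primeAt U hx
  obtain ⟨-, b, hb⟩ := isAssociatedPrime_iff.mp h
  have hb' : ∀ a, a ∈ primeAt U hx ↔ a * b = 0 := fun a => by
    rw [hb, Submodule.mem_colon_singleton, smul_eq_mul, Submodule.mem_bot]
  have hb0 : algebraMap Γ(X, U.1) (X.presheaf.stalk x) b ≠ 0 := by
    intro h0
    obtain ⟨s, hs⟩ := (IsLocalization.map_eq_zero_iff (primeAt U hx).primeCompl _ b).mp h0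
    exact s.2 ((hb' s).mpr hs)
  rw [IsLocalRing.isField_iff_maximalIdeal_eq,
    ← IsLocalization.AtPrime.map_eq_maximalIdeal (primeAt U hx) (X.presheaf.stalk x), eq_bot_iff,
    Ideal.map_le_iff_le_comap]
  intro a ha
  have h2 := congrArg (algebraMap Γ(X, U.1) (X.presheaf.stalk x)) ((hb' a).mp ha)
  rw [map_mul, map_zero] at h2
  exact (mul_eq_zero.mp h2).resolve_right hb0

lemma finite_preimage_support (i : X ⟶ PP n k) [IsImmersion i] {T : (PP n k).IdealSheafData}
    (hT : topologicalKrullDim T.subscheme ≤ 0) : {x : X | i x ∈ T.support}.Finite := by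
  have := isNoetherian_of_isImmersion T.subschemeι
  have := IsLocallyArtinian.of_topologicalKrullDim_le_zero hT
  have : IsArtinianScheme T.subscheme := {}
  have h1 : (T.support : Set (PP n k)).Finite := by
    rw [← Scheme.IdealSheafData.range_subschemeι]
    exact Set.finite_range _
  exact h1.preimage i.isEmbedding.injective.injOn

lemma exists_finite_meets_components {X : Type*} [TopologicalSpace X]
    [TopologicalSpace.NoetherianSpace X] (S : Set X) : ∃ F : Set X, F.Finite ∧ F ⊆ S ∧
      ∀ C ∈ irreducibleComponents S, ∃ x ∈ C, x.1 ∈ F := by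
  have hfin := TopologicalSpace.NoetherianSpace.finite_irreducibleComponents (α := S)
  have hne : ∀ C : irreducibleComponents S, ∃ x, x ∈ C.1 := fun C => C.2.1.1
  choose g hg using hne
  have := hfin.to_subtype
  refine ⟨Set.range fun C => (g C).1, Set.finite_range _, ?_, fun C hC => ?_⟩
  · rintro _ ⟨C, rfl⟩
    exact (g C).2
  · exact ⟨g ⟨C, hC⟩, hg ⟨C, hC⟩, ⟨C, hC⟩, rfl⟩

lemma primeAt_genericPoint_mem_associatedPrimes {C : Set X} (hC : C ∈ irreducibleComponents X)
    (U : X.affineOpens) [IsNoetherianRing Γ(X, U.1)] (hη : hC.1.genericPoint ∈ U.1) :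
    primeAt U hη ∈ associatedPrimes Γ(X, U.1) Γ(X, U.1) := by
  refine Module.associatedPrimes.minimalPrimes_annihilator_subset_associatedPrimes _ _
    ⟨⟨inferInstance, ?_⟩, ?_⟩
  · intro a ha
    have h1 : a * 1 = 0 := Module.mem_annihilator.mp ha 1
    rw [mul_one] at h1
    rw [h1]; exact zero_mem _
  · rintro q ⟨hq, -⟩ hle
    obtain ⟨z, hz, rfl⟩ := exists_primeAt_eq U q
    have h1 := specializes_of_primeAt_le U hη hz hle
    have h2 : C ⊆ closure {z} := by
      rw [← (isClosed_of_mem_irreducibleComponents C hC).closure_eq,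
        ← hC.1.genericPoint_closure_eq]
      exact h1.closure_subset
    have h3 : closure {z} ⊆ C := hC.2 isIrreducible_singleton.closure h2
    have h4 : hC.1.genericPoint ⤳ z := by
      rw [specializes_iff_mem_closure, hC.1.genericPoint_closure_eq,
        (isClosed_of_mem_irreducibleComponents C hC).closure_eq]
      exact h3 (subset_closure rfl)
    exact primeAt_le_of_specializes U hz hη h4

lemma mem_nonZeroDivisors_of_notMem_primeAt (U : X.affineOpens) [IsNoetherianRing Γ(X, U.1)]
    {a : Γ(X, U.1)} (h : ∀ x (hx : x ∈ U.1),
      primeAt U hx ∈ associatedPrimes Γ(X, U.1) Γ(X, U.1) → a ∉ primeAt U hx) :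
    a ∈ nonZeroDivisors Γ(X, U.1) := by
  by_contra h0
  have h1 : a ∈ ⋃ p ∈ associatedPrimes Γ(X, U.1) Γ(X, U.1), (p : Set Γ(X, U.1)) := by
    rw [biUnion_associatedPrimes_eq_compl_nonZeroDivisors]; exact h0
  obtain ⟨p, hp, hap⟩ := Set.mem_iUnion₂.mp h1
  have := hp.isPrime
  obtain ⟨x, hx, rfl⟩ := exists_primeAt_eq U p
  exact h x hx hp hap

end Finite
/-! ### General hypersurface sections are good -/

section Main

variable {k : Type u} [Field k] {n m : ℕ} {X : Scheme.{u}} {i : X ⟶ PP n k}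
  {Z T : (PP n k).IdealSheafData}

/-- A rational point of the open set determines a form only up to a scalar; some multiple is
generic, and the hypersurface is the same. -/
lemma forGeneralHypersurface_of_isGeneric [Infinite k] {P : (PP n k).IdealSheafData → Prop}
    (h : ∃ d₀, ∀ d ≥ d₀, Nontrivial (formsThrough Z d) ∧
      IsGeneric k {f : formsThrough Z d | P (hypersurface f.1)}) :
    ForGeneralHypersurface Z P := by
  obtain ⟨d₀, h⟩ := h
  refine ⟨d₀, fun d hd => ?_⟩
  obtain ⟨h1, h2⟩ := h d hd
  obtain ⟨U, hU, hU', hP⟩ := h2.exists_opens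
  refine ⟨U, hU, hU', fun f hf hfU => ?_⟩
  obtain ⟨c, hc, hcf⟩ := hP f hf hfU
  have h3 : P (hypersurface (c • f).1) := hcf
  rwa [Submodule.coe_smul, hypersurface_smul hc] at h3

variable [IsImmersion i]

/-- Avoiding the associated points makes the equation a nonzerodivisor and, since generic points of
components are among them, bounds the dimension by `m - 1`. A point of codimension at least `m` on
`H` gives equality. -/
lemma isGood_of_conditions (hm : 1 ≤ m)
    (hX : ∀ C ∈ irreducibleComponents X, topologicalKrullDim C = (m : WithBot ℕ∞))
    {t : Set X} {U : X → X.affineOpens} {j : X → Fin (n + 1)}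
    (hU : ∀ y, (U y).1 ≤ i ⁻¹ᵁ (chart n k (j y)).1) (ht : ∀ x, ∃ y ∈ t, x ∈ (U y).1)
    {d : ℕ} {f : MvPolynomial.homogeneousSubmodule (Fin (n + 1)) k d}
    (hT : ∀ x, i x ∈ T.support → x ∉ ((hypersurface f).comap i).support)
    (hS : ∀ C ∈ irreducibleComponents (singularLocus X), ∃ x ∈ C,
      x.1 ∉ ((hypersurface f).comap i).support)
    (hA : ∀ y ∈ t, ∀ x (hx : x ∈ (U y).1), primeAt (U y) hx ∈
      associatedPrimes Γ(X, (U y).1) Γ(X, (U y).1) → x ∉ ((hypersurface f).comap i).support)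
    (hdim : ∃ x ∈ ((hypersurface f).comap i).support,
      (m : WithBot ℕ∞) ≤ ringKrullDim (X.presheaf.stalk x)) :
    IsGood i m T (hypersurface f) := by
  have hnoeth : AlgebraicGeometry.IsNoetherian X := isNoetherian_of_isImmersion i
  set I := (hypersurface f).comap i
  refine ⟨fun x hx hxT => hT x hxT hx, fun x => ?_, le_antisymm ?_ ?_, fun C hC hCI => ?_⟩
  · obtain ⟨y, hy, hxy⟩ := ht x
    have := isNoetherianRing_sections (hU y)
    refine ⟨U y, hxy, restr i (U y) (j y) (hU y) (chartSection f (j y)), ?_,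
      ideal_comap_hypersurface (hU y) f⟩
    refine mem_nonZeroDivisors_of_notMem_primeAt (U y) fun z hz hza => ?_
    rw [← mem_support_comap_hypersurface (hU y) f hz]
    exact hA y hy z hz hza
  · refine topologicalKrullDim_le_sub_one I.subschemeι.isClosedEmbedding hX fun C hC hCr => ?_
    obtain ⟨y, hy, hxy⟩ := ht hC.1.genericPoint
    have := isNoetherianRing_sections (hU y)
    refine hA y hy _ hxy (primeAt_genericPoint_mem_associatedPrimes hC (U y) hxy) ?_
    have h1 : hC.1.genericPoint ∈ Set.range I.subschemeι := by
      refine hCr ((isClosed_of_mem_irreducibleComponents C hC).closure_eq.le ?_)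
      rw [← hC.1.genericPoint_closure_eq]
      exact subset_closure rfl
    rwa [I.range_subschemeι] at h1
  · obtain ⟨x, hx, hmx⟩ := hdim
    obtain ⟨z, rfl⟩ : x ∈ Set.range I.subschemeι := by rw [I.range_subschemeι]; exact hx
    obtain ⟨y, hy, hxy⟩ := ht (I.subschemeι z)
    have h1 := ringKrullDim_stalk_le_stalk_subscheme_add_one z (U y) hxy
      (ideal_comap_hypersurface (hU y) f)
    refine le_trans ?_ (ringKrullDim_stalk_le_topologicalKrullDim z)
    obtain ⟨e⟩ := nonempty_stalk_subscheme_equiv z (U y) hxy (ideal_comap_hypersurface (hU y) f)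
    have := isNoetherianRing_sections (hU y)
    have : IsNoetherianRing (Localization.AtPrime (primeAt (U y) hxy)) :=
      IsLocalization.isNoetherianRing (primeAt (U y) hxy).primeCompl _ inferInstance
    have := isNoetherianRing_of_ringEquiv _ e.symm
    obtain ⟨r, hr⟩ := exists_ringKrullDim_eq_natCast (I.subscheme.presheaf.stalk z)
    have h2 := hmx.trans h1
    rw [hr] at h2 ⊢
    have h3 : m ≤ r + 1 := by exact_mod_cast h2
    have h4 : m - 1 ≤ r := by omega
    exact_mod_cast h4
  · obtain ⟨x, hx, hxI⟩ := hS C hC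
    exact hxI (hCI ⟨x, hx, rfl⟩)

theorem exists_isGeneric_isGood [Infinite k] [Nonempty X] (hm : 1 ≤ m)
    (hX : ∀ C ∈ irreducibleComponents X, topologicalKrullDim C = (m : WithBot ℕ∞))
    (hT : topologicalKrullDim T.subscheme ≤ 0)
    (hZT : ∀ x : X, i x ∈ Z.support → i x ∉ T.support)
    (hZred : AlgebraicGeometry.IsReduced (Z ⊔ i.ker).subscheme)
    (hZ : IsArtinianScheme (Z ⊔ i.ker).subscheme)
    (hZreg : ((Z ⊔ i.ker).support : Set (PP n k)) ⊆ i '' regularLocus X)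
    {F : Set X} (hF : F.Finite) (hFZ : ∀ x ∈ F, i x ∉ Z.support) :
    ∃ d₀, ∀ d ≥ d₀, Nontrivial (formsThrough Z d) ∧ IsGeneric k {f : formsThrough Z d |
      IsGood i m T (hypersurface f.1) ∧ RegularOnRegularLocus i (hypersurface f.1) ∧
        ∀ x ∈ F, x ∉ ((hypersurface f.1).comap i).support} := by
  have hnoeth : AlgebraicGeometry.IsNoetherian X := isNoetherian_of_isImmersion i
  obtain ⟨e, he⟩ := exists_span_chartSection_eq Z
  obtain ⟨d₁, hd₁⟩ := exists_isGeneric_le_ringKrullDim hm hX hZ he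
  obtain ⟨t, U, j, htf, hU, ht⟩ := exists_finite_affine_cover i
  obtain ⟨F₁, hF₁, hF₁S, hF₁C⟩ := exists_finite_meets_components (singularLocus X)
  have hTf := finite_preimage_support i hT
  have hNoeth : ∀ y, IsNoetherianRing Γ(X, (U y).1) := fun y => isNoetherianRing_sections (hU y)
  have hAf : {x | ∃ y ∈ t, ∃ hx : x ∈ (U y).1, primeAt (U y) hx ∈
      associatedPrimes Γ(X, (U y).1) Γ(X, (U y).1)}.Finite := by
    refine (htf.biUnion fun y _ => finite_associated (U y)).subset ?_
    rintro x ⟨y, hy, hx, h⟩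
    exact Set.mem_biUnion hy ⟨hx, h⟩
  have hreg : ∀ x, i x ∈ Z.support → IsRegularLocalRing (X.presheaf.stalk x) :=
    fun x hx => mem_regularLocus_of_mem_support hZreg hx
  -- The `+ 1` leaves room for Bertini's theorem, which multiplies forms of degree `d - 1`
  -- generating `𝓘_Z` by coordinates.
  refine ⟨max d₁ (e + 1), fun d hd => ?_⟩
  have hde : e ≤ d := by omega
  have hspan := he d hde
  have hav : ∀ S : Set X, S.Finite → (∀ x ∈ S, i x ∉ Z.support) →
      IsGeneric k {f : formsThrough Z d | ∀ x ∈ S, x ∉ ((hypersurface f.1).comap i).support} :=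
    fun S hS hSZ => isGeneric_forall_mem hS fun x hx => isGeneric_notMem_support hspan (hSZ x hx)
  have hsq : IsGeneric k {f : formsThrough Z d | ∀ y ∈ t, ∀ x (hx : x ∈ (U y).1),
      ∀ s ∉ primeAt (U y) hx, s * restr i (U y) (j y) (hU y) (chartSection f.1 (j y)) ∉
        primeAt (U y) hx ^ 2} := by
    refine isGeneric_forall_mem htf fun y _ => ?_
    obtain ⟨d', rfl⟩ : ∃ d', d = 1 + d' := ⟨d - 1, by omega⟩
    have h1 := isGeneric_restr_mul_notMem_sq (hU y) Z (he d' (by omega)) hspan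
    have h2 : IsGeneric k {f : formsThrough Z (1 + d') | ∀ x ∈ {x : X | i x ∈ Z.support},
        ∀ (hx : x ∈ (U y).1), ∀ s ∉ primeAt (U y) hx,
          s * restr i (U y) (j y) (hU y) (chartSection f.1 (j y)) ∉ primeAt (U y) hx ^ 2} := by
      refine isGeneric_forall_mem (finite_setOf_mem_support hZ) fun x hx => ?_
      by_cases hxU : x ∈ (U y).1
      · exact (isGeneric_mul_notMem_sq_of_mem_support hm hX hZ hZred hspan hx (hU y) hxU).mono
          fun f hf _ => hf
      · exact (isGeneric_univ).mono fun f _ h => absurd h hxU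
    refine (h1.inter h2).mono fun f hf x hx => ?_
    by_cases hxZ : i x ∈ Z.support
    · exact hf.2 x hxZ hx
    · exact hf.1 x hx hxZ
  refine ⟨?_, ?_⟩
  · obtain ⟨x₀⟩ := ‹Nonempty X›
    have hC := irreducibleComponent_mem_irreducibleComponents x₀
    have hη := genericPoint_notMem_support hm hZ hC.1
      (isClosed_of_mem_irreducibleComponents _ hC) (hX _ hC)
    obtain ⟨V, l, hV, hxV⟩ := exists_affineOpen_le_chart i hC.1.genericPoint
    obtain ⟨w, hw⟩ := (notMem_support_iff hV Z hspan hxV).mp hη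
    let := sectionsAlgebra hV
    refine ⟨w, 0, fun h0 => hw ?_⟩
    rw [← restrForm_apply, h0, map_zero]
    exact zero_mem _
  · refine ((((hav _ hTf fun x hx hxZ => hZT x hxZ hx).inter
      (hav F₁ hF₁ fun x hx hxZ => hF₁S hx (hreg x hxZ))).inter ((hav _ hAf ?_).inter
        (hav F hF hFZ))).inter (hsq.inter (hd₁ d (by omega)))).mono ?_
    -- An associated point on `Z` would be a closed point whose regular local ring is a field.
    · rintro x ⟨y, hy, hx, h⟩ hxZ
      have := hreg x hxZ
      have := isDomain_of_isRegularLocalRing (X.presheaf.stalk x)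
      exact not_isField_stalk hm hX (isClosed_singleton_of_mem_support hZ hxZ)
        (isField_stalk_of_mem_associatedPrimes (U y) hx h)
    · rintro f ⟨⟨⟨hf1, hf2⟩, hf3, hf4⟩, hf5, hf6⟩
      refine ⟨isGood_of_conditions hm hX hU ht hf1 ?_ ?_ hf6, ?_, hf4⟩
      · intro C hC
        obtain ⟨x, hx, hxF⟩ := hF₁C C hC
        exact ⟨x, hx, hf2 x hxF⟩
      · exact fun y hy x hx h => hf3 x ⟨y, hy, hx, h⟩
      · intro z hz
        obtain ⟨y, hy, hxy⟩ := ht (((hypersurface f.1).comap i).subschemeι z)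
        exact isRegularLocalRing_stalk_subscheme z (U y) hxy
          (ideal_comap_hypersurface (hU y) f.1) (hf5 y hy _ hxy) hz

end Main
/-! ### Serre's conditions on schemes -/

section Serre

variable {X : Scheme.{u}}

/-- Localizations of a stalk are stalks at generizations, so pointwise conditions on the scheme give
the conditions at all primes of a stalk that the ring-theoretic criteria ask for. -/
lemma exists_stalk_equiv_localization (x : X) (q : Ideal (X.presheaf.stalk x)) [q.IsPrime] :
    ∃ z : X, Nonempty (X.presheaf.stalk z ≃+* Localization.AtPrime q) := by
  obtain ⟨U, hx⟩ : ∃ U : X.affineOpens, x ∈ U.1 := by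
    obtain ⟨U, hU, hxU, -⟩ := exists_isAffineOpen_mem_and_subset
      (TopologicalSpace.Opens.mem_top x)
    exact ⟨⟨U, hU⟩, hxU⟩
  let := (X.presheaf.germ U.1 x hx).hom.toAlgebra
  have := isLocalization_stalk_primeAt U hx
  obtain ⟨e⟩ := nonempty_localization_comap_equiv (B := Γ(X, U.1))
    (primeAt U hx).primeCompl q
  obtain ⟨z, hz, h⟩ := exists_primeAt_eq U
    (q.comap (algebraMap Γ(X, U.1) (X.presheaf.stalk x)))
  obtain ⟨e'⟩ := nonempty_stalk_equiv U hz
  refine ⟨z, ⟨e'.trans (RingEquiv.trans ?_ e)⟩⟩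
  exact Localization.localRingEquiv _ _ (RingEquiv.refl _) (h.trans (Ideal.comap_id _).symm)

lemma IsRegularInCodim.localization {a : ℕ} (hX : IsRegularInCodim a X) (x : X)
    (q : Ideal (X.presheaf.stalk x)) [q.IsPrime]
    (hq : ringKrullDim (Localization.AtPrime q) ≤ (a : WithBot ℕ∞)) :
    IsRegularLocalRing (Localization.AtPrime q) := by
  obtain ⟨z, ⟨e⟩⟩ := exists_stalk_equiv_localization x q
  have h1 : IsRegularLocalRing (X.presheaf.stalk z) :=
    hX z ((ringKrullDim_eq_of_ringEquiv e).trans_le hq)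
  exact IsRegularLocalRing.of_ringEquiv e

lemma SatisfiesS.localization {b : ℕ} (hX : SatisfiesS b X) (x : X)
    (q : Ideal (X.presheaf.stalk x)) [q.IsPrime] :
    min (b : WithBot ℕ∞) (ringKrullDim (Localization.AtPrime q)) ≤
      (depth (Localization.AtPrime q) : WithBot ℕ∞) := by
  obtain ⟨z, ⟨e⟩⟩ := exists_stalk_equiv_localization x q
  have h1 := hX z
  rwa [ringKrullDim_eq_of_ringEquiv e, depth_eq_of_ringEquiv e] at h1

lemma IsRSScheme.isReduced (hX : IsRSScheme 0 1 X) : AlgebraicGeometry.IsReduced X := by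
  have := hX.isNoetherian
  have h : ∀ x : X, _root_.IsReduced (X.presheaf.stalk x) := fun x =>
    isReduced_of_R0_S1 (fun q _ hq => hX.regularInCodim.localization x q hq)
      (fun q _ => hX.satisfiesS.localization x q)
  exact isReduced_of_isReduced_stalk X

lemma IsRSScheme.isNormalScheme (hX : IsRSScheme 1 2 X) : IsNormalScheme X := by
  have := hX.isNoetherian
  intro x
  have hR : ∀ (q : Ideal (X.presheaf.stalk x)) [q.IsPrime],
      ringKrullDim (Localization.AtPrime q) ≤ (1 : ℕ) →
        IsRegularLocalRing (Localization.AtPrime q) :=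
    fun q _ hq => hX.regularInCodim.localization x q hq
  have hS : ∀ (q : Ideal (X.presheaf.stalk x)) [q.IsPrime], min ((1 + 1 : ℕ) : WithBot ℕ∞)
      (ringKrullDim (Localization.AtPrime q)) ≤ (depth (Localization.AtPrime q) : WithBot ℕ∞) :=
    fun q _ => hX.satisfiesS.localization x q
  have := isDomain_of_R1_S2 hR hS
  exact ⟨this, isIntegrallyClosed_of_R1_S2 hR hS⟩

lemma isRSScheme_of_isReduced [AlgebraicGeometry.IsNoetherian X] [AlgebraicGeometry.IsReduced X] :
    IsRSScheme 0 1 X where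
  isNoetherian := inferInstance
  regularInCodim _ hx := isRegularLocalRing_of_isField (isField_of_isReduced hx)
  satisfiesS _ := min_one_le_depth_of_isReduced

lemma isRSScheme_of_isNormalScheme [AlgebraicGeometry.IsNoetherian X] (h : IsNormalScheme X) :
    IsRSScheme 1 2 X where
  isNoetherian := inferInstance
  regularInCodim x hx := by
    have := (h x).1
    exact isRegularLocalRing_of_isIntegrallyClosed (h x).2 hx
  satisfiesS x := by
    have := (h x).1
    exact min_two_le_depth_of_isIntegrallyClosed (h x).2

/-- A point of codimension at most `a` on the divisor has codimension at most `a + 1` in `X`, hence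
is regular in `X` and by `hreg` on the divisor. The depth condition loses one in the same way. -/
lemma IsEffectiveCartier.isRSScheme {I : X.IdealSheafData} (hI : IsEffectiveCartier I) {a b : ℕ}
    [AlgebraicGeometry.IsNoetherian X]
    (hreg : ∀ y : I.subscheme, I.subschemeι y ∈ regularLocus X → y ∈ regularLocus I.subscheme)
    (hR : ∀ x ∈ I.support, ringKrullDim (X.presheaf.stalk x) ≤ ((a + 1 : ℕ) : WithBot ℕ∞) →
      x ∈ regularLocus X)
    (hS : ∀ x ∈ I.support, min ((b + 1 : ℕ) : WithBot ℕ∞) (ringKrullDim (X.presheaf.stalk x)) ≤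
      (depth (X.presheaf.stalk x) : WithBot ℕ∞)) :
    IsRSScheme a b I.subscheme where
  isNoetherian := by
    have := LocallyOfFiniteType.isLocallyNoetherian I.subschemeι
    have : TopologicalSpace.NoetherianSpace I.subscheme :=
      I.subschemeι.isEmbedding.isInducing.noetherianSpace
    exact {}
  regularInCodim y hy := by
    obtain ⟨U, hyU, s, -, hs⟩ := hI (I.subschemeι y)
    refine hreg y (hR _ (subschemeι_mem_support y) ?_)
    refine (ringKrullDim_stalk_le_stalk_subscheme_add_one y U hyU hs).trans ?_
    push_cast
    gcongr
  satisfiesS y := by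
    obtain ⟨U, hyU, s, hs0, hs⟩ := hI (I.subschemeι y)
    have : IsNoetherianRing Γ(X, U.1) := IsLocallyNoetherian.component_noetherian U
    refine min_le_depth_stalk_subscheme y U hyU hs
      (isSMulRegular_of_notMem_associatedPrimes fun P hP _ hsP => ?_)
      (hS _ (subschemeι_mem_support y))
    have h1 : s ∈ ⋃ p ∈ associatedPrimes Γ(X, U.1) Γ(X, U.1), (p : Set Γ(X, U.1)) :=
      Set.mem_biUnion hP hsP
    rw [biUnion_associatedPrimes_eq_compl_nonZeroDivisors] at h1
    exact h1 hs0

end Serre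

/-! ### General sections of `(R_a + S_b)`-schemes -/

section RSScheme

variable {k : Type u} [Field k] {n m : ℕ} {X : Scheme.{u}} {i : X ⟶ PP n k}
  {Z T : (PP n k).IdealSheafData} [IsImmersion i]

/-- The finite set to avoid consists of the singular points of codimension at most `a + 1` and the
points violating `S_{b+1}`. Points of `Z` are regular, hence Cohen-Macaulay, so they are in neither
set. -/
theorem forGeneralHypersurface_isRSScheme [Infinite k] [Nonempty X] (hm : 1 ≤ m)
    (hX : ∀ C ∈ irreducibleComponents X, topologicalKrullDim C = (m : WithBot ℕ∞))
    (hT : topologicalKrullDim T.subscheme ≤ 0)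
    (hZT : ∀ x : X, i x ∈ Z.support → i x ∉ T.support)
    (hZred : AlgebraicGeometry.IsReduced (Z ⊔ i.ker).subscheme)
    (hZ : IsArtinianScheme (Z ⊔ i.ker).subscheme)
    (hZreg : ((Z ⊔ i.ker).support : Set (PP n k)) ⊆ i '' regularLocus X)
    {a b : ℕ} (hab : IsRSScheme a b X) {P : (PP n k).IdealSheafData → Prop}
    (hP : ∀ H : (PP n k).IdealSheafData, IsRSScheme a b (H.comap i).subscheme → P H) :
    ForGeneralHypersurface Z fun H => IsGood i m T H ∧ RegularOnRegularLocus i H ∧ P H := by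
  have := hab.isNoetherian
  have hF₁ := finite_singular_stalk i hab.regularInCodim
  have hF₂ := finite_not_satisfiesS_stalk i hab.satisfiesS
  obtain ⟨d₀, hd₀⟩ := exists_isGeneric_isGood hm hX hT hZT hZred hZ hZreg (hF₁.union hF₂) (by
    intro x hx hxZ
    have hreg := mem_regularLocus_of_mem_support hZreg hxZ
    have h1 : IsRegularLocalRing (X.presheaf.stalk x) := hreg
    rcases hx with hx | hx
    · exact hx.2 hreg
    · exact hx ((min_le_right _ _).trans (ringKrullDim_le_depth_of_isRegularLocalRing _)))
  refine forGeneralHypersurface_of_isGeneric ⟨d₀, fun d hd => ⟨(hd₀ d hd).1,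
    (hd₀ d hd).2.mono ?_⟩⟩
  rintro f ⟨h1, h2, h3⟩
  refine ⟨h1, h2, hP _ (h1.cartier.isRSScheme h2 (fun x hx hxa => ?_) fun x hx => ?_)⟩
  · by_contra h
    exact h3 x (Or.inl ⟨hxa, h⟩) hx
  · by_contra h
    exact h3 x (Or.inr h) hx

end RSScheme
end Bertini

end

theorem mainTheorem2 {k : Type u} [Field k] [Infinite k] {n m : ℕ} (hm : 1 ≤ m)
    {X : Scheme.{u}} (i : X ⟶ Bertini.PP n k) [IsImmersion i] [Nonempty X]
    (hX : ∀ C ∈ irreducibleComponents X, topologicalKrullDim C = (m : WithBot ℕ∞))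
    (Z T : (Bertini.PP n k).IdealSheafData)
    (hT : topologicalKrullDim T.subscheme ≤ 0)
    (hZT : ∀ x : X, i x ∈ Z.support → i x ∉ T.support)
    (hZred : AlgebraicGeometry.IsReduced (Z ⊔ i.ker).subscheme)
    (hZfin : IsFinite ((Z ⊔ i.ker).subschemeι ≫ Bertini.PP.structureMap n k))
    (hZreg : ((Z ⊔ i.ker).support : Set (Bertini.PP n k)) ⊆ i '' Bertini.regularLocus X) :
    (∀ a b : ℕ, Bertini.IsRSScheme a b X →
      Bertini.ForGeneralHypersurface Z fun H =>
        Bertini.IsGood i m T H ∧ Bertini.RegularOnRegularLocus i H ∧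
          Bertini.IsRSScheme a b (H.comap i).subscheme) ∧
    (AlgebraicGeometry.IsReduced X →
      Bertini.ForGeneralHypersurface Z fun H =>
        Bertini.IsGood i m T H ∧ Bertini.RegularOnRegularLocus i H ∧
          AlgebraicGeometry.IsReduced (H.comap i).subscheme) ∧
    (Bertini.IsNormalScheme X →
      Bertini.ForGeneralHypersurface Z fun H =>
        Bertini.IsGood i m T H ∧ Bertini.RegularOnRegularLocus i H ∧
          Bertini.IsNormalScheme (H.comap i).subscheme) := by
  have hZ := Bertini.isLocallyArtinian_of_isFinite
    ((Z ⊔ i.ker).subschemeι ≫ Bertini.PP.structureMap n k)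
  have := Bertini.isNoetherian_of_isImmersion i
  refine ⟨fun a b hab => ?_, fun hred => ?_, fun hnorm => ?_⟩
  · exact Bertini.forGeneralHypersurface_isRSScheme hm hX hT hZT hZred hZ hZreg hab fun _ h => h
  -- Reduced is the case `R₀ + S₁`; normal, below, is `R₁ + S₂`.
  · exact Bertini.forGeneralHypersurface_isRSScheme hm hX hT hZT hZred hZ hZreg
      Bertini.isRSScheme_of_isReduced fun _ h => h.isReduced
  · exact Bertini.forGeneralHypersurface_isRSScheme hm hX hT hZT hZred hZ hZreg
      (Bertini.isRSScheme_of_isNormalScheme hnorm) fun _ h => h.isNormalScheme
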